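/- Let $k$ be a commutative ring, $A$ a $k$-algebra, $H$ a Hopf $k$-algebra, $\otimes=\otimes_k$, and write $\Delta(h)=h^{(1)}\otimes h^{(2)}$ (summation understood). Let $H\otimes A\to A$, $h\otimes a\mapsto a^h$, be a weak action, i.e. $(ab)^h=a^{h^{(1)}}b^{h^{(2)}}$, $1^h=\epsilon(h)1$, $a^1=a$, and let $f:H\otimes H\to A$ be $k$-linear. Assume that $E=A\#_fH$ is a crossed product, i.e. $A\otimes H$ with the multiplication $(a\# h)(b\# l)=a\,b^{h^{(1)}}f(h^{(2)},l^{(1)})\# h^{(3)}l^{(2)}$ is associative with unit $1\#1$ ($f$ need not be convolution invertible). Let $M$ be an $E$-bimodule on which the two actions of $k$ agree. For a $k$-algebra $B$ put $\overline B=B/k$, and denote the class of $b\in B$ again by $b$. For $\mathbf h=h_1\otimes\cdots\otimes h_s$, $\mathbf a=a_1\otimes\cdots\otimes a_r$ write $\mathbf h_{ij}=h_i\otimes\cdots\otimes h_j$, $\mathfrak h_{ij}=h_i\cdots h_j$, $\mathbf a_{ij}=a_i\otimes\cdots\otimes a_j$ (empty if $i>j$); let $\mathbf h^{(1)}\otimes\mathbf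 h^{(2)}$ be the factorwise comultiplication, $a^{\overline{\mathbf h}}=(\cdots(a^{h_s})\cdots)^{h_1}$, and $\mathbf a^{\overline{\mathbf h}}=a_1^{\overline{\mathbf h^{(1)}}}\otimes\cdots\otimes a_r^{\overline{\mathbf h^{(r)}}}$ (equal to $\epsilon(h_1)\cdots\epsilon(h_s)$ if $r=0$). Define $F^{(l)}(\mathbf h\otimes\mathbf a)\in\overline A^{\otimes(r+l-1)}$ for $\mathbf h\in H^{\otimes l}$, $l\ge1$, by $F^{(1)}(h\otimes\mathbf a)=\mathbf a^{h}$ and $$F^{(l+1)}(\mathbf h\otimes\mathbf a)=\sum_{j=1}^{l}\sum_{i=0}^{r}(-1)^{il+j}\,\mathbf a_{1i}^{\overline{\mathbf h^{(1)}}}\otimes f(h_j^{(2)},h_{j+1}^{(2)})^{\overline{\mathbf h_{1,j-1}^{(2)}}}\otimes F^{(l)}\bigl((\mathbf h_{1,j-1}^{(3)}\otimes h_j^{(3)}h_{j+1}^{(3)}\otimes\mathbf h_{j+2,l+1}^{(2)})\otimes\mathbf a_{i+1,r}\bigr).$$ For $\mathbf x=m\otimes\mathbf h\otimes\mathbf a\in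 M\otimes\overline H^{\otimes s}\otimes\overline A^{\otimes r}$ put $$\widehat d^{\,0}(\mathbf x)=m a_1^{\overline{\mathbf h^{(1)}}}\otimes\mathbf h^{(2)}\otimes\mathbf a_{2r}+(-1)^r a_r m\otimes\mathbf h\otimes\mathbf a_{1,r-1}+\sum_{i=1}^{r-1}(-1)^i m\otimes\mathbf h\otimes\mathbf a_{1,i-1}\otimes a_ia_{i+1}\otimes\mathbf a_{i+2,r}\quad(r\ge1),$$ $$\widehat d^{\,1}(\mathbf x)=(-1)^r m(1\# h_1)\otimes\mathbf h_{2s}\otimes\mathbf a+(-1)^{r+s}(1\# h_s^{(2)})m\otimes\mathbf h_{1,s-1}\otimes\mathbf a^{h_s^{(1)}}+\sum_{i=1}^{s-1}(-1)^{r+i}m f(h_i^{(1)},h_{i+1}^{(1)})^{\overline{\mathbf h_{1,i-1}^{(1)}}}\otimes\mathbf h_{1,i-1}^{(2)}\otimes h_i^{(2)}h_{i+1}^{(2)}\otimes\mathbf h_{i+2,s}\otimes\mathbf a\quad(s\ge1),$$ $$\widehat d^{\,l}(\mathbf x)=(-1)^{l(r+s)}(1\#\mathfrak h_{s-l+1,s}^{(2)})m\otimes\mathbf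 h_{1,s-l}\otimes F^{(l)}(\mathbf h_{s-l+1,s}^{(1)}\otimes\mathbf a)\quad(2\le l\le s).$$ **Theorem.** (1) With $\widehat X_n=\bigoplus_{r+s=n}M\otimes\overline H^{\otimes s}\otimes\overline A^{\otimes r}$, the map $\widehat d_n=\sum_l\widehat d^{\,l}:\widehat X_n\to\widehat X_{n-1}$ is well defined for all $n\ge1$, and $\widehat X_*(E,M)=(\widehat X_*,\widehat d_*)$ is a chain complex. (2) For every $n\ge 0$, the Hochschild homology $H_n(E,M)$ of the $k$-algebra $E$, i.e. the homology of the complex $M\otimes E^{\otimes *}$ with the Hochschild boundary, is isomorphic to $H_n(\widehat X_*(E,M))$. (3) $\widehat X_*(E,M)$ is isomorphic to $M\otimes_{E^e}(X_*,d_*)$ through $m\otimes\mathbf h\otimes\mathbf a\mapsto m\otimes(1\otimes\mathbf h\otimes\mathbf a\otimes1)$. Here $(X_*,d_*)$ is the following complex of $E$-bimodules: $X_n=\bigoplus_{r+s=n}X_{rs}$, $X_{rs}=E\otimes\overline H^{\otimes s}\otimes\overline A^{\otimes r}\otimes E$, and $d_n=\sum_l d^l$ with well-defined $E$-bimodule maps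 $d^l:X_{rs}\to X_{r+l-1,s-l}$ ($0\le l\le s$, $r+l>0$) given as follows. Let $Y_s=E\otimes\overline H^{\otimes s}\otimes H$; let $\partial:Y_s\to Y_{s-1}$ ($s\ge1$) be $$\partial(e\otimes h_1\otimes\cdots\otimes h_{s+1})=-e(1\# h_1)\otimes\mathbf h_{2,s+1}+\sum_{i=1}^{s}(-1)^{i+1}e\bigl(f(h_i^{(1)},h_{i+1}^{(1)})^{\overline{\mathbf h_{1,i-1}^{(1)}}}\#1\bigr)\otimes\mathbf h_{1,i-1}^{(2)}\otimes h_i^{(2)}h_{i+1}^{(2)}\otimes\mathbf h_{i+2,s+1};$$ let $\sigma:Y_s\to X_{0s}$, $e\otimes\mathbf h\otimes h\mapsto e\otimes\mathbf h\otimes(1\# h)$, and $\sigma:X_{rs}\to X_{r+1,s}$, $e\otimes\mathbf h\otimes\mathbf a\otimes(a\# h)\mapsto(-1)^{r+1}e\otimes\mathbf h\otimes\mathbf a\otimes a\otimes(1\# h)$. Then, for $r\ge1$, $$d^0(e\otimes\mathbf h\otimes\mathbf a\otimes e')=e(a_1^{\overline{\mathbf h^{(1)}}}\#1)\otimes\mathbf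 h^{(2)}\otimes\mathbf a_{2r}\otimes e'+\sum_{i=1}^{r-1}(-1)^ie\otimes\mathbf h\otimes\mathbf a_{1,i-1}\otimes a_ia_{i+1}\otimes\mathbf a_{i+2,r}\otimes e'+(-1)^re\otimes\mathbf h\otimes\mathbf a_{1,r-1}\otimes(a_r\#1)e',$$ and for $x=1\otimes\mathbf h\otimes\mathbf a\otimes1$ one has $d^1(x)=-\sigma\partial(1\otimes\mathbf h\otimes1_H)$ if $r=0$, $d^l(x)=-\sum_{j=1}^{l-1}\sigma d^{l-j}d^j(x)$ if $r=0$ and $1<l\le s$, and $d^l(x)=-\sum_{j=0}^{l-1}\sigma d^{l-j}d^j(x)$ if $r>0$ and $1\le l\le s$. -/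

import Mathlib

open scoped TensorProduct DirectSum
open CategoryTheory

universe u

noncomputable section

namespace HopfCrossed

/-! ### Iterated tensor powers -/

section TensorPowers

variable (k : Type u) [CommRing k] (V : Type u) [AddCommGroup V] [Module k V]

/-- The tensor power `V ⊗ (V ⊗ (⋯ ⊗ k))` with `n` factors `V`, bundled as a `k`-module. -/
def TPowCat : ℕ → ModuleCat.{u} k
  | 0 => ModuleCat.of k k
  | n + 1 => ModuleCat.of k (V ⊗[k] (TPowCat n))

/-- The tensor power `V^{⊗ n}` over `k`. -/
abbrev TPow (n : ℕ) : Type u := TPowCat k V n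

namespace TPow

/-- `V^{⊗ 0} = k`. -/
def zeroEquiv : k ≃ₗ[k] TPow k V 0 := LinearEquiv.refl k k

/-- `V ⊗ V^{⊗ n} = V^{⊗ (n+1)}`. -/
def succEquiv (n : ℕ) : V ⊗[k] TPow k V n ≃ₗ[k] TPow k V (n + 1) :=
  LinearEquiv.refl k (V ⊗[k] TPow k V n)

variable {V}

/-- The empty tensor. -/
def nil : TPow k V 0 := zeroEquiv k V 1

/-- `cons v (v₁ ⊗ ⋯ ⊗ vₙ) = v ⊗ v₁ ⊗ ⋯ ⊗ vₙ`. -/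
def cons (n : ℕ) : V →ₗ[k] TPow k V n →ₗ[k] TPow k V (n + 1) :=
  (TensorProduct.mk k V (TPow k V n)).compr₂ (succEquiv k V n).toLinearMap

variable {W : Type u} [AddCommGroup W] [Module k W]

/-- A linear map out of `V^{⊗ (n+1)}` given by a bilinear map on `V × V^{⊗ n}`. -/
def lift {N : Type u} [AddCommGroup N] [Module k N] (n : ℕ) (g : V →ₗ[k] TPow k V n →ₗ[k] N) :
    TPow k V (n + 1) →ₗ[k] N :=
  TensorProduct.lift g ∘ₗ (succEquiv k V n).symm.toLinearMap

/-- The elementary tensor of a list. -/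
def ofList : (l : List V) → TPow k V l.length
  | [] => nil k
  | v :: l => cons k l.length v (ofList l)

/-- Functoriality: `g ⊗ ⋯ ⊗ g`. -/
def map (g : V →ₗ[k] W) : (n : ℕ) → TPow k V n →ₗ[k] TPow k W n
  | 0 => (zeroEquiv k W).toLinearMap ∘ₗ (zeroEquiv k V).symm.toLinearMap
  | n + 1 => lift k n (((cons k n).comp g).compl₂ (map g n))

/-- Splitting off the last factor: `v₁ ⊗ ⋯ ⊗ vₙ ⊗ v ↦ (v₁ ⊗ ⋯ ⊗ vₙ) ⊗ v`. -/
def unsnoc : (n : ℕ) → TPow k V (n + 1) →ₗ[k] TPow k V n ⊗[k] V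
  | 0 => lift k 0 ((TensorProduct.mk k (TPow k V 0) V).flip)
  | n + 1 => lift k (n + 1) (((LinearMap.rTensorHom V).comp (cons k n)).compl₂ (unsnoc n))

/-- The canonical embedding of `V^{⊗ n}` into the tensor algebra of `V`. -/
def toTensorAlgebra : (n : ℕ) → TPow k V n →ₗ[k] TensorAlgebra k V
  | 0 => Algebra.linearMap k (TensorAlgebra k V) ∘ₗ (zeroEquiv k V).symm.toLinearMap
  | n + 1 => lift k n
      (((LinearMap.mul k (TensorAlgebra k V)).comp (TensorAlgebra.ι k)).compl₂ (toTensorAlgebra n))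

variable {k}

theorem lift_cons {N : Type u} [AddCommGroup N] [Module k N] (n : ℕ)
    (g : V →ₗ[k] TPow k V n →ₗ[k] N) (v : V) (w : TPow k V n) :
    lift k n g (cons k n v w) = g v w := rfl

theorem unsnoc_succ_cons (n : ℕ) (v : V) (w : TPow k V (n + 1)) :
    unsnoc k (n + 1) (cons k (n + 1) v w) = (cons k n v).rTensor V (unsnoc k n w) := rfl

theorem ext_succ {N : Type u} [AddCommGroup N] [Module k N] {n : ℕ}
    {f g : TPow k V (n + 1) →ₗ[k] N} (h : ∀ v w, f (cons k n v w) = g (cons k n v w)) : f = g :=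
  TensorProduct.ext' (M := V) (N := TPow k V n) h

variable (k) in
/-- `snoc (v₁ ⊗ ⋯ ⊗ vₙ) v = v₁ ⊗ ⋯ ⊗ vₙ ⊗ v`. -/
def snoc : (n : ℕ) → TPow k V n →ₗ[k] V →ₗ[k] TPow k V (n + 1)
  | 0 => (cons k 0).flip
  | n + 1 => lift k n
      (((LinearMap.llcomp k V (TPow k V (n + 1)) (TPow k V (n + 2))).comp
        (cons k (n + 1))).compl₂ (snoc n))

theorem snoc_cons (n : ℕ) (v : V) (w : TPow k V n) (x : V) :
    snoc k (n + 1) (cons k n v w) x = cons k (n + 1) v (snoc k n w x) := rfl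

theorem unsnoc_snoc (n : ℕ) (w : TPow k V n) (x : V) : unsnoc k n (snoc k n w x) = w ⊗ₜ x := by
  induction n with
  | zero => rfl
  | succ n ih =>
    revert w
    suffices h : unsnoc k (n + 1) ∘ₗ (snoc k (n + 1)).flip x =
        (TensorProduct.mk k (TPow k V (n + 1)) V).flip x from fun w => LinearMap.congr_fun h w
    refine ext_succ fun v w => ?_
    simp only [LinearMap.comp_apply, LinearMap.flip_apply, snoc_cons, unsnoc_succ_cons, ih,
      LinearMap.rTensor_tmul, TensorProduct.mk_apply]

theorem lift_snoc_unsnoc (n : ℕ) : TensorProduct.lift (snoc k n) ∘ₗ unsnoc k n =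
    (LinearMap.id : TPow k V (n + 1) →ₗ[k] TPow k V (n + 1)) := by
  induction n with
  | zero => exact ext_succ fun v w => rfl
  | succ n ih =>
    refine ext_succ fun v w => ?_
    have h : TensorProduct.lift (snoc k (n + 1)) ∘ₗ (cons k n v).rTensor V =
        cons k (n + 1) v ∘ₗ TensorProduct.lift (snoc k n) := by
      ext; rfl
    have h1 := LinearMap.congr_fun h (unsnoc k n w)
    have h2 := LinearMap.congr_fun ih w
    simp only [LinearMap.comp_apply, LinearMap.id_apply] at h1 h2
    simp only [LinearMap.comp_apply, LinearMap.id_apply, unsnoc_succ_cons, h1, h2]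

theorem ext_snoc {N : Type u} [AddCommGroup N] [Module k N] {n : ℕ}
    {f g : TPow k V (n + 1) →ₗ[k] N} (h : ∀ w v, f (snoc k n w v) = g (snoc k n w v)) : f = g := by
  have h' : f ∘ₗ TensorProduct.lift (snoc k n) = g ∘ₗ TensorProduct.lift (snoc k n) :=
    TensorProduct.ext' h
  have := congrArg (fun t => t ∘ₗ unsnoc k n) h'
  simpa only [LinearMap.comp_assoc, lift_snoc_unsnoc, LinearMap.comp_id] using this

end TPow

end TensorPowers

/-! ### Hochschild homology -/

section Hochschild

variable (k : Type u) [CommRing k] {E : Type u} [Ring E] [Algebra k E]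

section Bimodule

variable (E) (M : Type u) [AddCommGroup M] [Module k M]

/-- The left action `e ⊗ m ↦ e m`. -/
def leftAct [Module E M] [IsScalarTower k E M] : E ⊗[k] M →ₗ[k] M :=
  TensorProduct.lift (Algebra.lsmul k k M).toLinearMap

/-- The right action `m ⊗ e ↦ m e`. -/
def rightAct [Module Eᵐᵒᵖ M] [IsScalarTower k Eᵐᵒᵖ M] : M ⊗[k] E →ₗ[k] M :=
  TensorProduct.lift
    ((Algebra.lsmul k k M).toLinearMap ∘ₗ (MulOpposite.opLinearEquiv k).toLinearMap).flip

end Bimodule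

/-- `m ⊗ (e ⊗ w) ↦ (m e) ⊗ w`, for a given right multiplication `act`. -/
def headAct {N : Type u} [AddCommGroup N] [Module k N] (act : N ⊗[k] E →ₗ[k] N) (n : ℕ) :
    N ⊗[k] TPow k E (n + 1) →ₗ[k] N ⊗[k] TPow k E n :=
  act.rTensor (TPow k E n) ∘ₗ (TensorProduct.assoc k N E (TPow k E n)).symm.toLinearMap ∘ₗ
    (TPow.succEquiv k E n).symm.toLinearMap.lTensor N

/-- `e₀ ⊗ ⋯ ⊗ eₙ ↦ ∑_{i=0}^{n-1} (-1)^i e₀ ⊗ ⋯ ⊗ eᵢ eᵢ₊₁ ⊗ ⋯ ⊗ eₙ`, by recursion on `n`. -/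
def barD : (n : ℕ) → TPow k E (n + 1) →ₗ[k] TPow k E n
  | 0 => 0
  | n + 1 => (TPow.succEquiv k E n).toLinearMap ∘ₗ
      (headAct k (LinearMap.mul' k E) n - (barD n).lTensor E) ∘ₗ
      (TPow.succEquiv k E (n + 1)).symm.toLinearMap

variable (M : Type u) [AddCommGroup M] [Module k M] [Module E M] [Module Eᵐᵒᵖ M]
  [IsScalarTower k E M] [IsScalarTower k Eᵐᵒᵖ M]

/-- `m ⊗ e₁ ⊗ ⋯ ⊗ eₙ₊₁ ↦ eₙ₊₁ m ⊗ e₁ ⊗ ⋯ ⊗ eₙ`. -/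
def lastAct (n : ℕ) : M ⊗[k] TPow k E (n + 1) →ₗ[k] M ⊗[k] TPow k E n :=
  (TensorProduct.comm k (TPow k E n) M).toLinearMap ∘ₗ
    (leftAct k E M).lTensor (TPow k E n) ∘ₗ
    (TensorProduct.assoc k (TPow k E n) E M).toLinearMap ∘ₗ
    (TensorProduct.comm k M (TPow k E n ⊗[k] E)).toLinearMap ∘ₗ
    (TPow.unsnoc k n).lTensor M

/-- The Hochschild boundary `b : M ⊗ E^{⊗ (n+1)} → M ⊗ E^{⊗ n}`,
`b (m ⊗ e₁ ⊗ ⋯ ⊗ eₙ₊₁) = m e₁ ⊗ e₂ ⊗ ⋯ ⊗ eₙ₊₁ + ∑_{i=1}^{n} (-1)^i m ⊗ ⋯ ⊗ eᵢ eᵢ₊₁ ⊗ ⋯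
  + (-1)^{n+1} eₙ₊₁ m ⊗ e₁ ⊗ ⋯ ⊗ eₙ`. -/
def hochschildD (n : ℕ) : M ⊗[k] TPow k E (n + 1) →ₗ[k] M ⊗[k] TPow k E n :=
  headAct k (rightAct k E M) n - (barD k n).lTensor M + (-1 : k) ^ (n + 1) • lastAct k M n

section Facts

set_option linter.unusedSectionVars false

variable {k}

theorem headAct_cons {N : Type u} [AddCommGroup N] [Module k N] (act : N ⊗[k] E →ₗ[k] N) (n : ℕ)
    (x : N) (e : E) (w : TPow k E n) :
    headAct k act n (x ⊗ₜ TPow.cons k n e w) = act (x ⊗ₜ e) ⊗ₜ w := rfl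

theorem barD_cons_cons (n : ℕ) (e e' : E) (w : TPow k E n) :
    barD k (n + 1) (TPow.cons k (n + 1) e (TPow.cons k n e' w)) =
      TPow.cons k n (e * e') w - TPow.cons k n e (barD k n (TPow.cons k n e' w)) := rfl

theorem barD_barD (n : ℕ) : barD k (E := E) n ∘ₗ barD k (n + 1) = 0 := by
  induction n with
  | zero => ext; rfl
  | succ n ih =>
    refine TPow.ext_succ fun e w => ?_
    revert w
    suffices h : (barD k (E := E) (n + 1) ∘ₗ barD k (n + 1 + 1)) ∘ₗ TPow.cons k (n + 2) e = 0 from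
      fun w => LinearMap.congr_fun h w
    refine TPow.ext_succ fun e' w => ?_
    revert w
    suffices h : ((barD k (E := E) (n + 1) ∘ₗ barD k (n + 1 + 1)) ∘ₗ TPow.cons k (n + 2) e) ∘ₗ
        TPow.cons k (n + 1) e' = 0 from fun w => LinearMap.congr_fun h w
    refine TPow.ext_succ fun e'' w => ?_
    have ih' := LinearMap.congr_fun ih (TPow.cons k (n + 1) e' (TPow.cons k n e'' w))
    simp only [LinearMap.comp_apply, barD_cons_cons, map_sub, LinearMap.zero_apply] at ih' ⊢
    rw [mul_assoc]
    have := congrArg (TPow.cons k n e) ih'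
    simp only [map_sub, map_zero] at this
    rw [← this]
    abel

theorem headAct_snoc {N : Type u} [AddCommGroup N] [Module k N] (act : N ⊗[k] E →ₗ[k] N) (n : ℕ)
    (x : N) (w : TPow k E (n + 1)) (e : E) :
    headAct k act (n + 1) (x ⊗ₜ TPow.snoc k (n + 1) w e) =
      ((TPow.snoc k n).flip e).lTensor N (headAct k act n (x ⊗ₜ w)) := by
  revert w
  suffices h : (headAct k act (n + 1) ∘ₗ TensorProduct.mk k N (TPow k E (n + 2)) x) ∘ₗ
      (TPow.snoc k (n + 1)).flip e =
      ((TPow.snoc k n).flip e).lTensor N ∘ₗ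
        (headAct k act n ∘ₗ TensorProduct.mk k N (TPow k E (n + 1)) x) from
    fun w => LinearMap.congr_fun h w
  exact TPow.ext_succ fun v w => rfl

theorem barD_cons (n : ℕ) (e : E) (w : TPow k E (n + 1)) :
    barD k (n + 1) (TPow.cons k (n + 1) e w) =
      TPow.succEquiv k E n (headAct k (LinearMap.mul' k E) n (e ⊗ₜ w)) -
        TPow.cons k n e (barD k n w) := rfl

theorem succEquiv_lTensor_snoc (n : ℕ) (e : E) (t : E ⊗[k] TPow k E n) :
    TPow.succEquiv k E (n + 1) (((TPow.snoc k n).flip e).lTensor E t) =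
      TPow.snoc k (n + 1) (TPow.succEquiv k E n t) e := by
  revert t
  suffices h : (TPow.succEquiv k E (n + 1)).toLinearMap ∘ₗ ((TPow.snoc k n).flip e).lTensor E =
      (TPow.snoc k (n + 1)).flip e ∘ₗ (TPow.succEquiv k E n).toLinearMap from
    fun t => LinearMap.congr_fun h t
  exact TensorProduct.ext' fun v w => rfl

theorem barD_snoc_snoc (n : ℕ) (w : TPow k E n) (e e' : E) :
    barD k (n + 1) (TPow.snoc k (n + 1) (TPow.snoc k n w e) e') =
      TPow.snoc k n (barD k n (TPow.snoc k n w e)) e' + (-1 : k) ^ n • TPow.snoc k n w (e * e') := by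
  induction n with
  | zero =>
    have h1 : barD k 1 (TPow.snoc k 1 (TPow.snoc k 0 w e) e') =
      TPow.cons k 0 (e * e') w - TPow.cons k 0 e (barD k 0 (TPow.cons k 0 e' w)) := rfl
    have h2 : ∀ y, barD k (E := E) 0 y = 0 := fun y => rfl
    have h3 : TPow.snoc k 0 w (e * e') = TPow.cons k 0 (e * e') w := rfl
    rw [h1, h2, h2, h3]
    simp
  | succ n ih =>
    revert w
    suffices h : barD k (n + 2) ∘ₗ (TPow.snoc k (n + 2)).flip e' ∘ₗ (TPow.snoc k (n + 1)).flip e =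
        (TPow.snoc k (n + 1)).flip e' ∘ₗ barD k (n + 1) ∘ₗ (TPow.snoc k (n + 1)).flip e +
        (-1 : k) ^ (n + 1) • (TPow.snoc k (n + 1)).flip (e * e') from
      fun w => LinearMap.congr_fun h w
    refine TPow.ext_succ fun x u => ?_
    simp only [LinearMap.comp_apply, LinearMap.flip_apply, LinearMap.add_apply,
      LinearMap.smul_apply, TPow.snoc_cons, barD_cons, headAct_snoc, ih, succEquiv_lTensor_snoc,
      map_sub, map_add, map_smul, pow_succ]
    simp only [mul_neg, mul_one, neg_smul]
    abel

theorem lastAct_snoc (n : ℕ) (m : M) (w : TPow k E n) (e : E) :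
    lastAct k M n (m ⊗ₜ TPow.snoc k n w e) = (e • m) ⊗ₜ w := by
  simp [lastAct, TPow.unsnoc_snoc, leftAct]

/-- The part of the Hochschild boundary without its last term. -/
def headD (n : ℕ) : M ⊗[k] TPow k E (n + 1) →ₗ[k] M ⊗[k] TPow k E n :=
  headAct k (rightAct k E M) n - (barD k n).lTensor M

theorem rightAct_tmul (m : M) (e : E) :
    rightAct k E M (m ⊗ₜ e) = MulOpposite.op e • m := rfl

theorem headD_cons (n : ℕ) (m : M) (e : E) (w : TPow k E n) :
    headD M n (m ⊗ₜ TPow.cons k n e w) =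
      (MulOpposite.op e • m) ⊗ₜ w - m ⊗ₜ barD k n (TPow.cons k n e w) := rfl

theorem headD_tmul (n : ℕ) (m : M) (w : TPow k E (n + 1)) :
    headD M n (m ⊗ₜ w) = headAct k (rightAct k E M) n (m ⊗ₜ w) - m ⊗ₜ barD k n w := rfl

theorem headD_headD (n : ℕ) : headD (k := k) (E := E) M n ∘ₗ headD M (n + 1) = 0 := by
  refine TensorProduct.ext' fun m w => ?_
  revert w
  suffices h : (headD (k := k) (E := E) M n ∘ₗ headD M (n + 1)) ∘ₗ TensorProduct.mk k M _ m = 0 from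
    fun w => LinearMap.congr_fun h w
  refine TPow.ext_succ fun e w => ?_
  revert w
  suffices h : ((headD (k := k) (E := E) M n ∘ₗ headD M (n + 1)) ∘ₗ TensorProduct.mk k M _ m) ∘ₗ
      TPow.cons k (n + 1) e = 0 from fun w => LinearMap.congr_fun h w
  refine TPow.ext_succ fun e' w => ?_
  have hb := LinearMap.congr_fun (barD_barD (k := k) (E := E) n)
    (TPow.cons k (n + 1) e (TPow.cons k n e' w))
  simp only [LinearMap.comp_apply, LinearMap.zero_apply] at hb
  simp only [LinearMap.comp_apply, TensorProduct.mk_apply, headD_cons, map_sub,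
    LinearMap.zero_apply]
  rw [headD_tmul M n m, hb, barD_cons_cons, TensorProduct.tmul_sub, map_sub, headAct_cons,
    headAct_cons, rightAct_tmul, rightAct_tmul, ← mul_smul, ← MulOpposite.op_mul,
    TensorProduct.tmul_zero]
  abel

theorem headD_smul [SMulCommClass E Eᵐᵒᵖ M] (n : ℕ) (e : E) (t : M ⊗[k] TPow k E (n + 1)) :
    headD M n ((Algebra.lsmul k k M e).rTensor _ t) =
      (Algebra.lsmul k k M e).rTensor _ (headD M n t) := by
  revert t
  suffices h : headD M n ∘ₗ (Algebra.lsmul k k M e).rTensor (TPow k E (n + 1)) =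
      (Algebra.lsmul k k M e).rTensor _ ∘ₗ headD M n from fun w => LinearMap.congr_fun h w
  refine TensorProduct.ext' fun m w => ?_
  revert w
  suffices h : (headD M n ∘ₗ (Algebra.lsmul k k M e).rTensor (TPow k E (n + 1))) ∘ₗ
      TensorProduct.mk k M _ m =
      ((Algebra.lsmul k k M e).rTensor _ ∘ₗ headD M n) ∘ₗ TensorProduct.mk k M _ m from
    fun w => LinearMap.congr_fun h w
  refine TPow.ext_succ fun x w => ?_
  simp only [LinearMap.comp_apply, TensorProduct.mk_apply, LinearMap.rTensor_tmul, headD_cons,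
    map_sub, Algebra.lsmul_coe, smul_comm]

theorem lastAct_lTensor_snoc (n : ℕ) (e : E) (t : M ⊗[k] TPow k E n) :
    lastAct k M n (((TPow.snoc k n).flip e).lTensor M t) =
      (Algebra.lsmul k k M e).rTensor _ t := by
  revert t
  suffices h : lastAct k M n ∘ₗ ((TPow.snoc k n).flip e).lTensor M =
      (Algebra.lsmul k k M e).rTensor _ from fun w => LinearMap.congr_fun h w
  exact TensorProduct.ext' fun m w => lastAct_snoc M n m w e

theorem headD_snoc_snoc (n : ℕ) (m : M) (w : TPow k E n) (e e' : E) :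
    headD M (n + 1) (m ⊗ₜ TPow.snoc k (n + 1) (TPow.snoc k n w e) e') =
      ((TPow.snoc k n).flip e').lTensor M (headD M n (m ⊗ₜ TPow.snoc k n w e)) -
        (-1 : k) ^ n • m ⊗ₜ TPow.snoc k n w (e * e') := by
  rw [headD_tmul, headD_tmul, headAct_snoc, barD_snoc_snoc, map_sub, LinearMap.lTensor_tmul,
    TensorProduct.tmul_add, TensorProduct.tmul_smul, LinearMap.flip_apply]
  abel

theorem hochschildD_hochschildD [SMulCommClass E Eᵐᵒᵖ M] (n : ℕ) :
    hochschildD k (E := E) M n ∘ₗ hochschildD k M (n + 1) = 0 := by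
  have hd : ∀ n, hochschildD k (E := E) M n = headD M n + (-1 : k) ^ (n + 1) • lastAct k M n :=
    fun n => rfl
  refine TensorProduct.ext' fun m w => ?_
  revert w
  suffices h : (hochschildD k (E := E) M n ∘ₗ hochschildD k M (n + 1)) ∘ₗ
      TensorProduct.mk k M _ m = 0 from fun w => LinearMap.congr_fun h w
  refine TPow.ext_snoc fun w e' => ?_
  revert w
  suffices h : ((hochschildD k (E := E) M n ∘ₗ hochschildD k M (n + 1)) ∘ₗ
      TensorProduct.mk k M _ m) ∘ₗ (TPow.snoc k (n + 1)).flip e' = 0 from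
    fun w => LinearMap.congr_fun h w
  refine TPow.ext_snoc fun w e => ?_
  have hh := LinearMap.congr_fun (headD_headD (k := k) (E := E) M n)
    (m ⊗ₜ TPow.snoc k (n + 1) (TPow.snoc k n w e) e')
  have hs := headD_smul (k := k) M n e' (m ⊗ₜ TPow.snoc k n w e)
  rw [LinearMap.rTensor_tmul, Algebra.lsmul_coe] at hs
  simp only [LinearMap.comp_apply, LinearMap.zero_apply] at hh
  simp only [LinearMap.comp_apply, LinearMap.flip_apply, TensorProduct.mk_apply, hd,
    LinearMap.add_apply, LinearMap.smul_apply, map_add, map_smul, LinearMap.zero_apply, hh,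
    lastAct_snoc, hs]
  rw [headD_snoc_snoc, map_sub, map_smul, lastAct_lTensor_snoc, lastAct_snoc, mul_smul]
  rcases neg_one_pow_eq_or k n with h | h <;> simp [pow_succ, h] <;> abel

end Facts

/-- The chain complex of `k`-modules `X 0 ← X 1 ← X 2 ← ⋯` with boundary maps `d`. -/
def chainComplexOf (X : ℕ → Type u) [∀ n, AddCommGroup (X n)] [∀ n, Module k (X n)]
    (d : ∀ n, X (n + 1) →ₗ[k] X n) (hd : ∀ n, d n ∘ₗ d (n + 1) = 0) :
    ChainComplex (ModuleCat.{u} k) ℕ :=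
  ChainComplex.of (fun n => ModuleCat.of k (X n)) (fun n => ModuleCat.ofHom (d n))
    (fun n => by rw [← ModuleCat.ofHom_comp, hd]; rfl)

variable (E) in
/-- The Hochschild homology `H_n(E, M)` of the `k`-algebra `E` with coefficients in the
`E`-bimodule `M`. -/
def HochschildHomology [SMulCommClass E Eᵐᵒᵖ M] (n : ℕ) : ModuleCat.{u} k :=
  (chainComplexOf k (fun n => M ⊗[k] TPow k E n) (hochschildD k M)
    (hochschildD_hochschildD M)).homology n

end Hochschild

/-! ### Crossed products -/

section Crossed

variable (k A H : Type u) [CommRing k] [Ring A] [Algebra k A] [Ring H] [HopfAlgebra k H]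

variable {k A H} in
/-- `h ⊗ a ↦ a^{h⁽¹⁾} ⊗ h⁽²⁾`. -/
def twist (act : H →ₗ[k] A →ₗ[k] A) : H ⊗[k] A →ₗ[k] A ⊗[k] H :=
  (TensorProduct.lift act).rTensor H ∘ₗ (TensorProduct.rightComm k H H A).toLinearMap ∘ₗ
    (Coalgebra.comul (R := k) (A := H)).rTensor A

variable {k A H} in
/-- `h ⊗ l ↦ f(h⁽¹⁾, l⁽¹⁾) ⊗ h⁽²⁾ l⁽²⁾`. -/
def cocycleMul (f : H ⊗[k] H →ₗ[k] A) : H ⊗[k] H →ₗ[k] A ⊗[k] H :=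
  TensorProduct.map f (LinearMap.mul' k H) ∘ₗ
    (TensorProduct.tensorTensorTensorComm k H H H H).toLinearMap ∘ₗ
    TensorProduct.map (Coalgebra.comul (R := k) (A := H)) (Coalgebra.comul (R := k) (A := H))

/-- `a ⊗ (b ⊗ h) ↦ a b ⊗ h`. -/
def mulFst : A ⊗[k] (A ⊗[k] H) →ₗ[k] A ⊗[k] H :=
  (LinearMap.mul' k A).rTensor H ∘ₗ (TensorProduct.assoc k A A H).symm.toLinearMap

variable {k A H} in
/-- The multiplication `(a ⊗ h)(b ⊗ l) = a b^{h⁽¹⁾} f(h⁽²⁾, l⁽¹⁾) ⊗ h⁽³⁾ l⁽²⁾` on `A ⊗ H`. -/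
def crossedMul (act : H →ₗ[k] A →ₗ[k] A) (f : H ⊗[k] H →ₗ[k] A) :
    (A ⊗[k] H) ⊗[k] (A ⊗[k] H) →ₗ[k] A ⊗[k] H :=
  mulFst k A H ∘ₗ (mulFst k A H).lTensor A ∘ₗ ((cocycleMul f).lTensor A).lTensor A ∘ₗ
    ((TensorProduct.assoc k A H H).toLinearMap).lTensor A ∘ₗ
    ((twist act).rTensor H).lTensor A ∘ₗ
    ((TensorProduct.assoc k H A H).symm.toLinearMap).lTensor A ∘ₗ
    (TensorProduct.assoc k A H (A ⊗[k] H)).toLinearMap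

/-- A weak action of `H` on `A` together with a map `f : H ⊗ H → A` such that `A #_f H` is a
crossed product, that is, the multiplication `crossedMul` is associative with unit `1 # 1`. -/
structure CrossedProduct where
  /-- The weak action, `act h a = a^h`. -/
  act : H →ₗ[k] A →ₗ[k] A
  /-- `(a b)^h = a^{h⁽¹⁾} b^{h⁽²⁾}`. -/
  act_mul : ∀ (h : H) (a b : A), act h (a * b) =
    LinearMap.mul' k A (TensorProduct.map (act.flip a) (act.flip b)
      (Coalgebra.comul (R := k) (A := H) h))
  /-- `1^h = ε(h) 1`. -/
  act_one : ∀ h : H, act h 1 = Coalgebra.counit (R := k) (A := H) h • (1 : A)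
  /-- `a^1 = a`. -/
  one_act : ∀ a : A, act 1 a = a
  /-- The cocycle `f`. -/
  cocycle : H ⊗[k] H →ₗ[k] A
  crossed_mul_assoc : ∀ x y z : A ⊗[k] H,
    crossedMul act cocycle (crossedMul act cocycle (x ⊗ₜ y) ⊗ₜ z) =
      crossedMul act cocycle (x ⊗ₜ crossedMul act cocycle (y ⊗ₜ z))
  crossed_one_mul : ∀ x : A ⊗[k] H, crossedMul act cocycle ((1 ⊗ₜ 1) ⊗ₜ x) = x
  crossed_mul_one : ∀ x : A ⊗[k] H, crossedMul act cocycle (x ⊗ₜ (1 ⊗ₜ 1)) = x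

variable {k A H} (D : CrossedProduct k A H)

namespace CrossedProduct

/-- The crossed product algebra `E = A #_f H`. -/
def E (_D : CrossedProduct k A H) : Type u := A ⊗[k] H

instance : AddCommGroup D.E := inferInstanceAs (AddCommGroup (A ⊗[k] H))

instance : Module k D.E := inferInstanceAs (Module k (A ⊗[k] H))

/-- The underlying module of `E` is `A ⊗ H`. -/
def toTensor : D.E ≃ₗ[k] A ⊗[k] H := LinearEquiv.refl k (A ⊗[k] H)

instance : Mul D.E :=
  ⟨fun x y => D.toTensor.symm (crossedMul D.act D.cocycle (D.toTensor x ⊗ₜ D.toTensor y))⟩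

instance : One D.E := ⟨D.toTensor.symm (1 ⊗ₜ 1)⟩

theorem toTensor_mul (x y : D.E) :
    D.toTensor (x * y) = crossedMul D.act D.cocycle (D.toTensor x ⊗ₜ D.toTensor y) := rfl

theorem toTensor_one : D.toTensor 1 = 1 ⊗ₜ 1 := rfl

instance : Ring D.E :=
  { (inferInstance : AddCommGroup D.E), (inferInstance : Mul D.E), (inferInstance : One D.E) with
    mul_assoc := fun x y z => D.crossed_mul_assoc _ _ _
    one_mul := fun x => D.crossed_one_mul _
    mul_one := fun x => D.crossed_mul_one _
    left_distrib := fun x y z => by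
      apply D.toTensor.injective
      simp only [map_add, toTensor_mul, TensorProduct.tmul_add]
    right_distrib := fun x y z => by
      apply D.toTensor.injective
      simp only [map_add, toTensor_mul, TensorProduct.add_tmul]
    zero_mul := fun x => by
      apply D.toTensor.injective
      simp only [map_zero, toTensor_mul, TensorProduct.zero_tmul]
    mul_zero := fun x => by
      apply D.toTensor.injective
      simp only [map_zero, toTensor_mul, TensorProduct.tmul_zero] }

instance : Algebra k D.E := Algebra.ofModule
  (fun r x y => by
    apply D.toTensor.injective
    simp only [map_smul, toTensor_mul, ← TensorProduct.smul_tmul'])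
  (fun r x y => by
    apply D.toTensor.injective
    simp only [map_smul, toTensor_mul, TensorProduct.tmul_smul])

/-- `a ↦ a # 1`. -/
def inA : A →ₗ[k] D.E := D.toTensor.symm.toLinearMap ∘ₗ (TensorProduct.mk k A H).flip 1

/-- `h ↦ 1 # h`. -/
def inH : H →ₗ[k] D.E := D.toTensor.symm.toLinearMap ∘ₗ TensorProduct.mk k A H 1

end CrossedProduct

/-! ### Sweedler calculus on tuples -/

section Tuples

/-- `B̄ = B / k`. -/
abbrev Red (k B : Type u) [CommRing k] [Ring B] [Algebra k B] : Type u :=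
  B ⧸ LinearMap.range (Algebra.linearMap k B)

/-- The class of `b ∈ B` in `B̄`, as an element of degree one of the tensor algebra of `B̄`. -/
def cls (k B : Type u) [CommRing k] [Ring B] [Algebra k B] :
    B →ₗ[k] TensorAlgebra k (Red k B) :=
  TensorAlgebra.ι k ∘ₗ (LinearMap.range (Algebra.linearMap k B)).mkQ

/-- The map `B^{⊗ n} → B̄^{⊗ n}`. -/
def redT (k B : Type u) [CommRing k] [Ring B] [Algebra k B] (n : ℕ) :
    TPow k B n →ₗ[k] TPow k (Red k B) n :=
  TPow.map k (LinearMap.range (Algebra.linearMap k B)).mkQ n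

/-- The map `B^{⊗ n} → B̄^{⊗ n}`, with target embedded in the tensor algebra of `B̄`. -/
def clsT (k B : Type u) [CommRing k] [Ring B] [Algebra k B] (n : ℕ) :
    TPow k B n →ₗ[k] TensorAlgebra k (Red k B) :=
  TPow.toTensorAlgebra k n ∘ₗ redT k B n

/-- The class of `b₁ ⊗ ⋯ ⊗ bₙ` in `B̄^{⊗ n}`, as an element of the tensor algebra of `B̄`. -/
def clsL (k : Type u) {B : Type u} [CommRing k] [Ring B] [Algebra k B] (l : List B) :
    TensorAlgebra k (Red k B) :=
  (l.map (cls k B)).prod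

variable (k H) in
/-- The comultiplication `𝐡 ↦ 𝐡⁽¹⁾ ⊗ 𝐡⁽²⁾` of `H^{⊗ n}`. -/
def comulT : (n : ℕ) → TPow k H n →ₗ[k] TPow k H n ⊗[k] TPow k H n
  | 0 => LinearMap.toSpanSingleton k _ (TPow.nil k ⊗ₜ TPow.nil k) ∘ₗ
      (TPow.zeroEquiv k H).symm.toLinearMap
  | n + 1 =>
      TensorProduct.map (TPow.succEquiv k H n).toLinearMap (TPow.succEquiv k H n).toLinearMap ∘ₗ
        (TensorProduct.tensorTensorTensorComm k H H (TPow k H n) (TPow k H n)).toLinearMap ∘ₗ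
        TensorProduct.map (Coalgebra.comul (R := k) (A := H)) (comulT n) ∘ₗ
        (TPow.succEquiv k H n).symm.toLinearMap

variable (k H) in
/-- The counit `𝐡 ↦ ε(h₁) ⋯ ε(hₙ)` of `H^{⊗ n}`. -/
def counitT : (n : ℕ) → TPow k H n →ₗ[k] k
  | 0 => (TPow.zeroEquiv k H).symm.toLinearMap
  | n + 1 => TPow.lift k n
      (((LinearMap.mul k k).comp (Coalgebra.counit (R := k) (A := H))).compl₂ (counitT n))

variable (k H) in
/-- `h₁ ⊗ ⋯ ⊗ hₙ ↦ h₁ ⋯ hₙ`. -/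
def prodT : (n : ℕ) → TPow k H n →ₗ[k] H
  | 0 => Algebra.linearMap k H ∘ₗ (TPow.zeroEquiv k H).symm.toLinearMap
  | n + 1 => TPow.lift k n ((LinearMap.mul k H).compl₂ (prodT n))

/-- The convolution `𝐡 ↦ g₁(𝐡⁽¹⁾) g₂(𝐡⁽²⁾)`. -/
def conv {R : Type u} [Ring R] [Algebra k R] {n : ℕ} (g₁ g₂ : TPow k H n →ₗ[k] R) :
    TPow k H n →ₗ[k] R :=
  LinearMap.mul' k R ∘ₗ TensorProduct.map g₁ g₂ ∘ₗ comulT k H n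

namespace CrossedProduct

/-- `a^{𝐡̄} = (⋯((a^{hₙ})^{hₙ₋₁})⋯)^{h₁}`. -/
def actT : (n : ℕ) → TPow k H n →ₗ[k] Module.End k A
  | 0 => LinearMap.toSpanSingleton k _ LinearMap.id ∘ₗ (TPow.zeroEquiv k H).symm.toLinearMap
  | n + 1 => TPow.lift k n (((LinearMap.mul k (Module.End k A)).comp D.act).compl₂ (actT n))

/-- `𝐡 ⊗ a ↦ a^{𝐡̄⁽¹⁾} ⊗ 𝐡⁽²⁾`. -/
def twistT (n : ℕ) : TPow k H n ⊗[k] A →ₗ[k] A ⊗[k] TPow k H n :=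
  (TensorProduct.lift (D.actT n)).rTensor (TPow k H n) ∘ₗ
    (TensorProduct.rightComm k (TPow k H n) (TPow k H n) A).toLinearMap ∘ₗ
    (comulT k H n).rTensor A

/-- `𝐚^{𝐡̄} = a₁^{𝐡̄⁽¹⁾} ⊗ ⋯ ⊗ aᵣ^{𝐡̄⁽ʳ⁾}` in `Ā^{⊗ r}`, for `𝐚 = a₁ ⊗ ⋯ ⊗ aᵣ`; it is `ε(𝐡)` if
`r = 0`. -/
def tupleAct (n : ℕ) : List A → (TPow k H n →ₗ[k] TensorAlgebra k (Red k A))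
  | [] => Algebra.linearMap k (TensorAlgebra k (Red k A)) ∘ₗ counitT k H n
  | a :: as => conv (cls k A ∘ₗ (D.actT n).flip a) (tupleAct n as)

/-- `h₁ ⊗ ⋯ ⊗ hₙ₊₁ ↦ f(hⱼ⁽¹⁾, hⱼ₊₁⁽¹⁾)^{𝐡̄} ⊗ 𝐡' ⊗ hⱼ⁽²⁾ hⱼ₊₁⁽²⁾ ⊗ hⱼ₊₂ ⊗ ⋯ ⊗ hₙ₊₁` with
`𝐡 = (h₁ ⊗ ⋯ ⊗ hⱼ₋₁)⁽¹⁾` and `𝐡' = (h₁ ⊗ ⋯ ⊗ hⱼ₋₁)⁽²⁾`, for `1 ≤ j ≤ n`. Here `j` is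
the second argument plus one. -/
def merge : (n : ℕ) → (i : ℕ) → TPow k H (n + 1) →ₗ[k] A ⊗[k] TPow k H n
  | 0, _ => 0
  | n + 1, 0 =>
      (TPow.succEquiv k H n).toLinearMap.lTensor A ∘ₗ
        (TensorProduct.assoc k A H (TPow k H n)).toLinearMap ∘ₗ
        (cocycleMul D.cocycle).rTensor (TPow k H n) ∘ₗ
        (TensorProduct.assoc k H H (TPow k H n)).symm.toLinearMap ∘ₗ
        (TPow.succEquiv k H n).symm.toLinearMap.lTensor H ∘ₗ
        (TPow.succEquiv k H (n + 1)).symm.toLinearMap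
  | n + 1, i + 1 =>
      (TPow.succEquiv k H n).toLinearMap.lTensor A ∘ₗ
        (TensorProduct.assoc k A H (TPow k H n)).toLinearMap ∘ₗ
        (twist D.act).rTensor (TPow k H n) ∘ₗ
        (TensorProduct.assoc k H A (TPow k H n)).symm.toLinearMap ∘ₗ
        (merge n i).lTensor H ∘ₗ
        (TPow.succEquiv k H (n + 1)).symm.toLinearMap

/-- The maps `F^{(l)}(𝐡 ⊗ 𝐚) ∈ Ā^{⊗ (r+l-1)}` for `𝐡 ∈ H^{⊗ l}`, `l ≥ 1`, and
`𝐚 = a₁ ⊗ ⋯ ⊗ aᵣ`: `F^{(1)}(h ⊗ 𝐚) = 𝐚^h` and, for `l ≥ 1`,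
`F^{(l+1)}(𝐡 ⊗ 𝐚) = ∑_{j=1}^{l} ∑_{i=0}^{r} (-1)^{il+j} (a₁ ⊗ ⋯ ⊗ aᵢ)^{𝐡̄⁽¹⁾} ⊗ b ⊗
F^{(l)}(𝐡' ⊗ aᵢ₊₁ ⊗ ⋯ ⊗ aᵣ)`, where `b ⊗ 𝐡' ∈ A ⊗ H^{⊗ l}` is `merge` of `𝐡⁽²⁾` at
position `j`. The value at `l = 0` is never used. -/
def F : (l : ℕ) → List A → (TPow k H l →ₗ[k] TensorAlgebra k (Red k A))
  | 0, _ => 0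
  | 1, a => D.tupleAct 1 a
  | l + 2, a => ∑ j ∈ Finset.range (l + 1), ∑ i ∈ Finset.range (a.length + 1),
      (-1 : k) ^ (i * (l + 1) + (j + 1)) •
        conv (D.tupleAct (l + 2) (a.take i))
          (LinearMap.mul' k _ ∘ₗ TensorProduct.map (cls k A) (F (l + 1) (a.drop i)) ∘ₗ
            D.merge (l + 1) j)

end CrossedProduct

end Tuples

/-! ### The complex `X̂` -/

section Hat

namespace CrossedProduct

variable (M : Type u) [AddCommGroup M] [Module k M]

/-- `X̂_n = ⨁_{r+s=n} M ⊗ H̄^{⊗ s} ⊗ Ā^{⊗ r}`; the summands are indexed by the pairs `(r, s)`. -/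
abbrev Hat (k A H M : Type u) [CommRing k] [Ring A] [Algebra k A] [Ring H] [HopfAlgebra k H]
    [AddCommGroup M] [Module k M] (n : ℕ) : Type u :=
  ⨁ p : Finset.HasAntidiagonal.antidiagonal n,
    M ⊗[k] (TPow k (Red k H) p.1.2 ⊗[k] TPow k (Red k A) p.1.1)

/-- `⨁_{r,s} M ⊗ H̄^{⊗ s} ⊗ Ā^{⊗ r}`, written with tensor algebras. -/
abbrev HatTot (k A H M : Type u) [CommRing k] [Ring A] [Algebra k A] [Ring H] [HopfAlgebra k H]
    [AddCommGroup M] [Module k M] : Type u :=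
  M ⊗[k] (TensorAlgebra k (Red k H) ⊗[k] TensorAlgebra k (Red k A))

variable (k A H) in
/-- The canonical embedding of `X̂_n`. -/
def hatIncl (n : ℕ) : Hat k A H M n →ₗ[k] HatTot k A H M :=
  DirectSum.toModule k _ _ fun p =>
    (TensorProduct.map (TPow.toTensorAlgebra k p.1.2) (TPow.toTensorAlgebra k p.1.1)).lTensor M

variable (k) in
variable {M} in
/-- The element `m ⊗ 𝐡 ⊗ 𝐚` of `X̂_n`. -/
def hatGen {n : ℕ} (m : M) (h : List H) (a : List A) (hn : a.length + h.length = n) :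
    Hat k A H M n :=
  DirectSum.lof k (Finset.HasAntidiagonal.antidiagonal n)
    (fun p => M ⊗[k] (TPow k (Red k H) p.1.2 ⊗[k] TPow k (Red k A) p.1.1))
    ⟨(a.length, h.length), Finset.HasAntidiagonal.mem_antidiagonal.2 hn⟩
    (m ⊗ₜ (redT k H h.length (TPow.ofList k h) ⊗ₜ redT k A a.length (TPow.ofList k a)))

variable [Module D.E M] [Module D.Eᵐᵒᵖ M] [IsScalarTower k D.E M] [IsScalarTower k D.Eᵐᵒᵖ M]

variable {M}

/-- `b ↦ m (b # 1)`. -/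
def mulInA (m : M) : A →ₗ[k] M := rightAct k D.E M ∘ₗ TensorProduct.mk k M D.E m ∘ₗ D.inA

/-- `h ↦ (1 # h) m`. -/
def inHMul (m : M) : H →ₗ[k] M := leftAct k D.E M ∘ₗ (TensorProduct.mk k D.E M).flip m ∘ₗ D.inH

/-- `d̂⁰(m ⊗ 𝐡 ⊗ 𝐚)` for `𝐚 = a₁ ⊗ ⋯ ⊗ aᵣ`; there is no `d̂⁰` if `r = 0`. -/
def hatD0 (m : M) (h : List H) : List A → HatTot k A H M
  | [] => 0
  | a₁ :: as =>
      TensorProduct.map (D.mulInA m)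
          ((TensorProduct.mk k _ _).flip (clsL k as) ∘ₗ clsT k H h.length)
          (D.twistT h.length (TPow.ofList k h ⊗ₜ a₁))
        + (-1 : k) ^ (as.length + 1) •
          (D.inA ((a₁ :: as).getLast (List.cons_ne_nil a₁ as)) • m) ⊗ₜ
            (clsL k h ⊗ₜ clsL k (a₁ :: as).dropLast)
        + ∑ i ∈ Finset.range as.length, (-1 : k) ^ (i + 1) •
          m ⊗ₜ (clsL k h ⊗ₜ
            (clsL k ((a₁ :: as).take i) *
              cls k A ((a₁ :: as).getD i 0 * (a₁ :: as).getD (i + 1) 0) *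
              clsL k ((a₁ :: as).drop (i + 2))))

/-- `(-1)^{l(r+s)} (1 # 𝔥⁽²⁾) m ⊗ h₁ ⊗ ⋯ ⊗ h_{s-l} ⊗ F^{(l)}(𝐡'⁽¹⁾ ⊗ 𝐚)`, where
`𝐡' = h_{s-l+1} ⊗ ⋯ ⊗ h_s` and `𝔥 = h_{s-l+1} ⋯ h_s`. For `2 ≤ l ≤ s` it is
`d̂^l(m ⊗ 𝐡 ⊗ 𝐚)`, and for `l = 1` it is a summand of `d̂¹(m ⊗ 𝐡 ⊗ 𝐚)`. -/
def hatTail (m : M) (h : List H) (a : List A) (l : ℕ) : HatTot k A H M :=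
  (-1 : k) ^ (l * (a.length + h.length)) •
    TensorProduct.map (D.inHMul m ∘ₗ prodT k H _)
      (TensorProduct.mk k _ _ (clsL k (h.take (h.length - l))) ∘ₗ D.F _ a)
      (TensorProduct.comm k _ _
        (comulT k H _ (TPow.ofList k (h.drop (h.length - l)))))

/-- `d̂¹(m ⊗ 𝐡 ⊗ 𝐚)` for `𝐡 = h₁ ⊗ ⋯ ⊗ hₛ`; there is no `d̂¹` if `s = 0`. -/
def hatD1 (m : M) (a : List A) : List H → HatTot k A H M
  | [] => 0
  | h₁ :: hs =>
      (-1 : k) ^ a.length • (MulOpposite.op (D.inH h₁) • m) ⊗ₜ (clsL k hs ⊗ₜ clsL k a)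
        + D.hatTail m (h₁ :: hs) a 1
        + ∑ i ∈ Finset.range hs.length, (-1 : k) ^ (a.length + (i + 1)) •
          TensorProduct.map (D.mulInA m)
            ((TensorProduct.mk k _ _).flip (clsL k a) ∘ₗ clsT k H hs.length)
            (D.merge hs.length i (TPow.ofList k (h₁ :: hs)))

/-- `∑_{l=0}^{s} d̂^l(m ⊗ 𝐡 ⊗ 𝐚)`. -/
def hatFormula (m : M) (h : List H) (a : List A) : HatTot k A H M :=
  D.hatD0 m h a + D.hatD1 m a h + ∑ l ∈ Finset.Icc 2 h.length, D.hatTail m h a l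

variable (M)

/-- The family `d̂_{n+1} : X̂_{n+1} → X̂_n` is given by `d̂ = ∑_l d̂^l`, the maps `d̂^l` being the
ones above. As the `m ⊗ 𝐡 ⊗ 𝐚` span `X̂_{n+1}` and `hatIncl` is injective, there is at most one
such family. -/
def IsHatDifferential (d : ∀ n, Hat k A H M (n + 1) →ₗ[k] Hat k A H M n) : Prop :=
  ∀ (n : ℕ) (m : M) (h : List H) (a : List A) (hn : a.length + h.length = n + 1),
    hatIncl k A H M n (d n (hatGen k m h a hn)) = D.hatFormula m h a

end CrossedProduct

end Hat

/-! ### The complex `(X, d)` of `E`-bimodules -/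

section Resolution

namespace CrossedProduct

/-- `X_n = ⨁_{r+s=n} E ⊗ H̄^{⊗ s} ⊗ Ā^{⊗ r} ⊗ E`. -/
abbrev Res (n : ℕ) : Type u :=
  ⨁ p : Finset.HasAntidiagonal.antidiagonal n,
    D.E ⊗[k] (TPow k (Red k H) p.1.2 ⊗[k] (TPow k (Red k A) p.1.1 ⊗[k] D.E))

/-- `⨁_{r,s} E ⊗ H̄^{⊗ s} ⊗ Ā^{⊗ r} ⊗ E`, written with tensor algebras. -/
abbrev ResTot : Type u :=
  D.E ⊗[k] (TensorAlgebra k (Red k H) ⊗[k] (TensorAlgebra k (Red k A) ⊗[k] D.E))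

/-- `⨁_s Y_s` with `Y_s = E ⊗ H̄^{⊗ s} ⊗ H`. -/
abbrev YTot : Type u := D.E ⊗[k] (TensorAlgebra k (Red k H) ⊗[k] H)

/-- The canonical embedding of `X_n`. -/
def resIncl (n : ℕ) : D.Res n →ₗ[k] D.ResTot :=
  DirectSum.toModule k _ _ fun p =>
    (TensorProduct.map (TPow.toTensorAlgebra k p.1.2)
      ((TPow.toTensorAlgebra k p.1.1).rTensor D.E)).lTensor D.E

/-- The element `1 ⊗ 𝐡 ⊗ 𝐚 ⊗ 1` of `X_n`. -/
def resGen {n : ℕ} (h : List H) (a : List A) (hn : a.length + h.length = n) : D.Res n :=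
  DirectSum.lof k (Finset.HasAntidiagonal.antidiagonal n)
    (fun p => D.E ⊗[k] (TPow k (Red k H) p.1.2 ⊗[k] (TPow k (Red k A) p.1.1 ⊗[k] D.E)))
    ⟨(a.length, h.length), Finset.HasAntidiagonal.mem_antidiagonal.2 hn⟩
    (1 ⊗ₜ (redT k H h.length (TPow.ofList k h) ⊗ₜ (redT k A a.length (TPow.ofList k a) ⊗ₜ 1)))

/-- The left action of `E` on `X_n`. -/
def resLeft (n : ℕ) (e : D.E) : D.Res n →ₗ[k] D.Res n :=
  DirectSum.lmap fun _ => (LinearMap.mulLeft k e).rTensor _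

/-- The right action of `E` on `X_n`. -/
def resRight (n : ℕ) (e : D.E) : D.Res n →ₗ[k] D.Res n :=
  DirectSum.lmap fun _ => (((LinearMap.mulRight k e).lTensor _).lTensor _).lTensor _

/-- The left action of `E` on `⨁ X_{rs}`. -/
def totLeft (e : D.E) : D.ResTot →ₗ[k] D.ResTot := (LinearMap.mulLeft k e).rTensor _

/-- The right action of `E` on `⨁ X_{rs}`. -/
def totRight (e : D.E) : D.ResTot →ₗ[k] D.ResTot :=
  (((LinearMap.mulRight k e).lTensor _).lTensor _).lTensor _

/-- `b ↦ e (b # 1)`. -/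
def mulA (e : D.E) : A →ₗ[k] D.E := LinearMap.mulLeft k e ∘ₗ D.inA

/-- `d⁰(e ⊗ 𝐡 ⊗ 𝐚 ⊗ e')` for `𝐚 = a₁ ⊗ ⋯ ⊗ aᵣ`; there is no `d⁰` if `r = 0`. -/
def resD0 (e : D.E) (h : List H) (e' : D.E) : List A → D.ResTot
  | [] => 0
  | a₁ :: as =>
      TensorProduct.map (D.mulA e)
          ((TensorProduct.mk k _ _).flip (clsL k as ⊗ₜ e') ∘ₗ clsT k H h.length)
          (D.twistT h.length (TPow.ofList k h ⊗ₜ a₁))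
        + (-1 : k) ^ (as.length + 1) •
          e ⊗ₜ (clsL k h ⊗ₜ (clsL k (a₁ :: as).dropLast ⊗ₜ
            (D.inA ((a₁ :: as).getLast (List.cons_ne_nil a₁ as)) * e')))
        + ∑ i ∈ Finset.range as.length, (-1 : k) ^ (i + 1) •
          e ⊗ₜ (clsL k h ⊗ₜ
            ((clsL k ((a₁ :: as).take i) *
              cls k A ((a₁ :: as).getD i 0 * (a₁ :: as).getD (i + 1) 0) *
              clsL k ((a₁ :: as).drop (i + 2))) ⊗ₜ e'))

/-- `H^{⊗ (s+1)} → H̄^{⊗ s} ⊗ H`; the value at exponent `0` is never used. -/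
def yT : (n : ℕ) → TPow k H n →ₗ[k] TensorAlgebra k (Red k H) ⊗[k] H
  | 0 => 0
  | n + 1 => (clsT k H n).rTensor H ∘ₗ TPow.unsnoc k n

/-- `∂(e ⊗ h₁ ⊗ ⋯ ⊗ hₛ₊₁) = - e (1 # h₁) ⊗ h₂ ⊗ ⋯ ⊗ hₛ₊₁ + ∑_{i=1}^{s} (-1)^{i+1}
e (f(hᵢ⁽¹⁾, hᵢ₊₁⁽¹⁾)^{𝐡̄} # 1) ⊗ 𝐡' ⊗ hᵢ⁽²⁾ hᵢ₊₁⁽²⁾ ⊗ hᵢ₊₂ ⊗ ⋯ ⊗ hₛ₊₁` for `s ≥ 1`, where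
`𝐡 = (h₁ ⊗ ⋯ ⊗ hᵢ₋₁)⁽¹⁾` and `𝐡' = (h₁ ⊗ ⋯ ⊗ hᵢ₋₁)⁽²⁾`; it is `0` on `Y_0`. -/
def yD (e : D.E) : List H → D.YTot
  | [] => 0
  | [_] => 0
  | h₁ :: h₂ :: hs =>
      - (e * D.inH h₁) ⊗ₜ yT (hs.length + 1) (TPow.ofList k (h₂ :: hs))
        + ∑ i ∈ Finset.range (hs.length + 1), (-1 : k) ^ i •
          TensorProduct.map (D.mulA e) (yT (hs.length + 1))
            (D.merge (hs.length + 1) i (TPow.ofList k (h₁ :: h₂ :: hs)))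

/-- `σ⁰ : Y_s → X_{0s}`, `e ⊗ 𝐡 ⊗ h ↦ e ⊗ 𝐡 ⊗ (1 # h)`. -/
def sigmaY : D.YTot →ₗ[k] D.ResTot :=
  ((TensorProduct.mk k (TensorAlgebra k (Red k A)) D.E 1 ∘ₗ D.inH).lTensor _).lTensor _

/-- `σ⁰ : X_{rs} → X_{r+1,s}`,
`e ⊗ 𝐡 ⊗ 𝐚 ⊗ (a # h) ↦ (-1)^{r+1} e ⊗ 𝐡 ⊗ (𝐚 ⊗ a) ⊗ (1 # h)`. -/
def sigmaX : D.ResTot →ₗ[k] D.ResTot :=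
  ((TensorProduct.map
      (LinearMap.mul' k _ ∘ₗ TensorProduct.map
        (-(TensorAlgebra.lift k (-(TensorAlgebra.ι k (M := Red k A)))).toLinearMap) (cls k A))
      D.inH ∘ₗ
    (TensorProduct.assoc k (TensorAlgebra k (Red k A)) A H).symm.toLinearMap ∘ₗ
    D.toTensor.toLinearMap.lTensor _).lTensor _).lTensor _

/-- The maps `∂ : Y_s → Y_{s-1}` and `d^l : X_{rs} → X_{r+l-1,s-l}`, assembled over all `r, s`, are
the ones of the recursive definition: `∂` and `d⁰` are given by `yD` and `resD0`, and for `l ≥ 1`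
the map `d^l` is the `E`-bimodule map which on `x = 1 ⊗ 𝐡 ⊗ 𝐚 ⊗ 1` is `0` if `l > s` and
otherwise is
`- σ⁰ ∂ μ(x)` if `r = 0` and `l = 1` (here `μ(x) = 1 ⊗ 𝐡 ⊗ 1`),
`- ∑_{j=1}^{l-1} σ⁰ d^{l-j} d^j (x)` if `r = 0` and `l > 1`, and
`- ∑_{j=0}^{l-1} σ⁰ d^{l-j} d^j (x)` if `r > 0`. -/
structure IsResolutionData (del : D.YTot →ₗ[k] D.YTot) (dl : ℕ → D.ResTot →ₗ[k] D.ResTot) :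
    Prop where
  del_apply : ∀ (e : D.E) (h : List H), h ≠ [] →
    del (e ⊗ₜ yT h.length (TPow.ofList k h)) = D.yD e h
  zero_apply : ∀ (e e' : D.E) (h : List H) (a : List A),
    dl 0 (e ⊗ₜ (clsL k h ⊗ₜ (clsL k a ⊗ₜ e'))) = D.resD0 e h e' a
  map_left : ∀ (l : ℕ) (e : D.E), dl l ∘ₗ D.totLeft e = D.totLeft e ∘ₗ dl l
  map_right : ∀ (l : ℕ) (e : D.E), dl l ∘ₗ D.totRight e = D.totRight e ∘ₗ dl l
  eq_zero : ∀ (l : ℕ) (h : List H) (a : List A), h.length < l →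
    dl l (1 ⊗ₜ (clsL k h ⊗ₜ (clsL k a ⊗ₜ 1))) = 0
  one_nil : ∀ h : List H, 1 ≤ h.length →
    dl 1 (1 ⊗ₜ (clsL k h ⊗ₜ (clsL k ([] : List A) ⊗ₜ 1))) =
      - D.sigmaY (del (1 ⊗ₜ (clsL k h ⊗ₜ 1)))
  rec_nil : ∀ (l : ℕ) (h : List H), 1 < l → l ≤ h.length →
    dl l (1 ⊗ₜ (clsL k h ⊗ₜ (clsL k ([] : List A) ⊗ₜ 1))) =
      - ∑ j ∈ Finset.Ico 1 l, D.sigmaX (dl (l - j) (dl j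
        (1 ⊗ₜ (clsL k h ⊗ₜ (clsL k ([] : List A) ⊗ₜ 1)))))
  rec_apply : ∀ (l : ℕ) (h : List H) (a : List A), 1 ≤ l → l ≤ h.length → a ≠ [] →
    dl l (1 ⊗ₜ (clsL k h ⊗ₜ (clsL k a ⊗ₜ 1))) =
      - ∑ j ∈ Finset.range l, D.sigmaX (dl (l - j) (dl j
        (1 ⊗ₜ (clsL k h ⊗ₜ (clsL k a ⊗ₜ 1)))))

/-- The family `d_{n+1} : X_{n+1} → X_n` is `∑_l d^l`, with the maps `d^l` of the recursive
definition. There is at most one such family. -/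
def IsResDifferential (d : ∀ n, D.Res (n + 1) →ₗ[k] D.Res n) : Prop :=
  ∃ (del : D.YTot →ₗ[k] D.YTot) (dl : ℕ → D.ResTot →ₗ[k] D.ResTot),
    D.IsResolutionData del dl ∧
    ∀ (n : ℕ) (x : D.Res (n + 1)),
      D.resIncl n (d n x) = ∑ l ∈ Finset.range (n + 2), dl l (D.resIncl (n + 1) x)

variable (M : Type u) [AddCommGroup M] [Module k M]
variable [Module D.E M] [Module D.Eᵐᵒᵖ M]

/-- The submodule of `M ⊗ X_n` spanned by all `m e ⊗ x - m ⊗ e x` and `e m ⊗ x - m ⊗ x e`. -/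
def balancedRel (n : ℕ) : Submodule k (M ⊗[k] D.Res n) :=
  Submodule.span k
    ({z | ∃ (m : M) (e : D.E) (x : D.Res n),
        z = (MulOpposite.op e • m) ⊗ₜ x - m ⊗ₜ D.resLeft n e x} ∪
      {z | ∃ (m : M) (e : D.E) (x : D.Res n), z = (e • m) ⊗ₜ x - m ⊗ₜ D.resRight n e x})

/-- `M ⊗_{E^e} X_n`. -/
abbrev ResTensor (n : ℕ) : Type u := (M ⊗[k] D.Res n) ⧸ D.balancedRel M n

end CrossedProduct

end Resolution

end Crossed

end HopfCrossed
end

/-! Let W_n be the sum of all H̄^{⊗s} ⊗ Ā^{⊗r} with r + s = n, read as words with the letters from H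
in front. Everything comes from one complex E ⊗ W_* ⊗ E, built together with a contraction; the rest
identifies its differential with the two descriptions in the statement.

The bar complex K_n = A ⊗ Ā^{⊗n} ⊗ E of E over A sits inside E ⊗ W_n ⊗ E by an inclusion i (`incK`).
Let P (`pushP`) send (a#h) ⊗ z to (a#1) ⊗ hz, and let T (`pushT`) send (a#h) ⊗ z to a ⊗ Θ(h,z), with
values in K and Θ still to be found. The differential is the one for which P deforms the identity to
the retraction -T onto K. Requiring ∂P + P∂ = id + iT, and using that P((1#h) ⊗ w ⊗ 1) = 1 ⊗ hw ⊗ 1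
and that ∂ is E-bilinear, gives ∂(hw) = h ⊗ w - P(h ∂w) + 1 ⊗ Θ(h,w), while on words in A alone ∂ is
the bar differential δ of K. For T to be a chain map, Θ is produced by the contraction κ of K:
Θ(h,w) is the prefixed form of T(h ∂w), starting from Θ(h,1) = -(1#h).

This looks circular, since Θ in degree n+1 needs ∂ in degree n. But prefixing a coefficient from A
reads it modulo k, so only the symbol of h ∂w in Ā ⊗ H ⊗ W_n matters; the terms 1 ⊗ Θ of ∂w do not
contribute to it, because (1#h)(1#1) = 1#h has coefficient 1. Symbols therefore obey their own
recursion (`symbD`), which defines Θ and then ∂; `symb_bd` and `theta_succ` close the loop. As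
letters live in H̄ and Ā, each recursion must also vanish on the letter 1, which is proved
simultaneously with the recursion itself (`symbD_succ_and`, `delta_succ_and`, `bd_succ_and`). Then
`bdE_bdZ_and` yields ∂² = 0 together with the chain map property of T, and P - iκT contracts the
complex (`bdE_homotopy_succ`).

For part (2), a bimodule map out of E ⊗ W_n ⊗ E is the same as a k-linear map out of W_n, and the
contractions are k-linear. Hence the usual comparison argument works with no projectivity over k:
two such resolutions give homotopy equivalent complexes after applying M ⊗_{E^e} -
(`BiRes.nonempty_homology_iso`). One is the complex of words, the other the bar resolution, which
gives the Hochschild complex (`extM_barBd`).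

For the recursive description of d^l, split ∂ by the number l of lost letters from H (`bdL`). The
operator σ contracts d⁰ on words with at least one letter from A (`bdZero_sigZ`), and it kills d^l(1
⊗ w ⊗ 1) for l ≥ 1 because those terms end in 1#H (`piB_bdT_mem_endsH`). Applying σ to ∑ d^{l-j} d^j
= 0 gives the recursion (`bdL_eq_sum`). The case r = 0, l = 1 is a direct comparison with the
differential of Y.

For the closed formula of d̂, unroll the recursion (`bdT_mono`). The lead terms give d̂¹ without its
tail, the bar differential carried through the letters from H gives d̂⁰, and each 1 ⊗ Θ gives one
tail. `gL_eq` identifies Θ with ± F^{(l)}(𝐡⁽¹⁾ ⊗ 𝐚) ⊗ 𝔥⁽²⁾: both obey the recursion "merge two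
neighbours in 𝐡, or move the first letter of 𝐚 to the front"; for F this needs merging and moving to
be compatible with the coaction 𝐡 ↦ 𝐡⁽¹⁾ ⊗ 𝔥⁽²⁾ (`coact_merge`, `coact_twistT`). Words and the
tensors of the statement differ by the sign (-1)^{rs}.

Part (3) is the computation of the coinvariants of an induced bimodule (`coinvEquiv`). -/

noncomputable section

namespace HopfCrossed

/-! ### Shortcut instances -/

namespace Shortcuts

scoped instance {R S M N : Type*} [Semiring R] [Semiring S] (f : R →+* S) [AddCommMonoid M]
    [AddCommMonoid N] [Module R M] [Module S N] : ZeroHomClass (M →ₛₗ[f] N) M N := inferInstance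

scoped instance {R S M N : Type*} [Semiring R] [Semiring S] (f : R →+* S) [AddCommMonoid M]
    [AddCommMonoid N] [Module R M] [Module S N] : AddMonoidHomClass (M →ₛₗ[f] N) M N :=
  inferInstance

scoped instance {R S M N : Type*} [Semiring R] [Semiring S] (f : R →+* S) [AddCommGroup M]
    [AddCommGroup N] [Module R M] [Module S N] : AddMonoidHomClass (M →ₛₗ[f] N) M N :=
  inferInstance

scoped instance {R M N : Type*} [Semiring R] [AddCommMonoid M] [AddCommMonoid N] [Module R M]
    [Module R N] : ZeroHomClass (M ≃ₗ[R] N) M N := inferInstance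

scoped instance {R M N : Type*} [Semiring R] [AddCommMonoid M] [AddCommMonoid N] [Module R M]
    [Module R N] : AddMonoidHomClass (M ≃ₗ[R] N) M N := inferInstance

scoped instance {R M N : Type*} [Semiring R] [AddCommGroup M] [AddCommGroup N] [Module R M]
    [Module R N] : AddMonoidHomClass (M ≃ₗ[R] N) M N := inferInstance

scoped instance {R M N : Type*} [Semiring R] [AddCommMonoid M] [AddCommMonoid N] [Module R M]
    [Module R N] : AddHomClass (M ≃ₗ[R] N) M N := inferInstance

scoped instance {R S M N : Type*} [Semiring R] [Semiring S] (f : R →+* S) [AddCommMonoid M]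
    [AddCommMonoid N] [Module R M] [Module S N] : AddHomClass (M →ₛₗ[f] N) M N := inferInstance

variable {M : Type*}

scoped instance [AddCommMonoid M] : AddZeroClass M := inferInstance
scoped instance [AddCommMonoid M] : AddMonoid M := inferInstance
scoped instance [AddCommGroup M] : InvolutiveNeg M := inferInstance
scoped instance [AddCommGroup M] : SubNegMonoid M := inferInstance
scoped instance [AddCommGroup M] : AddGroup M := inferInstance
scoped instance [AddCommGroup M] : NegZeroClass M := inferInstance
scoped instance [AddCommGroup M] : SubtractionMonoid M := inferInstance
scoped instance [AddCommGroup M] : SubtractionCommMonoid M := inferInstance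

scoped instance [Semiring M] : NonUnitalSemiring M := inferInstance
scoped instance [Semiring M] : Semigroup M := inferInstance
scoped instance [Semiring M] : NonUnitalNonAssocSemiring M := inferInstance

end Shortcuts

open scoped Shortcuts

/-! ### Arithmetic in the crossed product -/

namespace CrossedProduct

variable {k A H : Type u} [CommRing k] [Ring A] [Algebra k A] [Ring H] [HopfAlgebra k H]
variable (D : CrossedProduct k A H)

theorem toTensor_inA (a : A) : D.toTensor (D.inA a) = a ⊗ₜ 1 := rfl

theorem toTensor_inH (h : H) : D.toTensor (D.inH h) = 1 ⊗ₜ h := rfl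

theorem twist_one_left (act : H →ₗ[k] A →ₗ[k] A) (a : A) :
    twist act ((1 : H) ⊗ₜ[k] a) = act 1 a ⊗ₜ 1 := by
  simp [twist, Algebra.TensorProduct.one_def]

/-- The weak action sends 1 to ε(h)1, and the counit axiom absorbs the ε. -/
theorem twist_one_right (h : H) : twist D.act (h ⊗ₜ[k] (1 : A)) = 1 ⊗ₜ h := by
  have key : ∀ t : H ⊗[k] H, (TensorProduct.lift D.act).rTensor H
      ((TensorProduct.rightComm k H H A) (t ⊗ₜ (1 : A))) =
      (1 : A) ⊗ₜ (TensorProduct.lid k H ((Coalgebra.counit (R := k) (A := H)).rTensor H t)) := by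
    intro t
    induction t using TensorProduct.induction_on with
    | zero => simp
    | add x y hx hy => simp only [TensorProduct.add_tmul, map_add, hx, hy, TensorProduct.tmul_add]
    | tmul x y =>
      simp [D.act_one, TensorProduct.smul_tmul]
  have := key (Coalgebra.comul (R := k) h)
  simp only [Coalgebra.rTensor_counit_comul, TensorProduct.lid_tmul, one_smul] at this
  simpa [twist] using this

theorem mulFst_tmul (a b : A) (h : H) :
    mulFst k A H (a ⊗ₜ (b ⊗ₜ h)) = (a * b) ⊗ₜ h := rfl

theorem mulFst_one (t : A ⊗[k] H) : mulFst k A H (1 ⊗ₜ t) = t := by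
  induction t using TensorProduct.induction_on with
  | zero => simp
  | add x y hx hy => simp only [TensorProduct.tmul_add, map_add, hx, hy]
  | tmul x y => simp [mulFst_tmul]

/-- `t ⊗ l ↦ a·χ(h ⊗ l)` for `t = a ⊗ h`. -/
def mulTail (t : A ⊗[k] H) (l : H) : A ⊗[k] H :=
  mulFst k A H ((cocycleMul D.cocycle).lTensor A (TensorProduct.assoc k A H H (t ⊗ₜ l)))

theorem crossedMul_tmul (a b : A) (h l : H) :
    crossedMul D.act D.cocycle ((a ⊗ₜ h) ⊗ₜ (b ⊗ₜ l)) =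
      mulFst k A H (a ⊗ₜ D.mulTail (twist D.act (h ⊗ₜ b)) l) := rfl

theorem mulTail_tmul (a : A) (h l : H) :
    D.mulTail (a ⊗ₜ h) l = mulFst k A H (a ⊗ₜ cocycleMul D.cocycle (h ⊗ₜ l)) := rfl

/-- The structure does not state a normalisation of f. It is extracted, in this form, from the unit
axiom of E evaluated at 1#h. -/
theorem cocycleMul_one_left (h : H) : cocycleMul D.cocycle (1 ⊗ₜ h) = 1 ⊗ₜ h := by
  have := D.crossed_one_mul (1 ⊗ₜ h)
  rwa [crossedMul_tmul, twist_one_right, mulTail_tmul, mulFst_one, mulFst_one] at this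

theorem cocycleMul_one_right (h : H) : cocycleMul D.cocycle (h ⊗ₜ 1) = 1 ⊗ₜ h := by
  have := D.crossed_mul_one (1 ⊗ₜ h)
  rwa [crossedMul_tmul, twist_one_right, mulTail_tmul, mulFst_one, mulFst_one] at this

theorem inH_one : D.inH 1 = 1 := rfl

theorem inA_one : D.inA 1 = 1 := rfl

theorem inA_mul (a b : A) : D.inA (a * b) = D.inA a * D.inA b := by
  apply D.toTensor.injective
  rw [toTensor_mul, toTensor_inA, toTensor_inA, toTensor_inA, crossedMul_tmul, twist_one_left,
    D.one_act, mulTail_tmul, cocycleMul_one_left, mulFst_tmul, mulFst_tmul, mul_one]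

theorem toTensor_inA_mul (a : A) (e : D.E) :
    D.toTensor (D.inA a * e) = mulFst k A H (a ⊗ₜ D.toTensor e) := by
  rw [toTensor_mul, toTensor_inA]
  generalize D.toTensor e = t
  induction t using TensorProduct.induction_on with
  | zero => simp
  | add x y hx hy => simp only [TensorProduct.tmul_add, map_add, hx, hy]
  | tmul b l =>
    rw [crossedMul_tmul, twist_one_left, D.one_act, mulTail_tmul, cocycleMul_one_left, mulFst_tmul,
      mul_one]

theorem inA_mul_inH (a : A) (h : H) : D.inA a * D.inH h = D.toTensor.symm (a ⊗ₜ h) := by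
  apply D.toTensor.injective
  rw [toTensor_inA_mul, toTensor_inH, mulFst_tmul, mul_one, LinearEquiv.apply_symm_apply]

theorem toTensor_inA_mul_inH (a : A) (h : H) : D.toTensor (D.inA a * D.inH h) = a ⊗ₜ h := by
  rw [inA_mul_inH, LinearEquiv.apply_symm_apply]

theorem toTensor_inH_mul_inA (h : H) (a : A) :
    D.toTensor (D.inH h * D.inA a) = twist D.act (h ⊗ₜ a) := by
  rw [toTensor_mul, toTensor_inA, toTensor_inH, crossedMul_tmul, mulFst_one]
  generalize twist D.act (h ⊗ₜ[k] a) = t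
  induction t using TensorProduct.induction_on with
  | zero => simp [mulTail]
  | add x y hx hy =>
    simp only [mulTail, TensorProduct.add_tmul, map_add] at hx hy ⊢
    rw [hx, hy]
  | tmul b l => rw [mulTail_tmul, cocycleMul_one_right, mulFst_tmul, mul_one]

theorem toTensor_inH_mul_inH (h l : H) :
    D.toTensor (D.inH h * D.inH l) = cocycleMul D.cocycle (h ⊗ₜ l) := by
  rw [toTensor_mul, toTensor_inH, toTensor_inH, crossedMul_tmul, mulFst_one, twist_one_right,
    mulTail_tmul, mulFst_one]

variable {D} in
-- Every a#h factors as (a#1)(1#h). Working with this product, rather than with pure tensors, makes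
-- the later computations take place inside the ring E.
theorem E_induction {p : D.E → Prop} (h0 : ∀ a h, p (D.inA a * D.inH h))
    (hadd : ∀ x y, p x → p y → p (x + y)) (e : D.E) : p e := by
  have key : ∀ t : A ⊗[k] H, p (D.toTensor.symm t) := by
    intro t
    induction t using TensorProduct.induction_on with
    | zero =>
      have := h0 0 0
      rwa [map_zero, zero_mul] at this
    | add x y hx hy => rw [map_add]; exact hadd _ _ hx hy
    | tmul a h => rw [← inA_mul_inH]; exact h0 a h
  exact key (D.toTensor e)

end CrossedProduct

/-! ### Linear maps on a reduced algebra -/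

section RedLift

variable {k B N : Type u} [CommRing k] [Ring B] [Algebra k B] [AddCommGroup N] [Module k N]

open Classical in
/-- The map `B̄ → N` induced by a linear map `g : B → N` with `g 1 = 0` (and `0` otherwise). -/
def redLift (g : B →ₗ[k] N) : Red k B →ₗ[k] N :=
  if h : LinearMap.range (Algebra.linearMap k B) ≤ LinearMap.ker g then Submodule.liftQ _ g h else 0

variable (k) in
/-- The class of `b` in `B̄`. -/
def red : B →ₗ[k] Red k B := (LinearMap.range (Algebra.linearMap k B)).mkQ

/-- Because `redLift` is total, a recursion over reduced letters can be written down before it is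
known to vanish at 1. The vanishing is then proved by induction together with the recursion formula.
-/
theorem redLift_red {g : B →ₗ[k] N} (h : g 1 = 0) (b : B) : redLift g (red k b) = g b := by
  have : LinearMap.range (Algebra.linearMap k B) ≤ LinearMap.ker g := by
    rintro _ ⟨c, rfl⟩
    rw [LinearMap.mem_ker, Algebra.linearMap_apply, Algebra.algebraMap_eq_smul_one, map_smul, h,
      smul_zero]
  rw [redLift, dif_pos this]
  rfl

theorem red_one : red k (1 : B) = 0 :=
  (Submodule.Quotient.mk_eq_zero _).2 ⟨1, by simp⟩

theorem red_surjective : Function.Surjective (red k (B := B)) := Submodule.mkQ_surjective _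

end RedLift

/-! ### Linear maps between induced modules -/

section Induced

variable {k : Type u} [CommRing k] {B E N Z V W : Type u} [Ring B] [Algebra k B] [Ring E]
  [Algebra k E] [AddCommGroup N] [Module k N] [AddCommGroup Z] [Module k Z]
  [AddCommGroup V] [Module k V] [AddCommGroup W] [Module k W]

variable (k N) in
/-- Left multiplication on `B ⊗ N`. -/
def lMul : B →ₗ[k] Module.End k (B ⊗[k] N) := LinearMap.rTensorHom N ∘ₗ LinearMap.mul k B

variable (k V) in
/-- Right multiplication on `V ⊗ E`. -/
def rMul : E →ₗ[k] Module.End k (V ⊗[k] E) := LinearMap.lTensorHom V ∘ₗ (LinearMap.mul k E).flip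

@[simp] theorem lMul_tmul (b b' : B) (n : N) : lMul k N b (b' ⊗ₜ n) = (b * b') ⊗ₜ n := rfl

@[simp] theorem rMul_tmul (e e' : E) (v : V) : rMul k V e (v ⊗ₜ e') = v ⊗ₜ (e' * e) := rfl

theorem lMul_one (x : B ⊗[k] N) : lMul k N 1 x = x := by
  induction x using TensorProduct.induction_on with
  | zero => simp
  | add x y hx hy => rw [map_add, hx, hy]
  | tmul b n => simp

theorem lMul_mul (b b' : B) (x : B ⊗[k] N) : lMul k N (b * b') x = lMul k N b (lMul k N b' x) := by
  induction x using TensorProduct.induction_on with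
  | zero => simp
  | add x y hx hy => simp only [map_add, hx, hy]
  | tmul b n => simp [mul_assoc]

theorem rMul_one (x : V ⊗[k] E) : rMul k V 1 x = x := by
  induction x using TensorProduct.induction_on with
  | zero => simp
  | add x y hx hy => rw [map_add, hx, hy]
  | tmul b n => simp

theorem rMul_mul (e e' : E) (x : V ⊗[k] E) : rMul k V (e * e') x = rMul k V e' (rMul k V e x) := by
  induction x using TensorProduct.induction_on with
  | zero => simp
  | add x y hx hy => simp only [map_add, hx, hy]
  | tmul b n => simp [mul_assoc]

theorem lMul_lTensor (g : N →ₗ[k] Z) (b : B) (x : B ⊗[k] N) :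
    lMul k Z b (g.lTensor B x) = g.lTensor B (lMul k N b x) := by
  induction x using TensorProduct.induction_on with
  | zero => simp
  | add x y hx hy => simp only [map_add, hx, hy]
  | tmul b n => simp

theorem rMul_rTensor (g : V →ₗ[k] W) (e : E) (x : V ⊗[k] E) :
    rMul k W e (g.rTensor E x) = g.rTensor E (rMul k V e x) := by
  induction x using TensorProduct.induction_on with
  | zero => simp
  | add x y hx hy => simp only [map_add, hx, hy]
  | tmul b n => simp

/-- The left `B`-linear extension `b ⊗ z ↦ b q(z)`. -/
def leftExt (q : Z →ₗ[k] B ⊗[k] N) : B ⊗[k] Z →ₗ[k] B ⊗[k] N :=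
  TensorProduct.lift ((LinearMap.lcomp k (B ⊗[k] N) q) ∘ₗ lMul k N)

/-- The right `E`-linear extension `w ⊗ e ↦ g(w) e`. -/
def rightExt (g : W →ₗ[k] B ⊗[k] (V ⊗[k] E)) : W ⊗[k] E →ₗ[k] B ⊗[k] (V ⊗[k] E) :=
  TensorProduct.lift ((LinearMap.lTensorHom B ∘ₗ rMul k V).flip ∘ₗ g)

@[simp] theorem leftExt_tmul (q : Z →ₗ[k] B ⊗[k] N) (b : B) (z : Z) :
    leftExt q (b ⊗ₜ z) = lMul k N b (q z) := rfl

@[simp] theorem rightExt_tmul (g : W →ₗ[k] B ⊗[k] (V ⊗[k] E)) (w : W) (e : E) :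
    rightExt g (w ⊗ₜ e) = (rMul k V e).lTensor B (g w) := rfl

theorem leftExt_lMul (q : Z →ₗ[k] B ⊗[k] N) (b : B) (x : B ⊗[k] Z) :
    leftExt q (lMul k Z b x) = lMul k N b (leftExt q x) := by
  induction x using TensorProduct.induction_on with
  | zero => simp
  | add x y hx hy => simp only [map_add, hx, hy]
  | tmul b n => simp [lMul_mul]

theorem rightExt_rMul (g : W →ₗ[k] B ⊗[k] (V ⊗[k] E)) (e : E) (x : W ⊗[k] E) :
    rightExt g (rMul k W e x) = (rMul k V e).lTensor B (rightExt g x) := by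
  induction x using TensorProduct.induction_on with
  | zero => simp
  | add x y hx hy => simp only [map_add, hx, hy]
  | tmul w e' =>
    rw [rMul_tmul, rightExt_tmul, rightExt_tmul]
    generalize g w = y
    induction y using TensorProduct.induction_on with
    | zero => simp
    | add x y hx hy => simp only [map_add, hx, hy]
    | tmul w e' => simp [rMul_mul]

theorem leftExt_lTensor_rMul {g : W ⊗[k] E →ₗ[k] B ⊗[k] (V ⊗[k] E)}
    (hg : ∀ e x, g (rMul k W e x) = (rMul k V e).lTensor B (g x)) (e : E) (x : B ⊗[k] (W ⊗[k] E)) :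
    leftExt g ((rMul k W e).lTensor B x) = (rMul k V e).lTensor B (leftExt g x) := by
  induction x using TensorProduct.induction_on with
  | zero => simp
  | add x y hx hy => simp only [map_add, hx, hy]
  | tmul w e' => simp [hg, lMul_lTensor]

/-- Right `E`-linear maps out of `W ⊗ E` agree if they agree on `W ⊗ 1`. -/
theorem right_ext {f g : W ⊗[k] E →ₗ[k] N} (r : E → Module.End k N)
    (hf : ∀ e x, f (rMul k W e x) = r e (f x)) (hg : ∀ e x, g (rMul k W e x) = r e (g x))
    (h : ∀ w, f (w ⊗ₜ 1) = g (w ⊗ₜ 1)) : f = g := by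
  refine TensorProduct.ext' fun w e => ?_
  have : w ⊗ₜ[k] e = rMul k W e (w ⊗ₜ 1) := by simp
  rw [this, hf, hg, h]

end Induced

/-! ### Words -/

section Words

variable (k A H : Type u) [CommRing k] [Ring A] [Algebra k A] [Ring H] [Algebra k H]

/-- `⨁_{r+s=n} H̄^{⊗ s} ⊗ Ā^{⊗ r}`, by recursion on `n`, as a bundled module. -/
def WordCat : ℕ → ModuleCat.{u} k
  | 0 => ModuleCat.of k k
  | n + 1 => ModuleCat.of k ((Red k H ⊗[k] WordCat n) × TPow k (Red k A) (n + 1))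

/-- `⨁_{r+s=n} H̄^{⊗ s} ⊗ Ā^{⊗ r}`, by recursion on `n`. -/
abbrev Word (n : ℕ) : Type u := WordCat k A H n

namespace Word

variable {H} in
/-- `h ⊗ w ↦ h w`. -/
def consH (n : ℕ) : Red k H →ₗ[k] Word k A H n →ₗ[k] Word k A H (n + 1) :=
  (TensorProduct.mk k (Red k H) (Word k A H n)).compr₂
    (LinearMap.inl k (Red k H ⊗[k] Word k A H n) (TPow k (Red k A) (n + 1)))

/-- The inclusion of `Ā^{⊗ n}`. -/
def ofA : (n : ℕ) → TPow k (Red k A) n →ₗ[k] Word k A H n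
  | 0 => (TPow.zeroEquiv k (Red k A)).symm.toLinearMap
  | n + 1 => LinearMap.inr k (Red k H ⊗[k] Word k A H n) (TPow k (Red k A) (n + 1))

variable {k A H} {N : Type u} [AddCommGroup N] [Module k N]

/-- A linear map out of the words of positive length. -/
def lift (n : ℕ) (g : Red k H →ₗ[k] Word k A H n →ₗ[k] N) (f : TPow k (Red k A) (n + 1) →ₗ[k] N) :
    Word k A H (n + 1) →ₗ[k] N :=
  (TensorProduct.lift g).coprod f

theorem lift_consH (n : ℕ) (g : Red k H →ₗ[k] Word k A H n →ₗ[k] N)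
    (f : TPow k (Red k A) (n + 1) →ₗ[k] N) (h : Red k H) (w : Word k A H n) :
    lift n g f (consH k A n h w) = g h w := by
  change TensorProduct.lift g (h ⊗ₜ w) + f 0 = _
  simp

theorem lift_ofA (n : ℕ) (g : Red k H →ₗ[k] Word k A H n →ₗ[k] N)
    (f : TPow k (Red k A) (n + 1) →ₗ[k] N) (x : TPow k (Red k A) (n + 1)) :
    lift n g f (ofA k A H (n + 1) x) = f x := by
  change TensorProduct.lift g 0 + f x = _
  simp

theorem induction_succ {n : ℕ} {p : Word k A H (n + 1) → Prop}
    (hH : ∀ h w, p (consH k A n (red k h) w)) (hA : ∀ x, p (ofA k A H (n + 1) x))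
    (hadd : ∀ x y, p x → p y → p (x + y)) (w : Word k A H (n + 1)) : p w := by
  have h1 : ∀ t : Red k H ⊗[k] Word k A H n,
      p (LinearMap.inl k (Red k H ⊗[k] Word k A H n) (TPow k (Red k A) (n + 1)) t) := by
    intro t
    induction t using TensorProduct.induction_on with
    | zero =>
      have := hH 0 0
      rw [map_zero] at this
      rw [map_zero]
      exact this
    | add x y hx hy => rw [map_add]; exact hadd _ _ hx hy
    | tmul h w =>
      obtain ⟨h, rfl⟩ := red_surjective h
      exact hH h w
  have h2 : ∀ q : (Red k H ⊗[k] Word k A H n) × TPow k (Red k A) (n + 1),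
      q = LinearMap.inl k _ _ q.1 + LinearMap.inr k _ _ q.2 := fun q => by simp
  rw [h2 w]
  exact hadd _ _ (h1 _) (hA _)

theorem ext_succ {n : ℕ} {f g : Word k A H (n + 1) →ₗ[k] N}
    (hH : ∀ h w, f (consH k A n (red k h) w) = g (consH k A n (red k h) w))
    (hA : ∀ x, f (ofA k A H (n + 1) x) = g (ofA k A H (n + 1) x)) : f = g :=
  LinearMap.ext fun w => induction_succ (p := fun w => f w = g w) hH hA
    (fun x y hx hy => by rw [map_add, map_add, hx, hy]) w

theorem ext_zero {f g : Word k A H 0 →ₗ[k] N}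
    (h : f (ofA k A H 0 (TPow.nil k)) = g (ofA k A H 0 (TPow.nil k))) : f = g := by
  have h' : ∀ c : k, f (c • ofA k A H 0 (TPow.nil k)) = g (c • ofA k A H 0 (TPow.nil k)) := by
    intro c
    rw [map_smul, map_smul, h]
  refine LinearMap.ext fun w => ?_
  have : w = (show k from w) • ofA k A H 0 (TPow.nil k) := (mul_one (show k from w)).symm
  rw [this, h']

end Word

theorem TPow.induction_red {B : Type u} [Ring B] [Algebra k B] {n : ℕ}
    {p : TPow k (Red k B) (n + 1) → Prop}
    (h : ∀ b x, p (TPow.cons k n (red k b) x)) (hadd : ∀ x y, p x → p y → p (x + y))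
    (x : TPow k (Red k B) (n + 1)) : p x := by
  have key : ∀ t : Red k B ⊗[k] TPow k (Red k B) n, p (TPow.succEquiv k (Red k B) n t) := by
    intro t
    induction t using TensorProduct.induction_on with
    | zero =>
      have := h 0 0
      rwa [map_zero] at this
    | add x y hx hy => rw [map_add]; exact hadd _ _ hx hy
    | tmul b w =>
      obtain ⟨b, rfl⟩ := red_surjective b
      exact h b w
  exact key x

end Words

namespace CrossedProduct

variable {k A H : Type u} [CommRing k] [Ring A] [Algebra k A] [Ring H] [HopfAlgebra k H]
variable (D : CrossedProduct k A H)

/-! ### Pushing elements of `E` to the right -/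

section Push

variable {N Z Z' : Type u} [AddCommGroup N] [Module k N] [AddCommGroup Z] [Module k Z]
  [AddCommGroup Z'] [Module k Z']

/-- `(a # h) ⊗ z ↦ a ⊗ c(h, z)`. -/
def push (c : H →ₗ[k] Z →ₗ[k] Z') : D.E ⊗[k] Z →ₗ[k] A ⊗[k] Z' :=
  (TensorProduct.lift c).lTensor A ∘ₗ (TensorProduct.assoc k A H Z).toLinearMap ∘ₗ
    D.toTensor.toLinearMap.rTensor Z

@[simp] theorem push_tmul (c : H →ₗ[k] Z →ₗ[k] Z') (a : A) (h : H) (z : Z) :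
    D.push c ((D.inA a * D.inH h) ⊗ₜ z) = a ⊗ₜ c h z := by
  simp [push, toTensor_inA_mul_inH]

@[simp] theorem push_inA (c : H →ₗ[k] Z →ₗ[k] Z') (a : A) (z : Z) :
    D.push c (D.inA a ⊗ₜ z) = a ⊗ₜ c 1 z := by
  have := D.push_tmul c a 1 z
  rwa [inH_one, mul_one] at this

@[simp] theorem push_inH (c : H →ₗ[k] Z →ₗ[k] Z') (h : H) (z : Z) :
    D.push c (D.inH h ⊗ₜ z) = 1 ⊗ₜ c h z := by
  have := D.push_tmul c 1 h z
  rwa [inA_one, one_mul] at this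

@[simp] theorem push_one (c : H →ₗ[k] Z →ₗ[k] Z') (z : Z) :
    D.push c (1 ⊗ₜ z) = 1 ⊗ₜ c 1 z := D.push_inH c 1 z

variable {D} in
theorem ET_induction {p : D.E ⊗[k] Z → Prop} (h0 : ∀ a h z, p ((D.inA a * D.inH h) ⊗ₜ z))
    (hadd : ∀ x y, p x → p y → p (x + y)) (x : D.E ⊗[k] Z) : p x := by
  induction x using TensorProduct.induction_on with
  | zero =>
    have := h0 0 0 0
    rwa [TensorProduct.tmul_zero] at this
  | add x y hx hy => exact hadd _ _ hx hy
  | tmul e z =>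
    induction e using E_induction with
    | h0 a h => exact h0 a h z
    | hadd x y hx hy => rw [TensorProduct.add_tmul]; exact hadd _ _ hx hy

theorem push_lMul (c : H →ₗ[k] Z →ₗ[k] Z') (a : A) (x : D.E ⊗[k] Z) :
    D.push c (lMul k Z (D.inA a) x) = lMul k Z' a (D.push c x) := by
  induction x using ET_induction with
  | h0 b h z => rw [lMul_tmul, ← mul_assoc, ← inA_mul, push_tmul, push_tmul, lMul_tmul]
  | hadd x y hx hy => simp only [map_add, hx, hy]

theorem push_lTensor {c : H →ₗ[k] Z →ₗ[k] Z'} {r : Z →ₗ[k] Z} {r' : Z' →ₗ[k] Z'}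
    (h : ∀ h z, c h (r z) = r' (c h z)) (x : D.E ⊗[k] Z) :
    D.push c (r.lTensor D.E x) = r'.lTensor A (D.push c x) := by
  induction x using ET_induction with
  | h0 b l z => rw [LinearMap.lTensor_tmul, push_tmul, push_tmul, LinearMap.lTensor_tmul, h]
  | hadd x y hx hy => simp only [map_add, hx, hy]

variable (N) in
/-- The inclusion `A ⊗ N → E ⊗ N`. -/
def incA : A ⊗[k] N →ₗ[k] D.E ⊗[k] N := D.inA.rTensor N

@[simp] theorem incA_tmul (a : A) (n : N) : D.incA N (a ⊗ₜ n) = D.inA a ⊗ₜ n := rfl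

theorem incA_lMul (a : A) (x : A ⊗[k] N) :
    D.incA N (lMul k N a x) = lMul k N (D.inA a) (D.incA N x) := by
  induction x using TensorProduct.induction_on with
  | zero => simp
  | add x y hx hy => simp only [map_add, hx, hy]
  | tmul b n => simp [inA_mul]

theorem incA_lTensor (g : N →ₗ[k] Z) (x : A ⊗[k] N) :
    D.incA Z (g.lTensor A x) = g.lTensor D.E (D.incA N x) := by
  induction x using TensorProduct.induction_on with
  | zero => simp
  | add x y hx hy => simp only [map_add, hx, hy]
  | tmul b n => simp

variable (Z) in
/-- `(a # h) ⊗ z ↦ ā ⊗ h ⊗ z`. -/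
def symb : D.E ⊗[k] Z →ₗ[k] Red k A ⊗[k] (H ⊗[k] Z) :=
  (red k).rTensor (H ⊗[k] Z) ∘ₗ D.push (TensorProduct.mk k H Z)

@[simp] theorem symb_tmul (a : A) (h : H) (z : Z) :
    D.symb Z ((D.inA a * D.inH h) ⊗ₜ z) = red k a ⊗ₜ (h ⊗ₜ z) := by simp [symb]

-- The coefficient of 1#h is 1, which is zero in Ā. This is what makes the unknown terms 1 ⊗ Θ of
-- the differential invisible to symbols.
@[simp] theorem symb_inH (h : H) (z : Z) : D.symb Z (D.inH h ⊗ₜ z) = 0 := by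
  simp [symb, red_one]

/-- The map `H ⊗ Ā → Ā ⊗ H` induced by the multiplication of `E`. -/
def symbHA : Red k A →ₗ[k] H →ₗ[k] Red k A ⊗[k] H :=
  redLift (k := k) (B := A) (N := H →ₗ[k] Red k A ⊗[k] H)
    (((LinearMap.mul k D.E).compl₁₂ D.inH D.inA).compr₂
      ((red k).rTensor H ∘ₗ D.toTensor.toLinearMap)).flip

/-- Descends to Ā because (1#h)(1#1) = 1#h has coefficient 1, zero in Ā. -/
theorem symbHA_red (a : A) (h : H) :
    D.symbHA (red k a) h = (red k).rTensor H (D.toTensor (D.inH h * D.inA a)) := by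
  rw [symbHA, redLift_red]
  · rfl
  · ext h
    simp [inA_one, toTensor_inH, red_one]

/-- The composition `H ⊗ H → Ā ⊗ H` of the multiplication of `E` with the projection. -/
def symbHH : H →ₗ[k] H →ₗ[k] Red k A ⊗[k] H :=
  ((LinearMap.mul k D.E).compl₁₂ D.inH D.inH).compr₂
    ((red k).rTensor H ∘ₗ D.toTensor.toLinearMap)

theorem symbHH_apply (h l : H) :
    D.symbHH h l = (red k).rTensor H (D.toTensor (D.inH h * D.inH l)) := rfl

theorem symbHH_one_right (h : H) : D.symbHH h 1 = 0 := by
  simp [symbHH_apply, inH_one, toTensor_inH, red_one]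

theorem symbHH_one_left (h : H) : D.symbHH 1 h = 0 := by
  simp [symbHH_apply, inH_one, toTensor_inH, red_one]

theorem symb_eq_assoc (e : D.E) (z : Z) : D.symb Z (e ⊗ₜ z) =
    TensorProduct.assoc k _ _ _ ((red k).rTensor H (D.toTensor e) ⊗ₜ z) := by
  induction e using E_induction with
  | h0 b l => simp [toTensor_inA_mul_inH]
  | hadd x y hx hy => simp only [TensorProduct.add_tmul, map_add, hx, hy]

/-- `h, b ⊗ l ⊗ z ↦ [h b] ⊗ c(l, z)`. -/
def symbPush (c : H →ₗ[k] Z →ₗ[k] Z') :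
    H →ₗ[k] Red k A ⊗[k] (H ⊗[k] Z) →ₗ[k] Red k A ⊗[k] (H ⊗[k] Z') :=
  LinearMap.llcomp k _ _ _ (TensorProduct.assoc k _ _ _).toLinearMap ∘ₗ
    (TensorProduct.mapBilinear (.id k) _ _ _ _).flip (TensorProduct.lift c) ∘ₗ D.symbHA.flip

theorem symbPush_tmul (c : H →ₗ[k] Z →ₗ[k] Z') (h : H) (b : Red k A) (l : H) (z : Z) :
    D.symbPush c h (b ⊗ₜ (l ⊗ₜ z)) =
      TensorProduct.assoc k _ _ _ (D.symbHA b h ⊗ₜ c l z) := rfl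

/-- Changing the coefficient b by a scalar changes (1#h)(b#1) by a multiple of 1#h, whose symbol is
zero. So the symbol after a push and a left multiplication depends only on the symbol before, and
the recursion closes on symbols. -/
theorem symb_incA_push (c : H →ₗ[k] Z →ₗ[k] Z') (h : H) (x : D.E ⊗[k] Z) :
    D.symb Z' (lMul k Z' (D.inH h) (D.incA Z' (D.push c x))) = D.symbPush c h (D.symb Z x) := by
  induction x using ET_induction with
  | h0 b l z =>
    rw [push_tmul, incA_tmul, lMul_tmul, symb_tmul, symbPush_tmul, symb_eq_assoc, symbHA_red]
  | hadd x y hx hy => simp only [map_add, hx, hy]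

end Push

/-! ### The structure maps of the resolution -/

/-- Multiplication by `h` on words. -/
def wH (n : ℕ) : H →ₗ[k] Word k A H n →ₗ[k] Word k A H (n + 1) := Word.consH k A n ∘ₗ red k

theorem wH_apply (n : ℕ) (h : H) (w : Word k A H n) : wH n h w = Word.consH k A n (red k h) w := rfl

theorem wH_one (n : ℕ) (w : Word k A H n) : wH n 1 w = 0 := by rw [wH_apply, red_one]; simp

section Symbols

/-- `h', w, h ↦ [h h'] ⊗ w`. -/
def symbMul (N : Type u) [AddCommGroup N] [Module k N] :
    H →ₗ[k] N →ₗ[k] H →ₗ[k] Red k A ⊗[k] (H ⊗[k] N) :=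
  LinearMap.mk₂ k (fun h' w => (TensorProduct.assoc k _ _ _).toLinearMap ∘ₗ
      (TensorProduct.mk k _ _).flip w ∘ₗ D.symbHH.flip h')
    (by intros; ext; simp) (by intros; ext; simp) (by intros; ext; simp) (by intros; ext; simp)

set_option maxSynthPendingDepth 3 in
/-- The recursion step for `symbD`. -/
def symbStepSucc {n : ℕ}
    (s : Word k A H (n + 1) →ₗ[k] H →ₗ[k] Red k A ⊗[k] (H ⊗[k] Word k A H n)) :
    H →ₗ[k] Word k A H (n + 1) →ₗ[k] H →ₗ[k] Red k A ⊗[k] (H ⊗[k] Word k A H (n + 1)) :=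
 D.symbMul (Word k A H (n + 1)) - (s.compr₂ (D.symbPush (wH (k := k) (A := A) n)).flip).flip

/-- The symbol of `h ⊗ a x`. -/
def symbStepA (n : ℕ) :
    TPow k (Red k A) (n + 1) →ₗ[k] H →ₗ[k] Red k A ⊗[k] (H ⊗[k] Word k A H n) :=
  TPow.lift k n (LinearMap.mk₂ k (fun a x => (TensorProduct.assoc k _ _ _).toLinearMap ∘ₗ
      (TensorProduct.mk k _ _).flip (Word.ofA k A H n x) ∘ₗ D.symbHA a)
    (by intros; ext; simp) (by intros; ext; simp)
    (by intros; ext; simp) (by intros; ext; simp))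

set_option maxSynthPendingDepth 3 in
/-- The symbol of `h ∂(w)` in `Ā ⊗ H ⊗ W_n`. -/
def symbD : (n : ℕ) → Word k A H (n + 1) →ₗ[k] H →ₗ[k] Red k A ⊗[k] (H ⊗[k] Word k A H n)
  | 0 => Word.lift 0 (redLift (D.symbMul _)) (D.symbStepA 0)
  | n + 1 => Word.lift (n + 1) (redLift (D.symbStepSucc (symbD n))) (D.symbStepA (n + 1))

set_option maxSynthPendingDepth 3 in
theorem symbD_ofA (n : ℕ) (a : Red k A) (x : TPow k (Red k A) n) (h : H) :
    D.symbD n (Word.ofA k A H (n + 1) (TPow.cons k n a x)) h =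
      TensorProduct.assoc k _ _ _ (D.symbHA a h ⊗ₜ Word.ofA k A H n x) := by
  cases n <;> rw [symbD, Word.lift_ofA] <;> rfl

set_option maxSynthPendingDepth 3 in
theorem symbD_zero (h' : H) (w : Word k A H 0) (h : H) :
    D.symbD 0 (wH 0 h' w) h = TensorProduct.assoc k _ _ _ (D.symbHH h h' ⊗ₜ w) := by
  rw [symbD, wH_apply, Word.lift_consH, redLift_red]
  · rfl
  · refine LinearMap.ext fun w => LinearMap.ext fun h => ?_
    simp [symbMul, symbHH_one_right]

set_option maxSynthPendingDepth 3 in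
-- The recursion in degree n+2 is legitimate only if its right side vanishes for the letter 1, which
-- amounts to the first claim; the first claim one degree higher is in turn proved with that
-- recursion. Hence the joint induction.
theorem symbD_succ_and (n : ℕ) :
    (∀ (w : Word k A H (n + 1)) (h : H), D.symbPush (wH n) h (D.symbD n w 1) = 0) ∧
    ∀ (h' : H) (w : Word k A H (n + 1)) (h : H), D.symbD (n + 1) (wH (n + 1) h' w) h =
      TensorProduct.assoc k _ _ _ (D.symbHH h h' ⊗ₜ w) -
        D.symbPush (wH n) h (D.symbD n w h') := by
  have hA : ∀ (n : ℕ) (x : TPow k (Red k A) (n + 1)) (h : H),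
      D.symbPush (wH n) h (D.symbD n (Word.ofA k A H (n + 1) x) 1) = 0 := by
    intro n x h
    induction x using TPow.induction_red with
    | h b x => rw [symbD_ofA, symbHA_red]; simp [inH_one, toTensor_inA, symbPush_tmul, wH_one]
    | hadd x y hx hy => simp only [map_add, LinearMap.add_apply, hx, hy, add_zero]
  have step : ∀ n : ℕ,
      (∀ (w : Word k A H (n + 1)) (h : H), D.symbPush (wH n) h (D.symbD n w 1) = 0) →
      ∀ (h' : H) (w : Word k A H (n + 1)) (h : H), D.symbD (n + 1) (wH (n + 1) h' w) h =
        TensorProduct.assoc k _ _ _ (D.symbHH h h' ⊗ₜ w) -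
          D.symbPush (wH n) h (D.symbD n w h') := by
    intro n hn h' w h
    rw [symbD, wH_apply, Word.lift_consH, redLift_red]
    · rfl
    · refine LinearMap.ext fun w => LinearMap.ext fun h => ?_
      simp [symbStepSucc, symbMul, symbHH_one_right, hn]
  induction n with
  | zero =>
    have h0 : ∀ (w : Word k A H 1) (h : H), D.symbPush (wH 0) h (D.symbD 0 w 1) = 0 := by
      intro w h
      induction w using Word.induction_succ with
      | hH h' w => rw [← wH_apply, symbD_zero, symbHH_one_left]; simp
      | hA x => exact hA _ _ _
      | hadd x y hx hy => simp only [map_add, LinearMap.add_apply, hx, hy, add_zero]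
    exact ⟨h0, step 0 h0⟩
  | succ n ih =>
    have h0 : ∀ (w : Word k A H (n + 2)) (h : H),
        D.symbPush (wH (n + 1)) h (D.symbD (n + 1) w 1) = 0 := by
      intro w h
      induction w using Word.induction_succ with
      | hH h' w =>
        rw [← wH_apply, ih.2, symbHH_one_left, TensorProduct.zero_tmul, map_zero, zero_sub, map_neg]
        -- A push from the left factor 1 produces terms b ⊗ 1 ⊗ lw. The next push would prefix the
        -- letter 1, which is zero in H̄.
        generalize D.symbD n w h' = t
        rw [neg_eq_zero]
        induction t using TensorProduct.induction_on with
        | zero => simp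
        | add x y hx hy => simp only [map_add, hx, hy, add_zero]
        | tmul b t =>
          induction t using TensorProduct.induction_on with
          | zero => simp
          | add x y hx hy => simp only [TensorProduct.tmul_add, map_add, hx, hy, add_zero]
          | tmul l w =>
            obtain ⟨b, rfl⟩ := red_surjective b
            rw [symbPush_tmul, symbHA_red]
            simp [inH_one, toTensor_inA, symbPush_tmul, wH_one]
      | hA x => exact hA _ _ _
      | hadd x y hx hy => simp only [map_add, LinearMap.add_apply, hx, hy, add_zero]
    exact ⟨h0, step _ h0⟩

set_option maxSynthPendingDepth 3 in
theorem symbD_succ (n : ℕ) (h' : H) (w : Word k A H (n + 1)) (h : H) :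
    D.symbD (n + 1) (wH (n + 1) h' w) h =
      TensorProduct.assoc k _ _ _ (D.symbHH h h' ⊗ₜ w) - D.symbPush (wH n) h (D.symbD n w h') :=
  (D.symbD_succ_and n).2 h' w h

end Symbols

end CrossedProduct

/-! ### The tail map Θ, the push P and the retraction onto the bar complex of A -/

namespace CrossedProduct

variable {k A H : Type u} [CommRing k] [Ring A] [Algebra k A] [Ring H] [HopfAlgebra k H]
variable (D : CrossedProduct k A H)

section Theta

/-- `b ⊗ h ⊗ w ↦ b ⊗ g(w, h)`. -/
def consLift {n : ℕ} {N : Type u} [AddCommGroup N] [Module k N] {W : Type u} [AddCommGroup W]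
    [Module k W] (g : W →ₗ[k] H →ₗ[k] TPow k (Red k A) n ⊗[k] N) :
    Red k A ⊗[k] (H ⊗[k] W) →ₗ[k] TPow k (Red k A) (n + 1) ⊗[k] N :=
  TensorProduct.lift ((LinearMap.lcomp k _ (TensorProduct.lift g.flip)) ∘ₗ
    LinearMap.rTensorHom N ∘ₗ TPow.cons k n)

theorem consLift_tmul {n : ℕ} {N : Type u} [AddCommGroup N] [Module k N] {W : Type u}
    [AddCommGroup W] [Module k W] (g : W →ₗ[k] H →ₗ[k] TPow k (Red k A) n ⊗[k] N)
    (b : Red k A) (h : H) (w : W) : consLift g (b ⊗ₜ (h ⊗ₜ w)) =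
      (TPow.cons k n b).rTensor N (g w h) := rfl

/-- The map `(w, h) ↦ ± F(h⁽¹⁾ w⁽¹⁾) ⊗ 𝔥⁽²⁾`, by recursion on the degree of `w`. -/
def gT : (n : ℕ) → Word k A H n →ₗ[k] H →ₗ[k] TPow k (Red k A) n ⊗[k] H
  | 0 => TensorProduct.mk k (TPow k (Red k A) 0) H ∘ₗ (TPow.zeroEquiv k (Red k A)).toLinearMap
  | n + 1 => (D.symbD n).compr₂ (consLift (gT n))

theorem gT_zero (x : TPow k (Red k A) 0) (h : H) : D.gT 0 (Word.ofA k A H 0 x) h = x ⊗ₜ h := rfl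

theorem gT_succ (n : ℕ) (w : Word k A H (n + 1)) (h : H) :
    D.gT (n + 1) w h = consLift (D.gT n) (D.symbD n w h) := rfl

theorem gT_ofA_one (n : ℕ) (x : TPow k (Red k A) n) :
    D.gT n (Word.ofA k A H n x) 1 = x ⊗ₜ 1 := by
  induction n with
  | zero => rfl
  | succ n ih =>
    induction x using TPow.induction_red with
    | h b x =>
      rw [gT_succ, symbD_ofA, symbHA_red, inH_one, one_mul, toTensor_inA, LinearMap.rTensor_tmul,
        TensorProduct.assoc_tmul, consLift_tmul, ih, LinearMap.rTensor_tmul]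
    | hadd x y hx hy =>
      rw [map_add, map_add, LinearMap.add_apply, hx, hy, TensorProduct.add_tmul]

/-- Together with `gT_ofA_one` this says that, up to sign, Θ(1, -) is the projection to words in A
alone. That is the retraction property of -T, and it is what makes ∂(hw) vanish for h = 1. -/
theorem gT_wH_one (n : ℕ) (h' : H) (w : Word k A H n) : D.gT (n + 1) (wH n h' w) 1 = 0 := by
  induction n generalizing h' with
  | zero => rw [gT_succ, symbD_zero, symbHH_one_left]; simp
  | succ n ih =>
    rw [gT_succ, symbD_succ, symbHH_one_left, TensorProduct.zero_tmul, map_zero, zero_sub, map_neg,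
      neg_eq_zero]
    generalize D.symbD n w h' = t
    induction t using TensorProduct.induction_on with
    | zero => simp
    | add x y hx hy => simp only [map_add, hx, hy, add_zero]
    | tmul b t =>
      induction t using TensorProduct.induction_on with
      | zero => simp
      | add x y hx hy => simp only [TensorProduct.tmul_add, map_add, hx, hy, add_zero]
      | tmul l w =>
        obtain ⟨b, rfl⟩ := red_surjective b
        rw [symbPush_tmul, symbHA_red, inH_one, one_mul, toTensor_inA, LinearMap.rTensor_tmul,
          TensorProduct.assoc_tmul, consLift_tmul, ih, map_zero]

/-- `v ⊗ h ↦ (e ↦ v ⊗ (1 # h) e)`. -/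
def mulH (V : Type u) [AddCommGroup V] [Module k V] :
    V ⊗[k] H →ₗ[k] D.E →ₗ[k] V ⊗[k] D.E := (rMul k V).flip ∘ₗ D.inH.lTensor V

/-- The right `E`-linear extension of `-gT`, with the last factor `h` read as `1 # h`. -/
def theta (n : ℕ) : H →ₗ[k] Word k A H n ⊗[k] D.E →ₗ[k] TPow k (Red k A) n ⊗[k] D.E :=
  -(TensorProduct.lift (LinearMap.lflip.toLinearMap ∘ₗ
    (D.gT n).compr₂ (D.mulH (TPow k (Red k A) n)))).flip

theorem theta_tmul (n : ℕ) (h : H) (w : Word k A H n) (e : D.E) :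
    D.theta n h (w ⊗ₜ e) = -rMul k _ e (D.inH.lTensor _ (D.gT n w h)) := rfl

theorem theta_rMul (n : ℕ) (h : H) (e : D.E) (z : Word k A H n ⊗[k] D.E) :
    D.theta n h (rMul k _ e z) = rMul k _ e (D.theta n h z) := by
  induction z using TensorProduct.induction_on with
  | zero => simp
  | add x y hx hy => simp only [map_add, hx, hy]
  | tmul w e' => simp [theta_tmul, rMul_mul]

/-- `h ⊗ w ⊗ e ↦ h w ⊗ e`. -/
def wZ (n : ℕ) : H →ₗ[k] Word k A H n ⊗[k] D.E →ₗ[k] Word k A H (n + 1) ⊗[k] D.E :=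
  LinearMap.rTensorHom D.E ∘ₗ wH n

@[simp] theorem wZ_tmul (n : ℕ) (h : H) (w : Word k A H n) (e : D.E) :
    D.wZ n h (w ⊗ₜ e) = wH n h w ⊗ₜ e := rfl

theorem wZ_one (n : ℕ) (z : Word k A H n ⊗[k] D.E) : D.wZ n 1 z = 0 := by
  induction z using TensorProduct.induction_on with
  | zero => simp
  | add x y hx hy => simp only [map_add, hx, hy, add_zero]
  | tmul w e' => simp [wH_one]

theorem wZ_rMul (n : ℕ) (h : H) (e : D.E) (z : Word k A H n ⊗[k] D.E) :
    D.wZ n h (rMul k _ e z) = rMul k _ e (D.wZ n h z) := by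
  exact (rMul_rTensor _ _ _).symm

/-- The inclusion of `Ā^{⊗ n} ⊗ E`. -/
def ofK (n : ℕ) : TPow k (Red k A) n ⊗[k] D.E →ₗ[k] Word k A H n ⊗[k] D.E :=
  (Word.ofA k A H n).rTensor D.E

@[simp] theorem ofK_tmul (n : ℕ) (x : TPow k (Red k A) n) (e : D.E) :
    D.ofK n (x ⊗ₜ e) = Word.ofA k A H n x ⊗ₜ e := rfl

theorem ofK_rMul (n : ℕ) (e : D.E) (z : TPow k (Red k A) n ⊗[k] D.E) :
    D.ofK n (rMul k _ e z) = rMul k _ e (D.ofK n z) := by rw [ofK, rMul_rTensor]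

/-- The minus sign is the convention Θ = -g; it makes -T, not T, the retraction onto the bar
complex. -/
theorem theta_ofK_one (n : ℕ) (z : TPow k (Red k A) n ⊗[k] D.E) :
    D.theta n 1 (D.ofK n z) = -z := by
  induction z using TensorProduct.induction_on with
  | zero => simp
  | add x y hx hy => rw [map_add, map_add, hx, hy, neg_add]
  | tmul w e' => simp [theta_tmul, gT_ofA_one, inH_one]

theorem theta_wZ_one (n : ℕ) (h : H) (z : Word k A H n ⊗[k] D.E) :
    D.theta (n + 1) 1 (D.wZ n h z) = 0 := by
  induction z using TensorProduct.induction_on with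
  | zero => simp
  | add x y hx hy => rw [map_add, map_add, hx, hy, add_zero]
  | tmul w e' => simp [theta_tmul, gT_wH_one]

/-- `b ⊗ x ⊗ e ↦ b x ⊗ e`. -/
def consK (n : ℕ) :
    Red k A →ₗ[k] TPow k (Red k A) n ⊗[k] D.E →ₗ[k] TPow k (Red k A) (n + 1) ⊗[k] D.E :=
  LinearMap.rTensorHom D.E ∘ₗ TPow.cons k n

@[simp] theorem consK_tmul (n : ℕ) (b : Red k A) (x : TPow k (Red k A) n) (e : D.E) :
    D.consK n b (x ⊗ₜ e) = TPow.cons k n b x ⊗ₜ e := rfl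

theorem consK_rMul (n : ℕ) (b : Red k A) (e : D.E) (z : TPow k (Red k A) n ⊗[k] D.E) :
    D.consK n b (rMul k _ e z) = rMul k _ e (D.consK n b z) := by
  exact (rMul_rTensor _ _ _).symm

/-- `a ⊗ x ⊗ e ↦ ā x ⊗ e`. -/
def consA (n : ℕ) :
    A ⊗[k] (TPow k (Red k A) n ⊗[k] D.E) →ₗ[k] TPow k (Red k A) (n + 1) ⊗[k] D.E :=
  TensorProduct.lift (D.consK n ∘ₗ red k)

@[simp] theorem consA_tmul (n : ℕ) (a : A) (z : TPow k (Red k A) n ⊗[k] D.E) :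
    D.consA n (a ⊗ₜ z) = D.consK n (red k a) z := rfl

theorem consA_rMul (n : ℕ) (e : D.E) (z : A ⊗[k] (TPow k (Red k A) n ⊗[k] D.E)) :
    D.consA n ((rMul k _ e).lTensor A z) = rMul k _ e (D.consA n z) := by
  induction z using TensorProduct.induction_on with
  | zero => simp
  | add x y hx hy => simp only [map_add, hx, hy]
  | tmul w e' => simp [consK_rMul]

/-- `(a # h) ⊗ z ↦ a ⊗ Θ(h, z)`. -/
def pushT (n : ℕ) :
    D.E ⊗[k] (Word k A H n ⊗[k] D.E) →ₗ[k] A ⊗[k] (TPow k (Red k A) n ⊗[k] D.E) :=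
  D.push (D.theta n)

/-- `(a # h) ⊗ z ↦ a ⊗ h z`. -/
def pushP (n : ℕ) :
    D.E ⊗[k] (Word k A H n ⊗[k] D.E) →ₗ[k] D.E ⊗[k] (Word k A H (n + 1) ⊗[k] D.E) :=
  D.incA _ ∘ₗ D.push (D.wZ n)

/-- `a ⊗ z ↦ 1 ⊗ a z`. -/
def kappa (n : ℕ) : A ⊗[k] (TPow k (Red k A) n ⊗[k] D.E) →ₗ[k]
    A ⊗[k] (TPow k (Red k A) (n + 1) ⊗[k] D.E) :=
  TensorProduct.mk k A _ 1 ∘ₗ D.consA n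

theorem kappa_apply (n : ℕ) (y : A ⊗[k] (TPow k (Red k A) n ⊗[k] D.E)) :
    D.kappa n y = 1 ⊗ₜ D.consA n y := rfl

theorem kappa_kappa (n : ℕ) (y : A ⊗[k] (TPow k (Red k A) n ⊗[k] D.E)) :
    D.kappa (n + 1) (D.kappa n y) = 0 := by
  simp [kappa_apply, red_one]

theorem pushP_tmul (n : ℕ) (a : A) (h : H) (z : Word k A H n ⊗[k] D.E) :
    D.pushP n ((D.inA a * D.inH h) ⊗ₜ z) = D.inA a ⊗ₜ D.wZ n h z := by simp [pushP]

@[simp] theorem pushP_inH (n : ℕ) (h : H) (z : Word k A H n ⊗[k] D.E) :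
    D.pushP n (D.inH h ⊗ₜ z) = 1 ⊗ₜ D.wZ n h z := by simp [pushP, inA_one]

@[simp] theorem pushP_one (n : ℕ) (z : Word k A H n ⊗[k] D.E) :
    D.pushP n (1 ⊗ₜ z) = 0 := by simp [pushP, wZ_one]

@[simp] theorem pushP_incA {n : ℕ} (y : A ⊗[k] (Word k A H n ⊗[k] D.E)) :
    D.pushP n (D.incA _ y) = 0 := by
  induction y using TensorProduct.induction_on with
  | zero => simp
  | add x y hx hy => simp only [map_add, hx, hy, add_zero]
  | tmul w e' => simp [pushP, wZ_one]

@[simp] theorem pushP_pushP (n : ℕ) (y : D.E ⊗[k] (Word k A H n ⊗[k] D.E)) :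
    D.pushP (n + 1) (D.pushP n y) = 0 := D.pushP_incA _

theorem pushP_lMul (n : ℕ) (a : A) (x : D.E ⊗[k] (Word k A H n ⊗[k] D.E)) :
    D.pushP n (lMul k _ (D.inA a) x) = lMul k _ (D.inA a) (D.pushP n x) := by
  rw [pushP, LinearMap.comp_apply, push_lMul, incA_lMul, LinearMap.comp_apply]

theorem pushP_rMul (n : ℕ) (e : D.E) (x : D.E ⊗[k] (Word k A H n ⊗[k] D.E)) :
    D.pushP n ((rMul k _ e).lTensor _ x) = (rMul k _ e).lTensor _ (D.pushP n x) := by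
  rw [pushP, LinearMap.comp_apply, D.push_lTensor (fun h z => D.wZ_rMul n h e z), incA_lTensor,
    LinearMap.comp_apply]

theorem pushT_rMul (n : ℕ) (e : D.E) (x : D.E ⊗[k] (Word k A H n ⊗[k] D.E)) :
    D.pushT n ((rMul k _ e).lTensor _ x) = (rMul k _ e).lTensor _ (D.pushT n x) :=
  D.push_lTensor (fun h z => D.theta_rMul n h e z) x

theorem pushT_lMul (n : ℕ) (a : A) (x : D.E ⊗[k] (Word k A H n ⊗[k] D.E)) :
    D.pushT n (lMul k _ (D.inA a) x) = lMul k _ a (D.pushT n x) := D.push_lMul _ a x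

/-- Turning the coefficient from A into a letter forgets it modulo k, so only the symbol enters.
This is why Θ could be defined from symbols before any differential was available. -/
theorem consA_pushT (n : ℕ) (x : D.E ⊗[k] (Word k A H n ⊗[k] D.E)) :
    D.consA n (D.pushT n x) = consLift (D.theta n).flip (D.symb _ x) := by
  induction x using ET_induction with
  | h0 b h z => rw [pushT, push_tmul, symb_tmul, consLift_tmul]; rfl
  | hadd x y hx hy => simp only [map_add, hx, hy]

end Theta

/-! ### The bar differential of `Ā^{⊗ n} ⊗ E` -/

section Bar

/-- `x ↦ δ(a x)` for `x` of degree `0`. -/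
def deltaZero :
    A →ₗ[k] TPow k (Red k A) 0 →ₗ[k] A ⊗[k] (TPow k (Red k A) 0 ⊗[k] D.E) :=
  LinearMap.mk₂ k (fun a x => a ⊗ₜ (x ⊗ₜ 1) - 1 ⊗ₜ (x ⊗ₜ D.inA a))
    (fun a b x => by simp only [TensorProduct.add_tmul, TensorProduct.tmul_add, map_add]; abel)
    (fun c a x => by simp only [TensorProduct.tmul_smul, ← TensorProduct.smul_tmul', map_smul,
      smul_sub])
    (fun a x y => by simp only [TensorProduct.add_tmul, TensorProduct.tmul_add]; abel)
    (fun c a x => by simp only [TensorProduct.tmul_smul, ← TensorProduct.smul_tmul', smul_sub])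

/-- `x ↦ δ(a x)` for `x` of positive degree. -/
def deltaSucc {n : ℕ}
    (d : TPow k (Red k A) (n + 1) →ₗ[k] A ⊗[k] (TPow k (Red k A) n ⊗[k] D.E)) :
    A →ₗ[k] TPow k (Red k A) (n + 1) →ₗ[k] A ⊗[k] (TPow k (Red k A) (n + 1) ⊗[k] D.E) :=
  LinearMap.mk₂ k (fun a x => a ⊗ₜ (x ⊗ₜ 1) - D.kappa n (lMul k _ a (d x)))
    (fun a b x => by simp only [TensorProduct.add_tmul, map_add, LinearMap.add_apply]; abel)
    (fun c a x => by simp only [← TensorProduct.smul_tmul', map_smul, LinearMap.smul_apply,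
      smul_sub])
    (fun a x y => by simp only [TensorProduct.add_tmul, TensorProduct.tmul_add, map_add]; abel)
    (fun c a x => by simp only [TensorProduct.tmul_smul, ← TensorProduct.smul_tmul', map_smul,
      smul_sub])

set_option maxSynthPendingDepth 3 in
/-- The boundary of the bar resolution of `E` as a left `A`-module, on `1 ⊗ x ⊗ 1`. -/
def delta : (n : ℕ) → TPow k (Red k A) (n + 1) →ₗ[k] A ⊗[k] (TPow k (Red k A) n ⊗[k] D.E)
  | 0 => TPow.lift k 0 (redLift D.deltaZero)
  | n + 1 => TPow.lift k (n + 1) (redLift (D.deltaSucc (delta n)))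

theorem delta_zero (a : A) (x : TPow k (Red k A) 0) :
    D.delta 0 (TPow.cons k 0 (red k a) x) = a ⊗ₜ (x ⊗ₜ 1) - 1 ⊗ₜ (x ⊗ₜ D.inA a) := by
  rw [delta, TPow.lift_cons, redLift_red]
  · rfl
  · refine LinearMap.ext fun x => ?_
    simp [deltaZero, inA_one]

set_option maxSynthPendingDepth 3 in
-- The recursion is the contraction identity δκ = id - κδ read as a definition of δ. At a = 1 it
-- reads x = κδx, the first claim, so descent to Ā and the recursion are proved together.
theorem delta_succ_and (n : ℕ) :
    (∀ x, D.kappa n (D.delta n x) = 1 ⊗ₜ (x ⊗ₜ 1)) ∧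
    ∀ (a : A) (x : TPow k (Red k A) (n + 1)), D.delta (n + 1) (TPow.cons k (n + 1) (red k a) x) =
      a ⊗ₜ (x ⊗ₜ 1) - D.kappa n (lMul k _ a (D.delta n x)) := by
  have step : ∀ n : ℕ, (∀ x, D.kappa n (D.delta n x) = 1 ⊗ₜ (x ⊗ₜ 1)) →
      ∀ (a : A) (x : TPow k (Red k A) (n + 1)), D.delta (n + 1) (TPow.cons k (n + 1) (red k a) x) =
        a ⊗ₜ (x ⊗ₜ 1) - D.kappa n (lMul k _ a (D.delta n x)) := by
    intro n hn a x
    rw [delta, TPow.lift_cons, redLift_red]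
    · rfl
    · refine LinearMap.ext fun x => ?_
      simp [deltaSucc, lMul_one, hn]
  induction n with
  | zero =>
    have h0 : ∀ x, D.kappa 0 (D.delta 0 x) = 1 ⊗ₜ (x ⊗ₜ 1) := by
      intro x
      induction x using TPow.induction_red with
      | h a x => rw [delta_zero]; simp [kappa_apply, red_one]
      | hadd x y hx hy => simp only [map_add, hx, hy, TensorProduct.add_tmul, TensorProduct.tmul_add]
    exact ⟨h0, step 0 h0⟩
  | succ n ih =>
    have h0 : ∀ x, D.kappa (n + 1) (D.delta (n + 1) x) = 1 ⊗ₜ (x ⊗ₜ 1) := by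
      intro x
      induction x using TPow.induction_red with
      | h a x => rw [ih.2, map_sub, kappa_kappa]; simp [kappa_apply]
      | hadd x y hx hy => simp only [map_add, hx, hy, TensorProduct.add_tmul, TensorProduct.tmul_add]
    exact ⟨h0, step _ h0⟩

theorem delta_succ (n : ℕ) (a : A) (x : TPow k (Red k A) (n + 1)) :
    D.delta (n + 1) (TPow.cons k (n + 1) (red k a) x) =
      a ⊗ₜ (x ⊗ₜ 1) - D.kappa n (lMul k _ a (D.delta n x)) := (D.delta_succ_and n).2 a x

/-- The right `E`-linear extension of `delta`. -/
def deltaK (n : ℕ) : TPow k (Red k A) (n + 1) ⊗[k] D.E →ₗ[k]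
    A ⊗[k] (TPow k (Red k A) n ⊗[k] D.E) := rightExt (D.delta n)

/-- The `A`-`E`-linear extension of `delta`. -/
def deltaAK (n : ℕ) : A ⊗[k] (TPow k (Red k A) (n + 1) ⊗[k] D.E) →ₗ[k]
    A ⊗[k] (TPow k (Red k A) n ⊗[k] D.E) := leftExt (D.deltaK n)

/-- `a ⊗ x ⊗ e ↦ 1 ⊗ x ⊗ a e` for `x` of degree `0`. -/
def augK : A ⊗[k] (TPow k (Red k A) 0 ⊗[k] D.E) →ₗ[k] A ⊗[k] (TPow k (Red k A) 0 ⊗[k] D.E) :=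
  TensorProduct.mk k A _ 1 ∘ₗ
    TensorProduct.lift (LinearMap.lTensorHom (TPow k (Red k A) 0) ∘ₗ LinearMap.mul k D.E ∘ₗ D.inA)

@[simp] theorem augK_tmul (a : A) (x : TPow k (Red k A) 0) (e : D.E) :
    D.augK (a ⊗ₜ (x ⊗ₜ e)) = 1 ⊗ₜ (x ⊗ₜ (D.inA a * e)) := rfl

theorem kappa_rMul (n : ℕ) (e : D.E) (y : A ⊗[k] (TPow k (Red k A) n ⊗[k] D.E)) :
    D.kappa n ((rMul k _ e).lTensor A y) = (rMul k _ e).lTensor A (D.kappa n y) := by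
  rw [kappa_apply, consA_rMul, kappa_apply, LinearMap.lTensor_tmul]

/-- In degree 0 the contraction has a defect, the augmentation of the bar complex onto E. -/
theorem deltaK_consA_zero (y : A ⊗[k] (TPow k (Red k A) 0 ⊗[k] D.E)) :
    D.deltaK 0 (D.consA 0 y) = y - D.augK y := by
  induction y using TensorProduct.induction_on with
  | zero => simp
  | add x y hx hy => simp only [map_add, hx, hy]; abel
  | tmul a z =>
    induction z using TensorProduct.induction_on with
    | zero => simp
    | add x y hx hy => simp only [TensorProduct.tmul_add, map_add, hx, hy]; abel
    | tmul x e => simp [deltaK, delta_zero]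

theorem deltaK_consA_succ (n : ℕ) (y : A ⊗[k] (TPow k (Red k A) (n + 1) ⊗[k] D.E)) :
    D.deltaK (n + 1) (D.consA (n + 1) y) = y - D.kappa n (D.deltaAK n y) := by
  induction y using TensorProduct.induction_on with
  | zero => simp
  | add x y hx hy => simp only [map_add, hx, hy]; abel
  | tmul a z =>
    induction z using TensorProduct.induction_on with
    | zero => simp
    | add x y hx hy => simp only [TensorProduct.tmul_add, map_add, hx, hy]; abel
    | tmul x e => simp [deltaK, deltaAK, delta_succ, lMul_lTensor, kappa_rMul]

/-- Every element of positive degree is a prefix of some y, and two uses of δκ = id - κδ reduce δδ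
of it to κδδy, which vanishes by induction. In the lowest degree what is left is the augmentation of
δy, zero by associativity of E. -/
theorem deltaAK_deltaK (n : ℕ) (z : TPow k (Red k A) (n + 2) ⊗[k] D.E) :
    D.deltaAK n (D.deltaK (n + 1) z) = 0 := by
  have hc : ∀ m (z : TPow k (Red k A) (m + 1) ⊗[k] D.E), ∃ y, D.consA m y = z := by
    intro m z
    induction z using TensorProduct.induction_on with
    | zero => exact ⟨0, map_zero _⟩
    | add x y hx hy =>
      obtain ⟨x', rfl⟩ := hx
      obtain ⟨y', rfl⟩ := hy
      exact ⟨x' + y', map_add _ _ _⟩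
    | tmul x e =>
      induction x using TPow.induction_red with
      | h a x => exact ⟨a ⊗ₜ (x ⊗ₜ e), rfl⟩
      | hadd x y hx hy =>
        obtain ⟨x', hx⟩ := hx
        obtain ⟨y', hy⟩ := hy
        exact ⟨x' + y', by rw [map_add, hx, hy, TensorProduct.add_tmul]⟩
  have hone : ∀ m (w : A ⊗[k] (TPow k (Red k A) m ⊗[k] D.E)),
      D.deltaAK m (D.kappa m w) = D.deltaK m (D.consA m w) := by
    intro m w
    rw [kappa_apply, deltaAK, leftExt_tmul, lMul_one]
  obtain ⟨y, rfl⟩ := hc _ z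
  rw [deltaK_consA_succ, map_sub, hone]
  cases n with
  | zero =>
    rw [deltaK_consA_zero, sub_sub_cancel]
    have : ∀ y, D.augK (D.deltaAK 0 y) = 0 := by
      intro y
      induction y using TensorProduct.induction_on with
      | zero => simp
      | add x y hx hy => simp only [map_add, hx, hy, add_zero]
      | tmul a z =>
        induction z using TensorProduct.induction_on with
        | zero => simp
        | add x y hx hy => simp only [TensorProduct.tmul_add, map_add, hx, hy, add_zero]
        | tmul x e =>
          induction x using TPow.induction_red with
          | h b x => simp [deltaAK, deltaK, delta_zero, inA_mul, mul_assoc]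
          | hadd x y hx hy =>
            simp only [TensorProduct.add_tmul, TensorProduct.tmul_add, map_add, hx, hy, add_zero]
    rw [this]
  | succ n =>
    rw [deltaK_consA_succ, sub_sub_cancel]
    have : D.deltaAK n (D.deltaAK (n + 1) y) = 0 := by
      induction y using TensorProduct.induction_on with
      | zero => simp
      | add x y hx hy => simp only [map_add, hx, hy, add_zero]
      | tmul a z =>
        have := deltaAK_deltaK n z
        rw [deltaAK, deltaAK, leftExt_tmul, leftExt_lMul]
        rw [deltaAK] at this
        rw [this, map_zero]
    rw [this, map_zero]

end Bar

end CrossedProduct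

namespace CrossedProduct

variable {k A H : Type u} [CommRing k] [Ring A] [Algebra k A] [Ring H] [HopfAlgebra k H]
variable (D : CrossedProduct k A H)

/-! ### The differential of the resolution -/

section Boundary

/-- The inclusion of the bar resolution of `E` as a left `A`-module. -/
def incK (n : ℕ) : A ⊗[k] (TPow k (Red k A) n ⊗[k] D.E) →ₗ[k]
    D.E ⊗[k] (Word k A H n ⊗[k] D.E) := D.incA _ ∘ₗ (D.ofK n).lTensor A

@[simp] theorem incK_tmul (n : ℕ) (a : A) (z : TPow k (Red k A) n ⊗[k] D.E) :
    D.incK n (a ⊗ₜ z) = D.inA a ⊗ₜ D.ofK n z := rfl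

theorem incK_lMul (n : ℕ) (a : A) (y : A ⊗[k] (TPow k (Red k A) n ⊗[k] D.E)) :
    D.incK n (lMul k _ a y) = lMul k _ (D.inA a) (D.incK n y) := by
  rw [incK, LinearMap.comp_apply, ← lMul_lTensor, incA_lMul, LinearMap.comp_apply]

theorem incK_rMul (n : ℕ) (e : D.E) (y : A ⊗[k] (TPow k (Red k A) n ⊗[k] D.E)) :
    D.incK n ((rMul k _ e).lTensor A y) = (rMul k _ e).lTensor _ (D.incK n y) := by
  induction y using TensorProduct.induction_on with
  | zero => simp
  | add x y hx hy => simp only [map_add, hx, hy]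
  | tmul a z => simp [ofK_rMul]

@[simp] theorem pushP_incK (n : ℕ) (y : A ⊗[k] (TPow k (Red k A) n ⊗[k] D.E)) :
    D.pushP n (D.incK n y) = 0 := D.pushP_incA _

/-- The outer terms of `∂(h w)`. -/
def bdOuter (n : ℕ) : H →ₗ[k] Word k A H n →ₗ[k] D.E ⊗[k] (Word k A H n ⊗[k] D.E) :=
  LinearMap.mk₂ k (fun h w => D.inH h ⊗ₜ (w ⊗ₜ 1) + 1 ⊗ₜ D.ofK n (D.theta n h (w ⊗ₜ 1)))
    (fun a b x => by
      simp only [map_add, TensorProduct.add_tmul, TensorProduct.tmul_add, LinearMap.add_apply]; abel)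
    (fun c a x => by
      simp only [map_smul, TensorProduct.tmul_smul, ← TensorProduct.smul_tmul', smul_add,
        LinearMap.smul_apply])
    (fun a x y => by simp only [map_add, TensorProduct.add_tmul, TensorProduct.tmul_add]; abel)
    (fun c a x => by
      simp only [map_smul, TensorProduct.tmul_smul, ← TensorProduct.smul_tmul', smul_add])

/-- The inner terms of `∂(h w)`. -/
def bdInner {n : ℕ} (q : Word k A H (n + 1) →ₗ[k] D.E ⊗[k] (Word k A H n ⊗[k] D.E)) :
    H →ₗ[k] Word k A H (n + 1) →ₗ[k] D.E ⊗[k] (Word k A H (n + 1) ⊗[k] D.E) :=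
  LinearMap.mk₂ k (fun h w => D.pushP n (lMul k _ (D.inH h) (q w)))
    (fun a b x => by simp only [map_add, LinearMap.add_apply])
    (fun c a x => by simp only [map_smul, LinearMap.smul_apply])
    (fun a x y => by simp only [map_add]) (fun c a x => by simp only [map_smul])

/-- The differential of the resolution on `1 ⊗ w ⊗ 1`. -/
def bd : (n : ℕ) → Word k A H (n + 1) →ₗ[k] D.E ⊗[k] (Word k A H n ⊗[k] D.E)
  | 0 => Word.lift 0 (redLift (D.bdOuter 0)) (D.incK 0 ∘ₗ D.delta 0)
  | n + 1 => Word.lift (n + 1) (redLift (D.bdOuter (n + 1) - D.bdInner (bd n)))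
      (D.incK (n + 1) ∘ₗ D.delta (n + 1))

theorem bd_ofA (n : ℕ) (x : TPow k (Red k A) (n + 1)) :
    D.bd n (Word.ofA k A H (n + 1) x) = D.incK n (D.delta n x) := by
  cases n <;> rw [bd, Word.lift_ofA] <;> rfl

theorem bd_zero (h : H) (w : Word k A H 0) :
    D.bd 0 (wH 0 h w) = D.inH h ⊗ₜ (w ⊗ₜ 1) + 1 ⊗ₜ D.ofK 0 (D.theta 0 h (w ⊗ₜ 1)) := by
  rw [bd, wH_apply, Word.lift_consH, redLift_red]
  · rfl
  · refine Word.ext_zero ?_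
    have := D.theta_ofK_one 0 (TPow.nil k ⊗ₜ 1)
    rw [ofK_tmul] at this
    simp [bdOuter, this, inH_one, TensorProduct.tmul_neg]

/-- The first claim holds because P kills 1 ⊗ z and everything in its own image, leaving only P(h ⊗
w) = 1 ⊗ hw. It feeds the well-definedness of the recursion in the next degree. -/
theorem bd_succ_and (n : ℕ) :
    (∀ (h : H) (w : Word k A H n), D.pushP n (D.bd n (wH n h w)) = 1 ⊗ₜ (wH n h w ⊗ₜ 1)) ∧
    ∀ (h : H) (w : Word k A H (n + 1)), D.bd (n + 1) (wH (n + 1) h w) =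
      D.inH h ⊗ₜ (w ⊗ₜ 1) - D.pushP n (lMul k _ (D.inH h) (D.bd n w)) +
        1 ⊗ₜ D.ofK (n + 1) (D.theta (n + 1) h (w ⊗ₜ 1)) := by
  have step : ∀ n : ℕ,
      (∀ (h : H) (w : Word k A H n), D.pushP n (D.bd n (wH n h w)) = 1 ⊗ₜ (wH n h w ⊗ₜ 1)) →
      ∀ (h : H) (w : Word k A H (n + 1)), D.bd (n + 1) (wH (n + 1) h w) =
        D.inH h ⊗ₜ (w ⊗ₜ 1) - D.pushP n (lMul k _ (D.inH h) (D.bd n w)) +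
          1 ⊗ₜ D.ofK (n + 1) (D.theta (n + 1) h (w ⊗ₜ 1)) := by
    intro n hn h w
    rw [bd, wH_apply, Word.lift_consH, redLift_red]
    · simp only [LinearMap.sub_apply, bdOuter, bdInner, LinearMap.mk₂_apply]
      abel
    -- At h = 1 the terms are 1 ⊗ w, -P∂w and 1 ⊗ Θ(1,w). If w begins with a letter from H, the
    -- first two cancel and the last is zero; if w is a word in A, the first and last cancel and P∂w
    -- = 0.
    · refine Word.ext_succ (fun h' w' => ?_) (fun x => ?_)
      · have h1 := D.theta_wZ_one n h' (w' ⊗ₜ 1)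
        rw [wZ_tmul] at h1
        simp only [LinearMap.sub_apply, bdOuter, bdInner, LinearMap.mk₂_apply, inH_one, lMul_one,
          LinearMap.zero_apply, ← wH_apply]
        rw [hn, h1]
        simp
      · have h1 := D.theta_ofK_one (n + 1) (x ⊗ₜ 1)
        rw [ofK_tmul] at h1
        simp only [LinearMap.sub_apply, bdOuter, bdInner, LinearMap.mk₂_apply, inH_one, lMul_one,
          LinearMap.zero_apply]
        rw [h1, bd_ofA, pushP_incK]
        simp [TensorProduct.tmul_neg]
  induction n with
  | zero =>
    have h0 : ∀ (h : H) (w : Word k A H 0),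
        D.pushP 0 (D.bd 0 (wH 0 h w)) = 1 ⊗ₜ (wH 0 h w ⊗ₜ 1) := by
      intro h w
      rw [bd_zero]
      simp
    exact ⟨h0, step 0 h0⟩
  | succ n ih =>
    have h0 : ∀ (h : H) (w : Word k A H (n + 1)),
        D.pushP (n + 1) (D.bd (n + 1) (wH (n + 1) h w)) = 1 ⊗ₜ (wH (n + 1) h w ⊗ₜ 1) := by
      intro h w
      rw [ih.2]
      simp
    exact ⟨h0, step _ h0⟩

theorem bd_succ (n : ℕ) (h : H) (w : Word k A H (n + 1)) : D.bd (n + 1) (wH (n + 1) h w) =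
    D.inH h ⊗ₜ (w ⊗ₜ 1) - D.pushP n (lMul k _ (D.inH h) (D.bd n w)) +
      1 ⊗ₜ D.ofK (n + 1) (D.theta (n + 1) h (w ⊗ₜ 1)) := (D.bd_succ_and n).2 h w

/-- The right `E`-linear extension of the differential. -/
def bdZ (n : ℕ) : Word k A H (n + 1) ⊗[k] D.E →ₗ[k] D.E ⊗[k] (Word k A H n ⊗[k] D.E) :=
  rightExt (D.bd n)

/-- The differential of the resolution. -/
def bdE (n : ℕ) : D.E ⊗[k] (Word k A H (n + 1) ⊗[k] D.E) →ₗ[k]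
    D.E ⊗[k] (Word k A H n ⊗[k] D.E) := leftExt (D.bdZ n)

theorem bdZ_wZ_zero (h : H) (z : Word k A H 0 ⊗[k] D.E) :
    D.bdZ 0 (D.wZ 0 h z) = D.inH h ⊗ₜ z + 1 ⊗ₜ D.ofK 0 (D.theta 0 h z) := by
  induction z using TensorProduct.induction_on with
  | zero => simp
  | add x y hx hy => simp only [map_add, hx, hy, TensorProduct.tmul_add]; abel
  | tmul w e =>
    rw [wZ_tmul, bdZ, rightExt_tmul, bd_zero, map_add, LinearMap.lTensor_tmul,
      LinearMap.lTensor_tmul, ← ofK_rMul, ← theta_rMul, rMul_tmul, one_mul]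

theorem bdZ_wZ_succ (n : ℕ) (h : H) (z : Word k A H (n + 1) ⊗[k] D.E) :
    D.bdZ (n + 1) (D.wZ (n + 1) h z) = D.inH h ⊗ₜ z -
      D.pushP n (lMul k _ (D.inH h) (D.bdZ n z)) + 1 ⊗ₜ D.ofK (n + 1) (D.theta (n + 1) h z) := by
  induction z using TensorProduct.induction_on with
  | zero => simp
  | add x y hx hy => simp only [map_add, hx, hy, TensorProduct.tmul_add]; abel
  | tmul w e =>
    rw [wZ_tmul, bdZ, rightExt_tmul, bd_succ, map_add, map_sub, LinearMap.lTensor_tmul,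
      LinearMap.lTensor_tmul, ← ofK_rMul, ← theta_rMul, rMul_tmul, one_mul, ← pushP_rMul,
      ← lMul_lTensor, bdZ, rightExt_tmul]

theorem bdZ_ofK (n : ℕ) (z : TPow k (Red k A) (n + 1) ⊗[k] D.E) :
    D.bdZ n (D.ofK (n + 1) z) = D.incK n (D.deltaK n z) := by
  induction z using TensorProduct.induction_on with
  | zero => simp
  | add x y hx hy => simp only [map_add, hx, hy]
  | tmul w e => rw [ofK_tmul, bdZ, rightExt_tmul, bd_ofA, deltaK, rightExt_tmul, incK_rMul]

theorem bdE_incK (n : ℕ) (y : A ⊗[k] (TPow k (Red k A) (n + 1) ⊗[k] D.E)) :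
    D.bdE n (D.incK (n + 1) y) = D.incK n (D.deltaAK n y) := by
  induction y using TensorProduct.induction_on with
  | zero => simp
  | add x y hx hy => simp only [map_add, hx, hy]
  | tmul a z => rw [incK_tmul, bdE, leftExt_tmul, bdZ_ofK, deltaAK, leftExt_tmul, incK_lMul]

theorem bdE_pushP_zero (y : D.E ⊗[k] (Word k A H 0 ⊗[k] D.E)) :
    D.bdE 0 (D.pushP 0 y) = y + D.incK 0 (D.pushT 0 y) := by
  induction y using ET_induction with
  | h0 a h z =>
    rw [pushP_tmul, bdE, leftExt_tmul, bdZ_wZ_zero, map_add, lMul_tmul, lMul_tmul, mul_one, pushT,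
      push_tmul, incK_tmul]
  | hadd x y hx hy => simp only [map_add, hx, hy]; abel

/-- This is the recursion for ∂(hw), made left A-linear: ∂P + P∂ = id + iT. So P is a homotopy from
the identity to the retraction onto the bar complex. -/
theorem bdE_pushP_succ (n : ℕ) (y : D.E ⊗[k] (Word k A H (n + 1) ⊗[k] D.E)) :
    D.bdE (n + 1) (D.pushP (n + 1) y) =
      y - D.pushP n (D.bdE n y) + D.incK (n + 1) (D.pushT (n + 1) y) := by
  induction y using ET_induction with
  | h0 a h z =>
    rw [pushP_tmul, bdE, leftExt_tmul, bdZ_wZ_succ, map_add, map_sub, lMul_tmul, lMul_tmul,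
      mul_one, pushT, push_tmul, incK_tmul, ← pushP_lMul, ← lMul_mul, bdE, leftExt_tmul]
  | hadd x y hx hy => simp only [map_add, hx, hy]; abel

/-- Justifies the independent recursion for symbols. Each term of ∂w with left coefficient 1
becomes, after multiplication by 1#h, a term with coefficient 1 and disappears; the remaining ones
are h' ⊗ w, P(h' ∂w), and a ⊗ x for words in A. -/
theorem symb_bd (n : ℕ) (h : H) (w : Word k A H (n + 1)) :
    D.symb _ (lMul k _ (D.inH h) (D.bd n w)) =
      (((TensorProduct.mk k (Word k A H n) D.E).flip 1).lTensor H).lTensor (Red k A)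
        (D.symbD n w h) := by
  have hassoc : ∀ (n : ℕ) (t : Red k A ⊗[k] H) (w : Word k A H n),
      (((TensorProduct.mk k (Word k A H n) D.E).flip 1).lTensor H).lTensor (Red k A)
        (TensorProduct.assoc k _ _ _ (t ⊗ₜ w)) = TensorProduct.assoc k _ _ _ (t ⊗ₜ (w ⊗ₜ 1)) := by
    intro n t w
    induction t using TensorProduct.induction_on with
    | zero => simp
    | add x y hx hy => simp only [TensorProduct.add_tmul, map_add, hx, hy]
    | tmul b h => simp
  have hA : ∀ (n : ℕ) (x : TPow k (Red k A) (n + 1)) (h : H),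
      D.symb _ (lMul k _ (D.inH h) (D.bd n (Word.ofA k A H (n + 1) x))) =
      (((TensorProduct.mk k (Word k A H n) D.E).flip 1).lTensor H).lTensor (Red k A)
        (D.symbD n (Word.ofA k A H (n + 1) x) h) := by
    intro n x h
    induction x using TPow.induction_red with
    | h a x =>
      rw [symbD_ofA, hassoc, bd_ofA]
      cases n with
      | zero =>
        rw [delta_zero]
        simp [inA_one, symb_eq_assoc (e := _ * _), symbHA_red]
      | succ n =>
        rw [delta_succ]
        simp [inA_one, symb_eq_assoc (e := _ * _), symbHA_red, kappa_apply]
    | hadd x y hx hy => simp only [map_add, hx, hy, LinearMap.add_apply]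
  induction n generalizing h with
  | zero =>
    induction w using Word.induction_succ with
    | hH h' w =>
      rw [← wH_apply, bd_zero, symbD_zero, hassoc, map_add, map_add, lMul_tmul, lMul_tmul, mul_one,
        symb_inH, add_zero, symb_eq_assoc, symbHH_apply]
    | hA x => exact hA _ _ _
    | hadd x y hx hy => simp only [map_add, hx, hy, LinearMap.add_apply]
  | succ n ih =>
    induction w using Word.induction_succ with
    | hH h' w =>
      rw [← wH_apply, bd_succ, symbD_succ, map_sub, hassoc, map_add, map_add, map_sub, map_sub,
        lMul_tmul, lMul_tmul, mul_one, symb_inH, add_zero, symb_eq_assoc, symbHH_apply, pushP,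
        LinearMap.comp_apply, symb_incA_push, ih]
      congr 1
      generalize D.symbD n w h' = t
      induction t using TensorProduct.induction_on with
      | zero => simp
      | add x y hx hy => simp only [map_add, hx, hy]
      | tmul b t =>
        induction t using TensorProduct.induction_on with
        | zero => simp
        | add x y hx hy => simp only [TensorProduct.tmul_add, map_add, hx, hy]
        | tmul l w =>
          rw [symbPush_tmul, hassoc, LinearMap.lTensor_tmul, LinearMap.lTensor_tmul, symbPush_tmul]
          rfl
    | hA x => exact hA _ _ _
    | hadd x y hx hy => simp only [map_add, hx, hy, LinearMap.add_apply]

/-- The defining property of Θ in terms of ∂, now that ∂ exists. From here on symbols are no longer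
needed until Θ is computed explicitly. -/
theorem theta_succ (n : ℕ) (h : H) (z : Word k A H (n + 1) ⊗[k] D.E) :
    D.theta (n + 1) h z = D.consA n (D.pushT n (lMul k _ (D.inH h) (D.bdZ n z))) := by
  induction z using TensorProduct.induction_on with
  | zero => simp
  | add x y hx hy => simp only [map_add, hx, hy]
  | tmul w e =>
    rw [bdZ, rightExt_tmul, lMul_lTensor, pushT_rMul, consA_rMul, consA_pushT, symb_bd, theta_tmul,
      gT_succ]
    generalize D.symbD n w h = t
    rw [← map_neg]
    congr 1
    induction t using TensorProduct.induction_on with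
    | zero => simp
    | add x y hx hy => simp only [map_add, ← hx, ← hy, neg_add]
    | tmul b t =>
      induction t using TensorProduct.induction_on with
      | zero => simp
      | add x y hx hy => simp only [TensorProduct.tmul_add, map_add, ← hx, ← hy, neg_add]
      | tmul l w =>
        rw [LinearMap.lTensor_tmul, LinearMap.lTensor_tmul, consLift_tmul, consLift_tmul,
          LinearMap.flip_apply, LinearMap.flip_apply, TensorProduct.mk_apply, theta_tmul, rMul_one]
        generalize D.gT n w l = y
        rw [map_neg, neg_inj]
        induction y using TensorProduct.induction_on with
        | zero => simp
        | add x y hx hy => simp only [map_add, hx, hy]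
        | tmul x m => simp

theorem augK_pushT_bdE (y : D.E ⊗[k] (Word k A H 1 ⊗[k] D.E)) :
    D.augK (D.pushT 0 (D.bdE 0 y)) = 0 := by
  -- The augmentation after T is minus the multiplication e ⊗ e' ↦ ee'. The boundary of a one-letter
  -- word is a difference of two terms with equal product, so it is killed.
  have key : ∀ (e : D.E) (x : TPow k (Red k A) 0) (e' : D.E),
      D.augK (D.pushT 0 (e ⊗ₜ D.ofK 0 (x ⊗ₜ e'))) = -(1 ⊗ₜ (x ⊗ₜ (e * e'))) := by
    intro e x e'
    induction e using E_induction with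
    | h0 a h =>
      rw [pushT, push_tmul, ofK_tmul, theta_tmul, gT_zero]
      simp [mul_assoc, TensorProduct.tmul_neg]
    | hadd x y hx hy =>
      simp only [TensorProduct.add_tmul, map_add, hx, hy, add_mul, TensorProduct.tmul_add]
      abel
  have key2 : ∀ (e e₁ : D.E) (w : Word k A H 1),
      D.augK (D.pushT 0 (lMul k _ e ((rMul k _ e₁).lTensor _ (D.bd 0 w)))) = 0 := by
    intro e e₁ w
    induction w using Word.induction_succ with
    | hH h w =>
      obtain ⟨x, rfl⟩ : ∃ x, Word.ofA k A H 0 x = w := ⟨w, rfl⟩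
      rw [← wH_apply, bd_zero, theta_tmul, gT_zero]
      have h1 := key (e * D.inH h) x e₁
      have h2 := key e x (D.inH h * e₁)
      simp only [map_add, map_neg, LinearMap.lTensor_tmul, lMul_tmul, rMul_tmul, mul_one, one_mul,
        TensorProduct.tmul_neg, ofK_tmul] at h1 h2 ⊢
      rw [h1, h2, mul_assoc]
      abel
    | hA x =>
      induction x using TPow.induction_red with
      | h a x =>
        rw [bd_ofA, delta_zero]
        have h1 := key (e * D.inA a) x e₁
        have h2 := key e x (D.inA a * e₁)
        simp only [map_sub, LinearMap.lTensor_tmul, lMul_tmul, rMul_tmul, mul_one, one_mul,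
          ofK_tmul, incK_tmul, inA_one] at h1 h2 ⊢
        rw [h1, h2, mul_assoc]
        abel
      | hadd x y hx hy => simp only [map_add, hx, hy, add_zero]
    | hadd x y hx hy => simp only [map_add, hx, hy, add_zero]
  induction y using TensorProduct.induction_on with
  | zero => simp
  | add x y hx hy => simp only [map_add, hx, hy, add_zero]
  | tmul e z =>
    induction z using TensorProduct.induction_on with
    | zero => simp
    | add x y hx hy => simp only [TensorProduct.tmul_add, map_add, hx, hy, add_zero]
    | tmul w e₁ => exact key2 e e₁ w

/-- Since Θ(h,z) is the prefixed form of T(h ∂z), the identity δκ = id - κδ gives δΘ(h,z) = T(h ∂z)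
up to κ of T(∂(h ∂z)), which vanishes once ∂² = 0 one degree lower. Conversely, that formula and the
homotopy identity for P make the three parts of ∂∂(hw) cancel. -/
theorem bdE_bdZ_and (n : ℕ) :
    (∀ h z, D.deltaK n (D.theta (n + 1) h z) = D.pushT n (lMul k _ (D.inH h) (D.bdZ n z))) ∧
    ∀ z, D.bdE n (D.bdZ (n + 1) z) = 0 := by
  have step : ∀ n : ℕ,
      (∀ h z, D.deltaK n (D.theta (n + 1) h z) = D.pushT n (lMul k _ (D.inH h) (D.bdZ n z))) →
      (∀ m, n = m + 1 → ∀ z, D.bdE m (D.bdZ (m + 1) z) = 0) →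
      ∀ z, D.bdE n (D.bdZ (n + 1) z) = 0 := by
    intro n hn hm
    have hw : ∀ w : Word k A H (n + 2), D.bdE n (D.bdZ (n + 1) (w ⊗ₜ 1)) = 0 := by
      intro w
      induction w using Word.induction_succ with
      | hH h w =>
        have h1 := D.bdZ_wZ_succ n h (w ⊗ₜ 1)
        rw [wZ_tmul, wH_apply] at h1
        rw [h1, map_add, map_sub]
        have h2 : D.bdE n (1 ⊗ₜ D.ofK (n + 1) (D.theta (n + 1) h (w ⊗ₜ 1))) =
            D.incK n (D.pushT n (lMul k _ (D.inH h) (D.bdZ n (w ⊗ₜ 1)))) := by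
          rw [bdE, leftExt_tmul, lMul_one, bdZ_ofK, hn]
        have h3 : D.bdE n (D.inH h ⊗ₜ (w ⊗ₜ 1)) = lMul k _ (D.inH h) (D.bdZ n (w ⊗ₜ 1)) := rfl
        rw [h2, h3]
        cases n with
        | zero => rw [bdE_pushP_zero]; abel
        | succ n =>
          have h4 : D.bdE n (lMul k _ (D.inH h) (D.bdZ (n + 1) (w ⊗ₜ 1))) = 0 := by
            have := hm n rfl (w ⊗ₜ 1)
            rw [bdE, leftExt_lMul]
            rw [bdE] at this
            rw [this, map_zero]
          rw [bdE_pushP_succ, h4, map_zero]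
          abel
      | hA x =>
        have h1 := D.bdZ_ofK (n + 1) (x ⊗ₜ 1)
        rw [ofK_tmul] at h1
        rw [h1, bdE_incK, deltaAK_deltaK, map_zero]
      | hadd x y hx hy => rw [TensorProduct.add_tmul, map_add, map_add, hx, hy, add_zero]
    intro z
    -- Both maps are right E-linear, so the identity on w ⊗ 1 suffices.
    have hz : D.bdE n ∘ₗ D.bdZ (n + 1) = 0 := by
      refine right_ext (fun e => (rMul k _ e).lTensor _) (fun e x => ?_) (fun e x => by simp) hw
      rw [LinearMap.comp_apply, bdZ, rightExt_rMul, bdE, leftExt_lTensor_rMul, LinearMap.comp_apply]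
      exact fun e x => rightExt_rMul _ _ _
    exact LinearMap.congr_fun hz z
  induction n with
  | zero =>
    have h0 : ∀ h z, D.deltaK 0 (D.theta 1 h z) = D.pushT 0 (lMul k _ (D.inH h) (D.bdZ 0 z)) := by
      intro h z
      rw [theta_succ, deltaK_consA_zero]
      have := D.augK_pushT_bdE (D.inH h ⊗ₜ z)
      rw [bdE, leftExt_tmul] at this
      rw [this, sub_zero]
    exact ⟨h0, step 0 h0 (fun m hm => by omega)⟩
  | succ n ih =>
    have hT : ∀ y, D.deltaAK n (D.pushT (n + 1) y) = D.pushT n (D.bdE n y) := by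
      intro y
      induction y using ET_induction with
      | h0 a h z =>
        rw [pushT, push_tmul, deltaAK, leftExt_tmul, ih.1, ← pushT_lMul, ← lMul_mul, bdE,
          leftExt_tmul]
      | hadd x y hx hy => simp only [map_add, hx, hy]
    have h0 : ∀ h z, D.deltaK (n + 1) (D.theta (n + 2) h z) =
        D.pushT (n + 1) (lMul k _ (D.inH h) (D.bdZ (n + 1) z)) := by
      intro h z
      have h4 : D.bdE n (lMul k _ (D.inH h) (D.bdZ (n + 1) z)) = 0 := by
        have := ih.2 z
        rw [bdE, leftExt_lMul]
        rw [bdE] at this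
        rw [this, map_zero]
      rw [theta_succ, deltaK_consA_succ, hT, h4, map_zero, map_zero, sub_zero]
    exact ⟨h0, step _ h0 (fun m hm => by obtain rfl : n = m := by omega
                                         exact ih.2)⟩

theorem bdE_bdZ (n : ℕ) (z : Word k A H (n + 2) ⊗[k] D.E) : D.bdE n (D.bdZ (n + 1) z) = 0 :=
  (D.bdE_bdZ_and n).2 z

theorem deltaK_theta (n : ℕ) (h : H) (z : Word k A H (n + 1) ⊗[k] D.E) :
    D.deltaK n (D.theta (n + 1) h z) = D.pushT n (lMul k _ (D.inH h) (D.bdZ n z)) :=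
  (D.bdE_bdZ_and n).1 h z

/-- T is a chain map: `deltaK_theta` extended left A-linearly. -/
theorem deltaAK_pushT (n : ℕ) (y : D.E ⊗[k] (Word k A H (n + 1) ⊗[k] D.E)) :
    D.deltaAK n (D.pushT (n + 1) y) = D.pushT n (D.bdE n y) := by
  induction y using ET_induction with
  | h0 a h z =>
    rw [pushT, push_tmul, deltaAK, leftExt_tmul, deltaK_theta, ← pushT_lMul, ← lMul_mul, bdE,
      leftExt_tmul]
  | hadd x y hx hy => simp only [map_add, hx, hy]

/-- The contracting homotopy of the resolution. -/
def homotopy (n : ℕ) : D.E ⊗[k] (Word k A H n ⊗[k] D.E) →ₗ[k]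
    D.E ⊗[k] (Word k A H (n + 1) ⊗[k] D.E) :=
  D.pushP n - D.incK (n + 1) ∘ₗ D.kappa n ∘ₗ D.pushT n

theorem bdE_incK_kappa (n : ℕ) (y : A ⊗[k] (TPow k (Red k A) n ⊗[k] D.E)) :
    D.bdE n (D.incK (n + 1) (D.kappa n y)) = D.incK n (D.deltaK n (D.consA n y)) := by
  rw [bdE_incK, kappa_apply, deltaAK, leftExt_tmul, lMul_one]

theorem bdE_homotopy_zero (y : D.E ⊗[k] (Word k A H 0 ⊗[k] D.E)) :
    D.bdE 0 (D.homotopy 0 y) = y + D.incK 0 (D.augK (D.pushT 0 y)) := by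
  rw [homotopy, LinearMap.sub_apply, map_sub, bdE_pushP_zero, LinearMap.comp_apply,
    LinearMap.comp_apply, bdE_incK_kappa, deltaK_consA_zero, map_sub]
  abel

/-- P leaves the defect iT, a chain map into the bar complex. As κ contracts that complex,
subtracting iκT removes the defect. -/
theorem bdE_homotopy_succ (n : ℕ) (y : D.E ⊗[k] (Word k A H (n + 1) ⊗[k] D.E)) :
    D.bdE (n + 1) (D.homotopy (n + 1) y) = y - D.homotopy n (D.bdE n y) := by
  rw [homotopy, LinearMap.sub_apply, map_sub, bdE_pushP_succ, LinearMap.comp_apply,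
    LinearMap.comp_apply, bdE_incK_kappa, deltaK_consA_succ, map_sub, deltaAK_pushT, homotopy,
    LinearMap.sub_apply, LinearMap.comp_apply, LinearMap.comp_apply]
  abel

end Boundary

end CrossedProduct

/-! ### Comparison of relatively free bimodule resolutions -/

section Bimodules

variable {k : Type u} [CommRing k] {E W V U : Type u} [Ring E] [Algebra k E]
  [AddCommGroup W] [Module k W] [AddCommGroup V] [Module k V] [AddCommGroup U] [Module k U]

/-- The `E`-bilinear extension of a map out of `W`. -/
def biExt (g : W →ₗ[k] E ⊗[k] (V ⊗[k] E)) : E ⊗[k] (W ⊗[k] E) →ₗ[k] E ⊗[k] (V ⊗[k] E) :=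
  leftExt (rightExt g)

theorem biExt_tmul (g : W →ₗ[k] E ⊗[k] (V ⊗[k] E)) (e e' : E) (w : W) :
    biExt g (e ⊗ₜ (w ⊗ₜ e')) = lMul k _ e ((rMul k _ e').lTensor E (g w)) := rfl

theorem biExt_one (g : W →ₗ[k] E ⊗[k] (V ⊗[k] E)) (w : W) :
    biExt g (1 ⊗ₜ (w ⊗ₜ 1)) = g w := by
  rw [biExt_tmul, lMul_one]
  have : rMul k V (1 : E) = LinearMap.id := LinearMap.ext fun x => rMul_one x
  rw [this, LinearMap.lTensor_id, LinearMap.id_apply]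

theorem biExt_lMul (g : W →ₗ[k] E ⊗[k] (V ⊗[k] E)) (e : E) (y : E ⊗[k] (W ⊗[k] E)) :
    biExt g (lMul k _ e y) = lMul k _ e (biExt g y) := leftExt_lMul _ _ _

theorem biExt_rMul (g : W →ₗ[k] E ⊗[k] (V ⊗[k] E)) (e : E) (y : E ⊗[k] (W ⊗[k] E)) :
    biExt g ((rMul k _ e).lTensor E y) = (rMul k _ e).lTensor E (biExt g y) :=
  leftExt_lTensor_rMul (fun _ _ => rightExt_rMul _ _ _) _ _

theorem bi_induction {p : E ⊗[k] (W ⊗[k] E) → Prop} (h0 : ∀ e w e', p (e ⊗ₜ (w ⊗ₜ e')))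
    (hadd : ∀ x y, p x → p y → p (x + y)) (y : E ⊗[k] (W ⊗[k] E)) : p y := by
  have hz : p 0 := by simpa using h0 0 0 0
  induction y using TensorProduct.induction_on with
  | zero => exact hz
  | add x y hx hy => exact hadd _ _ hx hy
  | tmul e z =>
    induction z using TensorProduct.induction_on with
    | zero => simpa using hz
    | add x y hx hy => rw [TensorProduct.tmul_add]; exact hadd _ _ hx hy
    | tmul w e' => exact h0 e w e'

/-- Bimodule maps between induced bimodules are handled through their values on generators; this is
composition in that language. -/
theorem biExt_biExt (f : V →ₗ[k] E ⊗[k] (U ⊗[k] E)) (g : W →ₗ[k] E ⊗[k] (V ⊗[k] E))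
    (y : E ⊗[k] (W ⊗[k] E)) : biExt f (biExt g y) = biExt (biExt f ∘ₗ g) y := by
  induction y using bi_induction with
  | h0 e w e' => rw [biExt_tmul, biExt_lMul, biExt_rMul, biExt_tmul, LinearMap.comp_apply]
  | hadd x y hx hy => simp only [map_add, hx, hy]

theorem biExt_add (f g : W →ₗ[k] E ⊗[k] (V ⊗[k] E)) (y : E ⊗[k] (W ⊗[k] E)) :
    biExt (f + g) y = biExt f y + biExt g y := by
  induction y using bi_induction with
  | h0 e w e' => simp only [biExt_tmul, LinearMap.add_apply, map_add]
  | hadd x y hx hy => simp only [map_add, hx, hy]; abel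

set_option maxSynthPendingDepth 3 in
theorem biExt_sub (f g : W →ₗ[k] E ⊗[k] (V ⊗[k] E)) (y : E ⊗[k] (W ⊗[k] E)) :
    biExt (f - g) y = biExt f y - biExt g y := by
  rw [eq_sub_iff_add_eq, ← biExt_add, sub_add_cancel]

variable (k E W) in
/-- The unit `w ↦ 1 ⊗ w ⊗ 1`. -/
def biUnit : W →ₗ[k] E ⊗[k] (W ⊗[k] E) :=
  TensorProduct.mk k E (W ⊗[k] E) 1 ∘ₗ (TensorProduct.mk k W E).flip 1

theorem biUnit_apply (w : W) : biUnit k E W w = 1 ⊗ₜ (w ⊗ₜ 1) := rfl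

theorem biExt_biUnit (y : E ⊗[k] (W ⊗[k] E)) : biExt (biUnit k E W) y = y := by
  induction y using bi_induction with
  | h0 e w e' => rw [biExt_tmul, biUnit_apply]; simp
  | hadd x y hx hy => simp only [map_add, hx, hy]

/-- `e ⊗ c ⊗ e' ↦ c e e'`. -/
def augBi (z : W →ₗ[k] k) : E ⊗[k] (W ⊗[k] E) →ₗ[k] E :=
  LinearMap.mul' k E ∘ₗ (TensorProduct.lid k E ∘ₗ z.rTensor E).lTensor E

theorem augBi_tmul (z : W →ₗ[k] k) (e e' : E) (w : W) :
    augBi z (e ⊗ₜ (w ⊗ₜ e')) = z w • (e * e') := by simp [augBi]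

theorem augBi_lMul (z : W →ₗ[k] k) (e : E) (y : E ⊗[k] (W ⊗[k] E)) :
    augBi z (lMul k _ e y) = e * augBi z y := by
  induction y using bi_induction with
  | h0 e w e' => simp [augBi_tmul, mul_assoc]
  | hadd x y hx hy => simp only [map_add, hx, hy, mul_add]

theorem augBi_rMul (z : W →ₗ[k] k) (e : E) (y : E ⊗[k] (W ⊗[k] E)) :
    augBi z ((rMul k _ e).lTensor E y) = augBi z y * e := by
  induction y using bi_induction with
  | h0 e w e' => simp [augBi_tmul, mul_assoc]
  | hadd x y hx hy => simp only [map_add, hx, hy, add_mul]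

theorem augBi_biExt {z : W →ₗ[k] k} {z' : V →ₗ[k] k} {g : W →ₗ[k] E ⊗[k] (V ⊗[k] E)}
    (h : ∀ w, augBi z' (g w) = z w • 1) (y : E ⊗[k] (W ⊗[k] E)) :
    augBi z' (biExt g y) = augBi z y := by
  induction y using bi_induction with
  | h0 e w e' => rw [biExt_tmul, augBi_lMul, augBi_rMul, h, augBi_tmul]; simp
  | hadd x y hx hy => simp only [map_add, hx, hy]

/-! ### Induced bimodules with coefficients in M -/

section Coefficients

variable (M : Type u) [AddCommGroup M] [Module k M] [Module E M] [Module Eᵐᵒᵖ M]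
  [IsScalarTower k E M] [IsScalarTower k Eᵐᵒᵖ M]

/-- `m ⊗ e ⊗ w ⊗ e' ↦ e' (m e) ⊗ w`. -/
def contr : M ⊗[k] (E ⊗[k] (W ⊗[k] E)) →ₗ[k] M ⊗[k] W :=
  (leftAct k E M ∘ₗ (TensorProduct.comm k M E).toLinearMap).rTensor W ∘ₗ
    (TensorProduct.assoc k M E W).symm.toLinearMap ∘ₗ
    (TensorProduct.comm k W E).toLinearMap.lTensor M ∘ₗ
    (rightAct k E M).rTensor (W ⊗[k] E) ∘ₗ (TensorProduct.assoc k M E (W ⊗[k] E)).symm.toLinearMap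

theorem contr_tmul (m : M) (e e' : E) (w : W) :
    contr M (m ⊗ₜ[k] (e ⊗ₜ (w ⊗ₜ e'))) = (e' • MulOpposite.op e • m) ⊗ₜ w := rfl

/-- The map `M ⊗ W → M ⊗ V` induced by a map of `W` to `E ⊗ V ⊗ E`. -/
def extM (g : W →ₗ[k] E ⊗[k] (V ⊗[k] E)) : M ⊗[k] W →ₗ[k] M ⊗[k] V := contr M ∘ₗ g.lTensor M

theorem extM_tmul (g : W →ₗ[k] E ⊗[k] (V ⊗[k] E)) (m : M) (w : W) :
    extM M g (m ⊗ₜ w) = contr M (m ⊗ₜ g w) := rfl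

theorem extM_biUnit : extM M (biUnit k E W) = LinearMap.id := by
  refine TensorProduct.ext' fun m w => ?_
  rw [extM_tmul, biUnit_apply, contr_tmul]
  simp

theorem extM_add (f g : W →ₗ[k] E ⊗[k] (V ⊗[k] E)) : extM M (f + g) = extM M f + extM M g := by
  refine TensorProduct.ext' fun m w => ?_
  simp only [extM_tmul, LinearMap.add_apply, TensorProduct.tmul_add, map_add]

set_option maxSynthPendingDepth 3 in
theorem extM_sub (f g : W →ₗ[k] E ⊗[k] (V ⊗[k] E)) : extM M (f - g) = extM M f - extM M g := by
  rw [eq_sub_iff_add_eq, ← extM_add, sub_add_cancel]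

set_option maxSynthPendingDepth 3 in
theorem extM_zero : extM M (0 : W →ₗ[k] E ⊗[k] (V ⊗[k] E)) = 0 := by
  simpa using extM_sub M (0 : W →ₗ[k] E ⊗[k] (V ⊗[k] E)) 0

variable [SMulCommClass E Eᵐᵒᵖ M]

/-- The two actions on M commute, so factors can be carried cyclically from the tensor to m. This is
the relation that defines M ⊗_{E^e} -. -/
theorem contr_lMul_rMul (m : M) (e e' : E) (y : E ⊗[k] (W ⊗[k] E)) :
    contr M (m ⊗ₜ[k] lMul k _ e ((rMul k _ e').lTensor E y)) =
      contr M ((e' • MulOpposite.op e • m) ⊗ₜ[k] y) := by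
  induction y using bi_induction with
  | h0 f w f' =>
    simp only [LinearMap.lTensor_tmul, rMul_tmul, lMul_tmul, contr_tmul, MulOpposite.op_mul,
      mul_smul]
    congr 2
    rw [smul_comm]
  | hadd x y hx hy => simp only [map_add, TensorProduct.tmul_add, hx, hy]

theorem extM_contr (g : W →ₗ[k] E ⊗[k] (V ⊗[k] E)) (m : M) (y : E ⊗[k] (W ⊗[k] E)) :
    extM M g (contr M (m ⊗ₜ y)) = contr M (m ⊗ₜ biExt g y) := by
  induction y using bi_induction with
  | h0 e w e' => rw [contr_tmul, extM_tmul, biExt_tmul, contr_lMul_rMul]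
  | hadd x y hx hy => simp only [map_add, TensorProduct.tmul_add, hx, hy]

/-- Functoriality of M ⊗_{E^e} - on induced bimodules, with M ⊗_{E^e} (E ⊗ W ⊗ E) replaced
throughout by M ⊗ W. -/
theorem extM_comp (f : V →ₗ[k] E ⊗[k] (U ⊗[k] E)) (g : W →ₗ[k] E ⊗[k] (V ⊗[k] E)) :
    extM M f ∘ₗ extM M g = extM M (biExt f ∘ₗ g) := by
  refine TensorProduct.ext' fun m w => ?_
  rw [LinearMap.comp_apply, extM_tmul, extM_contr, extM_tmul, LinearMap.comp_apply]

end Coefficients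

end Bimodules

/-- A resolution of `E` by bimodules `E ⊗ W_n ⊗ E` with `W_0 = k`, together with a `k`-linear
contraction. -/
structure BiRes (k E : Type u) [CommRing k] [Ring E] [Algebra k E] where
  /-- The generators. -/
  W : ℕ → ModuleCat.{u} k
  /-- The identification `W_0 = k`. -/
  z : W 0 ≃ₗ[k] k
  /-- The differential. -/
  d : ∀ n, W (n + 1) →ₗ[k] E ⊗[k] (W n ⊗[k] E)
  /-- The contraction. -/
  s : ∀ n, E ⊗[k] (W n ⊗[k] E) →ₗ[k] E ⊗[k] (W (n + 1) ⊗[k] E)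
  d_d : ∀ n w, biExt (d n) (d (n + 1) w) = 0
  aug_d : ∀ w, augBi z.toLinearMap (d 0 w) = 0
  d_s_zero : ∀ y, biExt (d 0) (s 0 y) = y - 1 ⊗ₜ (z.symm 1 ⊗ₜ augBi z.toLinearMap y)
  d_s_succ : ∀ n y, biExt (d (n + 1)) (s (n + 1) y) = y - s n (biExt (d n) y)

namespace BiRes

variable {k E : Type u} [CommRing k] [Ring E] [Algebra k E] (R S T : BiRes k E)

/-- The comparison map of two resolutions, on generators. -/
def comparison : ∀ n, R.W n →ₗ[k] E ⊗[k] (S.W n ⊗[k] E)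
  | 0 => biUnit k E (S.W 0) ∘ₗ S.z.symm.toLinearMap ∘ₗ R.z.toLinearMap
  | n + 1 => S.s n ∘ₗ biExt (comparison n) ∘ₗ R.d n

theorem augBi_biExt_comparison (y : E ⊗[k] (R.W 0 ⊗[k] E)) :
    augBi S.z.toLinearMap (biExt (R.comparison S 0) y) = augBi R.z.toLinearMap y := by
  refine augBi_biExt (fun w => ?_) y
  simp [comparison, biUnit_apply, augBi_tmul]

set_option maxSynthPendingDepth 3 in
theorem biExt_d_d (n : ℕ) (y : E ⊗[k] (R.W (n + 2) ⊗[k] E)) :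
    biExt (R.d n) (biExt (R.d (n + 1)) y) = 0 := by
  have h : biExt (R.d n) ∘ₗ R.d (n + 1) = 0 := LinearMap.ext (R.d_d n)
  rw [biExt_biExt, h]
  have := biExt_sub (0 : R.W (n + 2) →ₗ[k] E ⊗[k] (R.W n ⊗[k] E)) 0 y
  rwa [sub_self, sub_self] at this

/-- Lifting is needed only on generators, where k-linearity is enough, so the k-linear contraction
of the target replaces projectivity. The defect ds = id - sd is zero because the element lifted is a
cycle; in degree 0 the defect is the augmentation, which comparison maps preserve and which kills
boundaries. -/
theorem d_comparison (n : ℕ) (w : R.W (n + 1)) :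
    biExt (S.d n) (R.comparison S (n + 1) w) = biExt (R.comparison S n) (R.d n w) := by
  induction n with
  | zero =>
    have h : R.comparison S 1 w = S.s 0 (biExt (R.comparison S 0) (R.d 0 w)) := rfl
    rw [h, S.d_s_zero, augBi_biExt_comparison, R.aug_d]
    simp
  | succ n ih =>
    have h : R.comparison S (n + 2) w = S.s (n + 1) (biExt (R.comparison S (n + 1)) (R.d (n + 1) w)) :=
      rfl
    have h2 : biExt (S.d n) ∘ₗ R.comparison S (n + 1) = biExt (R.comparison S n) ∘ₗ R.d n :=
      LinearMap.ext ih
    rw [h, S.d_s_succ, biExt_biExt, h2, ← biExt_biExt, R.d_d]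
    simp

/-- The homotopy between two chain maps of resolutions, on generators. -/
def htpy (f g : ∀ n, R.W n →ₗ[k] E ⊗[k] (S.W n ⊗[k] E)) :
    ∀ n, R.W n →ₗ[k] E ⊗[k] (S.W (n + 1) ⊗[k] E)
  | 0 => 0
  | n + 1 => S.s (n + 1) ∘ₗ (f (n + 1) - g (n + 1) - biExt (htpy f g n) ∘ₗ R.d n)

set_option maxSynthPendingDepth 3 in
-- The element f - g - h∂ to be lifted is a cycle, by induction, and the contraction of the target
-- lifts it. The induction starts with the zero homotopy, since f and g agree in degree 0.
theorem d_htpy {f g : ∀ n, R.W n →ₗ[k] E ⊗[k] (S.W n ⊗[k] E)} (h0 : f 0 = g 0)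
    (hf : ∀ n w, biExt (S.d n) (f (n + 1) w) = biExt (f n) (R.d n w))
    (hg : ∀ n w, biExt (S.d n) (g (n + 1) w) = biExt (g n) (R.d n w)) (n : ℕ) :
    biExt (S.d (n + 1)) ∘ₗ R.htpy S f g (n + 1) =
      f (n + 1) - g (n + 1) - biExt (R.htpy S f g n) ∘ₗ R.d n := by
  have key : ∀ n, biExt (S.d n) ∘ₗ (f (n + 1) - g (n + 1) - biExt (R.htpy S f g n) ∘ₗ R.d n) = 0 →
      biExt (S.d (n + 1)) ∘ₗ R.htpy S f g (n + 1) =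
      f (n + 1) - g (n + 1) - biExt (R.htpy S f g n) ∘ₗ R.d n := by
    intro n hn
    refine LinearMap.ext fun w => ?_
    have h1 : R.htpy S f g (n + 1) w =
      S.s (n + 1) ((f (n + 1) - g (n + 1) - biExt (R.htpy S f g n) ∘ₗ R.d n) w) := rfl
    rw [LinearMap.comp_apply, h1, S.d_s_succ]
    have := LinearMap.congr_fun hn w
    rw [LinearMap.comp_apply] at this
    rw [this]
    simp
  induction n with
  | zero =>
    refine key 0 (LinearMap.ext fun w => ?_)
    have hz : ∀ y, biExt (R.htpy S f g 0) y = 0 := by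
      intro y
      have := biExt_sub (0 : R.W 0 →ₗ[k] E ⊗[k] (S.W 1 ⊗[k] E)) 0 y
      rwa [sub_self, sub_self] at this
    simp [hz, hf, hg, h0]
  | succ n ih =>
    refine key (n + 1) (LinearMap.ext fun w => ?_)
    simp only [LinearMap.comp_apply, LinearMap.sub_apply, map_sub, hf, hg]
    rw [biExt_biExt, ih, biExt_sub, biExt_sub, ← biExt_biExt (R.htpy S f g n), R.d_d]
    simp

/-! ### Comparison of resolutions with coefficients in M -/

section Coefficients

variable (M : Type u) [AddCommGroup M] [Module k M] [Module E M] [Module Eᵐᵒᵖ M]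
  [IsScalarTower k E M] [IsScalarTower k Eᵐᵒᵖ M] [SMulCommClass E Eᵐᵒᵖ M]

theorem extM_d_d (n : ℕ) : extM M (R.d n) ∘ₗ extM M (R.d (n + 1)) = 0 := by
  have h : biExt (R.d n) ∘ₗ R.d (n + 1) = 0 := LinearMap.ext (R.d_d n)
  rw [extM_comp, h, extM_zero]

theorem extM_comparison (n : ℕ) : extM M (S.d n) ∘ₗ extM M (R.comparison S (n + 1)) =
    extM M (R.comparison S n) ∘ₗ extM M (R.d n) := by
  rw [extM_comp, extM_comp]
  exact congrArg _ (LinearMap.ext (R.d_comparison S n))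

/-- The composition of the two comparison maps is homotopic to the identity. -/
def roundTrip (n : ℕ) : M ⊗[k] R.W n →ₗ[k] M ⊗[k] R.W (n + 1) :=
  extM M (R.htpy R (fun n => biExt (S.comparison R n) ∘ₗ R.comparison S n)
    (fun n => biUnit k E (R.W n)) n)

/-- In degree 0 both comparison maps are the identification of W_0 with k, so the round trip is the
identity on the nose. -/
theorem comparison_comparison_zero (x : M ⊗[k] R.W 0) :
    extM M (S.comparison R 0) (extM M (R.comparison S 0) x) = x := by
  rw [← LinearMap.comp_apply, extM_comp]
  have : biExt (S.comparison R 0) ∘ₗ R.comparison S 0 = biUnit k E (R.W 0) := by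
    refine LinearMap.ext fun w => ?_
    have h : R.comparison S 0 w = 1 ⊗ₜ (S.z.symm (R.z w) ⊗ₜ 1) := rfl
    rw [LinearMap.comp_apply, h, biExt_one]
    simp [comparison]
  rw [this, extM_biUnit, LinearMap.id_apply]

theorem d_roundTrip_zero (x : M ⊗[k] R.W 0) : extM M (R.d 0) (R.roundTrip S M 0 x) = 0 := by
  have : R.roundTrip S M 0 = 0 := extM_zero M
  rw [this, LinearMap.zero_apply, map_zero]

theorem d_roundTrip_succ (n : ℕ) (x : M ⊗[k] R.W (n + 1)) :
    extM M (R.d (n + 1)) (R.roundTrip S M (n + 1) x) =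
      extM M (S.comparison R (n + 1)) (extM M (R.comparison S (n + 1)) x) - x -
        R.roundTrip S M n (extM M (R.d n) x) := by
  have h := R.d_htpy R (f := fun n => biExt (S.comparison R n) ∘ₗ R.comparison S n)
    (g := fun n => biUnit k E (R.W n)) (by
      refine LinearMap.ext fun w => ?_
      have h : R.comparison S 0 w = 1 ⊗ₜ (S.z.symm (R.z w) ⊗ₜ 1) := rfl
      rw [LinearMap.comp_apply, h, biExt_one]
      simp [comparison])
    (fun n w => by
      have h2 : biExt (R.d n) ∘ₗ S.comparison R (n + 1) = biExt (S.comparison R n) ∘ₗ S.d n :=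
        LinearMap.ext (S.d_comparison R n)
      rw [LinearMap.comp_apply, biExt_biExt, h2, ← biExt_biExt, d_comparison, biExt_biExt])
    (fun n w => by rw [biUnit_apply, biExt_one, biExt_biUnit]) n
  have h2 := congrArg (extM M) h
  rw [← extM_comp, extM_sub, extM_sub, ← extM_comp, ← extM_comp, extM_biUnit] at h2
  exact LinearMap.congr_fun h2 x

end Coefficients

end BiRes

/-! ### Homotopy equivalences -/

section Homology

variable {k : Type u} [CommRing k] {X Y : ℕ → Type u} [∀ n, AddCommGroup (X n)]
  [∀ n, Module k (X n)] [∀ n, AddCommGroup (Y n)] [∀ n, Module k (Y n)]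
  {dX : ∀ n, X (n + 1) →ₗ[k] X n} (hX : ∀ n, dX n ∘ₗ dX (n + 1) = 0)
  {dY : ∀ n, Y (n + 1) →ₗ[k] Y n} (hY : ∀ n, dY n ∘ₗ dY (n + 1) = 0)

theorem chainComplexOf_d (n : ℕ) :
    (chainComplexOf k X dX hX).d (n + 1) n = ModuleCat.ofHom (dX n) :=
  ChainComplex.of_d (fun n => ModuleCat.of k (X n)) (fun n => ModuleCat.ofHom (dX n)) n

/-- A chain map of complexes given by its components. -/
def chainMapOf (f : ∀ n, X n →ₗ[k] Y n) (hf : ∀ n, dY n ∘ₗ f (n + 1) = f n ∘ₗ dX n) :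
    chainComplexOf k X dX hX ⟶ chainComplexOf k Y dY hY :=
  ChainComplex.ofHom (X := chainComplexOf k X dX hX) (Y := chainComplexOf k Y dY hY)
    (fun n => ModuleCat.ofHom (f n)) (fun n => by
      rw [chainComplexOf_d, chainComplexOf_d]
      exact congrArg ModuleCat.ofHom (hf n))

theorem chainMapOf_f (f : ∀ n, X n →ₗ[k] Y n) (hf : ∀ n, dY n ∘ₗ f (n + 1) = f n ∘ₗ dX n)
    (n : ℕ) : (chainMapOf hX hY f hf).f n = ModuleCat.ofHom (f n) := by
  rfl

/-- A homotopy of an endomorphism to the identity, given by its components. -/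
def homotopyOf (f : ∀ n, X n →ₗ[k] X n) (hf : ∀ n, dX n ∘ₗ f (n + 1) = f n ∘ₗ dX n)
    (s : ∀ n, X n →ₗ[k] X (n + 1)) (h0 : ∀ x, dX 0 (s 0 x) = f 0 x - x)
    (hs : ∀ n x, dX (n + 1) (s (n + 1) x) = f (n + 1) x - x - s n (dX n x)) :
    Homotopy (chainMapOf hX hX f hf) (𝟙 _) where
  hom i j := if h : i + 1 = j then ModuleCat.ofHom (s i) ≫ eqToHom (by rw [← h]; rfl) else 0
  zero i j h := dif_neg h
  comm i := by
    have hd := chainComplexOf_d hX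
    rw [chainMapOf_f]
    cases i with
    | zero =>
      rw [Homotopy.dNext_zero_chainComplex, Homotopy.prevD_chainComplex, dif_pos rfl, hd]
      ext x
      have := h0 x
      simp only [zero_add, eqToHom_refl, Category.comp_id]
      change f 0 x = dX 0 (s 0 x) + x
      rw [this]
      abel
    | succ n =>
      rw [Homotopy.dNext_succ_chainComplex, Homotopy.prevD_chainComplex, dif_pos rfl, dif_pos rfl, hd, hd]
      ext x
      have := hs n x
      simp only [eqToHom_refl, Category.comp_id]
      change f (n + 1) x = s n (dX n x) + dX (n + 1) (s (n + 1) x) + x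
      rw [this]
      abel

theorem nonempty_homology_iso (f : ∀ n, X n →ₗ[k] Y n)
    (hf : ∀ n, dY n ∘ₗ f (n + 1) = f n ∘ₗ dX n) (g : ∀ n, Y n →ₗ[k] X n)
    (hg : ∀ n, dX n ∘ₗ g (n + 1) = g n ∘ₗ dY n)
    (s : ∀ n, X n →ₗ[k] X (n + 1)) (hs0 : ∀ x, dX 0 (s 0 x) = g 0 (f 0 x) - x)
    (hs : ∀ n x, dX (n + 1) (s (n + 1) x) = g (n + 1) (f (n + 1) x) - x - s n (dX n x))
    (t : ∀ n, Y n →ₗ[k] Y (n + 1)) (ht0 : ∀ x, dY 0 (t 0 x) = f 0 (g 0 x) - x)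
    (ht : ∀ n x, dY (n + 1) (t (n + 1) x) = f (n + 1) (g (n + 1) x) - x - t n (dY n x)) (n : ℕ) :
    Nonempty ((chainComplexOf k X dX hX).homology n ≅ (chainComplexOf k Y dY hY).homology n) := by
  have hcomp1 : ∀ n, dX n ∘ₗ (g (n + 1) ∘ₗ f (n + 1)) = (g n ∘ₗ f n) ∘ₗ dX n := fun n => by
    rw [← LinearMap.comp_assoc, hg, LinearMap.comp_assoc, hf, LinearMap.comp_assoc]
  have hcomp2 : ∀ n, dY n ∘ₗ (f (n + 1) ∘ₗ g (n + 1)) = (f n ∘ₗ g n) ∘ₗ dY n := fun n => by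
    rw [← LinearMap.comp_assoc, hf, LinearMap.comp_assoc, hg, LinearMap.comp_assoc]
  let e : HomotopyEquiv (chainComplexOf k X dX hX) (chainComplexOf k Y dY hY) :=
    { hom := chainMapOf hX hY f hf
      inv := chainMapOf hY hX g hg
      homotopyHomInvId := (Homotopy.ofEq (by ext n x; rfl)).trans
        (homotopyOf hX (fun n => g n ∘ₗ f n) hcomp1 s hs0 hs)
      homotopyInvHomId := (Homotopy.ofEq (by ext n x; rfl)).trans
        (homotopyOf hY (fun n => f n ∘ₗ g n) hcomp2 t ht0 ht) }
  exact ⟨e.toHomologyIso n⟩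

end Homology

/-! ### The bar resolution -/

section BarResolution

variable (k : Type u) [CommRing k] (E : Type u) [Ring E] [Algebra k E]

/-- `e ⊗ v ⊗ e' ↦ 1 ⊗ e v ⊗ e'`. -/
def barS (n : ℕ) : E ⊗[k] (TPow k E n ⊗[k] E) →ₗ[k] E ⊗[k] (TPow k E (n + 1) ⊗[k] E) :=
  TensorProduct.mk k E _ 1 ∘ₗ (TPow.succEquiv k E n).toLinearMap.rTensor E ∘ₗ
    (TensorProduct.assoc k E (TPow k E n) E).symm.toLinearMap

theorem barS_tmul (n : ℕ) (e e' : E) (v : TPow k E n) :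
    barS k E n (e ⊗ₜ (v ⊗ₜ e')) = 1 ⊗ₜ (TPow.cons k n e v ⊗ₜ e') := rfl

/-- The differential of the bar resolution on `1 ⊗ v ⊗ 1`. -/
def barBd (n : ℕ) : TPow k E (n + 1) →ₗ[k] E ⊗[k] (TPow k E n ⊗[k] E) :=
  ((TensorProduct.mk k (TPow k E n) E).flip 1).lTensor E ∘ₗ (TPow.succEquiv k E n).symm.toLinearMap -
    biUnit k E (TPow k E n) ∘ₗ barD k n +
    (-1 : k) ^ (n + 1) • TensorProduct.mk k E _ 1 ∘ₗ TPow.unsnoc k n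

set_option maxSynthPendingDepth 3 in
theorem barBd_zero (e : E) (x : TPow k E 0) :
    barBd k E 0 (TPow.cons k 0 e x) = e ⊗ₜ (x ⊗ₜ 1) - 1 ⊗ₜ (x ⊗ₜ e) := by
  have h1 : barBd k E 0 (TPow.cons k 0 e x) = e ⊗ₜ (x ⊗ₜ 1) - biUnit k E (TPow k E 0) 0 +
    (-1 : k) ^ (0 + 1) • (1 : E) ⊗ₜ (x ⊗ₜ e) := rfl
  rw [h1]
  simp [sub_eq_add_neg]

set_option maxSynthPendingDepth 3 in
-- The bar differential, defined by its closed formula, obeys the recursion d(ev) = e ⊗ v - s(e dv),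
-- with s the operator making the coefficient a letter. All properties of the bar resolution below
-- follow from it, as for δ above.
theorem barBd_succ (n : ℕ) (e : E) (v : TPow k E (n + 1)) :
    barBd k E (n + 1) (TPow.cons k (n + 1) e v) =
      e ⊗ₜ (v ⊗ₜ 1) - barS k E n (lMul k _ e (barBd k E n v)) := by
  have h1 : ∀ v : TPow k E (n + 1), barBd k E (n + 1) (TPow.cons k (n + 1) e v) = e ⊗ₜ (v ⊗ₜ 1) -
    1 ⊗ₜ ((TPow.succEquiv k E n (headAct k (LinearMap.mul' k E) n (e ⊗ₜ v)) -
        TPow.cons k n e (barD k n v)) ⊗ₜ 1) +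
    (-1 : k) ^ (n + 1 + 1) • (1 : E) ⊗ₜ ((TPow.cons k n e).rTensor E (TPow.unsnoc k n v)) :=
    fun v => rfl
  have h2 : barBd k E n v = ((TensorProduct.mk k (TPow k E n) E).flip 1).lTensor E
    ((TPow.succEquiv k E n).symm v) - 1 ⊗ₜ (barD k n v ⊗ₜ 1) +
    (-1 : k) ^ (n + 1) • 1 ⊗ₜ TPow.unsnoc k n v := rfl
  have h3 : barS k E n (lMul k _ e (((TensorProduct.mk k (TPow k E n) E).flip 1).lTensor E
    ((TPow.succEquiv k E n).symm v))) =
    1 ⊗ₜ (TPow.succEquiv k E n (headAct k (LinearMap.mul' k E) n (e ⊗ₜ v)) ⊗ₜ 1) := by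
    clear h2
    obtain ⟨v, rfl⟩ := (TPow.succEquiv k E n).surjective v
    rw [LinearEquiv.symm_apply_apply]
    induction v using TensorProduct.induction_on with
    | zero => simp
    | add x y hx hy => simp only [map_add, TensorProduct.tmul_add, TensorProduct.add_tmul, hx, hy]
    | tmul a v => rfl
  have h4 : ∀ t : TPow k E n ⊗[k] E, barS k E n (lMul k _ e (1 ⊗ₜ t)) =
      1 ⊗ₜ (TPow.cons k n e).rTensor E t := by
    intro t
    rw [lMul_tmul, mul_one]
    induction t using TensorProduct.induction_on with
    | zero => simp
    | add x y hx hy => simp only [map_add, TensorProduct.tmul_add, hx, hy]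
    | tmul a v => rfl
  rw [h1, h2, map_add, map_sub, map_add, map_sub, map_smul, map_smul, h3, h4, h4,
    LinearMap.rTensor_tmul, TensorProduct.sub_tmul, TensorProduct.tmul_sub, pow_succ (-1 : k) (n + 1),
    mul_neg_one, neg_smul]
  abel

theorem biExt_barBd_barS_zero (y : E ⊗[k] (TPow k E 0 ⊗[k] E)) :
    biExt (barBd k E 0) (barS k E 0 y) = y - 1 ⊗ₜ (TPow.nil k ⊗ₜ
      augBi (TPow.zeroEquiv k E).symm.toLinearMap y) := by
  induction y using bi_induction with
  | h0 e w e' =>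
    rw [barS_tmul, biExt_tmul, barBd_zero, lMul_one, augBi_tmul]
    simp only [map_sub, LinearMap.lTensor_tmul, rMul_tmul, one_mul]
    obtain ⟨c, rfl⟩ := (TPow.zeroEquiv k E).surjective w
    have : TPow.zeroEquiv k E c = c • TPow.nil k := by
      rw [TPow.nil, ← map_smul, smul_eq_mul, mul_one]
    simp [this, TPow.nil, TensorProduct.smul_tmul, TensorProduct.tmul_smul]
  | hadd x y hx hy => simp only [map_add, hx, hy, TensorProduct.tmul_add]; abel

theorem biExt_barBd_barS_succ (n : ℕ) (y : E ⊗[k] (TPow k E (n + 1) ⊗[k] E)) :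
    biExt (barBd k E (n + 1)) (barS k E (n + 1) y) = y - barS k E n (biExt (barBd k E n) y) := by
  have hr : ∀ (e : E) (y : E ⊗[k] (TPow k E n ⊗[k] E)),
      barS k E n ((rMul k _ e).lTensor E y) = (rMul k _ e).lTensor E (barS k E n y) := by
    intro e y
    induction y using bi_induction with
    | h0 e w e' => simp [barS_tmul]
    | hadd x y hx hy => simp only [map_add, hx, hy]
  induction y using bi_induction with
  | h0 e w e' =>
    rw [barS_tmul, biExt_tmul, barBd_succ, lMul_one, map_sub, biExt_tmul, lMul_lTensor, hr]
    simp
  | hadd x y hx hy => simp only [map_add, hx, hy]; abel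

theorem augBi_barBd (v : TPow k E 1) :
    augBi (TPow.zeroEquiv k E).symm.toLinearMap (barBd k E 0 v) = 0 := by
  revert v
  suffices h : augBi (TPow.zeroEquiv k E).symm.toLinearMap ∘ₗ barBd k E 0 = 0 from
    fun v => LinearMap.congr_fun h v
  refine TPow.ext_succ fun e x => ?_
  rw [LinearMap.comp_apply, barBd_zero, map_sub, augBi_tmul, augBi_tmul]
  simp

/-- Substitute the recursion for d(ev) and then ds = id - sd: what remains is s of e ddv, zero by
induction, or in the lowest degree the augmentation of a boundary. -/
theorem biExt_barBd_barBd (n : ℕ) (v : TPow k E (n + 2)) :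
    biExt (barBd k E n) (barBd k E (n + 1) v) = 0 := by
  induction n with
  | zero =>
    revert v
    suffices h : biExt (barBd k E 0) ∘ₗ barBd k E 1 = 0 from fun v => LinearMap.congr_fun h v
    refine TPow.ext_succ fun e x => ?_
    rw [LinearMap.comp_apply, barBd_succ, map_sub, biExt_barBd_barS_zero, augBi_lMul, augBi_barBd,
      ← mul_one e, ← lMul_tmul, biExt_lMul, biExt_one, mul_one]
    simp
  | succ n ih =>
    revert v
    suffices h : biExt (barBd k E (n + 1)) ∘ₗ barBd k E (n + 2) = 0 from
      fun v => LinearMap.congr_fun h v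
    refine TPow.ext_succ fun e x => ?_
    rw [LinearMap.comp_apply, barBd_succ, map_sub, biExt_barBd_barS_succ, biExt_lMul, ih,
      ← mul_one e, ← lMul_tmul, biExt_lMul, biExt_one, mul_one]
    simp

/-- The bar resolution. -/
def barRes : BiRes k E where
  W := TPowCat k E
  z := (TPow.zeroEquiv k E).symm
  d := barBd k E
  s := barS k E
  d_d := biExt_barBd_barBd k E
  aug_d := augBi_barBd k E
  d_s_zero := biExt_barBd_barS_zero k E
  d_s_succ := biExt_barBd_barS_succ k E

variable (M : Type u) [AddCommGroup M] [Module k M] [Module E M] [Module Eᵐᵒᵖ M]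
  [IsScalarTower k E M] [IsScalarTower k Eᵐᵒᵖ M] [SMulCommClass E Eᵐᵒᵖ M]

/-- The three summands of the bar differential become the first term, the inner products and the
last term of the Hochschild boundary, signs included. -/
theorem extM_barBd (n : ℕ) : extM M (barBd k E n) = hochschildD k M n := by
  have h1 : ∀ (m : M) (v : TPow k E (n + 1)), contr M (m ⊗ₜ[k]
      ((TensorProduct.mk k (TPow k E n) E).flip 1).lTensor E ((TPow.succEquiv k E n).symm v)) =
      headAct k (rightAct k E M) n (m ⊗ₜ v) := by
    intro m v
    obtain ⟨v, rfl⟩ := (TPow.succEquiv k E n).surjective v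
    rw [LinearEquiv.symm_apply_apply]
    induction v using TensorProduct.induction_on with
    | zero => simp
    | add x y hx hy => simp only [map_add, TensorProduct.tmul_add, hx, hy]
    | tmul a v =>
      rw [LinearMap.lTensor_tmul, LinearMap.flip_apply, TensorProduct.mk_apply, contr_tmul, one_smul]
      rfl
  have h2 : ∀ (m : M) (v : TPow k E n), contr M (m ⊗ₜ[k] biUnit k E _ v) = m ⊗ₜ v := by
    intro m v
    rw [biUnit_apply, contr_tmul]
    simp
  have h3 : ∀ (m : M) (v : TPow k E (n + 1)), contr M (m ⊗ₜ[k] ((1 : E) ⊗ₜ TPow.unsnoc k n v)) =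
      lastAct k M n (m ⊗ₜ v) := by
    intro m v
    have h : ∀ t : TPow k E n ⊗[k] E, contr M (m ⊗ₜ[k] ((1 : E) ⊗ₜ t)) =
      (TensorProduct.comm k (TPow k E n) M) ((leftAct k E M).lTensor (TPow k E n)
        (TensorProduct.assoc k (TPow k E n) E M (TensorProduct.comm k M (TPow k E n ⊗[k] E)
          (m ⊗ₜ t)))) := by
      intro t
      induction t using TensorProduct.induction_on with
      | zero => simp
      | add x y hx hy => simp only [map_add, TensorProduct.tmul_add, hx, hy]
      | tmul a v => rw [contr_tmul, MulOpposite.op_one, one_smul]; rfl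
    exact h _
  refine TensorProduct.ext' fun m v => ?_
  rw [extM_tmul, barBd, LinearMap.add_apply, LinearMap.sub_apply, TensorProduct.tmul_add,
    TensorProduct.tmul_sub, LinearMap.smul_apply, TensorProduct.tmul_smul, map_add, map_sub,
    map_smul, LinearMap.comp_apply, LinearMap.comp_apply, LinearMap.comp_apply,
    LinearEquiv.coe_coe, h1, h2, TensorProduct.mk_apply, h3]
  rfl

end BarResolution

theorem neg_one_pow_smul_smul {k N : Type*} [CommRing k] [AddCommGroup N] [Module k N] (n : ℕ)
    (x : N) : (-1 : k) ^ n • (-1 : k) ^ n • x = x := by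
  rcases neg_one_pow_eq_or k n with h | h <;> simp [h]

/-! ### Lists and tensor powers -/

section Lists

variable {k : Type u} [CommRing k] {B N : Type u} [Ring B] [Algebra k B] [AddCommGroup N]
  [Module k N]

/-- The class of a list in the tensor power of `B̄`. -/
def redL (k : Type u) [CommRing k] {B : Type u} [Ring B] [Algebra k B] (l : List B) :
    TPow k (Red k B) l.length := redT k B l.length (TPow.ofList k l)

theorem TPow.zero_eq_smul {V : Type u} [AddCommGroup V] [Module k V] (x : TPow k V 0) :
    x = (TPow.zeroEquiv k V).symm x • TPow.nil k := by
  obtain ⟨c, rfl⟩ := (TPow.zeroEquiv k V).surjective x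
  rw [LinearEquiv.symm_apply_apply, TPow.nil, ← map_smul, smul_eq_mul, mul_one]

/-- Classes of lists span the tensor power. The form with a submodule S allows induction on n; with
S = ⊥, applied to a difference of maps, it is a test for equality. -/
theorem TPow.mem_of_list {n : ℕ} (S : Submodule k N) (φ : TPow k (Red k B) n →ₗ[k] N)
    (h : ∀ (l : List B) (hl : l.length = n), φ (hl ▸ redL k l) ∈ S) (x : TPow k (Red k B) n) :
    φ x ∈ S := by
  induction n with
  | zero =>
    rw [TPow.zero_eq_smul x, map_smul]
    exact S.smul_mem _ (h [] rfl)
  | succ n ih =>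
    induction x using TPow.induction_red with
    | h b x =>
      refine ih (φ ∘ₗ TPow.cons k n (red k b)) (fun l hl => ?_) x
      subst hl
      exact h (b :: l) rfl
    | hadd x y hx hy => rw [map_add]; exact S.add_mem hx hy

theorem toTensorAlgebra_redL (l : List B) :
    TPow.toTensorAlgebra k l.length (redL k l) = clsL k l := by
  induction l with
  | nil => exact map_one (algebraMap k (TensorAlgebra k (Red k B)))
  | cons b l ih =>
    rw [clsL, List.map_cons, List.prod_cons]
    exact congrArg (cls k B b * ·) ih

theorem toTensorAlgebra_cons {V : Type u} [AddCommGroup V] [Module k V] (n : ℕ) (v : V)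
    (x : TPow k V n) : TPow.toTensorAlgebra k (n + 1) (TPow.cons k n v x) =
      TensorAlgebra.ι k v * TPow.toTensorAlgebra k n x := rfl

theorem toTensorAlgebra_nil {V : Type u} [AddCommGroup V] [Module k V] :
    TPow.toTensorAlgebra k 0 (TPow.nil k : TPow k V 0) = 1 :=
  map_one (algebraMap k (TensorAlgebra k V))

theorem clsL_nil : clsL k ([] : List B) = 1 := rfl

theorem clsL_cons (b : B) (l : List B) : clsL k (b :: l) = cls k B b * clsL k l := by
  rw [clsL, List.map_cons, List.prod_cons, clsL]

theorem clsL_append (l l' : List B) : clsL k (l ++ l') = clsL k l * clsL k l' := by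
  rw [clsL, List.map_append, List.prod_append, clsL, clsL]

theorem cls_eq (b : B) : cls k B b = TensorAlgebra.ι k (red k b) := rfl

theorem span_clsL : Submodule.span k (Set.range (clsL k (B := B))) = ⊤ := by
  refine (Submodule.eq_top_iff').2 fun x => ?_
  induction x using TensorAlgebra.induction with
  | algebraMap r =>
    rw [Algebra.algebraMap_eq_smul_one]
    exact Submodule.smul_mem _ _ (Submodule.subset_span ⟨[], rfl⟩)
  | ι x =>
    obtain ⟨b, rfl⟩ := red_surjective x
    exact Submodule.subset_span ⟨[b], by rw [clsL_cons, clsL_nil, mul_one, cls_eq]⟩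
  | mul x y hx hy =>
    have h := Submodule.mul_mem_mul hx hy
    rw [Submodule.span_mul_span] at h
    refine Submodule.span_mono ?_ h
    rintro _ ⟨_, ⟨l, rfl⟩, _, ⟨l', rfl⟩, rfl⟩
    exact ⟨l ++ l', clsL_append l l'⟩
  | add x y hx hy => exact Submodule.add_mem _ hx hy

variable (k) in
/-- The decomposition of the tensor algebra into tensor powers. -/
def tensorSplit (V : Type u) [AddCommGroup V] [Module k V] :
    TensorAlgebra k V →ₗ[k] ⨁ n, TPow k V n :=
  (TensorAlgebra.lift k ((DirectSum.toModule k ℕ (V →ₗ[k] ⨁ n, TPow k V n) (fun n =>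
    ((TPow.cons k n).compr₂ (DirectSum.lof k ℕ (fun n => TPow k V n) (n + 1))).flip)).flip :
      V →ₗ[k] Module.End k (⨁ n, TPow k V n))).toLinearMap.flip
    (DirectSum.lof k ℕ (fun n => TPow k V n) 0 (TPow.nil k))

/-- The tensor algebra acts on ⨁ V^{⊗n} by prefixing letters, and acting on the empty tensor
recovers the element. So T(V) splits into the tensor powers, and homogeneous components can be read
off. -/
theorem tensorSplit_toTensorAlgebra {V : Type u} [AddCommGroup V] [Module k V] (n : ℕ)
    (x : TPow k V n) : tensorSplit k V (TPow.toTensorAlgebra k n x) =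
      DirectSum.lof k ℕ (fun n => TPow k V n) n x := by
  induction n with
  | zero =>
    rw [TPow.zero_eq_smul x, map_smul, map_smul, map_smul, toTensorAlgebra_nil, tensorSplit,
      LinearMap.flip_apply, AlgHom.toLinearMap_apply, map_one]
    rfl
  | succ n ih =>
    revert x
    suffices h : tensorSplit k V ∘ₗ TPow.toTensorAlgebra k (n + 1) = DirectSum.lof k ℕ _ (n + 1) from
      fun x => LinearMap.congr_fun h x
    refine TPow.ext_succ fun v x => ?_
    have ih' := ih x
    rw [tensorSplit, LinearMap.flip_apply, AlgHom.toLinearMap_apply] at ih'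
    rw [LinearMap.comp_apply, toTensorAlgebra_cons, tensorSplit, LinearMap.flip_apply,
      AlgHom.toLinearMap_apply, map_mul, Module.End.mul_apply, ih', TensorAlgebra.lift_ι_apply,
      LinearMap.flip_apply, DirectSum.toModule_lof]
    rfl

theorem tensorSplit_clsL (l : List B) : tensorSplit k (Red k B) (clsL k l) =
    DirectSum.lof k ℕ (fun n => TPow k (Red k B) n) l.length (redL k l) := by
  rw [← toTensorAlgebra_redL, tensorSplit_toTensorAlgebra]

end Lists

/-! ### Words of arbitrary length -/

section TotalWords

variable (k A H : Type u) [CommRing k] [Ring A] [Algebra k A] [Ring H] [Algebra k H]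

/-- Words of arbitrary length. -/
abbrev WordT : Type u := ⨁ n, Word k A H n

namespace WordT

/-- The inclusion of the words of length `n`. -/
abbrev of (n : ℕ) : Word k A H n →ₗ[k] WordT k A H :=
  DirectSum.lof k ℕ (fun n => Word k A H n) n

/-- Left multiplication by a letter. -/
def hR : Red k H →ₗ[k] Module.End k (WordT k A H) :=
  (DirectSum.toModule k ℕ (Red k H →ₗ[k] WordT k A H) (fun n =>
    ((Word.consH k A n).compr₂ (of k A H (n + 1))).flip)).flip

/-- The inclusion of `Ā^{⊗ n}`. -/
def aT (n : ℕ) : TPow k (Red k A) n →ₗ[k] WordT k A H := of k A H n ∘ₗ Word.ofA k A H n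

variable {k A} in
/-- The sign `(-1)^r` on words with `r` letters from `A`. -/
def sgnW : (n : ℕ) → Module.End k (Word k A H n)
  | 0 => LinearMap.id
  | n + 1 => Word.lift n ((Word.consH k A n).compl₂ (sgnW n))
      ((-1 : k) ^ (n + 1) • Word.ofA k A H (n + 1))

/-- The sign `(-1)^r` on words with `r` letters from `A`. -/
def sgn : Module.End k (WordT k A H) :=
  DirectSum.toModule k ℕ _ fun n => of k A H n ∘ₗ sgnW H n

variable {k A H}

/-- Left multiplication by a letter. -/
def hT : H →ₗ[k] Module.End k (WordT k A H) := hR k A H ∘ₗ red k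

theorem hR_of (n : ℕ) (h : Red k H) (w : Word k A H n) :
    hR k A H h (of k A H n w) = of k A H (n + 1) (Word.consH k A n h w) := by
  rw [hR, LinearMap.flip_apply, DirectSum.toModule_lof]
  rfl

theorem hT_apply (h : H) (w : WordT k A H) : hT h w = hR k A H (red k h) w := rfl

theorem aT_apply (n : ℕ) (x : TPow k (Red k A) n) :
    aT k A H n x = of k A H n (Word.ofA k A H n x) := rfl

theorem sgn_aT (n : ℕ) (x : TPow k (Red k A) n) :
    sgn k A H (aT k A H n x) = (-1 : k) ^ n • aT k A H n x := by
  rw [aT_apply, sgn, DirectSum.toModule_lof]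
  cases n with
  | zero => simp [sgnW]
  | succ n =>
    rw [sgnW, LinearMap.comp_apply, Word.lift_ofA, LinearMap.smul_apply, map_smul]

/-- The sign counts letters from A only, so prefixing a letter from H does not change it. -/
theorem sgn_hR (h : Red k H) (w : WordT k A H) :
    sgn k A H (hR k A H h w) = hR k A H h (sgn k A H w) := by
  revert w
  suffices e : sgn k A H ∘ₗ hR k A H h = hR k A H h ∘ₗ sgn k A H from
    fun w => LinearMap.congr_fun e w
  refine DirectSum.linearMap_ext k fun n => LinearMap.ext fun w => ?_
  rw [LinearMap.comp_apply, LinearMap.comp_apply, LinearMap.comp_apply, LinearMap.comp_apply, hR_of,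
    sgn, DirectSum.toModule_lof, DirectSum.toModule_lof, LinearMap.comp_apply, LinearMap.comp_apply,
    hR_of, sgnW, Word.lift_consH]
  rfl

variable (k) in
/-- The word of two lists of letters. -/
def mono : List H → List A → WordT k A H
  | [], a => aT k A H a.length (redL k a)
  | h :: hs, a => hT h (mono hs a)

variable (k) in
/-- The word of two lists of letters, as a word of known length. -/
def monoG (a : List A) : (hs : List H) → Word k A H (a.length + hs.length)
  | [] => Word.ofA k A H a.length (redL k a)
  | h :: hs => Word.consH k A _ (red k h) (monoG a hs)

theorem of_monoG (hs : List H) (a : List A) : of k A H _ (monoG k a hs) = mono k hs a := by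
  induction hs with
  | nil => rfl
  | cons h hs ih => rw [mono, ← ih, hT_apply, hR_of]; rfl

theorem sgn_mono (hs : List H) (a : List A) :
    sgn k A H (mono k hs a) = (-1 : k) ^ a.length • mono k hs a := by
  induction hs with
  | nil => rw [mono, sgn_aT]
  | cons h hs ih => rw [mono, hT_apply, sgn_hR, ih, map_smul]

theorem span_mono : Submodule.span k {w | ∃ (hs : List H) (a : List A), w = mono k hs a} = ⊤ := by
  set S := Submodule.span k {w | ∃ (hs : List H) (a : List A), w = mono k hs a}
  have hA : ∀ n (x : TPow k (Red k A) n), aT k A H n x ∈ S := by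
    intro n
    refine TPow.mem_of_list S (aT k A H n) fun l hl => ?_
    subst hl
    exact Submodule.subset_span ⟨[], l, rfl⟩
  have hH : ∀ (h : H) w, w ∈ S → hT h w ∈ S := by
    intro h w hw
    have : S ≤ S.comap (hT (k := k) (A := A) h) := by
      refine Submodule.span_le.2 ?_
      rintro _ ⟨hs, a, rfl⟩
      exact Submodule.subset_span ⟨h :: hs, a, rfl⟩
    exact this hw
  have key : ∀ n w, of k A H n w ∈ S := by
    intro n
    induction n with
    | zero => exact fun w => hA 0 w
    | succ n ih =>
      intro w
      induction w using Word.induction_succ with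
      | hH h w =>
        have := hH h _ (ih w)
        rwa [hT_apply, hR_of] at this
      | hA x => exact hA _ x
      | hadd x y hx hy => rw [map_add]; exact S.add_mem hx hy
  refine (Submodule.eq_top_iff').2 fun w => ?_
  induction w using DirectSum.induction_on with
  | zero => exact S.zero_mem
  | of n w => exact key n w
  | add x y hx hy => exact S.add_mem hx hy

theorem ext_mono {N : Type u} [AddCommGroup N] [Module k N] {f g : WordT k A H →ₗ[k] N}
    (h : ∀ hs a, f (mono k hs a) = g (mono k hs a)) : f = g := by
  refine LinearMap.ext_on span_mono ?_
  rintro _ ⟨hs, a, rfl⟩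
  exact h hs a

theorem ext_of {N : Type u} [AddCommGroup N] [Module k N] {f g : WordT k A H →ₗ[k] N}
    (h : ∀ n w, f (of k A H n w) = g (of k A H n w)) : f = g :=
  DirectSum.linearMap_ext k fun n => LinearMap.ext fun w => h n w

/-! ### Words as elements of a product of tensor algebras -/

variable (k A H)

/-- The product of the two tensor algebras. -/
abbrev TT : Type u := TensorAlgebra k (Red k H) ⊗[k] TensorAlgebra k (Red k A)

/-- The sign `(-1)^r` on the tensor algebra. -/
def sgnT (V : Type u) [AddCommGroup V] [Module k V] : TensorAlgebra k V →ₐ[k] TensorAlgebra k V :=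
  TensorAlgebra.lift k (-(TensorAlgebra.ι k (M := V)))

/-- `h ⊗ (u ⊗ v) ↦ h u ⊗ v`. -/
def hTT : Red k H →ₗ[k] Module.End k (TT k A H) :=
  LinearMap.rTensorHom _ ∘ₗ LinearMap.mul k _ ∘ₗ TensorAlgebra.ι k

/-- Words of length `n` as tensors, with signs. -/
def toTTW : (n : ℕ) → Word k A H n →ₗ[k] TT k A H
  | 0 => TensorProduct.mk k _ _ 1 ∘ₗ TPow.toTensorAlgebra k 0
  | n + 1 => Word.lift n
      ((hTT k A H).compl₂ ((sgnT k (Red k A)).toLinearMap.lTensor _ ∘ₗ toTTW n))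
      (TensorProduct.mk k _ _ 1 ∘ₗ TPow.toTensorAlgebra k (n + 1))

/-- Words as tensors, with signs. -/
def toTT : WordT k A H →ₗ[k] TT k A H := DirectSum.toModule k ℕ _ fun n => toTTW k A H n

/-- Tensors as words, with signs. -/
def ofTT : TT k A H →ₗ[k] WordT k A H :=
  TensorProduct.lift
    ((TensorAlgebra.lift k ((LinearMap.mulRight k (sgn k A H)) ∘ₗ hR k A H)).toLinearMap.compl₂
      (DirectSum.toModule k ℕ _ (aT k A H) ∘ₗ tensorSplit k (Red k A)))

variable {k A H}

theorem sgnT_clsL {B : Type u} [Ring B] [Algebra k B] (l : List B) :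
    sgnT k (Red k B) (clsL k l) = (-1 : k) ^ l.length • clsL k l := by
  induction l with
  | nil => rw [clsL_nil, map_one, List.length_nil, pow_zero, one_smul]
  | cons b l ih =>
    rw [clsL_cons, map_mul, ih, cls_eq, sgnT, TensorAlgebra.lift_ι_apply, List.length_cons, pow_succ]
    simp

theorem sgnT_toTensorAlgebra {B : Type u} [Ring B] [Algebra k B] (n : ℕ)
    (x : TPow k (Red k B) n) : sgnT k (Red k B) (TPow.toTensorAlgebra k n x) =
      (-1 : k) ^ n • TPow.toTensorAlgebra k n x := by
  have := TPow.mem_of_list (⊥ : Submodule k (TensorAlgebra k (Red k B)))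
    ((sgnT k (Red k B)).toLinearMap ∘ₗ TPow.toTensorAlgebra k n -
      (-1 : k) ^ n • TPow.toTensorAlgebra k n) (fun l hl => by
        subst hl
        rw [Submodule.mem_bot, LinearMap.sub_apply, LinearMap.comp_apply, LinearMap.smul_apply,
          toTensorAlgebra_redL, AlgHom.toLinearMap_apply, sgnT_clsL, sub_self]) x
  rwa [Submodule.mem_bot, LinearMap.sub_apply, sub_eq_zero] at this

theorem toTT_aT (n : ℕ) (x : TPow k (Red k A) n) :
    toTT k A H (aT k A H n x) = 1 ⊗ₜ TPow.toTensorAlgebra k n x := by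
  rw [aT_apply, toTT, DirectSum.toModule_lof]
  cases n with
  | zero => rfl
  | succ n => rw [toTTW, Word.lift_ofA]; rfl

theorem toTT_hT (h : H) (w : WordT k A H) : toTT k A H (hT h w) =
    hTT k A H (red k h) ((sgnT k (Red k A)).toLinearMap.lTensor _ (toTT k A H w)) := by
  revert w
  suffices e : toTT k A H ∘ₗ hT h = hTT k A H (red k h) ∘ₗ
    (sgnT k (Red k A)).toLinearMap.lTensor _ ∘ₗ toTT k A H from fun w => LinearMap.congr_fun e w
  refine ext_of fun n w => ?_
  rw [LinearMap.comp_apply, LinearMap.comp_apply, LinearMap.comp_apply, hT_apply, hR_of, toTT,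
    DirectSum.toModule_lof, DirectSum.toModule_lof, toTTW, Word.lift_consH]
  rfl

/-- Each letter from H contributes (-1)^r on being prefixed, in total (-1)^{rs}. Words follow the
sign rule of the recursive differential, where passing a letter costs -1; the tensors of the
statement do not, and this factor translates. -/
theorem toTT_mono (hs : List H) (a : List A) : toTT k A H (mono k hs a) =
    (-1 : k) ^ (a.length * hs.length) • (clsL k hs ⊗ₜ clsL k a) := by
  induction hs with
  | nil => rw [mono, toTT_aT, toTensorAlgebra_redL, clsL_nil]; simp
  | cons h hs ih =>
    rw [mono, toTT_hT, ih, map_smul, LinearMap.lTensor_tmul, AlgHom.toLinearMap_apply, sgnT_clsL,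
      TensorProduct.tmul_smul, map_smul, map_smul, smul_smul, List.length_cons, Nat.mul_succ,
      pow_add, clsL_cons]
    rfl

theorem ofTT_clsL (hs : List H) (a : List A) : ofTT k A H (clsL k hs ⊗ₜ clsL k a) =
    (-1 : k) ^ (a.length * hs.length) • mono k hs a := by
  have h0 : ∀ u, ofTT k A H (u ⊗ₜ clsL k a) =
      TensorAlgebra.lift k ((LinearMap.mulRight k (sgn k A H)) ∘ₗ hR k A H) u (mono k [] a) := by
    intro u
    rw [ofTT, TensorProduct.lift.tmul, LinearMap.compl₂_apply, LinearMap.comp_apply,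
      tensorSplit_clsL, DirectSum.toModule_lof]
    rfl
  rw [h0]
  induction hs with
  | nil => rw [clsL_nil, map_one]; simp
  | cons h hs ih =>
    rw [clsL_cons, map_mul, Module.End.mul_apply, ih, cls_eq, TensorAlgebra.lift_ι_apply, map_smul,
      LinearMap.comp_apply, LinearMap.mulRight_apply, Module.End.mul_apply, sgn_mono, map_smul,
      smul_smul, List.length_cons, Nat.mul_succ, pow_add]
    rfl

set_option maxSynthPendingDepth 3 in
variable (k A H) in
/-- Words are tensors. -/
def equivTT : WordT k A H ≃ₗ[k] TT k A H :=
  LinearEquiv.ofLinearMap (toTT k A H) (ofTT k A H)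
    (by
      refine TensorProduct.ext ?_
      refine LinearMap.ext_on_range span_clsL fun hs => ?_
      refine LinearMap.ext_on_range span_clsL fun a => ?_
      change toTT k A H (ofTT k A H (clsL k hs ⊗ₜ clsL k a)) = clsL k hs ⊗ₜ clsL k a
      rw [ofTT_clsL, map_smul, toTT_mono, neg_one_pow_smul_smul])
    (by
      refine ext_mono fun hs a => ?_
      simp only [LinearMap.comp_apply, ofTT_clsL, map_smul, toTT_mono, neg_one_pow_smul_smul,
        LinearMap.id_apply])

theorem equivTT_apply (w : WordT k A H) : equivTT k A H w = toTT k A H w := rfl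

theorem equivTT_symm_clsL (hs : List H) (a : List A) : (equivTT k A H).symm (clsL k hs ⊗ₜ clsL k a) =
    (-1 : k) ^ (a.length * hs.length) • mono k hs a := ofTT_clsL hs a

end WordT

end TotalWords

namespace WordT

variable {k A H : Type u} [CommRing k] [Ring A] [Algebra k A] [Ring H] [Algebra k H]

/-! ### The projections on the words with a given number of letters from `H` -/

variable (k) in
/-- The projection of the tensor algebra on its part of degree `s`. -/
def prT (V : Type u) [AddCommGroup V] [Module k V] (s : ℕ) : Module.End k (TensorAlgebra k V) :=
  TPow.toTensorAlgebra k s ∘ₗ DirectSum.component k ℕ (fun n => TPow k V n) s ∘ₗ tensorSplit k V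

theorem prT_toTensorAlgebra {V : Type u} [AddCommGroup V] [Module k V] (s n : ℕ)
    (x : TPow k V n) : prT k V s (TPow.toTensorAlgebra k n x) =
      if n = s then TPow.toTensorAlgebra k n x else 0 := by
  rw [prT, LinearMap.comp_apply, LinearMap.comp_apply, tensorSplit_toTensorAlgebra]
  split_ifs with h
  · subst h
    rw [DirectSum.component.lof_self]
  · rw [DirectSum.component.of, dif_neg h, map_zero]

/-- Everything about the grading by letters from H is checked on monomials, through this test. -/
theorem prT_clsL {B : Type u} [Ring B] [Algebra k B] (s : ℕ) (l : List B) :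
    prT k (Red k B) s (clsL k l) = if l.length = s then clsL k l else 0 := by
  rw [← toTensorAlgebra_redL, prT_toTensorAlgebra]

/-- The projection on the words with `s` letters from `H`. -/
def piT (s : ℕ) : Module.End k (WordT k A H) :=
  (equivTT k A H).symm.toLinearMap ∘ₗ (prT k (Red k H) s).rTensor _ ∘ₗ (equivTT k A H).toLinearMap

theorem piT_mono (s : ℕ) (hs : List H) (a : List A) :
    piT s (mono k hs a) = if hs.length = s then mono k hs a else 0 := by
  rw [piT, LinearMap.comp_apply, LinearMap.comp_apply, LinearEquiv.coe_coe, LinearEquiv.coe_coe,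
    equivTT_apply, toTT_mono, map_smul, LinearMap.rTensor_tmul, prT_clsL]
  split_ifs with h
  · rw [map_smul, equivTT_symm_clsL, neg_one_pow_smul_smul]
  · rw [TensorProduct.zero_tmul, smul_zero, map_zero]

theorem piT_aT (s n : ℕ) (x : TPow k (Red k A) n) :
    piT s (aT k A H n x) = if s = 0 then aT k A H n x else 0 := by
  rw [piT, LinearMap.comp_apply, LinearMap.comp_apply, LinearEquiv.coe_coe, LinearEquiv.coe_coe,
    equivTT_apply, toTT_aT, LinearMap.rTensor_tmul, ← clsL_nil, prT_clsL]
  split_ifs with h1 h2 h2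
  · rw [clsL_nil, ← toTT_aT, ← equivTT_apply, LinearEquiv.symm_apply_apply]
  · exact absurd h1.symm h2
  · exact absurd h2.symm h1
  · rw [TensorProduct.zero_tmul, map_zero]

theorem piT_hT_succ (s : ℕ) (h : H) (w : WordT k A H) :
    piT (s + 1) (hT h w) = hT h (piT s w) := by
  revert w
  suffices e : piT (s + 1) ∘ₗ hT h = hT h ∘ₗ piT (k := k) (A := A) s from
    fun w => LinearMap.congr_fun e w
  refine ext_mono fun hs a => ?_
  have := piT_mono (k := k) (s + 1) (h :: hs) a
  rw [mono] at this
  rw [LinearMap.comp_apply, LinearMap.comp_apply, this, piT_mono, List.length_cons]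
  simp only [add_left_inj]
  split_ifs
  · rfl
  · rw [map_zero]

theorem piT_hT_zero (h : H) (w : WordT k A H) : piT 0 (hT h w) = 0 := by
  revert w
  suffices e : piT 0 ∘ₗ hT (k := k) (A := A) h = 0 from fun w => LinearMap.congr_fun e w
  refine ext_mono fun hs a => ?_
  have := piT_mono (k := k) 0 (h :: hs) a
  rw [mono] at this
  rw [LinearMap.comp_apply, this, if_neg (by simp), LinearMap.zero_apply]

theorem exists_sum_piT (w : WordT k A H) :
    ∃ N, ∀ N', N ≤ N' → ∑ t ∈ Finset.range N', piT t w = w := by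
  have hw : w ∈ Submodule.span k {w | ∃ (hs : List H) (a : List A), w = mono k hs a} := by
    rw [span_mono]; trivial
  induction hw using Submodule.span_induction with
  | mem w hw =>
    obtain ⟨hs, a, rfl⟩ := hw
    refine ⟨hs.length + 1, fun N' h => ?_⟩
    simp only [piT_mono]
    rw [Finset.sum_ite_eq, if_pos (Finset.mem_range.2 (by omega))]
  | zero => exact ⟨0, fun N' _ => by simp⟩
  | add x y _ _ hx hy =>
    obtain ⟨N, hN⟩ := hx
    obtain ⟨N₂, hN₂⟩ := hy
    refine ⟨max N N₂, fun N' h => ?_⟩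
    simp only [map_add]
    rw [Finset.sum_add_distrib, hN _ (by omega), hN₂ _ (by omega)]
  | smul c x _ hx =>
    obtain ⟨N, hN⟩ := hx
    refine ⟨N, fun N' h => ?_⟩
    simp only [map_smul]
    rw [← Finset.smul_sum, hN _ h]

end WordT

open WordT

namespace CrossedProduct

variable {k A H : Type u} [CommRing k] [Ring A] [Algebra k A] [Ring H] [HopfAlgebra k H]
variable (D : CrossedProduct k A H)

/-! ### The differential on words of arbitrary length -/

/-- `E ⊗ W ⊗ E` for the module `W` of all words. -/
abbrev BiT : Type u := D.E ⊗[k] (WordT k A H ⊗[k] D.E)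

/-- The inclusion of the words of length `n`. -/
def incT (n : ℕ) : D.E ⊗[k] (Word k A H n ⊗[k] D.E) →ₗ[k] D.BiT :=
  ((of k A H n).rTensor D.E).lTensor D.E

@[simp] theorem incT_tmul (n : ℕ) (e e' : D.E) (w : Word k A H n) :
    D.incT n (e ⊗ₜ (w ⊗ₜ e')) = e ⊗ₜ (of k A H n w ⊗ₜ e') := rfl

/-- Left multiplication by a letter. -/
def zT : H →ₗ[k] Module.End k (WordT k A H ⊗[k] D.E) := LinearMap.rTensorHom D.E ∘ₗ hT

@[simp] theorem zT_tmul (h : H) (w : WordT k A H) (e : D.E) : D.zT h (w ⊗ₜ e) = hT h w ⊗ₜ e := rfl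

/-- `(b # h) ⊗ z ↦ b ⊗ h z`. -/
def pushW : D.BiT →ₗ[k] D.BiT := D.incA _ ∘ₗ D.push D.zT

theorem pushW_tmul (a : A) (h : H) (z : WordT k A H ⊗[k] D.E) :
    D.pushW ((D.inA a * D.inH h) ⊗ₜ z) = D.inA a ⊗ₜ D.zT h z := by simp [pushW]

theorem pushW_inH (h : H) (z : WordT k A H ⊗[k] D.E) :
    D.pushW (D.inH h ⊗ₜ z) = 1 ⊗ₜ D.zT h z := by simp [pushW, inA_one]

theorem pushW_incT (n : ℕ) (y : D.E ⊗[k] (Word k A H n ⊗[k] D.E)) :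
    D.pushW (D.incT n y) = D.incT (n + 1) (D.pushP n y) := by
  induction y using ET_induction with
  | h0 a h z =>
    induction z using TensorProduct.induction_on with
    | zero => simp
    | add x y hx hy => simp only [TensorProduct.tmul_add, map_add, hx, hy]
    | tmul w e =>
      rw [incT_tmul, pushW_tmul, pushP_tmul, zT_tmul, wZ_tmul, incT_tmul, hT_apply, hR_of, wH_apply]
  | hadd x y hx hy => simp only [map_add, hx, hy]

theorem incT_lMul (n : ℕ) (e : D.E) (y : D.E ⊗[k] (Word k A H n ⊗[k] D.E)) :
    D.incT n (lMul k _ e y) = lMul k _ e (D.incT n y) := (lMul_lTensor _ _ _).symm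

theorem incT_rMul (n : ℕ) (e : D.E) (y : D.E ⊗[k] (Word k A H n ⊗[k] D.E)) :
    D.incT n ((rMul k _ e).lTensor D.E y) = (rMul k _ e).lTensor D.E (D.incT n y) := by
  induction y using bi_induction with
  | h0 e w e' => simp
  | hadd x y hx hy => simp only [map_add, hx, hy]

theorem pushW_rMul (e : D.E) (x : D.BiT) :
    D.pushW ((rMul k _ e).lTensor _ x) = (rMul k _ e).lTensor _ (D.pushW x) := by
  rw [pushW, LinearMap.comp_apply, D.push_lTensor (r' := rMul k _ e) (fun h z => ?_), incA_lTensor,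
    LinearMap.comp_apply]
  exact (rMul_rTensor _ _ _).symm

/-- The differential. -/
def bdT : WordT k A H →ₗ[k] D.BiT :=
  DirectSum.toModule k ℕ _ fun n => match n with
    | 0 => 0
    | n + 1 => D.incT n ∘ₗ D.bd n

theorem bdT_of_zero (w : Word k A H 0) : D.bdT (of k A H 0 w) = 0 := by
  rw [bdT, DirectSum.toModule_lof]
  rfl

theorem bdT_of_succ (n : ℕ) (w : Word k A H (n + 1)) :
    D.bdT (of k A H (n + 1) w) = D.incT n (D.bd n w) := by
  rw [bdT, DirectSum.toModule_lof]
  rfl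

theorem biExt_bdT_incT (n : ℕ) (y : D.E ⊗[k] (Word k A H (n + 1) ⊗[k] D.E)) :
    biExt D.bdT (D.incT (n + 1) y) = D.incT n (biExt (D.bd n) y) := by
  induction y using bi_induction with
  | h0 e w e' => rw [incT_tmul, biExt_tmul, biExt_tmul, bdT_of_succ, incT_lMul, incT_rMul]
  | hadd x y hx hy => simp only [map_add, hx, hy]

theorem biExt_bdT_incT_zero (y : D.E ⊗[k] (Word k A H 0 ⊗[k] D.E)) :
    biExt D.bdT (D.incT 0 y) = 0 := by
  induction y using bi_induction with
  | h0 e w e' => rw [incT_tmul, biExt_tmul, bdT_of_zero]; simp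
  | hadd x y hx hy => simp only [map_add, hx, hy, add_zero]

theorem biExt_bd_bd (n : ℕ) (w : Word k A H (n + 2)) : biExt (D.bd n) (D.bd (n + 1) w) = 0 := by
  have h1 := D.bdE_bdZ n (w ⊗ₜ 1)
  have h2 : D.bdZ (n + 1) (w ⊗ₜ 1) = D.bd (n + 1) w := by
    rw [← biExt_one (D.bd (n + 1)) w, biExt, leftExt_tmul, lMul_one, bdZ]
  rwa [h2] at h1

theorem biExt_bdT_bdT (w : WordT k A H) : biExt D.bdT (D.bdT w) = 0 := by
  revert w
  suffices e : biExt D.bdT ∘ₗ D.bdT = 0 from fun w => LinearMap.congr_fun e w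
  refine ext_of fun n w => ?_
  rw [LinearMap.comp_apply, LinearMap.zero_apply]
  match n, w with
  | 0, w => rw [bdT_of_zero, map_zero]
  | 1, w => rw [bdT_of_succ, biExt_bdT_incT_zero]
  | n + 2, w => rw [bdT_of_succ, biExt_bdT_incT, biExt_bd_bd, map_zero]

/-- The inclusion of `A ⊗ Ā^{⊗ n} ⊗ E`. -/
def incKT (n : ℕ) : A ⊗[k] (TPow k (Red k A) n ⊗[k] D.E) →ₗ[k] D.BiT :=
  D.incA _ ∘ₗ ((aT k A H n).rTensor D.E).lTensor A

@[simp] theorem incKT_tmul (n : ℕ) (a : A) (x : TPow k (Red k A) n) (e : D.E) :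
    D.incKT n (a ⊗ₜ (x ⊗ₜ e)) = D.inA a ⊗ₜ (aT k A H n x ⊗ₜ e) := rfl

theorem incT_incK (n : ℕ) (y : A ⊗[k] (TPow k (Red k A) n ⊗[k] D.E)) :
    D.incT n (D.incK n y) = D.incKT n y := by
  induction y using TensorProduct.induction_on with
  | zero => simp
  | add x y hx hy => simp only [map_add, hx, hy]
  | tmul a z =>
    induction z using TensorProduct.induction_on with
    | zero => simp
    | add x y hx hy => simp only [TensorProduct.tmul_add, map_add, hx, hy]
    | tmul x e => rfl

theorem bdT_aT_zero (x : TPow k (Red k A) 0) : D.bdT (aT k A H 0 x) = 0 := D.bdT_of_zero _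

theorem bdT_aT_succ (n : ℕ) (x : TPow k (Red k A) (n + 1)) :
    D.bdT (aT k A H (n + 1) x) = D.incKT n (D.delta n x) := by
  rw [aT_apply, bdT_of_succ, bd_ofA, incT_incK]

theorem bdT_mono_nil_nil : D.bdT (mono k [] []) = 0 := D.bdT_aT_zero _

theorem bdT_mono_nil_cons (a : A) (as : List A) : D.bdT (mono k [] (a :: as)) =
    D.incKT as.length (D.delta as.length (redL k (a :: as))) := D.bdT_aT_succ _ _

/-- The last term of the differential of `h w`. -/
def tailT : H →ₗ[k] WordT k A H →ₗ[k] WordT k A H ⊗[k] D.E :=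
  (DirectSum.toModule k ℕ _ fun n => (((D.theta n).compl₂
    ((TensorProduct.mk k _ D.E).flip 1)).compr₂ ((aT k A H n).rTensor D.E)).flip).flip

theorem tailT_of (h : H) (n : ℕ) (w : Word k A H n) :
    D.tailT h (of k A H n w) = (aT k A H n).rTensor D.E (D.theta n h (w ⊗ₜ 1)) := by
  rw [tailT, LinearMap.flip_apply, DirectSum.toModule_lof]
  rfl

/-- The one recursion used from now on. On words of length 0 the differential is set to zero, so the
middle term drops out and the formulas of both degrees merge into one. -/
theorem bdT_hT (h : H) (w : WordT k A H) : D.bdT (hT h w) =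
    D.inH h ⊗ₜ (w ⊗ₜ 1) - D.pushW (lMul k _ (D.inH h) (D.bdT w)) + 1 ⊗ₜ D.tailT h w := by
  have h1 : ∀ n (z : TPow k (Red k A) n ⊗[k] D.E), D.incT n (1 ⊗ₜ D.ofK n z) =
      1 ⊗ₜ (aT k A H n).rTensor D.E z := by
    intro n z
    induction z using TensorProduct.induction_on with
    | zero => simp
    | add x y hx hy => simp only [TensorProduct.tmul_add, map_add, hx, hy]
    | tmul x e => rfl
  revert w
  suffices e : D.bdT ∘ₗ hT h = TensorProduct.mk k D.E _ (D.inH h) ∘ₗ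
      (TensorProduct.mk k _ D.E).flip 1 - D.pushW ∘ₗ lMul k _ (D.inH h) ∘ₗ D.bdT +
      TensorProduct.mk k D.E _ 1 ∘ₗ D.tailT h from fun w => LinearMap.congr_fun e w
  refine ext_of fun n w => ?_
  change D.bdT (hT h (of k A H n w)) = D.inH h ⊗ₜ (of k A H n w ⊗ₜ 1) -
    D.pushW (lMul k _ (D.inH h) (D.bdT (of k A H n w))) + 1 ⊗ₜ D.tailT h (of k A H n w)
  rw [hT_apply, hR_of, bdT_of_succ, tailT_of, ← h1, ← wH_apply]
  cases n with
  | zero =>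
    rw [bd_zero, map_add, incT_tmul, bdT_of_zero]
    simp
  | succ n => rw [bd_succ, map_add, map_sub, incT_tmul, bdT_of_succ, ← incT_lMul, pushW_incT]

/-- The projection on the words with `s` letters from `H`. -/
def piB (s : ℕ) : D.BiT →ₗ[k] D.BiT := ((piT s).rTensor D.E).lTensor D.E

@[simp] theorem piB_tmul (s : ℕ) (e e' : D.E) (w : WordT k A H) :
    D.piB s (e ⊗ₜ (w ⊗ₜ e')) = e ⊗ₜ (piT s w ⊗ₜ e') := rfl

theorem piB_lMul (s : ℕ) (e : D.E) (y : D.BiT) :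
    D.piB s (lMul k _ e y) = lMul k _ e (D.piB s y) := (lMul_lTensor _ _ _).symm

theorem piB_rMul (s : ℕ) (e : D.E) (y : D.BiT) :
    D.piB s ((rMul k _ e).lTensor D.E y) = (rMul k _ e).lTensor D.E (D.piB s y) := by
  induction y using bi_induction with
  | h0 e w e' => simp
  | hadd x y hx hy => simp only [map_add, hx, hy]

theorem piB_pushW_succ (s : ℕ) (y : D.BiT) : D.piB (s + 1) (D.pushW y) = D.pushW (D.piB s y) := by
  induction y using ET_induction with
  | h0 a h z =>
    induction z using TensorProduct.induction_on with
    | zero => simp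
    | add x y hx hy => simp only [TensorProduct.tmul_add, map_add, hx, hy]
    | tmul w e => rw [piB_tmul, pushW_tmul, pushW_tmul, zT_tmul, zT_tmul, piB_tmul, piT_hT_succ]
  | hadd x y hx hy => simp only [map_add, hx, hy]

theorem piB_pushW_zero (y : D.BiT) : D.piB 0 (D.pushW y) = 0 := by
  induction y using ET_induction with
  | h0 a h z =>
    induction z using TensorProduct.induction_on with
    | zero => simp
    | add x y hx hy => simp only [TensorProduct.tmul_add, map_add, hx, hy, add_zero]
    | tmul w e => rw [pushW_tmul, zT_tmul, piB_tmul, piT_hT_zero]; simp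
  | hadd x y hx hy => simp only [map_add, hx, hy, add_zero]

theorem piB_incKT (s n : ℕ) (y : A ⊗[k] (TPow k (Red k A) n ⊗[k] D.E)) :
    D.piB s (D.incKT n y) = if s = 0 then D.incKT n y else 0 := by
  induction y using TensorProduct.induction_on with
  | zero => simp
  | add x y hx hy => simp only [map_add, hx, hy]; split_ifs <;> simp
  | tmul a z =>
    induction z using TensorProduct.induction_on with
    | zero => simp
    | add x y hx hy => simp only [TensorProduct.tmul_add, map_add, hx, hy]; split_ifs <;> simp
    | tmul x e => rw [incKT_tmul, piB_tmul, piT_aT]; split_ifs <;> simp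

theorem piB_tailT (s : ℕ) (h : H) (w : WordT k A H) :
    D.piB s (1 ⊗ₜ D.tailT h w) = if s = 0 then 1 ⊗ₜ D.tailT h w else 0 := by
  have h1 : ∀ n (z : TPow k (Red k A) n ⊗[k] D.E),
      D.incKT n (1 ⊗ₜ z) = 1 ⊗ₜ (aT k A H n).rTensor D.E z := by
    intro n z
    rw [incKT, LinearMap.comp_apply, LinearMap.lTensor_tmul, incA_tmul, inA_one]
  induction w using DirectSum.induction_on with
  | zero => simp
  | add x y hx hy => simp only [TensorProduct.tmul_add, map_add, hx, hy]; split_ifs <;> simp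
  | of n w =>
    change D.piB s (1 ⊗ₜ D.tailT h (of k A H n w)) =
      if s = 0 then 1 ⊗ₜ D.tailT h (of k A H n w) else 0
    rw [tailT_of, ← h1, piB_incKT]

theorem exists_sum_piB (y : D.BiT) :
    ∃ N, ∀ N', N ≤ N' → ∑ t ∈ Finset.range N', D.piB t y = y := by
  induction y using bi_induction with
  | h0 e w e' =>
    obtain ⟨N, hN⟩ := exists_sum_piT w
    refine ⟨N, fun N' h => ?_⟩
    simp only [piB_tmul]
    rw [← TensorProduct.tmul_sum, ← TensorProduct.sum_tmul, hN _ h]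
  | hadd x y hx hy =>
    obtain ⟨N, hN⟩ := hx
    obtain ⟨N₂, hN₂⟩ := hy
    refine ⟨max N N₂, fun N' h => ?_⟩
    simp only [map_add]
    rw [Finset.sum_add_distrib, hN _ (by omega), hN₂ _ (by omega)]

theorem sum_piB {s : ℕ} {y : D.BiT} (h : ∀ v, s < v → D.piB v y = 0) :
    ∑ t ∈ Finset.range (s + 1), D.piB t y = y := by
  obtain ⟨N, hN⟩ := D.exists_sum_piB y
  rw [← hN (max N (s + 1)) (le_max_left _ _)]
  have : Finset.range (s + 1) ⊆ Finset.range (max N (s + 1)) := by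
    intro t ht
    rw [Finset.mem_range] at ht ⊢
    omega
  rw [hN _ (le_max_left _ _), Finset.sum_subset this, hN _ (le_max_left _ _)]
  intro t _ ht
  exact h t (by rw [Finset.mem_range] at ht; omega)

/-- The differential never increases the number of letters from H: h ⊗ w has one fewer, P puts back
the letter taken from the coefficient, and Θ has none. -/
theorem piB_bdT_of_lt (hs : List H) (a : List A) (v : ℕ) (hv : hs.length < v) :
    D.piB v (D.bdT (mono k hs a)) = 0 := by
  induction hs generalizing v with
  | nil =>
    rw [List.length_nil] at hv
    cases a with
    | nil => rw [bdT_mono_nil_nil, map_zero]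
    | cons a₁ as => rw [bdT_mono_nil_cons, piB_incKT, if_neg (by omega)]
  | cons h hs ih =>
    rw [List.length_cons] at hv
    obtain ⟨v, rfl⟩ : ∃ v', v = v' + 1 := ⟨v - 1, by omega⟩
    rw [mono, bdT_hT, map_add, map_sub, piB_tmul, piT_mono, if_neg (by omega), piB_pushW_succ,
      piB_lMul, ih _ (by omega), piB_tailT, if_neg (by omega)]
    simp

theorem sum_piB_bdT (hs : List H) (a : List A) :
    ∑ t ∈ Finset.range (hs.length + 1), D.piB t (D.bdT (mono k hs a)) = D.bdT (mono k hs a) :=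
  D.sum_piB (D.piB_bdT_of_lt hs a)

/-- The part of the differential lowering the number of letters from `H` by `l`. -/
def bdL (l : ℕ) : WordT k A H →ₗ[k] D.BiT :=
  DirectSum.toModule k ℕ _ fun n => ∑ s ∈ Finset.range (n + 1),
    if l ≤ s then D.piB (s - l) ∘ₗ D.bdT ∘ₗ piT s ∘ₗ of k A H n else 0

theorem bdL_mono (l : ℕ) (hs : List H) (a : List A) : D.bdL l (mono k hs a) =
    if l ≤ hs.length then D.piB (hs.length - l) (D.bdT (mono k hs a)) else 0 := by
  rw [← of_monoG, bdL, DirectSum.toModule_lof, LinearMap.sum_apply, Finset.sum_eq_single hs.length]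
  · split_ifs with h
    · simp only [LinearMap.comp_apply]
      rw [of_monoG, piT_mono, if_pos rfl]
    · rfl
  · intro s _ hs'
    split_ifs with h
    · simp only [LinearMap.comp_apply]
      rw [of_monoG, piT_mono, if_neg (Ne.symm hs'), map_zero, map_zero]
    · rfl
  · intro h
    exact absurd (Finset.mem_range.2 (by omega)) h

theorem bi_induction_mono {p : D.BiT → Prop}
    (h0 : ∀ e (hs : List H) (a : List A) e', p (e ⊗ₜ (mono k hs a ⊗ₜ e')))
    (hadd : ∀ x y, p x → p y → p (x + y)) (y : D.BiT) : p y := by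
  induction y using bi_induction with
  | hadd x y hx hy => exact hadd _ _ hx hy
  | h0 e w e' =>
    have hw : w ∈ Submodule.span k {w | ∃ (hs : List H) (a : List A), w = mono k hs a} := by
      rw [span_mono]; trivial
    revert e
    induction hw using Submodule.span_induction with
    | mem w hw =>
      obtain ⟨hs, a, rfl⟩ := hw
      exact fun e => h0 e hs a e'
    | zero =>
      intro e
      have := h0 0 [] [] 0
      rwa [TensorProduct.zero_tmul, ← TensorProduct.tmul_zero _ e,
        ← TensorProduct.zero_tmul _ e'] at this
    | add x y _ _ hx hy =>
      intro e
      rw [TensorProduct.add_tmul, TensorProduct.tmul_add]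
      exact hadd _ _ (hx e) (hy e)
    | smul c x _ hx =>
      intro e
      rw [← TensorProduct.smul_tmul', ← TensorProduct.smul_tmul]
      exact hx _

/-- On the part with t letters from H, the component d^l is the full differential followed by
projection to t - l letters. The condition l ≤ t is needed because natural subtraction would
otherwise give a wrong component. -/
theorem biExt_bdL_piB (l t : ℕ) (y : D.BiT) : biExt (D.bdL l) (D.piB t y) =
    if l ≤ t then D.piB (t - l) (biExt D.bdT (D.piB t y)) else 0 := by
  induction y using bi_induction_mono with
  | h0 e hs a e' =>
    rw [piB_tmul, piT_mono]
    split_ifs with h1 h2 h2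
    · rw [biExt_tmul, biExt_tmul, bdL_mono, piB_lMul, piB_rMul, h1, if_pos h2]
    · rw [biExt_tmul, bdL_mono, h1, if_neg h2]; simp
    · simp
    · simp
  | hadd x y hx hy => simp only [map_add, hx, hy]; split_ifs <;> simp

theorem piB_biExt_bdT_piB {v t : ℕ} (h : t < v) (y : D.BiT) :
    D.piB v (biExt D.bdT (D.piB t y)) = 0 := by
  induction y using bi_induction_mono with
  | h0 e hs a e' =>
    rw [piB_tmul, piT_mono]
    split_ifs with h1
    · rw [biExt_tmul, piB_lMul, piB_rMul, piB_bdT_of_lt _ _ _ _ (by omega)]; simp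
    · simp
  | hadd x y hx hy => simp only [map_add, hx, hy, add_zero]

/-- The component of ∂² = 0 that loses l letters from H. Terms with j > l may be added freely, since
no letters from H can be regained. -/
theorem sum_bdL_bdL (l : ℕ) (hs : List H) (a : List A) (hl : l ≤ hs.length) :
    ∑ j ∈ Finset.range (l + 1), biExt (D.bdL (l - j)) (D.bdL j (mono k hs a)) = 0 := by
  have h1 : ∀ j ∈ Finset.range (l + 1), biExt (D.bdL (l - j)) (D.bdL j (mono k hs a)) =
      D.piB (hs.length - l) (biExt D.bdT (D.piB (hs.length - j) (D.bdT (mono k hs a)))) := by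
    intro j hj
    rw [Finset.mem_range] at hj
    rw [bdL_mono, if_pos (by omega), biExt_bdL_piB, if_pos (by omega)]
    congr 2
    omega
  have h2 : ∀ j ∈ Finset.range (hs.length + 1), j ∉ Finset.range (l + 1) →
      D.piB (hs.length - l) (biExt D.bdT (D.piB (hs.length - j) (D.bdT (mono k hs a)))) = 0 := by
    intro j hj1 hj2
    rw [Finset.mem_range] at hj1 hj2
    exact D.piB_biExt_bdT_piB (by omega) _
  have h3 : Finset.range (l + 1) ⊆ Finset.range (hs.length + 1) := by
    intro j hj
    rw [Finset.mem_range] at hj ⊢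
    omega
  rw [Finset.sum_congr rfl h1, Finset.sum_subset h3 h2, ← map_sum, ← map_sum]
  -- Reindexes by the number of remaining rather than of lost letters, to recognise the sum of all
  -- components of ∂.
  have h4 := Finset.sum_range_reflect (fun j => D.piB j (D.bdT (mono k hs a))) (hs.length + 1)
  simp only [Nat.add_sub_cancel] at h4
  rw [h4, sum_piB_bdT, biExt_bdT_bdT, map_zero]

theorem sum_bdL (N : ℕ) (hs : List H) (a : List A) (hN : hs.length < N) :
    ∑ l ∈ Finset.range N, D.bdL l (mono k hs a) = D.bdT (mono k hs a) := by
  have h3 : Finset.range (hs.length + 1) ⊆ Finset.range N := by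
    intro j hj
    rw [Finset.mem_range] at hj ⊢
    omega
  rw [← Finset.sum_subset h3]
  · have h4 := Finset.sum_range_reflect (fun j => D.piB j (D.bdT (mono k hs a))) (hs.length + 1)
    simp only [Nat.add_sub_cancel] at h4
    rw [← D.sum_piB_bdT hs a, ← h4]
    refine Finset.sum_congr rfl fun l hl => ?_
    rw [Finset.mem_range] at hl
    rw [bdL_mono, if_pos (by omega)]
  · intro l _ hl
    rw [Finset.mem_range] at hl
    rw [bdL_mono, if_neg (by omega)]

end CrossedProduct

theorem toTensorAlgebra_snoc {k V : Type u} [CommRing k] [AddCommGroup V] [Module k V] (n : ℕ)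
    (x : TPow k V n) (v : V) : TPow.toTensorAlgebra k (n + 1) (TPow.snoc k n x v) =
      TPow.toTensorAlgebra k n x * TensorAlgebra.ι k v := by
  induction n with
  | zero =>
    rw [TPow.zero_eq_smul x, map_smul, map_smul, LinearMap.smul_apply, map_smul,
      toTensorAlgebra_nil]
    have : TPow.snoc k 0 (TPow.nil k) v = TPow.cons k 0 v (TPow.nil k) := rfl
    rw [this, toTensorAlgebra_cons, toTensorAlgebra_nil]
    simp
  | succ n ih =>
    revert x
    suffices h : TPow.toTensorAlgebra k (n + 2) ∘ₗ (TPow.snoc k (n + 1)).flip v =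
      LinearMap.mulRight k (TensorAlgebra.ι k v) ∘ₗ TPow.toTensorAlgebra k (n + 1) from
      fun x => LinearMap.congr_fun h x
    refine TPow.ext_succ fun u x => ?_
    rw [LinearMap.comp_apply, LinearMap.comp_apply, LinearMap.flip_apply, TPow.snoc_cons,
      toTensorAlgebra_cons, ih, toTensorAlgebra_cons, LinearMap.mulRight_apply, mul_assoc]

namespace CrossedProduct

variable {k A H : Type u} [CommRing k] [Ring A] [Algebra k A] [Ring H] [HopfAlgebra k H]
variable (D : CrossedProduct k A H)

/-! ### The operator `σ` -/

/-- `W ⊗ E` as a product of tensor algebras. -/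
def zEquiv : WordT k A H ⊗[k] D.E ≃ₗ[k]
    TensorAlgebra k (Red k H) ⊗[k] (TensorAlgebra k (Red k A) ⊗[k] D.E) :=
  TensorProduct.congr (equivTT k A H) (LinearEquiv.refl k D.E) ≪≫ₗ TensorProduct.assoc k _ _ _

/-- `E ⊗ W ⊗ E` as a product of tensor algebras. -/
def totEquiv : D.BiT ≃ₗ[k] D.ResTot := TensorProduct.congr (LinearEquiv.refl k D.E) D.zEquiv

theorem totEquiv_tmul (e : D.E) (z : WordT k A H ⊗[k] D.E) :
    D.totEquiv (e ⊗ₜ z) = e ⊗ₜ D.zEquiv z := rfl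

theorem zEquiv_tmul (w : WordT k A H) (e : D.E) :
    D.zEquiv (w ⊗ₜ e) = TensorProduct.assoc k _ _ _ (toTT k A H w ⊗ₜ e) := rfl

theorem zEquiv_mono (hs : List H) (a : List A) (e : D.E) : D.zEquiv (mono k hs a ⊗ₜ e) =
    (-1 : k) ^ (a.length * hs.length) • (clsL k hs ⊗ₜ (clsL k a ⊗ₜ e)) := by
  rw [zEquiv_tmul, toTT_mono, ← TensorProduct.smul_tmul', map_smul, TensorProduct.assoc_tmul]

theorem totEquiv_mono (hs : List H) (a : List A) (e e' : D.E) :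
    D.totEquiv (e ⊗ₜ (mono k hs a ⊗ₜ e')) =
      (-1 : k) ^ (a.length * hs.length) • (e ⊗ₜ (clsL k hs ⊗ₜ (clsL k a ⊗ₜ e'))) := by
  rw [totEquiv_tmul, zEquiv_mono, TensorProduct.tmul_smul]

theorem totEquiv_symm_clsL (hs : List H) (a : List A) (e e' : D.E) :
    D.totEquiv.symm (e ⊗ₜ (clsL k hs ⊗ₜ (clsL k a ⊗ₜ e'))) =
      (-1 : k) ^ (a.length * hs.length) • (e ⊗ₜ (mono k hs a ⊗ₜ e')) := by
  rw [LinearEquiv.symm_apply_eq, map_smul, totEquiv_mono, neg_one_pow_smul_smul]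

/-- The operator `σ` on `T(Ā) ⊗ E`. -/
def sigTA : TensorAlgebra k (Red k A) ⊗[k] D.E →ₗ[k] TensorAlgebra k (Red k A) ⊗[k] D.E :=
  TensorProduct.map
      (LinearMap.mul' k _ ∘ₗ TensorProduct.map (-(sgnT k (Red k A)).toLinearMap) (cls k A))
      D.inH ∘ₗ
    (TensorProduct.assoc k (TensorAlgebra k (Red k A)) A H).symm.toLinearMap ∘ₗ
    D.toTensor.toLinearMap.lTensor _

theorem sigTA_tmul (v : TensorAlgebra k (Red k A)) (b : A) (m : H) :
    D.sigTA (v ⊗ₜ (D.inA b * D.inH m)) = -((sgnT k (Red k A) v * cls k A b) ⊗ₜ D.inH m) := by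
  simp [sigTA, toTensor_inA_mul_inH, TensorProduct.neg_tmul]

theorem sigTA_inH (v : TensorAlgebra k (Red k A)) (m : H) : D.sigTA (v ⊗ₜ D.inH m) = 0 := by
  have := D.sigTA_tmul v 1 m
  rw [inA_one, one_mul, cls_eq, red_one] at this
  rw [this]
  simp

/-- The operator `σ` on `W ⊗ E`. -/
def sigZ : Module.End k (WordT k A H ⊗[k] D.E) :=
  D.zEquiv.symm.toLinearMap ∘ₗ D.sigTA.lTensor _ ∘ₗ D.zEquiv.toLinearMap

theorem sigmaX_totEquiv (y : D.BiT) :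
    D.sigmaX (D.totEquiv y) = D.totEquiv (D.sigZ.lTensor D.E y) := by
  have h : D.sigmaX = (D.sigTA.lTensor (TensorAlgebra k (Red k H))).lTensor D.E := rfl
  rw [h]
  induction y using TensorProduct.induction_on with
  | zero => simp
  | add x y hx hy => simp only [map_add, hx, hy]
  | tmul e z => simp [totEquiv_tmul, sigZ]

set_option maxSynthPendingDepth 3 in
-- The sign (-1)^{r+1} of σ, corrected by (-1)^{rs} before and (-1)^{(r+1)s} after, becomes
-- (-1)^{r+s+1}. It depends on the total length alone, which is why σ anticommutes with prefixing
-- any letter.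
theorem sigZ_mono (hs : List H) (a : List A) (b : A) (m : H) :
    D.sigZ (mono k hs a ⊗ₜ (D.inA b * D.inH m)) =
      (-1 : k) ^ (a.length + hs.length + 1) • (mono k hs (a ++ [b]) ⊗ₜ D.inH m) := by
  have h1 : clsL k (a ++ [b]) = clsL k a * cls k A b := by
    rw [clsL_append, clsL_cons, clsL_nil, mul_one]
  rw [sigZ, LinearMap.comp_apply, LinearMap.comp_apply, LinearEquiv.coe_coe, LinearEquiv.coe_coe,
    LinearEquiv.symm_apply_eq, map_smul, zEquiv_mono, zEquiv_mono, map_smul,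
    LinearMap.lTensor_tmul, sigTA_tmul, sgnT_clsL, smul_mul_assoc, ← h1, ← TensorProduct.smul_tmul',
    ← neg_smul, TensorProduct.tmul_smul, smul_smul, smul_smul]
  congr 1
  rw [List.length_append, List.length_singleton, add_mul, one_mul, pow_add, pow_add _ _ 1, pow_add,
    pow_one]
  have h2 := neg_one_pow_smul_smul (k := k) hs.length (1 : k)
  rw [smul_smul, smul_eq_mul, mul_one] at h2
  linear_combination ((-1) ^ (a.length * hs.length) * (-1) ^ a.length) * h2

variable {D} in
theorem z_induction_mono {p : WordT k A H ⊗[k] D.E → Prop}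
    (h0 : ∀ (hs : List H) (a : List A) b m, p (mono k hs a ⊗ₜ (D.inA b * D.inH m)))
    (hadd : ∀ x y, p x → p y → p (x + y)) (z : WordT k A H ⊗[k] D.E) : p z := by
  have hz : p 0 := by simpa using h0 [] [] 0 0
  induction z using TensorProduct.induction_on with
  | zero => exact hz
  | add x y hx hy => exact hadd _ _ hx hy
  | tmul w e =>
    have hw : w ∈ Submodule.span k {w | ∃ (hs : List H) (a : List A), w = mono k hs a} := by
      rw [span_mono]; trivial
    revert e
    induction hw using Submodule.span_induction with
    | mem w hw =>
      obtain ⟨hs, a, rfl⟩ := hw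
      intro e
      induction e using E_induction with
      | h0 b m => exact h0 hs a b m
      | hadd x y hx hy => rw [TensorProduct.tmul_add]; exact hadd _ _ hx hy
    | zero => intro e; rwa [TensorProduct.zero_tmul]
    | add x y _ _ hx hy =>
      intro e
      rw [TensorProduct.add_tmul]
      exact hadd _ _ (hx e) (hy e)
    | smul c x _ hx =>
      intro e
      rw [TensorProduct.smul_tmul]
      exact hx _

set_option maxSynthPendingDepth 3 in
theorem sigZ_zT (h : H) (z : WordT k A H ⊗[k] D.E) : D.sigZ (D.zT h z) = -D.zT h (D.sigZ z) := by
  induction z using z_induction_mono with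
  | h0 hs a b m =>
    have := D.sigZ_mono (h :: hs) a b m
    rw [mono] at this
    rw [zT_tmul, this, sigZ_mono, map_smul, zT_tmul, List.length_cons, ← add_assoc, pow_succ,
      mul_neg_one, neg_smul]
    rfl
  | hadd x y hx hy => simp only [map_add, hx, hy, neg_add]

set_option maxSynthPendingDepth 3 in
-- The letter that σ would append is the class of 1 in Ā.
theorem sigZ_inH (w : WordT k A H) (m : H) : D.sigZ (w ⊗ₜ D.inH m) = 0 := by
  rw [sigZ, LinearMap.comp_apply, LinearMap.comp_apply, LinearEquiv.coe_coe, LinearEquiv.coe_coe,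
    zEquiv_tmul]
  generalize toTT k A H w = t
  induction t using TensorProduct.induction_on with
  | zero => simp
  | add x y hx hy => simp only [TensorProduct.add_tmul, map_add, hx, hy, add_zero]
  | tmul u v =>
    rw [TensorProduct.assoc_tmul, LinearMap.lTensor_tmul, sigTA_inH, TensorProduct.tmul_zero,
      map_zero]

/-- The operator `σ` on `Ā^{⊗ n} ⊗ E`. -/
def sigK (n : ℕ) : TPow k (Red k A) n ⊗[k] D.E →ₗ[k] TPow k (Red k A) (n + 1) ⊗[k] D.E :=
  (-1 : k) ^ (n + 1) • (TensorProduct.map (TensorProduct.lift ((TPow.snoc k n).compl₂ (red k)))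
    D.inH ∘ₗ (TensorProduct.assoc k (TPow k (Red k A) n) A H).symm.toLinearMap ∘ₗ
    D.toTensor.toLinearMap.lTensor _)

theorem sigK_tmul (n : ℕ) (x : TPow k (Red k A) n) (b : A) (m : H) :
    D.sigK n (x ⊗ₜ (D.inA b * D.inH m)) =
      (-1 : k) ^ (n + 1) • (TPow.snoc k n x (red k b) ⊗ₜ D.inH m) := by
  simp [sigK, toTensor_inA_mul_inH]

variable {D} in
theorem tmulE_induction {V : Type u} [AddCommGroup V] [Module k V] {p : V ⊗[k] D.E → Prop}
    (h0 : ∀ v b m, p (v ⊗ₜ (D.inA b * D.inH m)))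
    (hadd : ∀ x y, p x → p y → p (x + y)) (z : V ⊗[k] D.E) : p z := by
  induction z using TensorProduct.induction_on with
  | zero => simpa using h0 0 0 0
  | add x y hx hy => exact hadd _ _ hx hy
  | tmul w e =>
    induction e using E_induction with
    | h0 b m => exact h0 w b m
    | hadd x y hx hy => rw [TensorProduct.tmul_add]; exact hadd _ _ hx hy

set_option maxSynthPendingDepth 3 in
theorem sigZ_aT (n : ℕ) (z : TPow k (Red k A) n ⊗[k] D.E) :
    D.sigZ ((aT k A H n).rTensor D.E z) = (aT k A H (n + 1)).rTensor D.E (D.sigK n z) := by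
  induction z using tmulE_induction with
  | h0 x b m =>
    rw [LinearMap.rTensor_tmul, sigK_tmul, sigZ, LinearMap.comp_apply, LinearMap.comp_apply,
      LinearEquiv.coe_coe, LinearEquiv.coe_coe, LinearEquiv.symm_apply_eq, zEquiv_tmul, toTT_aT,
      map_smul, map_smul, LinearMap.rTensor_tmul, zEquiv_tmul, toTT_aT, TensorProduct.assoc_tmul,
      TensorProduct.assoc_tmul, LinearMap.lTensor_tmul, sigTA_tmul, sgnT_toTensorAlgebra,
      toTensorAlgebra_snoc, smul_mul_assoc, ← TensorProduct.smul_tmul', ← neg_smul,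
      TensorProduct.tmul_smul, pow_succ, mul_neg_one, cls_eq]
  | hadd x y hx hy => simp only [map_add, hx, hy]

theorem sigK_consK (n : ℕ) (a : Red k A) (z : TPow k (Red k A) n ⊗[k] D.E) :
    D.sigK (n + 1) (D.consK n a z) = -D.consK (n + 1) a (D.sigK n z) := by
  induction z using tmulE_induction with
  | h0 x b m =>
    rw [consK_tmul, sigK_tmul, sigK_tmul, TPow.snoc_cons, map_smul, consK_tmul, pow_succ,
      mul_neg_one, neg_smul]
  | hadd x y hx hy => simp only [map_add, hx, hy, neg_add]

theorem deltaK_consK_zero (a : A) (z : TPow k (Red k A) 0 ⊗[k] D.E) :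
    D.deltaK 0 (D.consK 0 (red k a) z) = a ⊗ₜ z - D.augK (a ⊗ₜ z) := D.deltaK_consA_zero (a ⊗ₜ z)

theorem deltaK_consK_succ (n : ℕ) (a : A) (z : TPow k (Red k A) (n + 1) ⊗[k] D.E) :
    D.deltaK (n + 1) (D.consK (n + 1) (red k a) z) =
      a ⊗ₜ z - D.kappa n (lMul k _ a (D.deltaK n z)) := D.deltaK_consA_succ n (a ⊗ₜ z)

theorem sigK_kappa (n : ℕ) (y : A ⊗[k] (TPow k (Red k A) n ⊗[k] D.E)) :
    (D.sigK (n + 1)).lTensor A (D.kappa n y) = -D.kappa (n + 1) ((D.sigK n).lTensor A y) := by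
  rw [kappa_apply, LinearMap.lTensor_tmul, kappa_apply, ← TensorProduct.tmul_neg]
  congr 1
  induction y using TensorProduct.induction_on with
  | zero => simp
  | add x y hx hy => simp only [map_add, hx, hy, neg_add]
  | tmul a z => rw [consA_tmul, sigK_consK, LinearMap.lTensor_tmul, consA_tmul]

variable {D} in
theorem consK_induction {n : ℕ} {p : TPow k (Red k A) (n + 1) ⊗[k] D.E → Prop}
    (h0 : ∀ a z, p (D.consK n (red k a) z)) (hadd : ∀ x y, p x → p y → p (x + y))
    (z : TPow k (Red k A) (n + 1) ⊗[k] D.E) : p z := by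
  induction z using TensorProduct.induction_on with
  | zero => simpa using h0 0 0
  | add x y hx hy => exact hadd _ _ hx hy
  | tmul x e =>
    induction x using TPow.induction_red with
    | h a x => exact h0 a (x ⊗ₜ e)
    | hadd x y hx hy => rw [TensorProduct.add_tmul]; exact hadd _ _ hx hy

/-- A second contraction of the bar complex, acting at the right end while κ acts at the left. Since
σ anticommutes with prefixing, the identity passes through the recursion δ(ax) = a ⊗ x - κ(a δx);
only words of one letter need a computation. -/
theorem deltaK_sigK (n : ℕ) (z : TPow k (Red k A) (n + 1) ⊗[k] D.E) :
    D.deltaK (n + 1) (D.sigK (n + 1) z) + (D.sigK n).lTensor A (D.deltaK n z) = 1 ⊗ₜ z := by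
  induction n with
  | zero =>
    induction z using consK_induction with
    | hadd x y hx hy =>
      simp only [map_add, TensorProduct.tmul_add, ← hx, ← hy]
      abel
    | h0 a z =>
      induction z using tmulE_induction with
      | hadd x y hx hy =>
        simp only [map_add, TensorProduct.tmul_add, ← hx, ← hy]
        abel
      | h0 x b m =>
        have h1 : ∀ b, D.sigK 0 (x ⊗ₜ (D.inA b * D.inH m)) = -D.consK 0 (red k b) (x ⊗ₜ D.inH m) := by
          intro b
          rw [sigK_tmul]
          simp [TPow.snoc]
        simp only [sigK_consK, h1, map_neg, neg_neg]
        rw [deltaK_consK_succ, deltaK_consK_zero,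
          deltaK_consK_zero, map_sub, map_sub, map_sub, augK_tmul, augK_tmul,
          LinearMap.lTensor_tmul, LinearMap.lTensor_tmul, h1, ← mul_assoc, ← inA_mul, h1,
          lMul_tmul, lMul_tmul, kappa_apply, kappa_apply, consA_tmul, consA_tmul,
          TensorProduct.tmul_neg, TensorProduct.tmul_neg, mul_one]
        abel
  | succ n ih =>
    induction z using consK_induction with
    | hadd x y hx hy =>
      simp only [map_add, TensorProduct.tmul_add, ← hx, ← hy]
      abel
    | h0 a z =>
      have h2 := congrArg (D.kappa (n + 1)) (congrArg (lMul k _ a) (ih z))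
      rw [map_add, map_add, lMul_tmul, mul_one, D.kappa_apply _ (a ⊗ₜ[k] z), consA_tmul] at h2
      rw [← h2, sigK_consK, map_neg, deltaK_consK_succ, deltaK_consK_succ, map_sub, sigK_kappa,
        LinearMap.lTensor_tmul, lMul_lTensor]
      abel

theorem bdL_zero_aT (n : ℕ) (x : TPow k (Red k A) n) :
    D.bdL 0 (aT k A H n x) = D.bdT (aT k A H n x) := by
  have := TPow.mem_of_list (⊥ : Submodule k D.BiT)
    ((D.bdL 0 - D.bdT) ∘ₗ aT k A H n) (fun a ha => by
      subst ha
      have h := D.bdL_mono 0 [] a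
      have h2 := D.sum_piB_bdT [] a
      rw [List.length_nil, zero_add, Finset.sum_range_one] at h2
      rw [List.length_nil, if_pos le_rfl, Nat.sub_zero, h2, mono] at h
      rw [Submodule.mem_bot, LinearMap.comp_apply, LinearMap.sub_apply, h, sub_self]) x
  rwa [Submodule.mem_bot, LinearMap.comp_apply, LinearMap.sub_apply, sub_eq_zero] at this

/-- Of the three terms in ∂(hw) only the middle one keeps all letters from H: the first loses h, and
Θ loses all of them. -/
theorem bdL_zero_cons (h : H) (hs : List H) (a : List A) : D.bdL 0 (mono k (h :: hs) a) =
    -D.pushW (lMul k _ (D.inH h) (D.bdL 0 (mono k hs a))) := by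
  rw [bdL_mono, if_pos (Nat.zero_le _), bdL_mono, if_pos (Nat.zero_le _), List.length_cons,
    Nat.sub_zero, Nat.sub_zero, mono, bdT_hT, map_add, map_sub, piB_tmul, piT_mono,
    if_neg (by omega), piB_pushW_succ, piB_lMul, piB_tailT, if_neg (by omega)]
  simp

/-- The part of the differential preserving the number of letters from `H`, on `W ⊗ E`. -/
def bdZero : WordT k A H ⊗[k] D.E →ₗ[k] D.BiT := rightExt (D.bdL 0)

theorem bdZero_zT (h : H) (z : WordT k A H ⊗[k] D.E) :
    D.bdZero (D.zT h z) = -D.pushW (lMul k _ (D.inH h) (D.bdZero z)) := by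
  induction z using z_induction_mono with
  | h0 hs a b m =>
    have := D.bdL_zero_cons h hs a
    rw [mono] at this
    rw [zT_tmul, bdZero, rightExt_tmul, this, map_neg, ← pushW_rMul, ← lMul_lTensor, rightExt_tmul]
  | hadd x y hx hy => simp only [map_add, hx, hy, neg_add]

theorem bdZero_aT (n : ℕ) (z : TPow k (Red k A) (n + 1) ⊗[k] D.E) :
    D.bdZero ((aT k A H (n + 1)).rTensor D.E z) = D.incKT n (D.deltaK n z) := by
  have hr : ∀ e (y : A ⊗[k] (TPow k (Red k A) n ⊗[k] D.E)),
      (rMul k _ e).lTensor D.E (D.incKT n y) = D.incKT n ((rMul k _ e).lTensor A y) := by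
    intro e y
    rw [← incT_incK, ← incT_rMul, ← incK_rMul, incT_incK]
  induction z using TensorProduct.induction_on with
  | zero => simp
  | add x y hx hy => simp only [map_add, hx, hy]
  | tmul x e =>
    rw [LinearMap.rTensor_tmul, bdZero, rightExt_tmul, bdL_zero_aT, bdT_aT_succ, hr, deltaK,
      rightExt_tmul]

theorem sigZ_pushW (y : D.BiT) :
    D.sigZ.lTensor D.E (D.pushW y) = -D.pushW (D.sigZ.lTensor D.E y) := by
  induction y using ET_induction with
  | h0 a h z =>
    rw [pushW_tmul, LinearMap.lTensor_tmul, LinearMap.lTensor_tmul, pushW_tmul, sigZ_zT,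
      TensorProduct.tmul_neg]
  | hadd x y hx hy => simp only [map_add, hx, hy, neg_add]

theorem sigZ_incKT (n : ℕ) (y : A ⊗[k] (TPow k (Red k A) n ⊗[k] D.E)) :
    D.sigZ.lTensor D.E (D.incKT n y) = D.incKT (n + 1) ((D.sigK n).lTensor A y) := by
  induction y using TensorProduct.induction_on with
  | zero => simp
  | add x y hx hy => simp only [map_add, hx, hy]
  | tmul a z =>
    rw [incKT, incKT, LinearMap.comp_apply, LinearMap.comp_apply, LinearMap.lTensor_tmul,
      LinearMap.lTensor_tmul, LinearMap.lTensor_tmul, incA_tmul, incA_tmul, LinearMap.lTensor_tmul,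
      sigZ_aT]

/-- The bound t < n says that at least one letter from A is present. Both d⁰ and σ anticommute with
the way a letter from H is prefixed, so the identity is carried from words in A alone to all words.
-/
theorem bdZero_sigZ (n : ℕ) (w : Word k A H n) (t : ℕ) (ht : t < n) (e : D.E) :
    D.sigZ.lTensor D.E (D.bdZero (piT t (of k A H n w) ⊗ₜ e)) +
      D.bdZero (D.sigZ (piT t (of k A H n w) ⊗ₜ e)) = 1 ⊗ₜ (piT t (of k A H n w) ⊗ₜ e) := by
  induction n generalizing t with
  | zero => omega
  | succ n ih =>
    induction w using Word.induction_succ with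
    | hadd x y hx hy =>
      simp only [map_add, TensorProduct.add_tmul, TensorProduct.tmul_add, ← hx, ← hy]
      abel
    | hA x =>
      rw [← aT_apply, piT_aT]
      have hd := (add_comm _ _).trans (D.deltaK_sigK n (x ⊗ₜ e))
      split_ifs with h
      · rw [← LinearMap.rTensor_tmul, sigZ_aT, bdZero_aT, bdZero_aT, sigZ_incKT, ← map_add,
          hd, incKT, LinearMap.comp_apply, LinearMap.lTensor_tmul, incA_tmul,
          inA_one]
      · simp
    | hH h w =>
      rw [← hR_of, ← hT_apply]
      cases t with
      | zero => rw [piT_hT_zero]; simp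
      | succ t =>
        rw [piT_hT_succ, ← zT_tmul, bdZero_zT, sigZ_zT, map_neg, map_neg, bdZero_zT, sigZ_pushW,
          ← lMul_lTensor, neg_neg, neg_neg, ← map_add, ← map_add, ih w t (by omega), lMul_tmul,
          mul_one, pushW_inH]

theorem biExt_bdL_zero_sigZ (n : ℕ) (y : D.E ⊗[k] (Word k A H n ⊗[k] D.E)) (t : ℕ) (ht : t < n) :
    D.sigZ.lTensor D.E (biExt (D.bdL 0) (D.piB t (D.incT n y))) +
      biExt (D.bdL 0) (D.sigZ.lTensor D.E (D.piB t (D.incT n y))) = D.piB t (D.incT n y) := by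
  induction y using bi_induction with
  | hadd x y hx hy =>
    simp only [map_add]
    rw [add_add_add_comm, hx, hy]
  | h0 e w e' =>
    have h1 : ∀ z, biExt (D.bdL 0) (e ⊗ₜ z) = lMul k _ e (D.bdZero z) := fun z => rfl
    rw [incT_tmul, piB_tmul, LinearMap.lTensor_tmul, h1, h1, ← lMul_lTensor, ← map_add,
      bdZero_sigZ _ _ _ _ ht, lMul_tmul, mul_one]

/-- The elements of `E ⊗ W ⊗ E` with last factor in `1 # H`. -/
def endsH : Submodule k D.BiT :=
  LinearMap.range ((D.inH.lTensor (WordT k A H)).lTensor D.E)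

theorem sigZ_of_mem_endsH {y : D.BiT} (hy : y ∈ D.endsH) : D.sigZ.lTensor D.E y = 0 := by
  obtain ⟨x, rfl⟩ := hy
  induction x using TensorProduct.induction_on with
  | zero => simp
  | add x y hx hy => simp only [map_add, hx, hy, add_zero]
  | tmul e z =>
    induction z using TensorProduct.induction_on with
    | zero => simp
    | add x y hx hy => simp only [TensorProduct.tmul_add, map_add, hx, hy, add_zero]
    | tmul w m =>
      rw [LinearMap.lTensor_tmul, LinearMap.lTensor_tmul, LinearMap.lTensor_tmul, sigZ_inH,
        TensorProduct.tmul_zero]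

theorem tmul_inH_mem_endsH (e : D.E) (w : WordT k A H) (m : H) : e ⊗ₜ (w ⊗ₜ D.inH m) ∈ D.endsH :=
  ⟨e ⊗ₜ (w ⊗ₜ m), rfl⟩

theorem mem_endsH_of {φ : D.BiT →ₗ[k] D.BiT}
    (hφ : ∀ e w m, φ (e ⊗ₜ (w ⊗ₜ D.inH m)) ∈ D.endsH) {y : D.BiT} (hy : y ∈ D.endsH) :
    φ y ∈ D.endsH := by
  obtain ⟨x, rfl⟩ := hy
  induction x using TensorProduct.induction_on with
  | zero => simp
  | add x y hx hy => rw [map_add, map_add]; exact D.endsH.add_mem hx hy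
  | tmul e z =>
    induction z using TensorProduct.induction_on with
    | zero => simp
    | add x y hx hy => rw [TensorProduct.tmul_add, map_add, map_add]; exact D.endsH.add_mem hx hy
    | tmul w m => exact hφ e w m

theorem pushW_mem_endsH {y : D.BiT} (hy : y ∈ D.endsH) : D.pushW y ∈ D.endsH := by
  refine D.mem_endsH_of (fun e w m => ?_) hy
  induction e using E_induction with
  | h0 a h => rw [pushW_tmul, zT_tmul]; exact D.tmul_inH_mem_endsH _ _ _
  | hadd x y hx hy => rw [TensorProduct.add_tmul, map_add]; exact D.endsH.add_mem hx hy

theorem lMul_mem_endsH (e : D.E) {y : D.BiT} (hy : y ∈ D.endsH) : lMul k _ e y ∈ D.endsH :=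
  D.mem_endsH_of (fun _ _ _ => by rw [lMul_tmul]; exact D.tmul_inH_mem_endsH _ _ _) hy

theorem tailT_mem_endsH (h : H) (w : WordT k A H) : 1 ⊗ₜ D.tailT h w ∈ D.endsH := by
  induction w using DirectSum.induction_on with
  | zero => simp
  | add x y hx hy => rw [map_add, TensorProduct.tmul_add]; exact D.endsH.add_mem hx hy
  | of n w =>
    change 1 ⊗ₜ D.tailT h (of k A H n w) ∈ D.endsH
    rw [tailT_of, theta_tmul, rMul_one, map_neg, TensorProduct.tmul_neg]
    refine D.endsH.neg_mem ?_
    generalize D.gT n w h = t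
    induction t using TensorProduct.induction_on with
    | zero => simp
    | add x y hx hy => simp only [map_add, TensorProduct.tmul_add]; exact D.endsH.add_mem hx hy
    | tmul x m => exact D.tmul_inH_mem_endsH _ _ _

/-- A term that loses a letter from H ends either in 1 = 1#1, from h ⊗ w, or in 1#𝔥, from Θ; pushing
and left multiplication do not touch the right factor. -/
theorem piB_bdT_mem_endsH (hs : List H) (a : List A) (t : ℕ) (ht : t < hs.length) :
    D.piB t (D.bdT (mono k hs a)) ∈ D.endsH := by
  induction hs generalizing t with
  | nil => simp at ht
  | cons h hs ih =>
    rw [List.length_cons] at ht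
    rw [mono, bdT_hT, map_add, map_sub, piB_tailT]
    refine D.endsH.add_mem (D.endsH.sub_mem ?_ ?_) ?_
    · rw [piB_tmul, ← inH_one]
      exact D.tmul_inH_mem_endsH _ _ _
    · cases t with
      | zero => rw [piB_pushW_zero]; exact D.endsH.zero_mem
      | succ t =>
        rw [piB_pushW_succ, piB_lMul]
        exact D.pushW_mem_endsH (D.lMul_mem_endsH _ (ih t (by omega)))
    · split_ifs
      · exact D.tailT_mem_endsH _ _
      · exact D.endsH.zero_mem

/-- Apply σ to the component of ∂² = 0. As σ kills d^l x, the contraction identity turns σd⁰d^l x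
into d^l x, and the other terms give the recursion. -/
theorem bdL_eq_sum (l : ℕ) (hs : List H) (a : List A) (hl : l ≤ hs.length) (h1 : 1 ≤ l)
    (ha : a ≠ [] ∨ 1 < l) : D.bdL l (mono k hs a) =
      -∑ j ∈ Finset.range l, D.sigZ.lTensor D.E (biExt (D.bdL (l - j)) (D.bdL j (mono k hs a))) := by
  have hs0 := D.sum_bdL_bdL l hs a hl
  rw [Finset.sum_range_succ, Nat.sub_self] at hs0
  have h2 := congrArg (D.sigZ.lTensor D.E) hs0
  rw [map_add, map_sum, map_zero] at h2
  obtain ⟨n, y, hn, hy⟩ : ∃ n y, n + 1 = a.length + hs.length ∧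
      D.bdT (mono k hs a) = D.incT n y := by
    cases hs with
    | nil => simp at hl; omega
    | cons h hs =>
      refine ⟨a.length + hs.length, D.bd _ (monoG k a (h :: hs)), by simp [add_assoc], ?_⟩
      rw [← of_monoG]
      exact D.bdT_of_succ _ _
  -- The value d^l x has r + l - 1 letters from A, and the contraction identity needs at least one.
  -- The excluded case r = 0, l = 1 is the one treated through Y.
  have hlen : 1 < a.length + l := by
    rcases ha with ha | ha
    · have := List.length_pos_of_ne_nil ha
      omega
    · omega
  have h3 := D.biExt_bdL_zero_sigZ n y (hs.length - l) (by omega)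
  have h4 := D.piB_bdT_mem_endsH hs a (hs.length - l) (by omega)
  have h5 : D.bdL l (mono k hs a) = D.piB (hs.length - l) (D.incT n y) := by
    rw [bdL_mono, if_pos hl, hy]
  rw [hy] at h4
  rw [D.sigZ_of_mem_endsH h4, map_zero, add_zero, ← h5] at h3
  rw [h3] at h2
  rw [eq_neg_iff_add_eq_zero, add_comm]
  exact h2

end CrossedProduct

/-! ### The resolution by words -/

namespace CrossedProduct

variable {k A H : Type u} [CommRing k] [Ring A] [Algebra k A] [Ring H] [HopfAlgebra k H]
variable (D : CrossedProduct k A H)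

variable (k A H) in
/-- The words of length `0`. -/
def wordZ : Word k A H 0 ≃ₗ[k] k := LinearEquiv.refl k k

/-- The augmentation of the bar complex composed with the retraction is the augmentation of the
bimodule resolution, so the degree 0 defect takes the form that `BiRes` asks for. -/
theorem incK_augK_pushT (y : D.E ⊗[k] (Word k A H 0 ⊗[k] D.E)) :
    D.incK 0 (D.augK (D.pushT 0 y)) =
      -(1 ⊗ₜ ((wordZ k A H).symm 1 ⊗ₜ augBi (wordZ k A H).toLinearMap y)) := by
  induction y using bi_induction with
  | h0 e w e' =>
    obtain ⟨x, rfl⟩ : ∃ x, Word.ofA k A H 0 x = w := ⟨w, rfl⟩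
    rw [augBi_tmul]
    have h1 : D.augK (D.pushT 0 (e ⊗ₜ (Word.ofA k A H 0 x ⊗ₜ e'))) = -(1 ⊗ₜ (x ⊗ₜ (e * e'))) := by
      induction e using E_induction with
      | h0 a h =>
        rw [pushT, push_tmul, theta_tmul, gT_zero]
        simp [mul_assoc, TensorProduct.tmul_neg]
      | hadd x y hx hy =>
        simp only [TensorProduct.add_tmul, map_add, hx, hy, add_mul, TensorProduct.tmul_add]
        abel
    rw [h1, map_neg, incK_tmul, inA_one]
    rw [TPow.zero_eq_smul x]
    have hz : (wordZ k A H).toLinearMap (Word.ofA k A H 0 (TPow.nil k)) = 1 := rfl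
    have hz' : (wordZ k A H).symm 1 = Word.ofA k A H 0 (TPow.nil k) := rfl
    simp only [map_smul, TensorProduct.smul_tmul, hz, hz', smul_assoc, one_smul, ofK_tmul]
  | hadd x y hx hy => rw [map_add, map_add, map_add, hx, hy, map_add, TensorProduct.tmul_add, TensorProduct.tmul_add]; abel

theorem augBi_bd (w : Word k A H 1) : augBi (wordZ k A H).toLinearMap (D.bd 0 w) = 0 := by
  have h := D.augK_pushT_bdE (1 ⊗ₜ (w ⊗ₜ 1))
  have h1 : D.bdE 0 (1 ⊗ₜ (w ⊗ₜ 1)) = D.bd 0 w := biExt_one _ _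
  have h2 := D.incK_augK_pushT (D.bdE 0 (1 ⊗ₜ (w ⊗ₜ 1)))
  rw [h, map_zero, h1] at h2
  -- The augmentation is a left inverse of x ↦ 1 ⊗ 1 ⊗ x, so it recovers the value from its image
  -- under that embedding.
  have h3 := congrArg (augBi (E := D.E) (wordZ k A H).toLinearMap) h2
  rw [map_zero, map_neg, augBi_tmul] at h3
  simpa using h3.symm

/-- The resolution of `E` by the words. -/
def wordRes : BiRes k D.E where
  W := WordCat k A H
  z := wordZ k A H
  d := D.bd
  s := D.homotopy
  d_d n w := D.biExt_bd_bd n w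
  aug_d := D.augBi_bd
  d_s_zero y := by
    rw [sub_eq_add_neg, ← D.incK_augK_pushT]
    exact D.bdE_homotopy_zero y
  d_s_succ n y := D.bdE_homotopy_succ n y

end CrossedProduct

/-! ### Finite decompositions -/

section Decomposition

variable {k W : Type u} {ι : Type} [CommRing k] [Fintype ι] [DecidableEq ι] {G : ι → Type u}
  [∀ i, AddCommGroup (G i)] [∀ i, Module k (G i)] [AddCommGroup W] [Module k W]

/-- A module is the direct sum of the summands of a finite decomposition. -/
def decompEquiv (j : ∀ i, G i →ₗ[k] W) (p : ∀ i, W →ₗ[k] G i) (h1 : ∑ i, j i ∘ₗ p i = LinearMap.id)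
    (h2 : ∀ i, p i ∘ₗ j i = LinearMap.id) (h3 : ∀ i i', i ≠ i' → p i ∘ₗ j i' = 0) :
    (⨁ i, G i) ≃ₗ[k] W :=
  LinearEquiv.ofLinearMap (DirectSum.toModule k ι W j) (∑ i, DirectSum.lof k ι G i ∘ₗ p i)
    (by
      rw [← h1]
      refine (map_sum (LinearMap.llcomp k W (⨁ i, G i) W (DirectSum.toModule k ι W j)) _ _).trans ?_
      refine Finset.sum_congr rfl fun i _ => ?_
      exact LinearMap.ext fun x => DirectSum.toModule_lof k i (p i x))
    (by
      refine DirectSum.linearMap_ext k fun i => LinearMap.ext fun x => ?_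
      rw [LinearMap.comp_apply, LinearMap.comp_apply, DirectSum.toModule_lof, LinearMap.sum_apply,
        Finset.sum_eq_single i]
      · rw [LinearMap.comp_apply, ← LinearMap.comp_apply (p i), h2]; rfl
      · intro i' _ hi
        rw [LinearMap.comp_apply, ← LinearMap.comp_apply (p i'), h3 i' i hi, LinearMap.zero_apply,
          map_zero]
      · intro hi; exact absurd (Finset.mem_univ i) hi)

theorem decompEquiv_lof (j : ∀ i, G i →ₗ[k] W) (p : ∀ i, W →ₗ[k] G i)
    (h1 : ∑ i, j i ∘ₗ p i = LinearMap.id) (h2 : ∀ i, p i ∘ₗ j i = LinearMap.id)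
    (h3 : ∀ i i', i ≠ i' → p i ∘ₗ j i' = 0) (i : ι) (x : G i) :
    decompEquiv j p h1 h2 h3 (DirectSum.lof k ι G i x) = j i x := DirectSum.toModule_lof k i x

end Decomposition

namespace WordT

variable {k A H : Type u} [CommRing k] [Ring A] [Algebra k A] [Ring H] [Algebra k H]

variable (k A H) in
/-- The inclusion of `H̄^{⊗ s} ⊗ Ā^{⊗ r}` into the words of length `n`; it is zero if
`r + s ≠ n`. -/
def bigrIncl (n r s : ℕ) : TPow k (Red k H) s ⊗[k] TPow k (Red k A) r →ₗ[k] Word k A H n :=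
  DirectSum.component k ℕ (fun n => Word k A H n) n ∘ₗ (equivTT k A H).symm.toLinearMap ∘ₗ
    TensorProduct.map (TPow.toTensorAlgebra k s) (TPow.toTensorAlgebra k r)

variable (k A H) in
/-- The projection of the words of length `n` to `H̄^{⊗ s} ⊗ Ā^{⊗ r}`. -/
def bigrProj (n r s : ℕ) : Word k A H n →ₗ[k] TPow k (Red k H) s ⊗[k] TPow k (Red k A) r :=
  TensorProduct.map (DirectSum.component k ℕ (fun n => TPow k (Red k H) n) s ∘ₗ tensorSplit k _)
    (DirectSum.component k ℕ (fun n => TPow k (Red k A) n) r ∘ₗ tensorSplit k _) ∘ₗ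
    toTT k A H ∘ₗ of k A H n

theorem bigr_induction {r s : ℕ} {N : Type u} [AddCommGroup N] [Module k N]
    {f g : TPow k (Red k H) s ⊗[k] TPow k (Red k A) r →ₗ[k] N}
    (h : ∀ (hs : List H) (a : List A) (h1 : hs.length = s) (h2 : a.length = r),
      f ((h1 ▸ redL k hs : TPow k (Red k H) s) ⊗ₜ (h2 ▸ redL k a : TPow k (Red k A) r)) =
      g ((h1 ▸ redL k hs : TPow k (Red k H) s) ⊗ₜ (h2 ▸ redL k a : TPow k (Red k A) r))) :
    f = g := by
  refine TensorProduct.ext' fun x y => ?_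
  have key : ∀ (hs : List H) (h1 : hs.length = s) y,
      (f - g) ((h1 ▸ redL k hs : TPow k (Red k H) s) ⊗ₜ y) ∈ (⊥ : Submodule k N) := by
    intro hs h1 y
    refine TPow.mem_of_list ⊥ ((f - g) ∘ₗ TensorProduct.mk k _ _ (h1 ▸ redL k hs)) (fun a h2 => ?_) y
    rw [Submodule.mem_bot, LinearMap.comp_apply, TensorProduct.mk_apply, LinearMap.sub_apply,
      sub_eq_zero]
    exact h hs a h1 h2
  have := TPow.mem_of_list ⊥ ((f - g) ∘ₗ (TensorProduct.mk k _ _).flip y) (fun hs h1 => key hs h1 y) x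
  rwa [Submodule.mem_bot, LinearMap.comp_apply, LinearMap.flip_apply, TensorProduct.mk_apply,
    LinearMap.sub_apply, sub_eq_zero] at this

/-- The summands enter through tensors, not words, so the sign (-1)^{rs} appears here once and
cancels in all statements about generators. -/
theorem bigrIncl_redL {n : ℕ} (hs : List H) (a : List A) (hn : a.length + hs.length = n) :
    of k A H n (bigrIncl k A H n a.length hs.length (redL k hs ⊗ₜ redL k a)) =
      (-1 : k) ^ (a.length * hs.length) • mono k hs a := by
  subst hn
  rw [bigrIncl, LinearMap.comp_apply, LinearMap.comp_apply, TensorProduct.map_tmul,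
    toTensorAlgebra_redL, toTensorAlgebra_redL, LinearEquiv.coe_coe, equivTT_symm_clsL, ← of_monoG,
    map_smul, map_smul, DirectSum.component.lof_self]

theorem of_injective (n : ℕ) : Function.Injective (of k A H n) := by
  intro x y h
  have := congrArg (DirectSum.component k ℕ (fun n => Word k A H n) n) h
  rwa [DirectSum.component.lof_self, DirectSum.component.lof_self] at this

theorem bigrIncl_redL_eq (hs : List H) (a : List A) :
    bigrIncl k A H (a.length + hs.length) a.length hs.length (redL k hs ⊗ₜ redL k a) =
      (-1 : k) ^ (a.length * hs.length) • monoG k a hs := by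
  apply of_injective
  rw [bigrIncl_redL hs a rfl, map_smul, of_monoG]

theorem bigrProj_of (n r s : ℕ) (w : Word k A H n) (hs : List H) (a : List A)
    (hw : of k A H n w = mono k hs a) (hrs : (a.length, hs.length) ≠ (r, s)) :
    bigrProj k A H n r s w = 0 := by
  rw [bigrProj, LinearMap.comp_apply, LinearMap.comp_apply, hw, toTT_mono, map_smul,
    TensorProduct.map_tmul, LinearMap.comp_apply, LinearMap.comp_apply, tensorSplit_clsL,
    tensorSplit_clsL]
  by_cases h1 : hs.length = s
  · have h2 : a.length ≠ r := fun h2 => hrs (by rw [h1, h2])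
    have h3 : DirectSum.component k ℕ (fun n => TPow k (Red k A) n) r
        (DirectSum.lof k ℕ (fun n => TPow k (Red k A) n) a.length (redL k a)) = 0 := by
      rw [DirectSum.component.of, dif_neg h2]
    rw [h3]
    simp
  · rw [DirectSum.component.of, dif_neg h1]
    simp

theorem bigrProj_of_self (n : ℕ) (w : Word k A H n) (hs : List H) (a : List A)
    (hw : of k A H n w = mono k hs a) : bigrProj k A H n a.length hs.length w =
      (-1 : k) ^ (a.length * hs.length) • (redL k hs ⊗ₜ redL k a) := by
  rw [bigrProj, LinearMap.comp_apply, LinearMap.comp_apply, hw, toTT_mono, map_smul,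
    TensorProduct.map_tmul, LinearMap.comp_apply, LinearMap.comp_apply, tensorSplit_clsL,
    tensorSplit_clsL, DirectSum.component.lof_self, DirectSum.component.lof_self]

theorem bigrProj_bigrIncl (n r s : ℕ) (h : r + s = n) :
    bigrProj k A H n r s ∘ₗ bigrIncl k A H n r s = LinearMap.id := by
  refine bigr_induction fun hs a h1 h2 => ?_
  subst h1 h2 h
  rw [LinearMap.comp_apply, bigrIncl_redL_eq, map_smul,
    bigrProj_of_self _ _ hs a (of_monoG hs a), neg_one_pow_smul_smul, LinearMap.id_apply]

theorem bigrProj_bigrIncl_of_ne (n r s r' s' : ℕ) (h : r' + s' = n) (hn : (r', s') ≠ (r, s)) :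
    bigrProj k A H n r s ∘ₗ bigrIncl k A H n r' s' = 0 := by
  refine bigr_induction fun hs a h1 h2 => ?_
  subst h1 h2 h
  rw [LinearMap.comp_apply, bigrIncl_redL_eq, map_smul,
    bigrProj_of _ _ _ _ hs a (of_monoG hs a) hn, smul_zero, LinearMap.zero_apply]

/-- Monomials are defined in the sum over all lengths; those of length n span the component of
length n, the other ones projecting to zero. -/
theorem ext_bigr {n : ℕ} {N : Type u} [AddCommGroup N] [Module k N] {f g : Word k A H n →ₗ[k] N}
    (h : ∀ w (hs : List H) (a : List A), a.length + hs.length = n → of k A H n w = mono k hs a →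
      f w = g w) : f = g := by
  have := ext_mono (f := f ∘ₗ DirectSum.component k ℕ (fun n => Word k A H n) n)
    (g := g ∘ₗ DirectSum.component k ℕ (fun n => Word k A H n) n) (fun hs a => by
      rw [← of_monoG, LinearMap.comp_apply, LinearMap.comp_apply]
      by_cases hn : a.length + hs.length = n
      · subst hn
        rw [DirectSum.component.lof_self]
        exact h _ hs a rfl (of_monoG hs a)
      · rw [DirectSum.component.of, dif_neg hn, map_zero, map_zero])
  refine LinearMap.ext fun w => ?_
  have h2 := LinearMap.congr_fun this (of k A H n w)
  rwa [LinearMap.comp_apply, LinearMap.comp_apply, DirectSum.component.lof_self] at h2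

theorem sum_bigrIncl_bigrProj (n : ℕ) :
    ∑ p : Finset.HasAntidiagonal.antidiagonal n,
      bigrIncl k A H n p.1.1 p.1.2 ∘ₗ bigrProj k A H n p.1.1 p.1.2 = LinearMap.id := by
  refine ext_bigr fun w hs a hn hw => ?_
  rw [LinearMap.sum_apply, Finset.sum_eq_single
    ⟨(a.length, hs.length), Finset.HasAntidiagonal.mem_antidiagonal.2 hn⟩]
  · rw [LinearMap.comp_apply, LinearMap.id_apply]
    change bigrIncl k A H n a.length hs.length (bigrProj k A H n a.length hs.length w) = w
    apply of_injective
    rw [bigrProj_of_self n w hs a hw, map_smul, map_smul, bigrIncl_redL hs a hn,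
      neg_one_pow_smul_smul, hw]
  · intro p _ hp
    rw [LinearMap.comp_apply, bigrProj_of n _ _ w hs a hw (fun h => hp (Subtype.ext h.symm)), map_zero]
  · intro h; exact absurd (Finset.mem_univ _) h

set_option maxSynthPendingDepth 3 in
-- The signs cancel, so the decomposition used here agrees with the plain embedding into tensor
-- algebras by which the statement reads its formulas.
theorem toTT_bigrIncl (n r s : ℕ) (h : r + s = n) :
    toTT k A H ∘ₗ of k A H n ∘ₗ bigrIncl k A H n r s =
      TensorProduct.map (TPow.toTensorAlgebra k s) (TPow.toTensorAlgebra k r) := by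
  refine bigr_induction fun hs a h1 h2 => ?_
  subst h1 h2
  rw [LinearMap.comp_apply, LinearMap.comp_apply, bigrIncl_redL hs a h, map_smul, toTT_mono,
    neg_one_pow_smul_smul, TensorProduct.map_tmul, toTensorAlgebra_redL, toTensorAlgebra_redL]

end WordT

/-! ### Isomorphisms of homology -/

section Homology

variable {k : Type u} [CommRing k] {X Y : ℕ → Type u} [∀ n, AddCommGroup (X n)]
  [∀ n, Module k (X n)] [∀ n, AddCommGroup (Y n)] [∀ n, Module k (Y n)]
  {dX dX' : ∀ n, X (n + 1) →ₗ[k] X n} (hX : ∀ n, dX n ∘ₗ dX (n + 1) = 0)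
  (hX' : ∀ n, dX' n ∘ₗ dX' (n + 1) = 0)
  {dY : ∀ n, Y (n + 1) →ₗ[k] Y n} (hY : ∀ n, dY n ∘ₗ dY (n + 1) = 0)

theorem nonempty_homology_iso_of_eq (h : dX = dX') (n : ℕ) :
    Nonempty ((chainComplexOf k X dX hX).homology n ≅ (chainComplexOf k X dX' hX').homology n) := by
  subst h
  exact ⟨Iso.refl _⟩

theorem nonempty_homology_iso_of_equiv (e : ∀ n, X n ≃ₗ[k] Y n)
    (he : ∀ n x, e n (dX n x) = dY n (e (n + 1) x)) (n : ℕ) :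
    Nonempty ((chainComplexOf k X dX hX).homology n ≅ (chainComplexOf k Y dY hY).homology n) :=
  nonempty_homology_iso hX hY (fun n => (e n).toLinearMap)
    (fun n => LinearMap.ext fun x => (he n x).symm) (fun n => (e n).symm.toLinearMap)
    (fun n => LinearMap.ext fun y => (e n).injective (by simp [he])) (fun _ => 0)
    (fun x => by simp) (fun n x => by simp) (fun _ => 0) (fun x => by simp) (fun n x => by simp) n

/-- The comparison maps in both directions, with the two homotopies from the round trips to the
identity, form a homotopy equivalence. -/
theorem BiRes.nonempty_homology_iso {E : Type u} [Ring E] [Algebra k E] (R S : BiRes k E)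
    (M : Type u) [AddCommGroup M] [Module k M] [Module E M] [Module Eᵐᵒᵖ M] [IsScalarTower k E M]
    [IsScalarTower k Eᵐᵒᵖ M] [SMulCommClass E Eᵐᵒᵖ M] (n : ℕ) :
    Nonempty ((chainComplexOf k (fun n => M ⊗[k] R.W n) (fun n => extM M (R.d n))
      (R.extM_d_d M)).homology n ≅ (chainComplexOf k (fun n => M ⊗[k] S.W n)
        (fun n => extM M (S.d n)) (S.extM_d_d M)).homology n) :=
  HopfCrossed.nonempty_homology_iso (R.extM_d_d M) (S.extM_d_d M)
    (fun n => extM M (R.comparison S n)) (R.extM_comparison S M)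
    (fun n => extM M (S.comparison R n)) (S.extM_comparison R M) (R.roundTrip S M)
    (fun x => (R.d_roundTrip_zero S M x).trans
      (sub_eq_zero.2 (R.comparison_comparison_zero S M x)).symm)
    (R.d_roundTrip_succ S M) (S.roundTrip R M)
    (fun x => (S.d_roundTrip_zero R M x).trans
      (sub_eq_zero.2 (S.comparison_comparison_zero R M x)).symm) (S.d_roundTrip_succ R M) n

end Homology

/-! ### Coinvariants of an induced bimodule -/

section Coinvariants

variable {k E W V X Y : Type u} [CommRing k] [Ring E] [Algebra k E] [AddCommGroup W] [Module k W]
  [AddCommGroup V] [Module k V]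
  [AddCommGroup X] [Module k X] [AddCommGroup Y] [Module k Y] (M : Type u) [AddCommGroup M]
  [Module k M] [Module E M] [Module Eᵐᵒᵖ M]

/-- The submodule of `M ⊗ X` spanned by all `m e ⊗ x - m ⊗ e x` and `e m ⊗ x - m ⊗ x e`. -/
def coinvRel (L R : E → X →ₗ[k] X) : Submodule k (M ⊗[k] X) :=
  Submodule.span k
    ({z | ∃ (m : M) (e : E) (x : X), z = (MulOpposite.op e • m) ⊗ₜ x - m ⊗ₜ L e x} ∪
      {z | ∃ (m : M) (e : E) (x : X), z = (e • m) ⊗ₜ x - m ⊗ₜ R e x})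

/-- `m ⊗ w ↦ m ⊗ (1 ⊗ w ⊗ 1)`. -/
def coinvUnit (ρ : X ≃ₗ[k] E ⊗[k] (W ⊗[k] E)) : M ⊗[k] W →ₗ[k] M ⊗[k] X :=
  (ρ.symm.toLinearMap ∘ₗ biUnit k E W).lTensor M

theorem coinvUnit_tmul (ρ : X ≃ₗ[k] E ⊗[k] (W ⊗[k] E)) (m : M) (w : W) :
    coinvUnit M ρ (m ⊗ₜ w) = m ⊗ₜ ρ.symm (1 ⊗ₜ (w ⊗ₜ 1)) := rfl

theorem coinvRel_left (L R : E → X →ₗ[k] X) (m : M) (e : E) (x : X) :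
    (coinvRel M L R).mkQ (m ⊗ₜ L e x) = (coinvRel M L R).mkQ ((MulOpposite.op e • m) ⊗ₜ x) := by
  have h : (MulOpposite.op e • m) ⊗ₜ x - m ⊗ₜ[k] L e x ∈ coinvRel M L R :=
    Submodule.subset_span (Or.inl ⟨m, e, x, rfl⟩)
  exact ((Submodule.Quotient.eq _).2 h).symm

theorem coinvRel_right (L R : E → X →ₗ[k] X) (m : M) (e : E) (x : X) :
    (coinvRel M L R).mkQ (m ⊗ₜ R e x) = (coinvRel M L R).mkQ ((e • m) ⊗ₜ x) := by
  have h : (e • m) ⊗ₜ x - m ⊗ₜ[k] R e x ∈ coinvRel M L R :=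
    Submodule.subset_span (Or.inr ⟨m, e, x, rfl⟩)
  exact ((Submodule.Quotient.eq _).2 h).symm

variable [IsScalarTower k E M] [IsScalarTower k Eᵐᵒᵖ M]

/-- `m ⊗ (e ⊗ w ⊗ e') ↦ e' m e ⊗ w`. -/
def coinvContr (ρ : X ≃ₗ[k] E ⊗[k] (W ⊗[k] E)) : M ⊗[k] X →ₗ[k] M ⊗[k] W :=
  contr M ∘ₗ ρ.toLinearMap.lTensor M

theorem coinvContr_tmul (ρ : X ≃ₗ[k] E ⊗[k] (W ⊗[k] E)) (m : M) (x : X) :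
    coinvContr M ρ (m ⊗ₜ x) = contr M (m ⊗ₜ ρ x) := rfl

theorem coinvContr_coinvUnit (ρ : X ≃ₗ[k] E ⊗[k] (W ⊗[k] E)) (x : M ⊗[k] W) :
    coinvContr M ρ (coinvUnit M ρ x) = x := by
  induction x using TensorProduct.induction_on with
  | zero => rw [map_zero, map_zero]
  | add x y hx hy => rw [map_add, map_add, hx, hy]
  | tmul m w =>
    rw [coinvUnit_tmul, coinvContr_tmul, LinearEquiv.apply_symm_apply, contr_tmul,
      MulOpposite.op_one, one_smul, one_smul]

/-- Write e ⊗ w ⊗ e' as e(1 ⊗ w ⊗ 1)e' and carry e and e' across to m by the defining relations. -/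
theorem mkQ_coinvUnit_coinvContr (ρ : X ≃ₗ[k] E ⊗[k] (W ⊗[k] E)) {L R : E → X →ₗ[k] X}
    (hL : ∀ e x, ρ (L e x) = lMul k _ e (ρ x)) (hR : ∀ e x, ρ (R e x) = (rMul k _ e).lTensor _ (ρ x))
    (z : M ⊗[k] X) : (coinvRel M L R).mkQ (coinvUnit M ρ (coinvContr M ρ z)) =
      (coinvRel M L R).mkQ z := by
  induction z using TensorProduct.induction_on with
  | zero => rw [map_zero, map_zero]
  | add x y hx hy => rw [map_add, map_add, map_add, hx, hy, map_add]
  | tmul m x =>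
    obtain ⟨y, rfl⟩ := ρ.symm.surjective x
    rw [coinvContr_tmul, LinearEquiv.apply_symm_apply]
    induction y using bi_induction with
    | hadd x y hx hy =>
      rw [TensorProduct.tmul_add, map_add, map_add, map_add, hx, hy, map_add ρ.symm,
        TensorProduct.tmul_add, map_add]
    | h0 e w e' =>
      have h1 : ρ.symm (e ⊗ₜ (w ⊗ₜ e')) = L e (R e' (ρ.symm (1 ⊗ₜ (w ⊗ₜ 1)))) := by
        rw [LinearEquiv.symm_apply_eq, hL, hR, LinearEquiv.apply_symm_apply,
          LinearMap.lTensor_tmul, rMul_tmul, lMul_tmul, mul_one, one_mul]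
      rw [contr_tmul, coinvUnit_tmul, h1, coinvRel_left, coinvRel_right]

variable [SMulCommClass E Eᵐᵒᵖ M]

theorem coinvContr_eq_zero (ρ : X ≃ₗ[k] E ⊗[k] (W ⊗[k] E)) {L R : E → X →ₗ[k] X}
    (hL : ∀ e x, ρ (L e x) = lMul k _ e (ρ x)) (hR : ∀ e x, ρ (R e x) = (rMul k _ e).lTensor _ (ρ x))
    {z : M ⊗[k] X} (hz : z ∈ coinvRel M L R) : coinvContr M ρ z = 0 := by
  induction hz using Submodule.span_induction with
  | zero => rw [map_zero]
  | add x y _ _ hx hy => rw [map_add, hx, hy, add_zero]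
  | smul c x _ hx => rw [map_smul, hx, smul_zero]
  | mem z hz =>
    rcases hz with ⟨m, e, x, rfl⟩ | ⟨m, e, x, rfl⟩
    · have h := contr_lMul_rMul M m e 1 (ρ x)
      have h1 : (rMul k W (1 : E)) = LinearMap.id := LinearMap.ext fun _ => rMul_one _
      rw [h1, LinearMap.lTensor_id, LinearMap.id_apply, one_smul] at h
      rw [map_sub, coinvContr_tmul, coinvContr_tmul, hL, h, sub_self]
    · have h := contr_lMul_rMul M m 1 e (ρ x)
      rw [lMul_one, MulOpposite.op_one, one_smul] at h
      rw [map_sub, coinvContr_tmul, coinvContr_tmul, hR, h, sub_self]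

/-- The coinvariants of `M ⊗ X`, for an induced bimodule `X`. -/
def coinvEquiv (ρ : X ≃ₗ[k] E ⊗[k] (W ⊗[k] E)) {L R : E → X →ₗ[k] X}
    (hL : ∀ e x, ρ (L e x) = lMul k _ e (ρ x))
    (hR : ∀ e x, ρ (R e x) = (rMul k _ e).lTensor _ (ρ x)) :
    M ⊗[k] W ≃ₗ[k] (M ⊗[k] X) ⧸ coinvRel M L R :=
  LinearEquiv.ofLinearMap ((coinvRel M L R).mkQ ∘ₗ coinvUnit M ρ)
    ((coinvRel M L R).liftQ (coinvContr M ρ) fun _ hz => coinvContr_eq_zero M ρ hL hR hz)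
    (Submodule.linearMap_qext _ (LinearMap.ext fun z => mkQ_coinvUnit_coinvContr M ρ hL hR z))
    (LinearMap.ext fun x => coinvContr_coinvUnit M ρ x)

theorem coinvEquiv_tmul (ρ : X ≃ₗ[k] E ⊗[k] (W ⊗[k] E)) {L R : E → X →ₗ[k] X}
    (hL : ∀ e x, ρ (L e x) = lMul k _ e (ρ x))
    (hR : ∀ e x, ρ (R e x) = (rMul k _ e).lTensor _ (ρ x)) (m : M) (w : W) :
    coinvEquiv M ρ hL hR (m ⊗ₜ w) = (coinvRel M L R).mkQ (m ⊗ₜ ρ.symm (1 ⊗ₜ (w ⊗ₜ 1))) := rfl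

/-- Naturality of the identification of coinvariants: it matches the map induced on M ⊗ V by values
on generators with M ⊗ d. -/
theorem coinvEquiv_extM (τ : Y ≃ₗ[k] E ⊗[k] (V ⊗[k] E)) (ρ : X ≃ₗ[k] E ⊗[k] (W ⊗[k] E))
    {L R : E → X →ₗ[k] X} (hL : ∀ e x, ρ (L e x) = lMul k _ e (ρ x))
    (hR : ∀ e x, ρ (R e x) = (rMul k _ e).lTensor _ (ρ x)) (g : V →ₗ[k] E ⊗[k] (W ⊗[k] E))
    (d : Y →ₗ[k] X) (hd : ∀ y, ρ (d y) = biExt g (τ y)) (z : M ⊗[k] Y) :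
    coinvEquiv M ρ hL hR (extM M g (coinvContr M τ z)) =
      (coinvRel M L R).mkQ (d.lTensor M z) := by
  rw [← mkQ_coinvUnit_coinvContr M ρ hL hR]
  refine congrArg (fun x => (coinvRel M L R).mkQ (coinvUnit M ρ x)) ?_
  induction z using TensorProduct.induction_on with
  | zero => rw [map_zero, map_zero, map_zero, map_zero]
  | add x y hx hy => rw [map_add, map_add, hx, hy, map_add, map_add]
  | tmul m x => rw [LinearMap.lTensor_tmul, coinvContr_tmul, coinvContr_tmul, extM_contr, hd]

end Coinvariants

/-! ### The two complexes in terms of words -/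

namespace CrossedProduct

variable {k A H : Type u} [CommRing k] [Ring A] [Algebra k A] [Ring H] [HopfAlgebra k H]
variable (D : CrossedProduct k A H)

variable (k A H) in
/-- `X̂_n` in terms of words. -/
def hatEquiv (M : Type u) [AddCommGroup M] [Module k M] (n : ℕ) :
    Hat k A H M n ≃ₗ[k] M ⊗[k] Word k A H n :=
  decompEquiv (ι := Finset.HasAntidiagonal.antidiagonal n)
    (G := fun p => M ⊗[k] (TPow k (Red k H) p.1.2 ⊗[k] TPow k (Red k A) p.1.1))
    (fun p => (bigrIncl k A H n p.1.1 p.1.2).lTensor M)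
    (fun p => (bigrProj k A H n p.1.1 p.1.2).lTensor M)
    (by
      have h := congrArg (LinearMap.lTensorHom M) (sum_bigrIncl_bigrProj (k := k) (A := A) (H := H) n)
      rw [map_sum] at h
      refine Eq.trans (Finset.sum_congr rfl fun p _ => ?_) (h.trans ?_)
      · exact (LinearMap.lTensor_comp _ _ _).symm
      · exact LinearMap.lTensor_id _ _)
    (fun p => by
      rw [← LinearMap.lTensor_comp, bigrProj_bigrIncl _ _ _
        (Finset.HasAntidiagonal.mem_antidiagonal.1 p.2), LinearMap.lTensor_id])
    (fun p q hpq => by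
      rw [← LinearMap.lTensor_comp, bigrProj_bigrIncl_of_ne _ _ _ _ _
        (Finset.HasAntidiagonal.mem_antidiagonal.1 q.2) (fun h => hpq (Subtype.ext h.symm)),
        LinearMap.lTensor_zero])

/-- Lets the formula for d̂, an equation between tensors, be checked on words. -/
theorem hatIncl_eq (M : Type u) [AddCommGroup M] [Module k M] (n : ℕ) (x : Hat k A H M n) :
    hatIncl k A H M n x = (toTT k A H ∘ₗ of k A H n).lTensor M (hatEquiv k A H M n x) := by
  revert x
  suffices e : hatIncl k A H M n = (toTT k A H ∘ₗ of k A H n).lTensor M ∘ₗ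
    (hatEquiv k A H M n).toLinearMap from fun x => LinearMap.congr_fun e x
  refine DirectSum.linearMap_ext k fun p => LinearMap.ext fun x => ?_
  rw [LinearMap.comp_apply, LinearMap.comp_apply, LinearMap.comp_apply, LinearEquiv.coe_coe, hatEquiv,
    decompEquiv_lof, hatIncl, DirectSum.toModule_lof, ← LinearMap.lTensor_comp_apply,
    LinearMap.comp_assoc, toTT_bigrIncl _ _ _ (Finset.HasAntidiagonal.mem_antidiagonal.1 p.2)]

theorem hatEquiv_gen {M : Type u} [AddCommGroup M] [Module k M] {n : ℕ} (m : M) (h : List H)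
    (a : List A) (hn : a.length + h.length = n) :
    hatEquiv k A H M n (hatGen k m h a hn) =
      m ⊗ₜ bigrIncl k A H n a.length h.length (redL k h ⊗ₜ redL k a) := by
  rw [hatGen, hatEquiv, decompEquiv_lof]
  rfl

/-- The inclusion of a summand of `X_n`. -/
def resBigrIncl (n r s : ℕ) :
    D.E ⊗[k] (TPow k (Red k H) s ⊗[k] (TPow k (Red k A) r ⊗[k] D.E)) →ₗ[k]
      D.E ⊗[k] (Word k A H n ⊗[k] D.E) :=
  ((bigrIncl k A H n r s).rTensor D.E ∘ₗ
    (TensorProduct.assoc k _ _ D.E).symm.toLinearMap).lTensor D.E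

/-- The projection to a summand of `X_n`. -/
def resBigrProj (n r s : ℕ) : D.E ⊗[k] (Word k A H n ⊗[k] D.E) →ₗ[k]
    D.E ⊗[k] (TPow k (Red k H) s ⊗[k] (TPow k (Red k A) r ⊗[k] D.E)) :=
  ((TensorProduct.assoc k _ _ D.E).toLinearMap ∘ₗ (bigrProj k A H n r s).rTensor D.E).lTensor D.E

theorem resBigrIncl_tmul (n r s : ℕ) (e e' : D.E) (x : TPow k (Red k H) s)
    (y : TPow k (Red k A) r) : D.resBigrIncl n r s (e ⊗ₜ (x ⊗ₜ (y ⊗ₜ e'))) =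
      e ⊗ₜ (bigrIncl k A H n r s (x ⊗ₜ y) ⊗ₜ e') := rfl

theorem resBigrProj_tmul (n r s : ℕ) (e e' : D.E) (w : Word k A H n) :
    D.resBigrProj n r s (e ⊗ₜ (w ⊗ₜ e')) =
      e ⊗ₜ TensorProduct.assoc k _ _ _ (bigrProj k A H n r s w ⊗ₜ e') := rfl

theorem resBigr_comp (n r s r' s' : ℕ) : D.resBigrProj n r s ∘ₗ D.resBigrIncl n r' s' =
    ((TensorProduct.assoc k _ _ D.E).toLinearMap ∘ₗ
      (bigrProj k A H n r s ∘ₗ bigrIncl k A H n r' s').rTensor D.E ∘ₗ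
        (TensorProduct.assoc k _ _ D.E).symm.toLinearMap).lTensor D.E := by
  rw [resBigrProj, resBigrIncl, ← LinearMap.lTensor_comp, LinearMap.rTensor_comp]
  rfl

/-- `X_n` in terms of words. -/
def resEquiv (n : ℕ) : D.Res n ≃ₗ[k] D.E ⊗[k] (Word k A H n ⊗[k] D.E) :=
  decompEquiv (ι := Finset.HasAntidiagonal.antidiagonal n)
    (G := fun p => D.E ⊗[k] (TPow k (Red k H) p.1.2 ⊗[k] (TPow k (Red k A) p.1.1 ⊗[k] D.E)))
    (fun p => D.resBigrIncl n p.1.1 p.1.2) (fun p => D.resBigrProj n p.1.1 p.1.2)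
    (by
      refine LinearMap.ext fun y => ?_
      induction y using bi_induction with
      | hadd x y hx hy => rw [map_add, map_add, hx, hy]
      | h0 e w e' =>
        have h := LinearMap.congr_fun (sum_bigrIncl_bigrProj (k := k) (A := A) (H := H) n) w
        rw [LinearMap.sum_apply, LinearMap.id_apply] at h
        rw [LinearMap.sum_apply, LinearMap.id_apply]
        conv_rhs => rw [← h]
        rw [TensorProduct.sum_tmul, TensorProduct.tmul_sum]
        refine Finset.sum_congr rfl fun p _ => ?_
        rw [LinearMap.comp_apply, resBigrProj_tmul, resBigrIncl, LinearMap.lTensor_tmul,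
          LinearMap.comp_apply, LinearEquiv.coe_coe, LinearEquiv.symm_apply_apply,
          LinearMap.rTensor_tmul, LinearMap.comp_apply])
    (fun p => by
      have h := D.resBigr_comp n p.1.1 p.1.2 p.1.1 p.1.2
      rw [h, bigrProj_bigrIncl _ _ _ (Finset.HasAntidiagonal.mem_antidiagonal.1 p.2)]
      refine LinearMap.ext fun y => ?_
      simp)
    (fun p q hpq => by
      have h := D.resBigr_comp n p.1.1 p.1.2 q.1.1 q.1.2
      rw [h, bigrProj_bigrIncl_of_ne _ _ _ _ _
        (Finset.HasAntidiagonal.mem_antidiagonal.1 q.2) (fun h => hpq (Subtype.ext h.symm))]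
      simp)

theorem resEquiv_lof (n : ℕ) (p : Finset.HasAntidiagonal.antidiagonal n)
    (x : D.E ⊗[k] (TPow k (Red k H) p.1.2 ⊗[k] (TPow k (Red k A) p.1.1 ⊗[k] D.E))) :
    D.resEquiv n (DirectSum.lof k (Finset.HasAntidiagonal.antidiagonal n)
      (fun p => D.E ⊗[k] (TPow k (Red k H) p.1.2 ⊗[k] (TPow k (Red k A) p.1.1 ⊗[k] D.E))) p x) =
      D.resBigrIncl n p.1.1 p.1.2 x := by
  rw [resEquiv, decompEquiv_lof]

variable {D} in
theorem quad_induction {X Y : Type u} [AddCommGroup X] [Module k X] [AddCommGroup Y] [Module k Y]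
    {p : D.E ⊗[k] (X ⊗[k] (Y ⊗[k] D.E)) → Prop} (h0 : ∀ e x y e', p (e ⊗ₜ (x ⊗ₜ (y ⊗ₜ e'))))
    (hadd : ∀ x y, p x → p y → p (x + y)) (z : D.E ⊗[k] (X ⊗[k] (Y ⊗[k] D.E))) : p z := by
  have hz : p 0 := by simpa using h0 0 0 0 0
  induction z using TensorProduct.induction_on with
  | zero => exact hz
  | add x y hx hy => exact hadd _ _ hx hy
  | tmul e z =>
    induction z using TensorProduct.induction_on with
    | zero => rwa [TensorProduct.tmul_zero]
    | add x y hx hy => rw [TensorProduct.tmul_add]; exact hadd _ _ hx hy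
    | tmul x z =>
      induction z using TensorProduct.induction_on with
      | zero => rwa [TensorProduct.tmul_zero, TensorProduct.tmul_zero]
      | add x y hx hy =>
        rw [TensorProduct.tmul_add, TensorProduct.tmul_add]; exact hadd _ _ hx hy
      | tmul y e' => exact h0 e x y e'

theorem res_induction {n : ℕ} {p : D.Res n → Prop}
    (h0 : ∀ (i : Finset.HasAntidiagonal.antidiagonal n) e x y e',
      p (DirectSum.lof k (Finset.HasAntidiagonal.antidiagonal n)
      (fun p => D.E ⊗[k] (TPow k (Red k H) p.1.2 ⊗[k] (TPow k (Red k A) p.1.1 ⊗[k] D.E))) i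
        (e ⊗ₜ (x ⊗ₜ (y ⊗ₜ e')))))
    (hz : p 0) (hadd : ∀ x y, p x → p y → p (x + y)) (z : D.Res n) : p z := by
  induction z using DirectSum.induction_on with
  | zero => exact hz
  | add x y hx hy => exact hadd _ _ hx hy
  | of i x =>
    induction x using quad_induction with
    | h0 e x y e' => exact h0 i e x y e'
    | hadd x y hx hy => rw [map_add]; exact hadd _ _ hx hy

theorem resIncl_eq (n : ℕ) (x : D.Res n) :
    D.resIncl n x = D.totEquiv (D.incT n (D.resEquiv n x)) := by
  induction x using res_induction with
  | hz => simp
  | hadd x y hx hy => simp only [map_add, hx, hy]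
  | h0 i e x y e' =>
    have h := LinearMap.congr_fun (toTT_bigrIncl (k := k) (A := A) (H := H) n _ _
      (Finset.HasAntidiagonal.mem_antidiagonal.1 i.2)) (x ⊗ₜ y)
    rw [LinearMap.comp_apply, LinearMap.comp_apply] at h
    rw [resEquiv_lof, resBigrIncl_tmul, incT_tmul, totEquiv_tmul, zEquiv_tmul, h, resIncl,
      DirectSum.toModule_lof]
    rfl

theorem resEquiv_gen {n : ℕ} (h : List H) (a : List A) (hn : a.length + h.length = n) :
    D.resEquiv n (D.resGen h a hn) =
      1 ⊗ₜ (bigrIncl k A H n a.length h.length (redL k h ⊗ₜ redL k a) ⊗ₜ 1) := by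
  rw [resGen, resEquiv_lof]
  rfl

theorem resEquiv_left (n : ℕ) (e : D.E) (x : D.Res n) :
    D.resEquiv n (D.resLeft n e x) = lMul k _ e (D.resEquiv n x) := by
  induction x using res_induction with
  | hz => simp
  | hadd x y hx hy => simp only [map_add, hx, hy]
  | h0 i e₁ x y e' =>
    rw [resLeft, DirectSum.lmap_lof, resEquiv_lof, resEquiv_lof, LinearMap.rTensor_tmul,
      resBigrIncl_tmul, resBigrIncl_tmul, lMul_tmul]
    rfl

theorem resEquiv_right (n : ℕ) (e : D.E) (x : D.Res n) :
    D.resEquiv n (D.resRight n e x) = (rMul k _ e).lTensor _ (D.resEquiv n x) := by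
  induction x using res_induction with
  | hz => simp
  | hadd x y hx hy => simp only [map_add, hx, hy]
  | h0 i e₁ x y e' =>
    rw [resRight, DirectSum.lmap_lof, resEquiv_lof, resEquiv_lof, LinearMap.lTensor_tmul,
      LinearMap.lTensor_tmul, LinearMap.lTensor_tmul,
      resBigrIncl_tmul, resBigrIncl_tmul, LinearMap.lTensor_tmul, rMul_tmul]
    rfl

/-! ### The differentials -/

/-- The differential of `X`. -/
def resD (n : ℕ) : D.Res (n + 1) →ₗ[k] D.Res n :=
  (D.resEquiv n).symm.toLinearMap ∘ₗ biExt (D.bd n) ∘ₗ (D.resEquiv (n + 1)).toLinearMap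

theorem resEquiv_resD (n : ℕ) (x : D.Res (n + 1)) :
    D.resEquiv n (D.resD n x) = biExt (D.bd n) (D.resEquiv (n + 1) x) := by
  simp [resD]

theorem resD_resD (n : ℕ) : D.resD n ∘ₗ D.resD (n + 1) = 0 := by
  refine LinearMap.ext fun x => (D.resEquiv n).injective ?_
  rw [LinearMap.comp_apply, resEquiv_resD, resEquiv_resD, LinearMap.zero_apply, map_zero]
  exact D.wordRes.biExt_d_d n _

/-- The maps `d^l`. -/
def resDl (l : ℕ) : D.ResTot →ₗ[k] D.ResTot :=
  D.totEquiv.toLinearMap ∘ₗ biExt (D.bdL l) ∘ₗ D.totEquiv.symm.toLinearMap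

theorem resDl_totEquiv (l : ℕ) (y : D.BiT) :
    D.resDl l (D.totEquiv y) = D.totEquiv (biExt (D.bdL l) y) := by
  simp [resDl]

theorem resDl_apply (l : ℕ) (e e' : D.E) (h : List H) (a : List A) :
    D.resDl l (e ⊗ₜ (clsL k h ⊗ₜ (clsL k a ⊗ₜ e'))) = (-1 : k) ^ (a.length * h.length) •
      D.totEquiv (lMul k _ e ((rMul k _ e').lTensor _ (D.bdL l (mono k h a)))) := by
  rw [resDl, LinearMap.comp_apply, LinearMap.comp_apply, LinearEquiv.coe_coe, LinearEquiv.coe_coe,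
    totEquiv_symm_clsL, map_smul, map_smul, biExt_tmul]

theorem resDl_apply_one (l : ℕ) (h : List H) (a : List A) :
    D.resDl l (1 ⊗ₜ (clsL k h ⊗ₜ (clsL k a ⊗ₜ 1))) = (-1 : k) ^ (a.length * h.length) •
      D.totEquiv (D.bdL l (mono k h a)) := by
  rw [resDl_apply, ← biExt_tmul, biExt_one]

theorem totLeft_totEquiv (e : D.E) (y : D.BiT) :
    D.totLeft e (D.totEquiv y) = D.totEquiv (lMul k _ e y) := by
  induction y using bi_induction with
  | h0 e₁ w e' => rfl
  | hadd x y hx hy => simp only [map_add, hx, hy]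

theorem totRight_totEquiv (e : D.E) (y : D.BiT) :
    D.totRight e (D.totEquiv y) = D.totEquiv ((rMul k _ e).lTensor _ y) := by
  induction y using bi_induction_mono with
  | h0 e₁ hs a e' =>
    rw [LinearMap.lTensor_tmul, rMul_tmul, totEquiv_mono, totEquiv_mono, map_smul]
    rfl
  | hadd x y hx hy => simp only [map_add, hx, hy]

theorem resDl_totLeft (l : ℕ) (e : D.E) :
    D.resDl l ∘ₗ D.totLeft e = D.totLeft e ∘ₗ D.resDl l := by
  refine LinearMap.ext fun x => ?_
  obtain ⟨y, rfl⟩ := D.totEquiv.surjective x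
  rw [LinearMap.comp_apply, LinearMap.comp_apply, totLeft_totEquiv, resDl_totEquiv, biExt_lMul,
    resDl_totEquiv, totLeft_totEquiv]

theorem resDl_totRight (l : ℕ) (e : D.E) :
    D.resDl l ∘ₗ D.totRight e = D.totRight e ∘ₗ D.resDl l := by
  refine LinearMap.ext fun x => ?_
  obtain ⟨y, rfl⟩ := D.totEquiv.surjective x
  rw [LinearMap.comp_apply, LinearMap.comp_apply, totRight_totEquiv, resDl_totEquiv, biExt_rMul,
    resDl_totEquiv, totRight_totEquiv]

theorem resDl_eq_zero (l : ℕ) (h : List H) (a : List A) (hl : h.length < l) :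
    D.resDl l (1 ⊗ₜ (clsL k h ⊗ₜ (clsL k a ⊗ₜ 1))) = 0 := by
  rw [resDl_apply_one, bdL_mono, if_neg (by omega), map_zero, smul_zero]

theorem resDl_eq_sum (l : ℕ) (h : List H) (a : List A) (h1 : 1 ≤ l) (hl : l ≤ h.length)
    (ha : a ≠ [] ∨ 1 < l) :
    D.resDl l (1 ⊗ₜ (clsL k h ⊗ₜ (clsL k a ⊗ₜ 1))) =
      - ∑ j ∈ Finset.range l, D.sigmaX (D.resDl (l - j) (D.resDl j
        (1 ⊗ₜ (clsL k h ⊗ₜ (clsL k a ⊗ₜ 1))))) := by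
  rw [resDl_apply_one, D.bdL_eq_sum l h a hl h1 ha, map_neg, smul_neg, map_sum, Finset.smul_sum]
  congr 1
  refine Finset.sum_congr rfl fun j _ => ?_
  rw [resDl_apply_one, map_smul, map_smul, resDl_totEquiv, sigmaX_totEquiv]

/-- Without letters from A there is nothing for d⁰ to act on, which is why the recursion for r = 0
starts its sum at j = 1. -/
theorem bdL_zero_mono_nil (h : List H) : D.bdL 0 (mono k h ([] : List A)) = 0 := by
  induction h with
  | nil => rw [bdL_mono, if_pos (Nat.zero_le _), bdT_mono_nil_nil, map_zero]
  | cons x h ih => rw [bdL_zero_cons, ih]; simp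

theorem resDl_nil_eq_sum (l : ℕ) (h : List H) (h1 : 1 < l) (hl : l ≤ h.length) :
    D.resDl l (1 ⊗ₜ (clsL k h ⊗ₜ (clsL k ([] : List A) ⊗ₜ 1))) =
      - ∑ j ∈ Finset.Ico 1 l, D.sigmaX (D.resDl (l - j) (D.resDl j
        (1 ⊗ₜ (clsL k h ⊗ₜ (clsL k ([] : List A) ⊗ₜ 1))))) := by
  rw [D.resDl_eq_sum l h [] h1.le hl (Or.inr h1), Finset.range_eq_Ico,
    Finset.sum_eq_sum_Ico_succ_bot (by omega), D.resDl_apply_one 0, bdL_zero_mono_nil]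
  simp

theorem resIncl_resD (n : ℕ) (x : D.Res (n + 1)) :
    D.resIncl n (D.resD n x) = ∑ l ∈ Finset.range (n + 2), D.resDl l (D.resIncl (n + 1) x) := by
  have h1 : ∀ y : D.E ⊗[k] (Word k A H (n + 1) ⊗[k] D.E), D.incT n (biExt (D.bd n) y) =
      ∑ l ∈ Finset.range (n + 2), biExt (D.bdL l) (D.incT (n + 1) y) := by
    intro y
    induction y using bi_induction with
    | hadd x y hx hy => simp only [map_add, hx, hy, Finset.sum_add_distrib]
    | h0 e w e' =>
      simp only [incT_tmul, biExt_tmul, incT_lMul, incT_rMul]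
      rw [← map_sum, ← map_sum, ← bdT_of_succ]
      congr 2
      -- A word of length n + 1 has at most n + 1 letters from H, so the components l < n + 2
      -- exhaust ∂.
      have := LinearMap.congr_fun (ext_bigr (f := D.bdT ∘ₗ of k A H (n + 1))
        (g := ∑ l ∈ Finset.range (n + 2), D.bdL l ∘ₗ of k A H (n + 1)) fun w hs a hn hw => by
          rw [LinearMap.comp_apply, LinearMap.sum_apply]
          simp only [LinearMap.comp_apply, hw]
          rw [D.sum_bdL (n + 2) hs a (by omega)]) w
      rw [LinearMap.comp_apply, LinearMap.sum_apply] at this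
      exact this
  simp only [resIncl_eq, resEquiv_resD, resDl_totEquiv, h1, map_sum]

/-! ### The complex X̂ and its homology -/

section Coefficients

variable (M : Type u) [AddCommGroup M] [Module k M] [Module D.E M] [Module D.Eᵐᵒᵖ M]
  [IsScalarTower k D.E M] [IsScalarTower k D.Eᵐᵒᵖ M]

/-- The differential of `X̂`. -/
def hatD (n : ℕ) : Hat k A H M (n + 1) →ₗ[k] Hat k A H M n :=
  (hatEquiv k A H M n).symm.toLinearMap ∘ₗ extM M (D.bd n) ∘ₗ (hatEquiv k A H M (n + 1)).toLinearMap

theorem hatEquiv_hatD (n : ℕ) (x : Hat k A H M (n + 1)) :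
    hatEquiv k A H M n (D.hatD M n x) = extM M (D.bd n) (hatEquiv k A H M (n + 1) x) := by
  simp [hatD]

/-- `m ⊗ (e ⊗ u ⊗ v ⊗ e') ↦ e' m e ⊗ u ⊗ v`. -/
def contrTot : M ⊗[k] D.ResTot →ₗ[k] HatTot k A H M :=
  (toTT k A H).lTensor M ∘ₗ contr M ∘ₗ D.totEquiv.symm.toLinearMap.lTensor M

theorem contrTot_totEquiv (m : M) (y : D.BiT) :
    D.contrTot M (m ⊗ₜ D.totEquiv y) = (toTT k A H).lTensor M (contr M (m ⊗ₜ y)) := by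
  simp [contrTot]

variable {M} in
theorem contrTot_clsL (m : M) (e e' : D.E) (u : TensorAlgebra k (Red k H))
    (v : TensorAlgebra k (Red k A)) : D.contrTot M (m ⊗ₜ (e ⊗ₜ (u ⊗ₜ (v ⊗ₜ e')))) =
      (e' • MulOpposite.op e • m) ⊗ₜ (u ⊗ₜ v) := by
  have h : e ⊗ₜ (u ⊗ₜ (v ⊗ₜ e')) =
    D.totEquiv (e ⊗ₜ ((equivTT k A H).symm (u ⊗ₜ v) ⊗ₜ e')) := by
    rw [totEquiv_tmul, zEquiv_tmul, ← equivTT_apply, LinearEquiv.apply_symm_apply]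
    rfl
  rw [h, contrTot_totEquiv, contr_tmul, LinearMap.lTensor_tmul, ← equivTT_apply,
    LinearEquiv.apply_symm_apply]

theorem contr_incT (n : ℕ) (m : M) (y : D.E ⊗[k] (Word k A H n ⊗[k] D.E)) :
    (of k A H n).lTensor M (contr M (m ⊗ₜ y)) = contr M (m ⊗ₜ D.incT n y) := by
  induction y using bi_induction with
  | h0 e w e' => rfl
  | hadd x y hx hy => simp only [map_add, TensorProduct.tmul_add, hx, hy]

/-- Reduces the formula for d̂ to the differential of a single word. The sign passes from the tensor
to the word; on the target side the translation absorbs it. -/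
theorem hatIncl_hatD (n : ℕ) (m : M) (h : List H) (a : List A)
    (hn : a.length + h.length = n + 1) :
    hatIncl k A H M n (D.hatD M n (hatGen k m h a hn)) = D.contrTot M (m ⊗ₜ
      ((-1 : k) ^ (a.length * h.length) • D.totEquiv (D.bdT (mono k h a)))) := by
  rw [hatIncl_eq, hatEquiv_hatD, hatEquiv_gen, extM_tmul, LinearMap.lTensor_comp,
    LinearMap.comp_apply, contr_incT, ← bdT_of_succ, bigrIncl_redL h a hn, map_smul,
    ← map_smul D.totEquiv, contrTot_totEquiv]

variable [SMulCommClass D.E D.Eᵐᵒᵖ M]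

theorem hatD_hatD (n : ℕ) : D.hatD M n ∘ₗ D.hatD M (n + 1) = 0 := by
  refine LinearMap.ext fun x => (hatEquiv k A H M n).injective ?_
  rw [LinearMap.comp_apply, hatEquiv_hatD, hatEquiv_hatD, LinearMap.zero_apply, map_zero]
  exact LinearMap.congr_fun (D.wordRes.extM_d_d M n) _

/-- X̂ is the complex of words with coefficients, which is homotopy equivalent to the bar complex
with coefficients, and the latter has the Hochschild boundary. -/
theorem nonempty_homology_iso_hochschild (n : ℕ) :
    Nonempty ((chainComplexOf k (Hat k A H M) (D.hatD M) (D.hatD_hatD M)).homology n ≅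
      HochschildHomology k D.E M n) := by
  obtain ⟨e₁⟩ := nonempty_homology_iso_of_equiv (D.hatD_hatD M) (D.wordRes.extM_d_d M)
    (hatEquiv k A H M) (D.hatEquiv_hatD M) n
  obtain ⟨e₂⟩ := D.wordRes.nonempty_homology_iso (barRes k D.E) M n
  obtain ⟨e₃⟩ := nonempty_homology_iso_of_eq (X := fun n => M ⊗[k] TPow k D.E n)
    ((barRes k D.E).extM_d_d M) (hochschildD_hochschildD M) (funext fun n => extM_barBd k D.E M n) n
  exact ⟨e₁ ≪≫ e₂ ≪≫ e₃⟩

/-! ### The tensor product over the enveloping algebra -/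

/-- `X̂_n` is `M ⊗_{E^e} X_n`. -/
def tensorEquiv (n : ℕ) : Hat k A H M n ≃ₗ[k] D.ResTensor M n :=
  hatEquiv k A H M n ≪≫ₗ coinvEquiv M (D.resEquiv n) (D.resEquiv_left n) (D.resEquiv_right n)

theorem tensorEquiv_hatGen (n : ℕ) (m : M) (h : List H) (a : List A)
    (hn : a.length + h.length = n) : D.tensorEquiv M n (hatGen k m h a hn) =
      (D.balancedRel M n).mkQ (m ⊗ₜ D.resGen h a hn) := by
  -- The relations defining `ResTensor` unfold to `coinvRel` for the two actions on X_n, so the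
  -- general statements on coinvariants apply up to unfolding.
  refine (congrArg (coinvEquiv M (D.resEquiv n) (D.resEquiv_left n) (D.resEquiv_right n))
    (hatEquiv_gen m h a hn)).trans ?_
  refine (coinvEquiv_tmul M (D.resEquiv n) (D.resEquiv_left n) (D.resEquiv_right n) _ _).trans ?_
  rw [← resEquiv_gen, LinearEquiv.symm_apply_apply]
  rfl

theorem tensorEquiv_hatD (n : ℕ) (z : M ⊗[k] D.Res (n + 1)) :
    D.tensorEquiv M n (D.hatD M n ((D.tensorEquiv M (n + 1)).symm
      ((D.balancedRel M (n + 1)).mkQ z))) = (D.balancedRel M n).mkQ ((D.resD n).lTensor M z) := by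
  have h1 : (D.tensorEquiv M (n + 1)).symm ((D.balancedRel M (n + 1)).mkQ z) =
    (hatEquiv k A H M (n + 1)).symm (coinvContr M (D.resEquiv (n + 1)) z) := rfl
  rw [h1]
  refine (congrArg (coinvEquiv M (D.resEquiv n) (D.resEquiv_left n) (D.resEquiv_right n))
    ((D.hatEquiv_hatD M n _).trans (congrArg _ (LinearEquiv.apply_symm_apply _ _)))).trans ?_
  exact coinvEquiv_extM M (D.resEquiv (n + 1)) (D.resEquiv n) (D.resEquiv_left n)
    (D.resEquiv_right n) (D.bd n) (D.resD n) (D.resEquiv_resD n) z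

end Coefficients

end CrossedProduct

/-! ### The structure maps on tuples -/

namespace CrossedProduct

variable {k A H : Type u} [CommRing k] [Ring A] [Algebra k A] [Ring H] [HopfAlgebra k H]
variable (D : CrossedProduct k A H)

section Recursions

theorem comulT_cons (n : ℕ) (h : H) (u : TPow k H n) : comulT k H (n + 1) (TPow.cons k n h u) =
    TensorProduct.map (TPow.succEquiv k H n).toLinearMap (TPow.succEquiv k H n).toLinearMap
      (TensorProduct.tensorTensorTensorComm k H H (TPow k H n) (TPow k H n)
        (Coalgebra.comul (R := k) h ⊗ₜ comulT k H n u)) := rfl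

theorem twist_tmul (h : H) (b : A) : twist D.act (h ⊗ₜ b) =
    (D.act.flip b).rTensor H (Coalgebra.comul (R := k) h) := by
  rw [twist]
  simp only [LinearMap.comp_apply, LinearMap.rTensor_tmul, LinearEquiv.coe_coe]
  generalize Coalgebra.comul (R := k) h = t
  induction t using TensorProduct.induction_on with
  | zero => simp
  | add x y hx hy => simp only [TensorProduct.add_tmul, map_add, hx, hy]
  | tmul x y => simp

theorem twistT_tmul (n : ℕ) (u : TPow k H n) (b : A) : D.twistT n (u ⊗ₜ b) =
    ((D.actT n).flip b).rTensor (TPow k H n) (comulT k H n u) := by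
  rw [twistT]
  simp only [LinearMap.comp_apply, LinearMap.rTensor_tmul, LinearEquiv.coe_coe]
  generalize comulT k H n u = t
  induction t using TensorProduct.induction_on with
  | zero => simp
  | add x y hx hy => simp only [TensorProduct.add_tmul, map_add, hx, hy]
  | tmul x y => simp

/-- `h ⊗ (b ⊗ u) ↦ b^{h⁽¹⁾} ⊗ (h⁽²⁾ ⊗ u)`. -/
def twCons (n : ℕ) : H ⊗[k] (A ⊗[k] TPow k H n) →ₗ[k] A ⊗[k] TPow k H (n + 1) :=
  (TPow.succEquiv k H n).toLinearMap.lTensor A ∘ₗ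
    (TensorProduct.assoc k A H (TPow k H n)).toLinearMap ∘ₗ
    (twist D.act).rTensor (TPow k H n) ∘ₗ
    (TensorProduct.assoc k H A (TPow k H n)).symm.toLinearMap

theorem lTensor_succEquiv_assoc (n : ℕ) (t : A ⊗[k] H) (u : TPow k H n) :
    (TPow.succEquiv k H n).toLinearMap.lTensor A (TensorProduct.assoc k A H (TPow k H n) (t ⊗ₜ u)) =
      ((TPow.cons k n).flip u).lTensor A t := by
  induction t using TensorProduct.induction_on with
  | zero => simp
  | add x y hx hy => simp only [TensorProduct.add_tmul, map_add, hx, hy]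
  | tmul x y => rfl

theorem twCons_tmul (n : ℕ) (h : H) (b : A) (u : TPow k H n) : D.twCons n (h ⊗ₜ (b ⊗ₜ u)) =
    ((TPow.cons k n).flip u).lTensor A (twist D.act (h ⊗ₜ b)) :=
  lTensor_succEquiv_assoc n _ u

theorem merge_zero_cons (n : ℕ) (h l : H) (u : TPow k H n) :
    D.merge (n + 1) 0 (TPow.cons k (n + 1) h (TPow.cons k n l u)) =
      ((TPow.cons k n).flip u).lTensor A (cocycleMul D.cocycle (h ⊗ₜ l)) :=
  lTensor_succEquiv_assoc n _ u

theorem merge_succ_cons (n i : ℕ) (h : H) (u : TPow k H (n + 1)) :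
    D.merge (n + 1) (i + 1) (TPow.cons k (n + 1) h u) = D.twCons n (h ⊗ₜ D.merge n i u) := rfl

theorem twistT_nil (b : A) : D.twistT 0 (TPow.nil k ⊗ₜ b) = b ⊗ₜ TPow.nil k := by
  have h : comulT k H 0 (TPow.nil k) = TPow.nil k ⊗ₜ TPow.nil k := by
    rw [comulT]
    simp [TPow.nil]
  have h2 : D.actT 0 (TPow.nil k) b = b := by
    rw [actT]
    simp [TPow.nil]
  rw [twistT_tmul, h, LinearMap.rTensor_tmul, LinearMap.flip_apply, h2]

/-- An element of A passes the last letter of the tuple first and h last, each time by the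
commutation rule of E. -/
theorem twistT_cons (n : ℕ) (h : H) (u : TPow k H n) (b : A) :
    D.twistT (n + 1) (TPow.cons k n h u ⊗ₜ b) = D.twCons n (h ⊗ₜ D.twistT n (u ⊗ₜ b)) := by
  rw [twistT_tmul, twistT_tmul, comulT_cons]
  generalize comulT k H n u = t
  induction t using TensorProduct.induction_on with
  | zero => simp
  | add x y hx hy => simp only [TensorProduct.tmul_add, map_add, hx, hy]
  | tmul x y =>
    rw [LinearMap.rTensor_tmul, twCons_tmul, twist_tmul]
    generalize Coalgebra.comul (R := k) h = t
    induction t using TensorProduct.induction_on with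
    | zero => simp
    | add x y hx hy => simp only [TensorProduct.add_tmul, map_add, hx, hy]
    | tmul l m => rfl

end Recursions

/-! ### Iterating y ↦ -P(h y) over a tuple of letters from H -/

section Operators

variable {Z : Type u} [AddCommGroup Z] [Module k Z] (r : H →ₗ[k] Module.End k Z)

/-- The product of operators `h₁ ⋯ hₙ`. -/
def prodR : (n : ℕ) → TPow k H n →ₗ[k] Module.End k Z
  | 0 => LinearMap.toSpanSingleton k _ LinearMap.id ∘ₗ (TPow.zeroEquiv k H).symm.toLinearMap
  | n + 1 => TPow.lift k n (((LinearMap.mul k (Module.End k Z)).comp r).compl₂ (prodR n))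

theorem prodR_nil (z : Z) : prodR r 0 (TPow.nil k) z = z := by
  rw [prodR]
  simp [TPow.nil]

theorem prodR_cons (n : ℕ) (h : H) (u : TPow k H n) (z : Z) :
    prodR r (n + 1) (TPow.cons k n h u) z = r h (prodR r n u z) := rfl

/-- `b ⊗ u ↦ b ⊗ u z`. -/
def evA (n : ℕ) (z : Z) : A ⊗[k] TPow k H n →ₗ[k] D.E ⊗[k] Z :=
  TensorProduct.map D.inA ((prodR r n).flip z)

theorem evA_tmul (n : ℕ) (z : Z) (b : A) (u : TPow k H n) :
    D.evA r n z (b ⊗ₜ u) = D.inA b ⊗ₜ prodR r n u z := rfl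

/-- `(b # l) ⊗ z ↦ - b₁ ⊗ l₁ z`, where `b₁ # l₁ = (1 # h) (b # l)`. -/
def opQ (h : H) : D.E ⊗[k] Z →ₗ[k] D.E ⊗[k] Z := -(D.incA _ ∘ₗ D.push r ∘ₗ lMul k _ (D.inH h))

theorem opQ_apply (h : H) (y : D.E ⊗[k] Z) :
    D.opQ r h y = -(D.incA _ (D.push r (lMul k _ (D.inH h) y))) := rfl

theorem incA_push_tmul (e : D.E) (n : ℕ) (u : TPow k H n) (z : Z) :
    D.incA _ (D.push r (e ⊗ₜ prodR r n u z)) =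
      D.evA r (n + 1) z (((TPow.cons k n).flip u).lTensor A (D.toTensor e)) := by
  induction e using E_induction with
  | h0 b l => rw [push_tmul, toTensor_inA_mul_inH]; rfl
  | hadd x y hx hy => simp only [TensorProduct.add_tmul, map_add, hx, hy]

theorem opQ_inH (h l : H) (n : ℕ) (u : TPow k H n) (z : Z) :
    D.opQ r h (D.inH l ⊗ₜ prodR r n u z) =
      -D.evA r (n + 1) z (((TPow.cons k n).flip u).lTensor A (cocycleMul D.cocycle (h ⊗ₜ l))) := by
  rw [opQ_apply, lMul_tmul, incA_push_tmul, toTensor_inH_mul_inH]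

theorem opQ_evA (h : H) (n : ℕ) (z : Z) (t : A ⊗[k] TPow k H n) :
    D.opQ r h (D.evA r n z t) = -D.evA r (n + 1) z (D.twCons n (h ⊗ₜ t)) := by
  induction t using TensorProduct.induction_on with
  | zero => simp
  | add x y hx hy =>
    simp only [TensorProduct.tmul_add, map_add, hx, hy, neg_add]
  | tmul b u =>
    rw [evA_tmul, opQ_apply, lMul_tmul, incA_push_tmul, toTensor_inH_mul_inA, twCons_tmul]

theorem opQ_one (h : H) (z : Z) : D.opQ r h (1 ⊗ₜ z) = -(1 ⊗ₜ r h z) := by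
  rw [opQ_apply, lMul_tmul, mul_one, push_inH, incA_tmul, inA_one]

/-- The composition of the operators `opQ`. -/
def opsQ : List H → D.E ⊗[k] Z →ₗ[k] D.E ⊗[k] Z
  | [] => LinearMap.id
  | h :: hs => D.opQ r h ∘ₗ opsQ hs

/-- Each step moves one letter past the coefficient from A and costs one sign. -/
theorem opsQ_inA (hs : List H) (b : A) (z : Z) : D.opsQ r hs (D.inA b ⊗ₜ z) =
    (-1 : k) ^ hs.length • D.evA r hs.length z (D.twistT hs.length (TPow.ofList k hs ⊗ₜ b)) := by
  induction hs with
  | nil =>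
    have : TPow.ofList k ([] : List H) = TPow.nil k := rfl
    change D.inA b ⊗ₜ z = (-1 : k) ^ 0 • D.evA r 0 z (D.twistT 0 (TPow.nil k ⊗ₜ b))
    rw [twistT_nil, evA_tmul, prodR_nil, pow_zero, one_smul]
  | cons h hs ih =>
    change D.opQ r h (D.opsQ r hs (D.inA b ⊗ₜ z)) = (-1 : k) ^ (hs.length + 1) •
      D.evA r (hs.length + 1) z
        (D.twistT (hs.length + 1) (TPow.cons k hs.length h (TPow.ofList k hs) ⊗ₜ b))
    rw [ih, map_smul, opQ_evA, twistT_cons, smul_neg, pow_succ, mul_neg, mul_one, neg_smul]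

/-- The terms of the differential that do not involve the last letter. -/
def leadR : List H → Z → D.E ⊗[k] Z
  | [], _ => 0
  | h :: hs, z => D.inH h ⊗ₜ prodR r _ (TPow.ofList k hs) z + D.opQ r h (leadR hs z)

/-- Unrolling the recursion: multiplying l ⊗ u by 1#h and pushing merges h with l through f, and
later letters carry the resulting coefficient from A further left. So the i-th term merges two
neighbours and twists f by everything before them. -/
theorem leadR_cons (h : H) (hs : List H) (z : Z) : D.leadR r (h :: hs) z =
    D.inH h ⊗ₜ prodR r _ (TPow.ofList k hs) z + ∑ i ∈ Finset.range hs.length,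
      (-1 : k) ^ (i + 1) • D.evA r hs.length z (D.merge hs.length i (TPow.ofList k (h :: hs))) := by
  induction hs generalizing h with
  | nil => simp [leadR]
  | cons l hs ih =>
    have h1 : TPow.ofList k (h :: l :: hs) = TPow.cons k (hs.length + 1) h (TPow.cons k hs.length l
      (TPow.ofList k hs)) := rfl
    have h2 : TPow.ofList k (h :: l :: hs) =
      TPow.cons k (hs.length + 1) h (TPow.ofList k (l :: hs)) := rfl
    change _ = _ + ∑ i ∈ Finset.range (hs.length + 1), (-1 : k) ^ (i + 1) •
      D.evA r (hs.length + 1) z (D.merge (hs.length + 1) i (TPow.ofList k (h :: l :: hs)))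
    rw [leadR, ih, Finset.sum_range_succ', map_add, map_sum]
    congr 1
    rw [opQ_inH, add_comm]
    congr 1
    · refine Finset.sum_congr rfl fun i _ => ?_
      rw [map_smul, opQ_evA, h2, merge_succ_cons, smul_neg, pow_succ _ (i + 1), mul_neg, mul_one,
        neg_smul]
    · rw [h1, merge_zero_cons]
      simp

/-- Naturality in the module of tails, which allows the same unrolled terms to be used for W ⊗ E and
for Y. -/
theorem opQ_map {Z' : Type u} [AddCommGroup Z'] [Module k Z'] (r' : H →ₗ[k] Module.End k Z')
    (φ : Z →ₗ[k] Z') (hφ : ∀ h z, φ (r h z) = r' h (φ z)) (h : H) (y : D.E ⊗[k] Z) :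
    φ.lTensor D.E (D.opQ r h y) = D.opQ r' h (φ.lTensor D.E y) := by
  rw [opQ_apply, opQ_apply, map_neg, lMul_lTensor]
  congr 1
  generalize lMul k Z (D.inH h) y = y
  induction y using ET_induction with
  | h0 b l z => simp [hφ]
  | hadd x y hx hy => simp only [map_add, hx, hy]

end Operators

end CrossedProduct

/-! ### The part of the differential of degree zero -/

theorem clsT_ofList {k B : Type u} [CommRing k] [Ring B] [Algebra k B] (l : List B) :
    clsT k B l.length (TPow.ofList k l) = clsL k l := toTensorAlgebra_redL l

theorem clsT_cons {k B : Type u} [CommRing k] [Ring B] [Algebra k B] (n : ℕ) (b : B)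
    (u : TPow k B n) : clsT k B (n + 1) (TPow.cons k n b u) = cls k B b * clsT k B n u := rfl

theorem clsT_nil {k B : Type u} [CommRing k] [Ring B] [Algebra k B] :
    clsT k B 0 (TPow.nil k) = 1 := clsT_ofList []

namespace CrossedProduct

variable {k A H : Type u} [CommRing k] [Ring A] [Algebra k A] [Ring H] [HopfAlgebra k H]
variable (D : CrossedProduct k A H)

theorem twistT_one (n : ℕ) (u : TPow k H n) : D.twistT n (u ⊗ₜ 1) = 1 ⊗ₜ u := by
  induction n with
  | zero => rw [TPow.zero_eq_smul u, ← TensorProduct.smul_tmul', map_smul, twistT_nil,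
      TensorProduct.tmul_smul]
  | succ n ih =>
    revert u
    suffices h : D.twistT (n + 1) ∘ₗ (TensorProduct.mk k _ A).flip 1 = TensorProduct.mk k A _ 1 from
      fun u => LinearMap.congr_fun h u
    refine TPow.ext_succ fun h u => ?_
    change D.twistT (n + 1) (TPow.cons k n h u ⊗ₜ 1) = 1 ⊗ₜ TPow.cons k n h u
    rw [twistT_cons, ih, twCons_tmul, twist_one_right]
    rfl

/-- `A ⊗ Ā^{⊗ n} ⊗ E → A ⊗ T(Ā) ⊗ E`. -/
def toTA (n : ℕ) : A ⊗[k] (TPow k (Red k A) n ⊗[k] D.E) →ₗ[k]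
    A ⊗[k] (TensorAlgebra k (Red k A) ⊗[k] D.E) :=
  ((TPow.toTensorAlgebra k n).rTensor D.E).lTensor A

/-- `b ⊗ v ⊗ e ↦ b v ⊗ e`. -/
def mulTA : A ⊗[k] (TensorAlgebra k (Red k A) ⊗[k] D.E) →ₗ[k] TensorAlgebra k (Red k A) ⊗[k] D.E :=
  TensorProduct.lift (LinearMap.rTensorHom D.E ∘ₗ LinearMap.mul k _ ∘ₗ cls k A)

theorem mulTA_tmul (b : A) (v : TensorAlgebra k (Red k A)) (e : D.E) :
    D.mulTA (b ⊗ₜ (v ⊗ₜ e)) = (cls k A b * v) ⊗ₜ e := rfl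

theorem toTA_kappa (n : ℕ) (b : A) (y : A ⊗[k] (TPow k (Red k A) n ⊗[k] D.E)) :
    D.toTA (n + 1) (D.kappa n (lMul k _ b y)) = 1 ⊗ₜ D.mulTA (lMul k _ b (D.toTA n y)) := by
  rw [kappa_apply, toTA, LinearMap.lTensor_tmul]
  congr 1
  induction y using TensorProduct.induction_on with
  | zero => simp
  | add x y hx hy => simp only [map_add, hx, hy]
  | tmul a z =>
    induction z using TensorProduct.induction_on with
    | zero => simp
    | add x y hx hy => simp only [TensorProduct.tmul_add, map_add, hx, hy]
    | tmul x e => rfl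

/-- The boundary of `1 ⊗ 𝐚 ⊗ 1`. -/
def barTA : List A → A ⊗[k] (TensorAlgebra k (Red k A) ⊗[k] D.E)
  | [] => 0
  | a₁ :: as => a₁ ⊗ₜ (clsL k as ⊗ₜ 1)
      + (-1 : k) ^ (as.length + 1) • 1 ⊗ₜ (clsL k (a₁ :: as).dropLast ⊗ₜ
          D.inA ((a₁ :: as).getLast (List.cons_ne_nil a₁ as)))
      + ∑ i ∈ Finset.range as.length, (-1 : k) ^ (i + 1) •
          1 ⊗ₜ ((clsL k ((a₁ :: as).take i) *
              cls k A ((a₁ :: as).getD i 0 * (a₁ :: as).getD (i + 1) 0) *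
              clsL k ((a₁ :: as).drop (i + 2))) ⊗ₜ 1)

set_option maxSynthPendingDepth 3 in
-- The alternating sum satisfies the recursion of δ: multiplying by a and prefixing shifts each
-- inner product one place, which costs a sign, and the term b ⊗ as becomes the product ab.
theorem barTA_cons_cons (a b : A) (as : List A) : D.barTA (a :: b :: as) =
    a ⊗ₜ (clsL k (b :: as) ⊗ₜ 1) - 1 ⊗ₜ D.mulTA (lMul k _ a (D.barTA (b :: as))) := by
  rw [barTA, barTA]
  simp only [map_add, map_smul, lMul_tmul, mul_one, mulTA_tmul, map_sum, TensorProduct.tmul_add,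
    TensorProduct.tmul_sum, TensorProduct.tmul_smul, List.length_cons, Finset.sum_range_succ' _ as.length]
  simp only [List.take_succ_cons, List.take_zero, clsL_nil, one_mul, clsL_cons, List.getD_cons_zero,
    List.getD_cons_succ, List.drop_succ_cons, List.drop_zero, List.dropLast_cons_cons,
    List.getLast_cons_cons, mul_assoc, pow_succ _ (_ + 1), mul_neg, mul_one, neg_smul,
    Finset.sum_neg_distrib, zero_add, pow_one, one_smul]
  abel

set_option maxSynthPendingDepth 3 in
theorem toTA_delta (a : A) (as : List A) :
    D.toTA as.length (D.delta as.length (redL k (a :: as))) = D.barTA (a :: as) := by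
  induction as generalizing a with
  | nil =>
    change D.toTA 0 (D.delta 0 (TPow.cons k 0 (red k a) (redL k []))) = _
    rw [delta_zero, map_sub, barTA]
    have h : TPow.toTensorAlgebra k 0 (redL k ([] : List A)) = clsL k ([] : List A) :=
      toTensorAlgebra_redL []
    simp only [toTA, LinearMap.lTensor_tmul, LinearMap.rTensor_tmul, h]
    simp [sub_eq_add_neg]
  | cons b as ih =>
    change D.toTA (as.length + 1) (D.delta (as.length + 1)
      (TPow.cons k (as.length + 1) (red k a) (redL k (b :: as)))) = _
    have h : TPow.toTensorAlgebra k (as.length + 1) (redL k (b :: as)) = clsL k (b :: as) :=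
      toTensorAlgebra_redL (b :: as)
    rw [delta_succ, map_sub, toTA_kappa, ih, barTA_cons_cons]
    simp only [toTA, LinearMap.lTensor_tmul, LinearMap.rTensor_tmul, h]

set_option maxSynthPendingDepth 3 in
theorem zEquiv_zT (h : H) (z : WordT k A H ⊗[k] D.E) : D.zEquiv (D.zT h z) =
    TensorProduct.map (LinearMap.mulLeft k (cls k H h)) ((sgnT k (Red k A)).toLinearMap.rTensor D.E)
      (D.zEquiv z) := by
  induction z using TensorProduct.induction_on with
  | zero => simp
  | add x y hx hy => simp only [map_add, hx, hy]
  | tmul w e =>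
    rw [zT_tmul, zEquiv_tmul, toTT_hT, zEquiv_tmul]
    generalize toTT k A H w = t
    induction t using TensorProduct.induction_on with
    | zero => simp
    | add x y hx hy => simp only [TensorProduct.add_tmul, map_add, hx, hy]
    | tmul x y => rfl

/-- Prefixing s letters from H to n letters from A costs (-1)^{ns} in the translation to tensors. -/
theorem zEquiv_prodR (s n : ℕ) (u : TPow k H s) (z : TPow k (Red k A) n ⊗[k] D.E) :
    D.zEquiv (prodR D.zT s u ((aT k A H n).rTensor D.E z)) =
      (-1 : k) ^ (n * s) • (clsT k H s u ⊗ₜ (TPow.toTensorAlgebra k n).rTensor D.E z) := by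
  have hs : (sgnT k (Red k A)).toLinearMap.rTensor D.E
      ((TPow.toTensorAlgebra k n).rTensor D.E z) =
      (-1 : k) ^ n • (TPow.toTensorAlgebra k n).rTensor D.E z := by
    induction z using TensorProduct.induction_on with
    | zero => simp
    | add x y hx hy => simp only [map_add, hx, hy, smul_add]
    | tmul x e =>
      rw [LinearMap.rTensor_tmul, LinearMap.rTensor_tmul, AlgHom.toLinearMap_apply,
        sgnT_toTensorAlgebra, TensorProduct.smul_tmul']
  induction s with
  | zero =>
    rw [TPow.zero_eq_smul u, map_smul, LinearMap.smul_apply, prodR_nil, map_smul, map_smul,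
      clsT_nil, ← TensorProduct.smul_tmul', mul_zero, pow_zero, one_smul]
    congr 1
    clear hs
    induction z using TensorProduct.induction_on with
    | zero => simp
    | add x y hx hy => simp only [TensorProduct.tmul_add, map_add, hx, hy]
    | tmul x e =>
      rw [LinearMap.rTensor_tmul, zEquiv_tmul, toTT_aT, TensorProduct.assoc_tmul,
        LinearMap.rTensor_tmul]
  | succ s ih =>
    revert u
    suffices h : D.zEquiv.toLinearMap ∘ₗ
        (prodR D.zT (s + 1)).flip ((aT k A H n).rTensor D.E z) =
        (-1 : k) ^ (n * (s + 1)) • (TensorProduct.mk k _ _).flip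
          ((TPow.toTensorAlgebra k n).rTensor D.E z) ∘ₗ clsT k H (s + 1) from
      fun u => LinearMap.congr_fun h u
    refine TPow.ext_succ fun h u => ?_
    change D.zEquiv (prodR D.zT (s + 1) (TPow.cons k s h u) ((aT k A H n).rTensor D.E z)) =
      (-1 : k) ^ (n * (s + 1)) • (clsT k H (s + 1) (TPow.cons k s h u) ⊗ₜ
          ((TPow.toTensorAlgebra k n).rTensor D.E z))
    rw [prodR_cons, zEquiv_zT, ih, map_smul, TensorProduct.map_tmul, hs, TensorProduct.tmul_smul,
      smul_smul, clsT_cons, Nat.mul_succ, pow_add]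
    rfl

/-- `b ⊗ z ↦ b^{𝐡⁽¹⁾} ⊗ 𝐡⁽²⁾ ⊗ z`. -/
def moveL (hs : List H) : A ⊗[k] (TensorAlgebra k (Red k A) ⊗[k] D.E) →ₗ[k] D.ResTot :=
  TensorProduct.lift (LinearMap.mk₂ k (fun b z =>
    TensorProduct.map D.inA ((TensorProduct.mk k _ _).flip z ∘ₗ clsT k H hs.length)
      (D.twistT hs.length (TPow.ofList k hs ⊗ₜ b)))
    (fun b b' z => by rw [TensorProduct.tmul_add, map_add, map_add])
    (fun c b z => by rw [TensorProduct.tmul_smul, map_smul, map_smul])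
    (fun b z z' => by
      rw [map_add, LinearMap.add_comp, TensorProduct.map_add_right, LinearMap.add_apply])
    (fun c b z => by
      rw [map_smul, LinearMap.smul_comp, TensorProduct.map_smul_right, LinearMap.smul_apply]))

theorem moveL_tmul (hs : List H) (b : A) (z : TensorAlgebra k (Red k A) ⊗[k] D.E) :
    D.moveL hs (b ⊗ₜ z) =
    TensorProduct.map D.inA ((TensorProduct.mk k _ _).flip z ∘ₗ clsT k H hs.length)
      (D.twistT hs.length (TPow.ofList k hs ⊗ₜ b)) := rfl

theorem moveL_one (hs : List H) (z : TensorAlgebra k (Red k A) ⊗[k] D.E) :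
    D.moveL hs (1 ⊗ₜ z) = 1 ⊗ₜ (clsL k hs ⊗ₜ z) := by
  rw [moveL_tmul, twistT_one, TensorProduct.map_tmul, inA_one, LinearMap.comp_apply, clsT_ofList]
  rfl

/-- Of the exponent, n times the number of letters is the translation of words to tensors, and one
more multiple comes from the sign of each push. -/
theorem totEquiv_opsQ (hs : List H) (n : ℕ) (y : A ⊗[k] (TPow k (Red k A) n ⊗[k] D.E)) :
    D.totEquiv (D.opsQ D.zT hs (D.incKT n y)) =
      (-1 : k) ^ ((n + 1) * hs.length) • D.moveL hs (D.toTA n y) := by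
  induction y using TensorProduct.induction_on with
  | zero => simp
  | add x y hx hy => simp only [map_add, hx, hy, smul_add]
  | tmul a z =>
    have h : D.incKT n (a ⊗ₜ z) = D.inA a ⊗ₜ (aT k A H n).rTensor D.E z := rfl
    rw [h, opsQ_inA, map_smul, toTA, LinearMap.lTensor_tmul, moveL_tmul, add_mul, one_mul, add_comm,
      pow_add, ← smul_smul]
    congr 1
    generalize D.twistT hs.length (TPow.ofList k hs ⊗ₜ a) = t
    induction t using TensorProduct.induction_on with
    | zero => simp
    | add x y hx hy => simp only [map_add, hx, hy, smul_add]
    | tmul b u =>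
      rw [evA_tmul, totEquiv_tmul, zEquiv_prodR, TensorProduct.tmul_smul]
      rfl

theorem bdL_zero_eq_opsQ (hs : List H) (a : List A) :
    D.bdL 0 (mono k hs a) = D.opsQ D.zT hs (D.bdT (mono k [] a)) := by
  induction hs with
  | nil => exact D.bdL_zero_aT _ _
  | cons h hs ih => rw [bdL_zero_cons, ih]; rfl

theorem resD0_eq (e e' : D.E) (h : List H) (a : List A) :
    D.resD0 e h e' a = D.totLeft e (D.totRight e' (D.moveL h (D.barTA a))) := by
  cases a with
  | nil => simp [resD0, barTA]
  | cons a as =>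
    rw [resD0, barTA]
    simp only [map_add, map_smul, map_sum, moveL_one]
    have h1 : ∀ v (x : D.E), D.totLeft e (D.totRight e' (1 ⊗ₜ (clsL k h ⊗ₜ (v ⊗ₜ x)))) =
        e ⊗ₜ (clsL k h ⊗ₜ (v ⊗ₜ (x * e'))) := by
      intro v x
      simp [totLeft, totRight]
    simp only [h1, one_mul]
    congr 2
    rw [moveL_tmul]
    generalize D.twistT h.length (TPow.ofList k h ⊗ₜ a) = t
    induction t using TensorProduct.induction_on with
    | zero => simp
    | add x y hx hy => simp only [map_add, hx, hy]
    | tmul b u => simp [totLeft, totRight, mulA]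

/-- The part of the differential involving the letters from `A` only. -/
theorem totEquiv_opsQ_bdT (h : List H) (a : List A) :
    D.totEquiv (D.opsQ D.zT h (D.bdT (mono k [] a))) =
      (-1 : k) ^ (a.length * h.length) • D.resD0 1 h 1 a := by
  have h1 : ∀ x, D.totLeft 1 (D.totRight 1 x) = x := by
    intro x
    simp [totLeft, totRight]
  rw [resD0_eq, h1]
  cases a with
  | nil => simp [bdT_mono_nil_nil, barTA]
  | cons a as => rw [bdT_mono_nil_cons, totEquiv_opsQ, toTA_delta]; rfl

/-- The component d⁰ is the bar differential of A carried through the letters from H. Its sign is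
(-1)^{rs}, which cancels against that of the translation. -/
theorem resDl_zero_apply (e e' : D.E) (h : List H) (a : List A) :
    D.resDl 0 (e ⊗ₜ (clsL k h ⊗ₜ (clsL k a ⊗ₜ e'))) = D.resD0 e h e' a := by
  have h1 : ∀ x, D.totLeft 1 (D.totRight 1 x) = x := by
    intro x
    simp [totLeft, totRight]
  have h2 := D.totEquiv_opsQ_bdT h a
  rw [resDl_apply, ← totLeft_totEquiv, ← totRight_totEquiv, bdL_zero_eq_opsQ, h2, map_smul, map_smul,
    neg_one_pow_smul_smul, resD0_eq, resD0_eq, h1]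

section Hat

variable {M : Type u} [AddCommGroup M] [Module k M] [Module D.E M] [Module D.Eᵐᵒᵖ M]
  [IsScalarTower k D.E M] [IsScalarTower k D.Eᵐᵒᵖ M]

theorem contrTot_resD0 (m : M) (h : List H) (a : List A) :
    D.contrTot M (m ⊗ₜ D.resD0 1 h 1 a) = D.hatD0 m h a := by
  cases a with
  | nil => simp [resD0, hatD0]
  | cons a as =>
    rw [resD0, hatD0]
    simp only [TensorProduct.tmul_add, TensorProduct.tmul_sum, TensorProduct.tmul_smul, map_add,
      map_smul, map_sum, contrTot_clsL, mul_one, MulOpposite.op_one, one_smul]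
    congr 2
    generalize D.twistT h.length (TPow.ofList k h ⊗ₜ a) = t
    induction t using TensorProduct.induction_on with
    | zero => simp
    | add x y hx hy => simp only [TensorProduct.tmul_add, map_add, hx, hy]
    | tmul b u =>
      rw [TensorProduct.map_tmul, TensorProduct.map_tmul]
      change D.contrTot M (m ⊗ₜ ((1 * D.inA b) ⊗ₜ (clsT k H h.length u ⊗ₜ (clsL k as ⊗ₜ 1)))) = _
      rw [contrTot_clsL, one_mul, one_smul]
      rfl

end Hat

end CrossedProduct

namespace CrossedProduct

variable {k A H : Type u} [CommRing k] [Ring A] [Algebra k A] [Ring H] [HopfAlgebra k H]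
variable (D : CrossedProduct k A H)

/-! ### The differential of `Y` -/

variable (k H) in
/-- `⨁_s H̄^{⊗ s} ⊗ H`, with a unit for the product of tensors adjoined. -/
abbrev TailT : Type u := k × (TensorAlgebra k (Red k H) ⊗[k] H)

/-- Left multiplication on `T(H̄) ⊗ H`. -/
def yR : H →ₗ[k] Module.End k (TensorAlgebra k (Red k H) ⊗[k] H) :=
  LinearMap.rTensorHom H ∘ₗ LinearMap.mul k _ ∘ₗ cls k H

theorem yR_tmul (h : H) (u : TensorAlgebra k (Red k H)) (l : H) :
    yR (k := k) h (u ⊗ₜ l) = (cls k H h * u) ⊗ₜ l := rfl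

/-- Left multiplication by `h`, where `h · 1 = h` for the adjoined unit. -/
def yZ : H →ₗ[k] Module.End k (TailT k H) :=
  LinearMap.mk₂ k (fun h z => (0, z.1 • (1 ⊗ₜ h) + yR h z.2))
    (fun h h' z => by ext <;> simp [TensorProduct.tmul_add]; abel)
    (fun c h z => Prod.ext (by simp) (by
      change z.1 • (1 ⊗ₜ (c • h)) + yR (c • h) z.2 = c • (z.1 • (1 ⊗ₜ h) + yR h z.2)
      rw [TensorProduct.tmul_smul, map_smul, LinearMap.smul_apply, smul_add, smul_comm]))
    (fun h z z' => by ext <;> simp [add_smul]; abel)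
    (fun c h z => by ext <;> simp [mul_smul])

theorem yZ_unit (h : H) : yZ (k := k) h (1, 0) = (0, 1 ⊗ₜ h) := by
  change ((0 : k), (1 : k) • ((1 : TensorAlgebra k (Red k H)) ⊗ₜ h) + yR h 0) = _
  simp

theorem yZ_inr (h : H) (y : TensorAlgebra k (Red k H) ⊗[k] H) :
    yZ (k := k) h (0, y) = (0, yR h y) := by
  change ((0 : k), (0 : k) • ((1 : TensorAlgebra k (Red k H)) ⊗ₜ h) + yR h y) = _
  simp

theorem yR_one (y : TensorAlgebra k (Red k H) ⊗[k] H) : yR (k := k) 1 y = 0 := by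
  have : cls k H (1 : H) = 0 := by rw [cls_eq, red_one, map_zero]
  rw [yR, LinearMap.comp_apply, LinearMap.comp_apply, this]
  simp

/-- The purpose of the adjoined unit: a letter in front of a nonempty tail is read in H̄, so 1 gives
zero, but a letter in front of the unit is the last factor of Y and stays in H, where 1 survives. -/
theorem yZ_one_yZ (h : H) (z : TailT k H) : yZ (k := k) 1 (yZ h z) = 0 := by
  have : yZ (k := k) h z = (0, (yZ (k := k) h z).2) := rfl
  rw [this, yZ_inr, yR_one]
  rfl

theorem prodR_yZ (n : ℕ) (u : TPow k H (n + 1)) :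
    prodR yZ (n + 1) u ((1, 0) : TailT k H) = (0, yT (n + 1) u) := by
  induction n with
  | zero =>
    revert u
    suffices h : (prodR yZ 1).flip ((1, 0) : TailT k H) = LinearMap.inr k _ _ ∘ₗ yT 1 from
      fun u => LinearMap.congr_fun h u
    refine TPow.ext_succ fun h u => ?_
    rw [TPow.zero_eq_smul u]
    have h1 : (prodR yZ 1).flip ((1, 0) : TailT k H) (TPow.cons k 0 h (TPow.nil k)) =
      yZ h (prodR yZ 0 (TPow.nil k) (1, 0)) := rfl
    have h2 : yT 1 (TPow.cons k 0 h (TPow.nil k)) = clsT k H 0 (TPow.nil k) ⊗ₜ h := rfl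
    rw [map_smul, map_smul, map_smul, h1, prodR_nil, yZ_unit, LinearMap.comp_apply, h2, clsT_nil]
    rfl
  | succ n ih =>
    revert u
    suffices h : (prodR yZ (n + 2)).flip ((1, 0) : TailT k H) = LinearMap.inr k _ _ ∘ₗ yT (n + 2) from
      fun u => LinearMap.congr_fun h u
    refine TPow.ext_succ fun h u => ?_
    change yZ h (prodR yZ (n + 1) u (1, 0)) = (0, (clsT k H (n + 1)).rTensor H
      (TPow.unsnoc k (n + 1) (TPow.cons k (n + 1) h u)))
    rw [ih, yZ_inr, TPow.unsnoc_succ_cons, yT, LinearMap.comp_apply]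
    congr 1
    generalize TPow.unsnoc k n u = t
    induction t using TensorProduct.induction_on with
    | zero => simp
    | add x y hx hy => simp only [map_add, hx, hy]
    | tmul x y => rfl

theorem opQ_add {Z : Type u} [AddCommGroup Z] [Module k Z] (r : H →ₗ[k] Module.End k Z)
    (h h' : H) (y : D.E ⊗[k] Z) : D.opQ r (h + h') y = D.opQ r h y + D.opQ r h' y := by
  simp only [opQ_apply, map_add, LinearMap.add_apply, neg_add]

theorem opQ_smul {Z : Type u} [AddCommGroup Z] [Module k Z] (r : H →ₗ[k] Module.End k Z)
    (c : k) (h : H) (y : D.E ⊗[k] Z) : D.opQ r (c • h) y = c • D.opQ r h y := by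
  simp only [opQ_apply, map_smul, LinearMap.smul_apply, smul_neg]

/-- The recursion step for `delY`. -/
def delYSucc {n : ℕ} (g : TPow k (Red k H) n →ₗ[k] H →ₗ[k] D.E ⊗[k] TailT k H) :
    H →ₗ[k] TPow k (Red k H) n →ₗ[k] H →ₗ[k] D.E ⊗[k] TailT k H :=
  LinearMap.mk₂ k (fun h u => TensorProduct.mk k D.E (TailT k H) (D.inH h) ∘ₗ LinearMap.inr k _ _ ∘ₗ
      TensorProduct.mk k _ H (TPow.toTensorAlgebra k n u) + D.opQ yZ h ∘ₗ g u)
    (fun h h' u => LinearMap.ext fun l => by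
      simp only [LinearMap.add_apply, LinearMap.comp_apply, map_add, opQ_add]; abel)
    (fun c h u => LinearMap.ext fun l => by
      simp only [LinearMap.add_apply, LinearMap.smul_apply, LinearMap.comp_apply, map_smul, opQ_smul,
        smul_add])
    (fun h u u' => LinearMap.ext fun l => by
      simp only [LinearMap.add_apply, LinearMap.comp_apply, map_add]; abel)
    (fun c h u => LinearMap.ext fun l => by
      simp only [LinearMap.add_apply, LinearMap.smul_apply, LinearMap.comp_apply, map_smul, smul_add])

set_option maxSynthPendingDepth 3 in
/-- The differential of `1 ⊗ 𝐡 ⊗ l`, up to sign. -/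
def delY : (n : ℕ) → TPow k (Red k H) n →ₗ[k] H →ₗ[k] D.E ⊗[k] TailT k H
  | 0 => (LinearMap.lsmul k (H →ₗ[k] D.E ⊗[k] TailT k H)).flip
      ((TensorProduct.mk k D.E (TailT k H)).flip (1, 0) ∘ₗ D.inH) ∘ₗ
      (TPow.zeroEquiv k (Red k H)).symm.toLinearMap
  | n + 1 => TPow.lift k n (redLift (D.delYSucc (delY n)))

theorem delY_nil (l : H) : D.delY 0 (TPow.nil k) l = D.inH l ⊗ₜ (1, 0) := by
  change (1 : k) • (D.inH l ⊗ₜ[k] ((1, 0) : TailT k H)) = _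
  rw [one_smul]

set_option maxSynthPendingDepth 3 in
-- As for ∂ on words: the first claim is exactly the vanishing of the recursion at h = 1, and it is
-- reproduced by the recursion because a second push prefixes the letter 1.
theorem delY_succ_and (n : ℕ) :
    (∀ u l, D.incA _ (D.push yZ (D.delY n u l)) =
      1 ⊗ₜ ((0, TPow.toTensorAlgebra k n u ⊗ₜ l) : TailT k H)) ∧
    ∀ h u l, D.delY (n + 1) (TPow.cons k n (red k h) u) l =
      D.inH h ⊗ₜ ((0, TPow.toTensorAlgebra k n u ⊗ₜ l) : TailT k H) + D.opQ yZ h (D.delY n u l) := by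
  have key : ∀ n, (∀ u l, D.incA _ (D.push yZ (D.delY n u l)) =
      1 ⊗ₜ ((0, TPow.toTensorAlgebra k n u ⊗ₜ l) : TailT k H)) →
      ∀ h u l, D.delY (n + 1) (TPow.cons k n (red k h) u) l =
      D.inH h ⊗ₜ ((0, TPow.toTensorAlgebra k n u ⊗ₜ l) : TailT k H) +
        D.opQ yZ h (D.delY n u l) := by
    intro n hn h u l
    rw [delY, TPow.lift_cons, redLift_red]
    · rfl
    · refine LinearMap.ext fun u => LinearMap.ext fun l => ?_
      change D.inH 1 ⊗ₜ ((0, TPow.toTensorAlgebra k n u ⊗ₜ l) : TailT k H) +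
        D.opQ yZ 1 (D.delY n u l) = 0
      rw [opQ_apply, inH_one, lMul_one, hn, add_neg_cancel]
  induction n with
  | zero =>
    refine (fun hn => ⟨hn, key 0 hn⟩) fun u l => ?_
    rw [TPow.zero_eq_smul u, map_smul, map_smul, LinearMap.smul_apply, map_smul, map_smul, delY_nil,
      push_inH, incA_tmul, inA_one, yZ_unit, toTensorAlgebra_nil, ← TensorProduct.tmul_smul,
      ← TensorProduct.smul_tmul', Prod.smul_mk, smul_zero]
  | succ n ih =>
    refine (fun hn => ⟨hn, key (n + 1) hn⟩) fun u l => ?_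
    induction u using TPow.induction_red with
    | h h u =>
      have h0 : ∀ x : D.E ⊗[k] TailT k H, D.push yZ (D.incA _ (D.push yZ x)) = 0 := by
        intro x
        induction x using ET_induction with
        | h0 b m z =>
          have := D.push_tmul (yZ (k := k)) b 1 (yZ m z)
          rw [inH_one, mul_one] at this
          rw [push_tmul, incA_tmul, this, yZ_one_yZ, TensorProduct.tmul_zero]
        | hadd x y hx hy => simp only [map_add, hx, hy, add_zero]
      rw [ih.2, map_add, map_add, push_inH, incA_tmul, inA_one, yZ_inr, opQ_apply, map_neg, h0,
        neg_zero, map_zero, add_zero]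
      rfl
    | hadd x y hx hy =>
      simp only [map_add, LinearMap.add_apply, hx, hy, TensorProduct.add_tmul]
      rw [← TensorProduct.tmul_add, Prod.mk_add_mk, add_zero]

theorem delY_succ (n : ℕ) (h : H) (u : TPow k (Red k H) n) (l : H) :
    D.delY (n + 1) (TPow.cons k n (red k h) u) l =
      D.inH h ⊗ₜ ((0, TPow.toTensorAlgebra k n u ⊗ₜ l) : TailT k H) + D.opQ yZ h (D.delY n u l) :=
  (D.delY_succ_and n).2 h u l

theorem delY_redL (hs : List H) (l : H) :
    D.delY hs.length (redL k hs) l = D.leadR yZ (hs ++ [l]) (1, 0) := by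
  induction hs with
  | nil =>
    refine (D.delY_nil l).trans ?_
    have : TPow.ofList k ([] : List H) = TPow.nil k := rfl
    change _ = D.inH l ⊗ₜ prodR yZ 0 (TPow.ofList k ([] : List H)) ((1, 0) : TailT k H) + D.opQ yZ l 0
    rw [this, prodR_nil, map_zero, add_zero]
  | cons h hs ih =>
    change D.delY (hs.length + 1) (TPow.cons k hs.length (red k h) (redL k hs)) l = D.inH h ⊗ₜ
      prodR yZ _ (TPow.ofList k (hs ++ [l])) ((1, 0) : TailT k H) + D.opQ yZ h (D.leadR yZ (hs ++ [l]) _)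
    rw [delY_succ, ih, toTensorAlgebra_redL]
    congr 2
    clear ih
    induction hs with
    | nil =>
      change _ = yZ l (prodR yZ 0 (TPow.nil k) (1, 0))
      rw [prodR_nil, yZ_unit, clsL_nil]
    | cons m hs ih =>
      change _ = yZ m (prodR yZ _ (TPow.ofList k (hs ++ [l])) (1, 0))
      rw [← ih, yZ_inr, yR_tmul, clsL_cons]

/-- The differential of `Y`. -/
def yDel : D.YTot →ₗ[k] D.YTot :=
  -leftExt ((LinearMap.snd k k _).lTensor D.E ∘ₗ TensorProduct.lift
    (DirectSum.toModule k ℕ _ D.delY ∘ₗ tensorSplit k (Red k H)))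

theorem yDel_tmul (e : D.E) (hs : List H) (l : H) : D.yDel (e ⊗ₜ (clsL k hs ⊗ₜ l)) =
    -lMul k _ e ((LinearMap.snd k k _).lTensor D.E (D.leadR yZ (hs ++ [l]) (1, 0))) := by
  rw [yDel, LinearMap.neg_apply, leftExt_tmul, LinearMap.comp_apply, TensorProduct.lift.tmul,
    LinearMap.comp_apply, tensorSplit_clsL, DirectSum.toModule_lof, delY_redL]

theorem yT_ofList (h : H) (hs : List H) : yT (hs.length + 1) (TPow.ofList k (h :: hs)) =
    clsL k (h :: hs).dropLast ⊗ₜ (h :: hs).getLast (List.cons_ne_nil h hs) := by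
  induction hs generalizing h with
  | nil =>
    have h2 : yT 1 (TPow.ofList k [h]) = clsT k H 0 (TPow.nil k) ⊗ₜ h := rfl
    refine h2.trans ?_
    rw [clsT_nil, List.dropLast_singleton, clsL_nil, List.getLast_singleton]
  | cons l hs ih =>
    change (clsT k H (hs.length + 1)).rTensor H (TPow.unsnoc k (hs.length + 1)
      (TPow.cons k (hs.length + 1) h (TPow.ofList k (l :: hs)))) = _
    have h1 : yT (hs.length + 1) (TPow.ofList k (l :: hs)) = (clsT k H hs.length).rTensor H
      (TPow.unsnoc k hs.length (TPow.ofList k (l :: hs))) := rfl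
    rw [List.dropLast_cons_cons, List.getLast_cons_cons, clsL_cons, ← yR_tmul, ← ih, h1,
      TPow.unsnoc_succ_cons]
    generalize TPow.unsnoc k hs.length (TPow.ofList k (l :: hs)) = t
    induction t using TensorProduct.induction_on with
    | zero => simp
    | add x y hx hy => simp only [map_add, hx, hy]
    | tmul x y => rfl

/-- The unrolled recursion is, up to an overall sign, the alternating sum of the statement. A single
letter leaves only the adjoined unit, which the projection to Y drops; this is ∂ = 0 on Y_0. -/
theorem yDel_apply (e : D.E) (h : List H) (hn : h ≠ []) :
    D.yDel (e ⊗ₜ yT h.length (TPow.ofList k h)) = D.yD e h := by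
  match h, hn with
  | h₁ :: tl, hn =>
    have h1 := D.yDel_tmul e (h₁ :: tl).dropLast ((h₁ :: tl).getLast (List.cons_ne_nil h₁ tl))
    rw [List.dropLast_append_getLast, leadR_cons] at h1
    refine (congrArg (fun t => D.yDel (e ⊗ₜ t)) (yT_ofList h₁ tl)).trans (h1.trans ?_)
    clear h1
    cases tl with
    | nil =>
      have h2 : prodR yZ ([] : List H).length (TPow.ofList k ([] : List H)) ((1, 0) : TailT k H) =
        (1, 0) := prodR_nil _ _
      rw [h2]
      simp [yD]
    | cons h₂ hs =>
      have h2 : prodR yZ (h₂ :: hs).length (TPow.ofList k (h₂ :: hs)) ((1, 0) : TailT k H) =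
        (0, yT (hs.length + 1) (TPow.ofList k (h₂ :: hs))) := prodR_yZ _ _
      have h3 : ∀ i, lMul k _ e ((LinearMap.snd k k _).lTensor D.E (D.evA yZ (hs.length + 1)
          ((1, 0) : TailT k H)
          (D.merge (hs.length + 1) i (TPow.ofList k (h₁ :: h₂ :: hs))))) =
          TensorProduct.map (D.mulA e) (yT (hs.length + 1))
            (D.merge (hs.length + 1) i (TPow.ofList k (h₁ :: h₂ :: hs))) := by
        intro i
        generalize D.merge (hs.length + 1) i (TPow.ofList k (h₁ :: h₂ :: hs)) = t
        induction t using TensorProduct.induction_on with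
        | zero => simp
        | add x y hx hy => simp only [map_add, hx, hy]
        | tmul b u => rw [evA_tmul, prodR_yZ]; rfl
      rw [h2, yD, map_add, map_add, map_sum, map_sum, neg_add, ← Finset.sum_neg_distrib,
        LinearMap.lTensor_tmul, lMul_tmul]
      refine congrArg _ (Finset.sum_congr rfl fun i _ => ?_)
      rw [map_smul, map_smul, ← h3, pow_succ, mul_neg, mul_one, neg_smul, neg_neg]
      rfl

/-- `𝐡 ⊗ l ↦ 𝐡 ⊗ (1 # l)`. -/
def yW : TensorAlgebra k (Red k H) ⊗[k] H →ₗ[k] WordT k A H ⊗[k] D.E :=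
  TensorProduct.map ((equivTT k A H).symm.toLinearMap ∘ₗ (TensorProduct.mk k _ _).flip 1) D.inH

theorem yW_yR (h : H) (y : TensorAlgebra k (Red k H) ⊗[k] H) :
    D.yW (yR h y) = D.zT h (D.yW y) := by
  induction y using TensorProduct.induction_on with
  | zero => simp
  | add x y hx hy => simp only [map_add, hx, hy]
  | tmul u l =>
    rw [yR_tmul, yW, TensorProduct.map_tmul, TensorProduct.map_tmul, zT_tmul]
    congr 1
    rw [LinearMap.comp_apply, LinearMap.comp_apply, LinearEquiv.coe_coe, LinearEquiv.symm_apply_eq,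
      equivTT_apply, toTT_hT, ← equivTT_apply, LinearEquiv.apply_symm_apply, LinearMap.flip_apply,
      TensorProduct.mk_apply, LinearMap.flip_apply, TensorProduct.mk_apply, LinearMap.lTensor_tmul,
      AlgHom.toLinearMap_apply, map_one]
    rfl

theorem yW_clsL (hs : List H) (l : H) : D.yW (clsL k hs ⊗ₜ l) = mono k hs [] ⊗ₜ D.inH l := by
  have h := equivTT_symm_clsL (k := k) hs ([] : List A)
  rw [clsL_nil, List.length_nil, zero_mul, pow_zero, one_smul] at h
  rw [yW, TensorProduct.map_tmul, ← h]
  rfl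

theorem sigmaY_eq (y : D.YTot) : D.sigmaY y = D.totEquiv (D.yW.lTensor D.E y) := by
  induction y using TensorProduct.induction_on with
  | zero => simp
  | add x y hx hy => simp only [map_add, hx, hy]
  | tmul e y =>
    rw [LinearMap.lTensor_tmul, totEquiv_tmul, sigmaY, LinearMap.lTensor_tmul]
    congr 1
    induction y using TensorProduct.induction_on with
    | zero => simp
    | add x y hx hy => simp only [map_add, hx, hy]
    | tmul u l =>
      rw [yW, TensorProduct.map_tmul, LinearMap.comp_apply, zEquiv_tmul, LinearEquiv.coe_coe,
        ← equivTT_apply, LinearEquiv.apply_symm_apply]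
      rfl

theorem tailT_nil_nil (h : H) :
    D.tailT h (mono k [] ([] : List A)) = -(mono k [] ([] : List A) ⊗ₜ D.inH h) := by
  have h1 := D.tailT_of h 0 (Word.ofA k A H 0 (TPow.nil k))
  rw [theta_tmul, rMul_one, gT_zero, LinearMap.lTensor_tmul, map_neg, LinearMap.rTensor_tmul] at h1
  exact h1

/-- For r = 0 the component d¹ and the differential of Y at last letter 1 follow the same recursion.
In the base case, merging the last letter h with 1 gives back h, which matches the tail Θ(h,1) =
-(1#h). The witness y is carried along because the lead terms have no component at the adjoined
unit. -/
theorem exists_leadR_eq_bdL (h : H) (hs : List H) : ∃ y : D.YTot,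
    D.leadR yZ (h :: (hs ++ [1])) (1, 0) = (LinearMap.inr k k _).lTensor D.E y ∧
    D.yW.lTensor D.E y = D.bdL 1 (mono k (h :: hs) []) := by
  have hY : ∀ h (y : D.YTot), D.opQ yZ h ((LinearMap.inr k k _).lTensor D.E y) =
      (LinearMap.inr k k _).lTensor D.E (D.opQ yR h y) := fun h y =>
    (D.opQ_map yR yZ (LinearMap.inr k k _) (fun h z => (yZ_inr h z).symm) h y).symm
  have hW : ∀ h (y : D.YTot), D.yW.lTensor D.E (D.opQ yR h y) =
      D.opQ D.zT h (D.yW.lTensor D.E y) := D.opQ_map yR D.zT D.yW D.yW_yR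
  induction hs generalizing h with
  | nil =>
    refine ⟨D.inH h ⊗ₜ (1 ⊗ₜ 1) - 1 ⊗ₜ (1 ⊗ₜ h), ?_, ?_⟩
    · change D.inH h ⊗ₜ prodR yZ 1 (TPow.ofList k [1]) ((1, 0) : TailT k H) + D.opQ yZ h
        (D.inH 1 ⊗ₜ prodR yZ 0 (TPow.nil k) ((1, 0) : TailT k H) + D.opQ yZ 1 0) = _
      have h1 : prodR yZ 1 (TPow.ofList k [(1 : H)]) ((1, 0) : TailT k H) =
        (0, clsT k H 0 (TPow.nil k) ⊗ₜ 1) := prodR_yZ 0 _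
      rw [h1, prodR_nil, map_zero, add_zero, inH_one, opQ_one, yZ_unit, clsT_nil, ← sub_eq_add_neg,
        map_sub]
      rfl
    · rw [bdL_mono, if_pos (by simp), map_sub, LinearMap.lTensor_tmul, LinearMap.lTensor_tmul,
        ← clsL_nil (k := k) (B := H), yW_clsL, yW_clsL]
      change _ = D.piB 0 (D.bdT (hT h (mono k [] [])))
      rw [bdT_hT, map_add, map_sub, piB_pushW_zero, piB_tailT, if_pos rfl, piB_tmul, piT_mono,
        if_pos List.length_nil, tailT_nil_nil, inH_one, TensorProduct.tmul_neg, sub_zero, sub_eq_add_neg]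
  | cons l hs ih =>
    obtain ⟨y, h1, h2⟩ := ih l
    refine ⟨D.inH h ⊗ₜ (clsL k (l :: hs) ⊗ₜ 1) + D.opQ yR h y, ?_, ?_⟩
    · have h3 : (l :: (hs ++ [1])).dropLast = l :: hs := by
        rw [← List.cons_append, List.dropLast_concat]
      have h4 : ∀ hn, (l :: (hs ++ [1])).getLast hn = 1 := by simp
      have h5 : prodR yZ (l :: (hs ++ [1])).length (TPow.ofList k (l :: (hs ++ [1])))
          ((1, 0) : TailT k H) = (0, yT ((hs ++ [1]).length + 1) (TPow.ofList k (l :: (hs ++ [1])))) :=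
        prodR_yZ _ _
      rw [yT_ofList, h3, h4] at h5
      rw [List.cons_append, leadR, h1, hY, h5, map_add]
      rfl
    · rw [map_add, LinearMap.lTensor_tmul, yW_clsL, hW, h2, bdL_mono, if_pos (by simp), bdL_mono,
        if_pos (by simp)]
      change _ = D.piB (hs.length + 1) (D.bdT (hT h (mono k (l :: hs) [])))
      rw [bdT_hT, map_add, map_sub, piB_pushW_succ, piB_lMul, piB_tailT, if_neg (by omega), piB_tmul,
        piT_mono, if_pos (by simp), add_zero, inH_one, sub_eq_add_neg]
      rfl

theorem resDl_one_nil (h : List H) (hn : 1 ≤ h.length) :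
    D.resDl 1 (1 ⊗ₜ (clsL k h ⊗ₜ (clsL k ([] : List A) ⊗ₜ 1))) =
      -D.sigmaY (D.yDel (1 ⊗ₜ (clsL k h ⊗ₜ 1))) := by
  match h, hn with
  | h :: hs, hn =>
    obtain ⟨y, h1, h2⟩ := D.exists_leadR_eq_bdL h hs
    have h3 : (LinearMap.snd k k _).lTensor D.E ((LinearMap.inr k k _).lTensor D.E y) = y := by
      rw [← LinearMap.comp_apply, ← LinearMap.lTensor_comp, LinearMap.snd_comp_inr,
        LinearMap.lTensor_id, LinearMap.id_apply]
    rw [resDl_apply_one, yDel_tmul, lMul_one, List.cons_append, h1, h3, map_neg, neg_neg, sigmaY_eq,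
      h2]
    simp

end CrossedProduct

/-! ### The coalgebra of tuples -/

section TupleCoalgebra

variable {k H : Type u} [CommRing k] [Ring H] [HopfAlgebra k H]

theorem comulT_nil : comulT k H 0 (TPow.nil k) = TPow.nil k ⊗ₜ TPow.nil k := by
  change (1 : k) • (TPow.nil (V := H) k ⊗ₜ[k] TPow.nil (V := H) k) = _
  rw [one_smul]

/-- The maps on tuples are those of the iterated tensor product coalgebra, so coassociativity and
counitality come for free. -/
theorem exists_coalgebra_TPow (n : ℕ) : ∃ C : Coalgebra k (TPow k H n),
    C.comul = comulT k H n ∧ C.counit = counitT k H n := by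
  induction n with
  | zero =>
    refine ⟨inferInstanceAs (Coalgebra k k), ?_, rfl⟩
    refine LinearMap.ext fun c => ?_
    rw [TPow.zero_eq_smul c, map_smul, map_smul, comulT_nil]
    rfl
  | succ n ih =>
    obtain ⟨C, h1, h2⟩ := ih
    refine ⟨inferInstanceAs (Coalgebra k (H ⊗[k] TPow k H n)), ?_, ?_⟩
    · refine TPow.ext_succ fun h u => ?_
      rw [CrossedProduct.comulT_cons, ← h1]
      -- Since `succEquiv` is the identity, the outer map in the recursion for `comulT` is a tensor
      -- product of identities.
      refine Eq.trans ?_ (LinearMap.congr_fun (TensorProduct.map_id (R := k) (M := H ⊗[k] TPow k H n)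
        (N := H ⊗[k] TPow k H n)).symm _)
      rfl
    · refine TPow.ext_succ fun h u => ?_
      change C.counit u • Coalgebra.counit (R := k) h = Coalgebra.counit (R := k) h * counitT k H n u
      rw [h2, smul_eq_mul, mul_comm]

theorem comulT_coassoc (n : ℕ) (u : TPow k H n) :
    TensorProduct.assoc k _ _ _ ((comulT k H n).rTensor _ (comulT k H n u)) =
      (comulT k H n).lTensor _ (comulT k H n u) := by
  obtain ⟨C, h1, -⟩ := exists_coalgebra_TPow (k := k) (H := H) n
  have := LinearMap.congr_fun C.coassoc u
  rw [h1] at this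
  exact this

theorem rTensor_counitT_comulT (n : ℕ) (u : TPow k H n) :
    (counitT k H n).rTensor _ (comulT k H n u) = 1 ⊗ₜ u := by
  obtain ⟨C, h1, h2⟩ := exists_coalgebra_TPow (k := k) (H := H) n
  have := LinearMap.congr_fun C.rTensor_counit_comp_comul u
  rw [h1, h2] at this
  exact this

/-! ### Convolution on tuples -/

section Conv

variable {R : Type u} [Ring R] [Algebra k R] {n : ℕ}

theorem conv_assoc (g₁ g₂ g₃ : TPow k H n →ₗ[k] R) :
    conv (conv g₁ g₂) g₃ = conv g₁ (conv g₂ g₃) := by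
  refine LinearMap.ext fun u => ?_
  have h1 : ∀ t : TPow k H n ⊗[k] TPow k H n, LinearMap.mul' k R (TensorProduct.map (conv g₁ g₂) g₃ t) =
      LinearMap.mul' k R (TensorProduct.map g₁ (LinearMap.mul' k R ∘ₗ TensorProduct.map g₂ g₃)
        (TensorProduct.assoc k _ _ _ ((comulT k H n).rTensor _ t))) := by
    intro t
    induction t using TensorProduct.induction_on with
    | zero => simp
    | add x y hx hy => simp only [map_add, hx, hy]
    | tmul x y =>
      rw [TensorProduct.map_tmul, LinearMap.rTensor_tmul, conv, LinearMap.comp_apply,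
        LinearMap.comp_apply]
      generalize comulT k H n x = t
      induction t using TensorProduct.induction_on with
      | zero => simp
      | add x y hx hy => simp only [map_add, TensorProduct.add_tmul, hx, hy]
      | tmul x z => simp [mul_assoc]
  have h2 : ∀ t : TPow k H n ⊗[k] TPow k H n, LinearMap.mul' k R (TensorProduct.map g₁ (conv g₂ g₃) t) =
      LinearMap.mul' k R (TensorProduct.map g₁ (LinearMap.mul' k R ∘ₗ TensorProduct.map g₂ g₃)
        ((comulT k H n).lTensor _ t)) := by
    intro t
    rw [← LinearMap.comp_apply (TensorProduct.map g₁ _), LinearMap.lTensor, ← TensorProduct.map_comp]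
    rfl
  change LinearMap.mul' k R (TensorProduct.map (conv g₁ g₂) g₃ (comulT k H n u)) =
    LinearMap.mul' k R (TensorProduct.map g₁ (conv g₂ g₃) (comulT k H n u))
  rw [h1, h2, comulT_coassoc]

theorem counit_conv (g : TPow k H n →ₗ[k] R) : conv (Algebra.linearMap k R ∘ₗ counitT k H n) g = g := by
  refine LinearMap.ext fun u => ?_
  change LinearMap.mul' k R (TensorProduct.map (Algebra.linearMap k R ∘ₗ counitT k H n) g
    (comulT k H n u)) = _
  have h : TensorProduct.map (Algebra.linearMap k R ∘ₗ counitT k H n) g =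
      TensorProduct.map (Algebra.linearMap k R) g ∘ₗ (counitT k H n).rTensor _ := by
    rw [LinearMap.rTensor, ← TensorProduct.map_comp, LinearMap.comp_id]
  rw [h, LinearMap.comp_apply, rTensor_counitT_comulT]
  simp

theorem conv_sum {ι : Type*} (s : Finset ι) (g₁ : TPow k H n →ₗ[k] R) (g : ι → TPow k H n →ₗ[k] R) :
    conv g₁ (∑ i ∈ s, g i) = ∑ i ∈ s, conv g₁ (g i) := by
  classical
  induction s using Finset.induction_on with
  | empty => simp [conv]
  | insert i s hi ih =>
    rw [Finset.sum_insert hi, Finset.sum_insert hi, ← ih, conv, TensorProduct.map_add_right,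
      LinearMap.add_comp, LinearMap.comp_add]
    rfl

theorem conv_smul (c : k) (g₁ g : TPow k H n →ₗ[k] R) : conv g₁ (c • g) = c • conv g₁ g := by
  rw [conv, TensorProduct.map_smul_right, LinearMap.smul_comp, LinearMap.comp_smul]
  rfl

end Conv

variable (k H) in
/-- The coaction `𝐡 ↦ 𝐡⁽¹⁾ ⊗ 𝔥⁽²⁾` of `H` on `H^{⊗ n}`. -/
def coact (n : ℕ) : TPow k H n →ₗ[k] TPow k H n ⊗[k] H := (prodT k H n).lTensor _ ∘ₗ comulT k H n

/-- `(h ⊗ h') ⊗ (u ⊗ l) ↦ (h ⊗ u) ⊗ h' l`. -/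
def coactCons (n : ℕ) : (H ⊗[k] H) ⊗[k] (TPow k H n ⊗[k] H) →ₗ[k] TPow k H (n + 1) ⊗[k] H :=
  TensorProduct.map (TPow.succEquiv k H n).toLinearMap (LinearMap.mul' k H) ∘ₗ
    (TensorProduct.tensorTensorTensorComm k H H (TPow k H n) H).toLinearMap

theorem coactCons_tmul (n : ℕ) (h h' l : H) (u : TPow k H n) :
    coactCons n ((h ⊗ₜ[k] h') ⊗ₜ (u ⊗ₜ l)) = TPow.cons k n h u ⊗ₜ (h' * l) := rfl

theorem coact_cons (n : ℕ) (h : H) (u : TPow k H n) : coact k H (n + 1) (TPow.cons k n h u) =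
    coactCons n (Coalgebra.comul (R := k) h ⊗ₜ coact k H n u) := by
  rw [coact, coact, LinearMap.comp_apply, LinearMap.comp_apply,
    CrossedProduct.comulT_cons]
  generalize comulT k H n u = t
  induction t using TensorProduct.induction_on with
  | zero => simp
  | add x y hx hy => simp only [TensorProduct.tmul_add, map_add, hx, hy]
  | tmul x y =>
    generalize Coalgebra.comul (R := k) h = t
    induction t using TensorProduct.induction_on with
    | zero => simp
    | add x y hx hy => simp only [TensorProduct.add_tmul, map_add, hx, hy]
    | tmul l m => rfl

theorem coact_nil : coact k H 0 (TPow.nil k) = TPow.nil k ⊗ₜ 1 := by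
  have h : prodT k H 0 (TPow.nil k) = 1 := map_one (algebraMap k H)
  rw [coact, LinearMap.comp_apply, comulT_nil, LinearMap.lTensor_tmul, h]

end TupleCoalgebra

namespace CrossedProduct

variable {k A H : Type u} [CommRing k] [Ring A] [Algebra k A] [Ring H] [HopfAlgebra k H]
variable (D : CrossedProduct k A H)

/-! ### Colinearity -/

/-- Uses that Δ is multiplicative and that H ⊗ H is coassociative: the product of h⁽²⁾ and l⁽²⁾ can
be comultiplied before or after f is applied. -/
theorem comul_cocycleMul (f : H ⊗[k] H →ₗ[k] A) (h l : H) :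
    (Coalgebra.comul (R := k) (A := H)).lTensor A (cocycleMul f (h ⊗ₜ l)) =
      TensorProduct.assoc k A H H (TensorProduct.map (cocycleMul f) (LinearMap.mul' k H)
        (TensorProduct.tensorTensorTensorComm k H H H H
          (Coalgebra.comul (R := k) h ⊗ₜ Coalgebra.comul (R := k) l))) := by
  have h0 : TensorProduct.tensorTensorTensorComm k H H H H
      (Coalgebra.comul (R := k) h ⊗ₜ Coalgebra.comul (R := k) l) =
      Coalgebra.comul (R := k) (h ⊗ₜ[k] l) := rfl
  have hc : ∀ x : H ⊗[k] H, cocycleMul f x = TensorProduct.map f (LinearMap.mul' k H)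
      (Coalgebra.comul (R := k) x) := fun x => rfl
  have h1 : (Coalgebra.comul (R := k) (A := H)) ∘ₗ LinearMap.mul' k H =
      TensorProduct.map (LinearMap.mul' k H) (LinearMap.mul' k H) ∘ₗ Coalgebra.comul (R := k) := by
    refine TensorProduct.ext' fun h l => ?_
    rw [LinearMap.comp_apply, LinearMap.mul'_apply, Bialgebra.comul_mul, LinearMap.comp_apply]
    change _ = TensorProduct.map (LinearMap.mul' k H) (LinearMap.mul' k H)
      (TensorProduct.tensorTensorTensorComm k H H H H
      (Coalgebra.comul (R := k) h ⊗ₜ Coalgebra.comul (R := k) l))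
    generalize Coalgebra.comul (R := k) h = s
    generalize Coalgebra.comul (R := k) l = t
    induction s using TensorProduct.induction_on with
    | zero => simp
    | add x y hx hy => simp only [add_mul, TensorProduct.add_tmul, map_add, hx, hy]
    | tmul x y =>
      induction t using TensorProduct.induction_on with
      | zero => simp
      | add x y hx hy => simp only [mul_add, TensorProduct.tmul_add, map_add, hx, hy]
      | tmul z w => simp
  rw [h0, hc, ← LinearMap.comp_apply, LinearMap.lTensor, ← TensorProduct.map_comp, LinearMap.id_comp,
    h1]
  have h2 : ∀ t : (H ⊗[k] H) ⊗[k] (H ⊗[k] H), TensorProduct.map f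
      (TensorProduct.map (LinearMap.mul' k H) (LinearMap.mul' k H) ∘ₗ Coalgebra.comul (R := k)) t =
      TensorProduct.map f (TensorProduct.map (LinearMap.mul' k H) (LinearMap.mul' k H))
        ((Coalgebra.comul (R := k) (A := H ⊗[k] H)).lTensor _ t) := by
    intro t
    induction t using TensorProduct.induction_on with
    | zero => simp
    | add x y hx hy => simp only [map_add, hx, hy]
    | tmul x y => rfl
  rw [h2, ← Coalgebra.coassoc_apply]
  generalize Coalgebra.comul (R := k) (h ⊗ₜ[k] l) = t
  induction t using TensorProduct.induction_on with
  | zero => simp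
  | add x y hx hy => simp only [map_add, hx, hy]
  | tmul x y =>
    rw [LinearMap.rTensor_tmul, TensorProduct.map_tmul, hc]
    generalize Coalgebra.comul (R := k) x = t
    induction t using TensorProduct.induction_on with
    | zero => simp
    | add x y hx hy => simp only [TensorProduct.add_tmul, map_add, hx, hy]
    | tmul x y => rfl

theorem comul_twist (h : H) (b : A) :
    (Coalgebra.comul (R := k) (A := H)).lTensor A (twist D.act (h ⊗ₜ b)) =
      TensorProduct.assoc k A H H ((twist D.act ∘ₗ (TensorProduct.mk k H A).flip b).rTensor H
        (Coalgebra.comul (R := k) h)) := by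
  have h2 : ∀ t : H ⊗[k] H, (Coalgebra.comul (R := k) (A := H)).lTensor A
      ((D.act.flip b).rTensor H t) = (D.act.flip b).rTensor (H ⊗[k] H)
        ((Coalgebra.comul (R := k) (A := H)).lTensor H t) := by
    intro t
    induction t using TensorProduct.induction_on with
    | zero => simp
    | add x y hx hy => simp only [map_add, hx, hy]
    | tmul x y => rfl
  rw [twist_tmul, h2, ← Coalgebra.coassoc_apply]
  generalize Coalgebra.comul (R := k) h = t
  induction t using TensorProduct.induction_on with
  | zero => simp
  | add x y hx hy => simp only [map_add, hx, hy]
  | tmul x y =>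
    rw [LinearMap.rTensor_tmul, LinearMap.rTensor_tmul, LinearMap.comp_apply, LinearMap.flip_apply,
      TensorProduct.mk_apply, twist_tmul]
    generalize Coalgebra.comul (R := k) x = t
    induction t using TensorProduct.induction_on with
    | zero => simp
    | add x y hx hy => simp only [TensorProduct.add_tmul, map_add, hx, hy]
    | tmul x y => rfl

theorem lTensor_coact_cons (n : ℕ) (u : TPow k H n) (t : A ⊗[k] H) :
    (coact k H (n + 1)).lTensor A (((TPow.cons k n).flip u).lTensor A t) =
      (coactCons n ∘ₗ (TensorProduct.mk k _ _).flip (coact k H n u)).lTensor A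
        ((Coalgebra.comul (R := k) (A := H)).lTensor A t) := by
  induction t using TensorProduct.induction_on with
  | zero => simp
  | add x y hx hy => simp only [map_add, hx, hy]
  | tmul b l =>
    simp only [LinearMap.lTensor_tmul, LinearMap.flip_apply, LinearMap.comp_apply, coact_cons,
      TensorProduct.mk_apply]

/-- `(h ⊗ h') ⊗ (b ⊗ (u ⊗ l)) ↦ b^{h⁽¹⁾} ⊗ (h⁽²⁾ ⊗ u) ⊗ h' l`. -/
def coactTw (n : ℕ) : (H ⊗[k] H) ⊗[k] (A ⊗[k] (TPow k H n ⊗[k] H)) →ₗ[k]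
    A ⊗[k] (TPow k H (n + 1) ⊗[k] H) :=
  (TensorProduct.assoc k A _ H).toLinearMap ∘ₗ
    TensorProduct.map (D.twCons n) (LinearMap.mul' k H) ∘ₗ
    (TensorProduct.tensorTensorTensorComm k H H (A ⊗[k] TPow k H n) H).toLinearMap ∘ₗ
    (TensorProduct.assoc k A _ H).symm.toLinearMap.lTensor _

theorem coactTw_assoc (n : ℕ) (h h' l : H) (q : A ⊗[k] TPow k H n) :
    D.coactTw n ((h ⊗ₜ h') ⊗ₜ TensorProduct.assoc k A _ H (q ⊗ₜ l)) =
      TensorProduct.assoc k A _ H (D.twCons n (h ⊗ₜ q) ⊗ₜ (h' * l)) := by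
  rw [coactTw, LinearMap.comp_apply, LinearMap.comp_apply, LinearMap.comp_apply,
    LinearMap.lTensor_tmul, LinearEquiv.coe_coe, LinearEquiv.coe_coe, LinearEquiv.coe_coe,
    LinearEquiv.symm_apply_apply]
  rfl

theorem coact_twCons (n : ℕ) (h : H) (q : A ⊗[k] TPow k H n) :
    (coact k H (n + 1)).lTensor A (D.twCons n (h ⊗ₜ q)) =
      D.coactTw n (Coalgebra.comul (R := k) h ⊗ₜ (coact k H n).lTensor A q) := by
  induction q using TensorProduct.induction_on with
  | zero => simp
  | add x y hx hy => simp only [TensorProduct.tmul_add, map_add, hx, hy]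
  | tmul b u =>
    rw [twCons_tmul, lTensor_coact_cons, comul_twist, LinearMap.lTensor_tmul]
    generalize Coalgebra.comul (R := k) h = s
    generalize coact k H n u = w
    induction s using TensorProduct.induction_on with
    | zero => simp
    | add x y hx hy => simp only [TensorProduct.add_tmul, map_add, hx, hy]
    | tmul h h' =>
      induction w using TensorProduct.induction_on with
      | zero => simp
      | add x y hx hy =>
        simp only [TensorProduct.tmul_add, map_add, ← hx, ← hy, LinearMap.comp_add,
          LinearMap.lTensor_add, LinearMap.add_apply]
      | tmul u l =>
        have h1 := D.coactTw_assoc n h h' l (b ⊗ₜ u)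
        rw [TensorProduct.assoc_tmul] at h1
        rw [h1, twCons_tmul, LinearMap.rTensor_tmul, LinearMap.comp_apply, LinearMap.flip_apply,
          TensorProduct.mk_apply]
        generalize twist D.act (h ⊗ₜ[k] b) = t
        induction t using TensorProduct.induction_on with
        | zero => simp
        | add x y hx hy => simp only [TensorProduct.add_tmul, map_add, hx, hy]
        | tmul c m => rfl

theorem coact_merge_zero (n : ℕ) (h l : H) (u : TPow k H n) :
    (coact k H (n + 1)).lTensor A (D.merge (n + 1) 0 (TPow.cons k (n + 1) h (TPow.cons k n l u))) =
      TensorProduct.assoc k A _ H ((D.merge (n + 1) 0).rTensor H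
        (coact k H (n + 2) (TPow.cons k (n + 1) h (TPow.cons k n l u)))) := by
  rw [merge_zero_cons, lTensor_coact_cons, comul_cocycleMul, coact_cons, coact_cons]
  generalize Coalgebra.comul (R := k) h = s
  generalize Coalgebra.comul (R := k) l = t
  generalize coact k H n u = w
  induction s using TensorProduct.induction_on with
  | zero => simp
  | add x y hx hy => simp only [TensorProduct.add_tmul, map_add, hx, hy]
  | tmul h h' =>
    induction t using TensorProduct.induction_on with
    | zero => simp
    | add x y hx hy => simp only [TensorProduct.tmul_add, TensorProduct.add_tmul, map_add, hx, hy]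
    | tmul l l' =>
      induction w using TensorProduct.induction_on with
      | zero => simp
      | add x y hx hy =>
        simp only [TensorProduct.tmul_add, map_add, ← hx, ← hy, LinearMap.comp_add,
          LinearMap.lTensor_add, LinearMap.add_apply]
      | tmul u m =>
        rw [coactCons_tmul, coactCons_tmul, LinearMap.rTensor_tmul, merge_zero_cons,
          TensorProduct.tensorTensorTensorComm_tmul, TensorProduct.map_tmul, LinearMap.mul'_apply,
          ← mul_assoc]
        generalize cocycleMul D.cocycle (h ⊗ₜ[k] l) = t
        induction t using TensorProduct.induction_on with
        | zero => simp
        | add x y hx hy => simp only [TensorProduct.add_tmul, map_add, hx, hy]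
        | tmul c m => rfl

/-- Merging two neighbours does not change the product of all letters, so it commutes with 𝐡 ↦ 𝐡⁽¹⁾
⊗ 𝔥⁽²⁾. This allows F, which is defined on 𝐡⁽¹⁾ alone, to be compared with Θ, which carries the
factor 𝔥⁽²⁾ along. -/
theorem coact_merge (n i : ℕ) (u : TPow k H (n + 1)) :
    (coact k H n).lTensor A (D.merge n i u) =
      TensorProduct.assoc k A _ H ((D.merge n i).rTensor H (coact k H (n + 1) u)) := by
  induction n generalizing i with
  | zero => simp [merge]
  | succ n ih =>
    revert u
    suffices e : (coact k H (n + 1)).lTensor A ∘ₗ D.merge (n + 1) i =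
        (TensorProduct.assoc k A _ H).toLinearMap ∘ₗ (D.merge (n + 1) i).rTensor H ∘ₗ
        coact k H (n + 2) from fun u => LinearMap.congr_fun e u
    refine TPow.ext_succ fun h u => ?_
    cases i with
    | zero =>
      revert u
      suffices e : (coact k H (n + 1)).lTensor A ∘ₗ D.merge (n + 1) 0 ∘ₗ TPow.cons k (n + 1) h =
          (TensorProduct.assoc k A _ H).toLinearMap ∘ₗ (D.merge (n + 1) 0).rTensor H ∘ₗ
          coact k H (n + 2) ∘ₗ TPow.cons k (n + 1) h from fun u => LinearMap.congr_fun e u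
      exact TPow.ext_succ fun l u => D.coact_merge_zero n h l u
    | succ i =>
      change (coact k H (n + 1)).lTensor A (D.merge (n + 1) (i + 1) (TPow.cons k (n + 1) h u)) =
        TensorProduct.assoc k A _ H ((D.merge (n + 1) (i + 1)).rTensor H
          (coact k H (n + 2) (TPow.cons k (n + 1) h u)))
      rw [merge_succ_cons, coact_twCons, ih, coact_cons]
      generalize Coalgebra.comul (R := k) h = s
      generalize coact k H (n + 1) u = w
      induction s using TensorProduct.induction_on with
      | zero => simp
      | add x y hx hy => simp only [TensorProduct.add_tmul, map_add, hx, hy]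
      | tmul h h' =>
        induction w using TensorProduct.induction_on with
        | zero => simp
        | add x y hx hy => simp only [TensorProduct.tmul_add, map_add, hx, hy]
        | tmul u l =>
          rw [LinearMap.rTensor_tmul, coactTw_assoc, coactCons_tmul, LinearMap.rTensor_tmul,
            merge_succ_cons]

theorem coact_twistT (n : ℕ) (b : A) (u : TPow k H n) :
    (coact k H n).lTensor A (D.twistT n (u ⊗ₜ b)) =
      TensorProduct.assoc k A _ H ((D.twistT n ∘ₗ (TensorProduct.mk k _ A).flip b).rTensor H
        (coact k H n u)) := by
  induction n with
  | zero =>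
    rw [TPow.zero_eq_smul u, ← TensorProduct.smul_tmul', map_smul, map_smul, map_smul, map_smul,
      map_smul, twistT_nil, LinearMap.lTensor_tmul, coact_nil, LinearMap.rTensor_tmul,
      LinearMap.comp_apply, LinearMap.flip_apply, TensorProduct.mk_apply, twistT_nil,
      TensorProduct.assoc_tmul]
  | succ n ih =>
    revert u
    suffices e : (coact k H (n + 1)).lTensor A ∘ₗ D.twistT (n + 1) ∘ₗ
        (TensorProduct.mk k _ A).flip b = (TensorProduct.assoc k A _ H).toLinearMap ∘ₗ
        (D.twistT (n + 1) ∘ₗ (TensorProduct.mk k _ A).flip b).rTensor H ∘ₗ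
        coact k H (n + 1) from fun u => LinearMap.congr_fun e u
    refine TPow.ext_succ fun h u => ?_
    change (coact k H (n + 1)).lTensor A (D.twistT (n + 1) (TPow.cons k n h u ⊗ₜ b)) =
      TensorProduct.assoc k A _ H ((D.twistT (n + 1) ∘ₗ (TensorProduct.mk k _ A).flip b).rTensor H
        (coact k H (n + 1) (TPow.cons k n h u)))
    rw [twistT_cons, coact_twCons, ih, coact_cons]
    generalize Coalgebra.comul (R := k) h = s
    generalize coact k H n u = w
    induction s using TensorProduct.induction_on with
    | zero => simp
    | add x y hx hy => simp only [TensorProduct.add_tmul, map_add, hx, hy]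
    | tmul h h' =>
      induction w using TensorProduct.induction_on with
      | zero => simp
      | add x y hx hy => simp only [TensorProduct.tmul_add, map_add, hx, hy]
      | tmul u l =>
        rw [LinearMap.rTensor_tmul, coactTw_assoc, coactCons_tmul, LinearMap.rTensor_tmul,
          LinearMap.comp_apply, LinearMap.flip_apply, TensorProduct.mk_apply, LinearMap.comp_apply,
          LinearMap.flip_apply, TensorProduct.mk_apply, twistT_cons]

end CrossedProduct

namespace CrossedProduct

variable {k A H : Type u} [CommRing k] [Ring A] [Algebra k A] [Ring H] [HopfAlgebra k H]
variable (D : CrossedProduct k A H)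

/-! ### Recursions for `F` -/

/-- `b ⊗ (v ⊗ h) ↦ b v ⊗ h`. -/
def consC : A ⊗[k] (TensorAlgebra k (Red k A) ⊗[k] H) →ₗ[k] TensorAlgebra k (Red k A) ⊗[k] H :=
  TensorProduct.lift (LinearMap.rTensorHom H ∘ₗ LinearMap.mul k _ ∘ₗ cls k A)

/-- `u ↦ b g(u')`, where `μ u = b ⊗ u'`. -/
def consF {m n : ℕ} (g : TPow k H n →ₗ[k] TensorAlgebra k (Red k A))
    (μ : TPow k H m →ₗ[k] A ⊗[k] TPow k H n) : TPow k H m →ₗ[k] TensorAlgebra k (Red k A) :=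
  LinearMap.mul' k _ ∘ₗ TensorProduct.map (cls k A) g ∘ₗ μ

/-- If μ is colinear, splitting off 𝔥⁽²⁾ before or after μ gives the same result; this is how the
recursion for F becomes one for F ⊗ 𝔥⁽²⁾. -/
theorem rTensor_consF_coact {m n : ℕ} (g : TPow k H n →ₗ[k] TensorAlgebra k (Red k A))
    (μ : TPow k H m →ₗ[k] A ⊗[k] TPow k H n) (u : TPow k H m)
    (hμ : (coact k H n).lTensor A (μ u) = TensorProduct.assoc k A _ H (μ.rTensor H (coact k H m u))) :
    (consF g μ).rTensor H (coact k H m u) =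
      consC ((g.rTensor H ∘ₗ coact k H n).lTensor A (μ u)) := by
  rw [LinearMap.lTensor_comp, LinearMap.comp_apply, hμ]
  generalize coact k H m u = w
  induction w using TensorProduct.induction_on with
  | zero => simp
  | add x y hx hy => simp only [map_add, hx, hy]
  | tmul x l =>
    rw [LinearMap.rTensor_tmul, LinearMap.rTensor_tmul, consF, LinearMap.comp_apply,
      LinearMap.comp_apply]
    generalize μ x = t
    induction t using TensorProduct.induction_on with
    | zero => simp
    | add x y hx hy => simp only [TensorProduct.add_tmul, map_add, hx, hy]
    | tmul b u => rfl

theorem conv_actT (n : ℕ) (b : A) (g : TPow k H n →ₗ[k] TensorAlgebra k (Red k A)) :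
    conv (cls k A ∘ₗ (D.actT n).flip b) g =
      consF g (D.twistT n ∘ₗ (TensorProduct.mk k _ A).flip b) := by
  refine LinearMap.ext fun u => ?_
  change LinearMap.mul' k _ (TensorProduct.map (cls k A ∘ₗ (D.actT n).flip b) g (comulT k H n u)) =
    LinearMap.mul' k _ (TensorProduct.map (cls k A) g (D.twistT n (u ⊗ₜ b)))
  rw [twistT_tmul]
  generalize comulT k H n u = t
  induction t using TensorProduct.induction_on with
  | zero => simp
  | add x y hx hy => simp only [map_add, hx, hy]
  | tmul x y => rfl

theorem F_one_nil : D.F 1 [] = Algebra.linearMap k _ ∘ₗ counitT k H 1 := by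
  rw [F, tupleAct]

theorem F_succ_succ (l : ℕ) (a : List A) : D.F (l + 2) a = ∑ i ∈ Finset.range (a.length + 1),
    (-1 : k) ^ (i * (l + 1)) • conv (D.tupleAct (l + 2) (a.take i))
      (∑ j ∈ Finset.range (l + 1), (-1 : k) ^ (j + 1) •
        consF (D.F (l + 1) (a.drop i)) (D.merge (l + 1) j)) := by
  rw [F, Finset.sum_comm]
  refine Finset.sum_congr rfl fun i _ => ?_
  rw [conv_sum, Finset.smul_sum]
  refine Finset.sum_congr rfl fun j _ => ?_
  rw [conv_smul, smul_smul, ← pow_add]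
  rfl

theorem F_succ_nil (n : ℕ) : D.F (n + 2) [] = ∑ j ∈ Finset.range (n + 1),
    (-1 : k) ^ (j + 1) • consF (D.F (n + 1) []) (D.merge (n + 1) j) := by
  rw [F_succ_succ, List.length_nil, zero_add, Finset.sum_range_one, List.take_nil, tupleAct,
    counit_conv, List.drop_nil, zero_mul, pow_zero, one_smul]

theorem F_one_cons (a : A) (as : List A) : D.F 1 (a :: as) =
    consF (D.F 1 as) (D.twistT 1 ∘ₗ (TensorProduct.mk k _ A).flip a) := by
  rw [F, tupleAct, conv_actT, F]

/-- Split the sum over i. The part i = 0 inserts f before all of 𝐚; in the parts i ≥ 1 the first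
letter stands in front, and coassociativity factors it out of the expression for the shorter list,
with sign (-1)^l from the exponent il. -/
theorem F_succ_succ_cons (n : ℕ) (a : A) (as : List A) : D.F (n + 2) (a :: as) =
    ∑ j ∈ Finset.range (n + 1),
      (-1 : k) ^ (j + 1) • consF (D.F (n + 1) (a :: as)) (D.merge (n + 1) j) +
    (-1 : k) ^ (n + 1) •
      consF (D.F (n + 2) as) (D.twistT (n + 2) ∘ₗ (TensorProduct.mk k _ A).flip a) := by
  rw [F_succ_succ, List.length_cons, Finset.sum_range_succ', List.take_zero, tupleAct, counit_conv,
    List.drop_zero, zero_mul, pow_zero, one_smul, ← conv_actT, F_succ_succ D n as, conv_sum,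
    Finset.smul_sum]
  refine (add_comm _ _).trans ?_
  refine congrArg _ (Finset.sum_congr rfl fun i _ => ?_)
  rw [List.take_succ_cons, List.drop_succ_cons, tupleAct, conv_assoc, conv_smul, smul_smul,
    add_mul, one_mul, pow_add _ (i * _), mul_comm]

/-- `𝐡 ↦ F(𝐡⁽¹⁾ ⊗ 𝐚) ⊗ 𝔥⁽²⁾`. -/
def FT (n : ℕ) (a : List A) : TPow k H n →ₗ[k] TensorAlgebra k (Red k A) ⊗[k] H :=
  (D.F n a).rTensor H ∘ₗ coact k H n

theorem FT_merge (n j : ℕ) (a : List A) (u : TPow k H (n + 1)) :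
    (consF (D.F n a) (D.merge n j)).rTensor H (coact k H (n + 1) u) =
      consC ((D.FT n a).lTensor A (D.merge n j u)) :=
  rTensor_consF_coact _ _ _ (D.coact_merge n j u)

theorem FT_succ_nil (n : ℕ) (u : TPow k H (n + 2)) : D.FT (n + 2) [] u =
    ∑ j ∈ Finset.range (n + 1),
      (-1 : k) ^ (j + 1) • consC ((D.FT (n + 1) []).lTensor A (D.merge (n + 1) j u)) := by
  simp only [← FT_merge]
  rw [FT, LinearMap.comp_apply, F_succ_nil, ← LinearMap.coe_rTensorHom, map_sum,
    LinearMap.sum_apply]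
  refine Finset.sum_congr rfl fun j _ => ?_
  rw [map_smul, LinearMap.smul_apply]

theorem FT_twistT (n : ℕ) (a : A) (as : List A) (u : TPow k H n) :
    (consF (D.F n as) (D.twistT n ∘ₗ (TensorProduct.mk k _ A).flip a)).rTensor H (coact k H n u) =
      consC ((D.FT n as).lTensor A (D.twistT n (u ⊗ₜ a))) :=
  rTensor_consF_coact _ (D.twistT n ∘ₗ (TensorProduct.mk k _ A).flip a) _ (D.coact_twistT n a u)

theorem FT_succ_cons (n : ℕ) (a : A) (as : List A) (u : TPow k H (n + 1)) :
    D.FT (n + 1) (a :: as) u = ∑ j ∈ Finset.range n,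
      (-1 : k) ^ (j + 1) • consC ((D.FT n (a :: as)).lTensor A (D.merge n j u)) + (-1 : k) ^ n •
      consC ((D.FT (n + 1) as).lTensor A (D.twistT (n + 1) (u ⊗ₜ a))) := by
  simp only [← FT_merge, ← FT_twistT]
  cases n with
  | zero =>
    rw [Finset.sum_range_zero, pow_zero, one_smul]
    refine Eq.trans ?_ (zero_add _).symm
    rw [FT, LinearMap.comp_apply, F_one_cons]
  | succ n =>
    rw [FT, LinearMap.comp_apply, F_succ_succ_cons, ← LinearMap.coe_rTensorHom, map_add, map_sum,
      LinearMap.add_apply, LinearMap.sum_apply, map_smul, LinearMap.smul_apply]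
    refine congrArg (· + _) (Finset.sum_congr rfl fun j _ => ?_)
    rw [map_smul, LinearMap.smul_apply]

/-- For an empty tuple F is the counit, and ε(h⁽¹⁾)h⁽²⁾ = h. -/
theorem FT_one_nil (h : H) : D.FT 1 [] (TPow.cons k 0 h (TPow.nil k)) = 1 ⊗ₜ h := by
  have h1 : ∀ t : H ⊗[k] H, (Algebra.linearMap k (TensorAlgebra k (Red k A)) ∘ₗ
      counitT k H 1).rTensor H (coactCons 0 (t ⊗ₜ (TPow.nil k ⊗ₜ 1))) =
      (Algebra.linearMap k (TensorAlgebra k (Red k A))).rTensor H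
        ((Coalgebra.counit (R := k)).rTensor H t) := by
    intro t
    induction t using TensorProduct.induction_on with
    | zero => simp
    | add x y hx hy => simp only [TensorProduct.add_tmul, map_add, hx, hy]
    | tmul x y =>
      have : counitT k H 1 (TPow.cons k 0 x (TPow.nil k)) = Coalgebra.counit (R := k) x * 1 := rfl
      rw [coactCons_tmul, LinearMap.rTensor_tmul, LinearMap.comp_apply, this, mul_one, mul_one]
      rfl
  rw [FT, LinearMap.comp_apply, F_one_nil, coact_cons, coact_nil, h1,
    Coalgebra.rTensor_counit_comul]
  simp

/-! ### Symbols of words -/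

/-- The map `symbD` on words of arbitrary length. -/
def symbTot : WordT k A H →ₗ[k] H →ₗ[k] Red k A ⊗[k] (H ⊗[k] WordT k A H) :=
  DirectSum.toModule k ℕ _ fun n => match n with
    | 0 => 0
    | n + 1 => (D.symbD n).compr₂ (((of k A H n).lTensor H).lTensor (Red k A))

theorem symbTot_of_zero (w : Word k A H 0) (h : H) : D.symbTot (of k A H 0 w) h = 0 := by
  rw [symbTot, DirectSum.toModule_lof]
  rfl

theorem symbTot_of_succ (n : ℕ) (w : Word k A H (n + 1)) (h : H) :
    D.symbTot (of k A H (n + 1) w) h =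
      ((of k A H n).lTensor H).lTensor (Red k A) (D.symbD n w h) := by
  rw [symbTot, DirectSum.toModule_lof]
  rfl

theorem lTensor_of_assoc (n : ℕ) (t : Red k A ⊗[k] H) (w : Word k A H n) :
    ((of k A H n).lTensor H).lTensor (Red k A) (TensorProduct.assoc k _ _ _ (t ⊗ₜ w)) =
      TensorProduct.assoc k _ _ _ (t ⊗ₜ of k A H n w) := by
  induction t using TensorProduct.induction_on with
  | zero => simp
  | add x y hx hy => simp only [TensorProduct.add_tmul, map_add, hx, hy]
  | tmul x y => rfl

theorem hT_of (n : ℕ) (h : H) (w : Word k A H n) : hT h (of k A H n w) = of k A H (n + 1) (wH n h w) := by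
  rw [hT_apply, hR_of, wH_apply]

theorem lTensor_of_symbPush (n : ℕ) (h : H) (y : Red k A ⊗[k] (H ⊗[k] Word k A H n)) :
    ((of k A H (n + 1)).lTensor H).lTensor (Red k A) (D.symbPush (wH n) h y) =
      D.symbPush hT h (((of k A H n).lTensor H).lTensor (Red k A) y) := by
  induction y using TensorProduct.induction_on with
  | zero => simp
  | add x y hx hy => simp only [map_add, hx, hy]
  | tmul b z =>
    induction z using TensorProduct.induction_on with
    | zero => simp
    | add x y hx hy => simp only [TensorProduct.tmul_add, map_add, hx, hy]
    | tmul l w =>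
      rw [symbPush_tmul, lTensor_of_assoc, LinearMap.lTensor_tmul, LinearMap.lTensor_tmul,
        symbPush_tmul, hT_of]

/-- The recursion for symbols without reference to the length; on words of length 0 the symbol is
zero by convention, so the second term drops out. -/
theorem symbTot_hT (l : H) (w : WordT k A H) (h : H) : D.symbTot (hT l w) h =
    TensorProduct.assoc k _ _ _ (D.symbHH h l ⊗ₜ w) - D.symbPush hT h (D.symbTot w l) := by
  induction w using DirectSum.induction_on with
  | zero => simp
  | add x y hx hy =>
    simp only [map_add, TensorProduct.tmul_add, LinearMap.add_apply, hx, hy]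
    abel
  | of n w =>
    change D.symbTot (hT l (of k A H n w)) h = TensorProduct.assoc k _ _ _
      (D.symbHH h l ⊗ₜ of k A H n w) - D.symbPush hT h (D.symbTot (of k A H n w) l)
    rw [hT_of, symbTot_of_succ]
    cases n with
    | zero => rw [symbD_zero, lTensor_of_assoc, symbTot_of_zero, map_zero, sub_zero]
    | succ n =>
      rw [symbD_succ, map_sub, lTensor_of_assoc, lTensor_of_symbPush, symbTot_of_succ]

theorem symbTot_mono_nil_cons (a : A) (as : List A) (h : H) :
    D.symbTot (mono k [] (a :: as)) h =
      TensorProduct.assoc k _ _ _ (D.symbHA (red k a) h ⊗ₜ mono k [] as) := by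
  change D.symbTot (of k A H (as.length + 1) (Word.ofA k A H (as.length + 1)
    (TPow.cons k as.length (red k a) (redL k as)))) h = _
  rw [symbTot_of_succ, symbD_ofA, lTensor_of_assoc]
  rfl

/-- `b ⊗ (h ⊗ u) ↦ b ⊗ (h ⊗ u z)`. -/
def evS (z : WordT k A H) : (n : ℕ) → A ⊗[k] TPow k H n →ₗ[k] Red k A ⊗[k] (H ⊗[k] WordT k A H)
  | 0 => 0
  | n + 1 => TensorProduct.map (red k)
      (TPow.lift k n ((TensorProduct.mk k H (WordT k A H)).compl₂ ((prodR hT n).flip z)))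

theorem evS_tmul (z : WordT k A H) (n : ℕ) (b : A) (h : H) (u : TPow k H n) :
    evS (k := k) z (n + 1) (b ⊗ₜ TPow.cons k n h u) = red k b ⊗ₜ (h ⊗ₜ prodR hT n u z) := rfl

theorem evS_lTensor (z : WordT k A H) (n : ℕ) (t : A ⊗[k] H) (u : TPow k H n) :
    evS z (n + 1) (((TPow.cons k n).flip u).lTensor A t) =
      TensorProduct.assoc k _ _ _ ((red k).rTensor H t ⊗ₜ prodR hT n u z) := by
  induction t using TensorProduct.induction_on with
  | zero => simp
  | add x y hx hy => simp only [TensorProduct.add_tmul, map_add, hx, hy]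
  | tmul x y => rfl

theorem tmul_cons_induction {n : ℕ} {p : A ⊗[k] TPow k H (n + 1) → Prop}
    (h0 : ∀ b h u, p (b ⊗ₜ TPow.cons k n h u)) (hadd : ∀ x y, p x → p y → p (x + y))
    (t : A ⊗[k] TPow k H (n + 1)) : p t := by
  induction t using TensorProduct.induction_on with
  | zero =>
    have := h0 0 0 0
    rwa [TensorProduct.zero_tmul] at this
  | add x y hx hy => exact hadd x y hx hy
  | tmul b u =>
    have key : ∀ u : H ⊗[k] TPow k H n, p (b ⊗ₜ TPow.succEquiv k H n u) := by
      intro u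
      induction u using TensorProduct.induction_on with
      | zero =>
        rw [← TensorProduct.zero_tmul (R := k) H (0 : TPow k H n)]
        exact h0 b 0 0
      | add x y hx hy => rw [map_add, TensorProduct.tmul_add]; exact hadd _ _ hx hy
      | tmul h u => exact h0 b h u
    exact key u

theorem symbPush_evS (z : WordT k A H) (n : ℕ) (h : H) (t : A ⊗[k] TPow k H (n + 1)) :
    D.symbPush hT h (evS z (n + 1) t) = evS z (n + 2) (D.twCons (n + 1) (h ⊗ₜ t)) := by
  induction t using tmul_cons_induction with
  | h0 b l u =>
    rw [evS_tmul, symbPush_tmul, twCons_tmul, evS_lTensor, symbHA_red, toTensor_inH_mul_inA]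
    rfl
  | hadd x y hx hy => simp only [TensorProduct.tmul_add, map_add, hx, hy]

set_option maxSynthPendingDepth 3 in
-- Unrolls the recursion for symbols over a tuple of letters from H. The merges come from products
-- of neighbours, with a sign for each letter passed; X stands for the contribution of the letters
-- from A, and is required only to start correctly and to commute with prefixing.
theorem symbTot_prodR {z : WordT k A H}
    {X : ∀ n, TPow k H (n + 1) →ₗ[k] Red k A ⊗[k] (H ⊗[k] WordT k A H)}
    (h0 : ∀ h, D.symbTot z h = X 0 (TPow.cons k 0 h (TPow.nil k)))
    (h1 : ∀ n h u, D.symbPush hT h (X n u) = X (n + 1) (TPow.cons k (n + 1) h u))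
    (n : ℕ) (u : TPow k H n) (h : H) : D.symbTot (prodR hT n u z) h =
      ∑ j ∈ Finset.range n, (-1 : k) ^ j • evS z n (D.merge n j (TPow.cons k n h u)) +
        (-1 : k) ^ n • X n (TPow.cons k n h u) := by
  induction n generalizing h with
  | zero =>
    rw [TPow.zero_eq_smul u, map_smul, LinearMap.smul_apply, prodR_nil, map_smul,
      LinearMap.smul_apply, h0, Finset.sum_range_zero, pow_zero]
    refine Eq.trans ?_ ((zero_add _).trans (one_smul _ _)).symm
    rw [map_smul, map_smul]
  | succ n ih =>
    revert u
    suffices e : ((D.symbTot.flip h) ∘ₗ (prodR hT (n + 1)).flip z) =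
        (∑ j ∈ Finset.range (n + 1), (-1 : k) ^ j • evS z (n + 1) ∘ₗ D.merge (n + 1) j +
        (-1 : k) ^ (n + 1) • X (n + 1)) ∘ₗ TPow.cons k (n + 1) h from fun u => by
      have := LinearMap.congr_fun e u
      simp only [LinearMap.comp_apply, LinearMap.add_apply, LinearMap.sum_apply,
        LinearMap.smul_apply] at this
      exact this
    refine TPow.ext_succ fun l u => ?_
    simp only [LinearMap.comp_apply, LinearMap.add_apply, LinearMap.sum_apply,
        LinearMap.smul_apply, LinearMap.flip_apply]
    rw [prodR_cons, symbTot_hT, ih, map_add, map_sum, Finset.sum_range_succ', merge_zero_cons,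
      evS_lTensor, symbHH_apply, toTensor_inH_mul_inH, map_smul, h1, pow_zero, one_smul, pow_succ,
      mul_neg, mul_one, neg_smul]
    have h2 : ∑ j ∈ Finset.range n, (-1 : k) ^ (j + 1) • evS z (n + 1) (D.merge (n + 1) (j + 1)
        (TPow.cons k (n + 1) h (TPow.cons k n l u))) = -∑ j ∈ Finset.range n, D.symbPush hT h
          ((-1 : k) ^ j • evS z n (D.merge n j (TPow.cons k n l u))) := by
      rw [← Finset.sum_neg_distrib]
      refine Finset.sum_congr rfl fun j hj => ?_
      obtain ⟨m, rfl⟩ : ∃ m, n = m + 1 := ⟨n - 1, by have := Finset.mem_range.1 hj; omega⟩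
      rw [map_smul, symbPush_evS, merge_succ_cons, pow_succ, mul_neg, mul_one, neg_smul]
    rw [h2]
    abel

/-! ### The last term of the differential -/

/-- The map `gT` on words of arbitrary length. -/
def gTot : WordT k A H →ₗ[k] H →ₗ[k] TensorAlgebra k (Red k A) ⊗[k] H :=
  DirectSum.toModule k ℕ _ fun n => (D.gT n).compr₂ ((TPow.toTensorAlgebra k n).rTensor H)

theorem gTot_of (n : ℕ) (w : Word k A H n) (h : H) :
    D.gTot (of k A H n w) h = (TPow.toTensorAlgebra k n).rTensor H (D.gT n w h) := by
  rw [gTot, DirectSum.toModule_lof]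
  rfl

/-- `b ⊗ (h ⊗ w) ↦ b g(w, h)`. -/
def consG : Red k A ⊗[k] (H ⊗[k] WordT k A H) →ₗ[k] TensorAlgebra k (Red k A) ⊗[k] H :=
  TensorProduct.lift ((LinearMap.lcomp k _ (TensorProduct.lift D.gTot.flip)) ∘ₗ
    LinearMap.rTensorHom H ∘ₗ LinearMap.mul k _ ∘ₗ TensorAlgebra.ι k)

theorem consG_tmul (b : Red k A) (h : H) (w : WordT k A H) : D.consG (b ⊗ₜ (h ⊗ₜ w)) =
    (LinearMap.mulLeft k (TensorAlgebra.ι k b)).rTensor H (D.gTot w h) := rfl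

theorem gTot_of_succ (n : ℕ) (w : Word k A H (n + 1)) (h : H) :
    D.gTot (of k A H (n + 1) w) h = D.consG (D.symbTot (of k A H (n + 1) w) h) := by
  rw [gTot_of, symbTot_of_succ, gT_succ]
  generalize D.symbD n w h = y
  induction y using TensorProduct.induction_on with
  | zero => simp
  | add x y hx hy => simp only [map_add, hx, hy]
  | tmul b z =>
    induction z using TensorProduct.induction_on with
    | zero => simp
    | add x y hx hy => simp only [TensorProduct.tmul_add, map_add, hx, hy]
    | tmul l w =>
      rw [consLift_tmul, LinearMap.lTensor_tmul, LinearMap.lTensor_tmul, consG_tmul, gTot_of]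
      generalize D.gT n w l = t
      induction t using TensorProduct.induction_on with
      | zero => simp
      | add x y hx hy => simp only [map_add, hx, hy]
      | tmul x y => rfl

theorem gTot_hT (l : H) (w : WordT k A H) (h : H) :
    D.gTot (hT l w) h = D.consG (D.symbTot (hT l w) h) := by
  induction w using DirectSum.induction_on with
  | zero => simp
  | add x y hx hy => simp only [map_add, LinearMap.add_apply, hx, hy]
  | of n w =>
    change D.gTot (hT l (of k A H n w)) h = D.consG (D.symbTot (hT l (of k A H n w)) h)
    rw [hT_of, gTot_of_succ]

theorem gTot_prodR_succ (n : ℕ) (u : TPow k H (n + 1)) (z : WordT k A H) (h : H) :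
    D.gTot (prodR hT (n + 1) u z) h = D.consG (D.symbTot (prodR hT (n + 1) u z) h) := by
  revert u
  suffices e : (D.gTot.flip h) ∘ₗ (prodR hT (n + 1)).flip z =
      D.consG ∘ₗ (D.symbTot.flip h) ∘ₗ (prodR hT (n + 1)).flip z from
    fun u => LinearMap.congr_fun e u
  exact TPow.ext_succ fun l u => D.gTot_hT l _ h

theorem gTot_mono_nil_nil (h : H) : D.gTot (mono k [] ([] : List A)) h = 1 ⊗ₜ h := by
  change D.gTot (of k A H 0 (Word.ofA k A H 0 (TPow.nil k))) h = _
  rw [gTot_of, gT_zero, LinearMap.rTensor_tmul, toTensorAlgebra_nil]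

theorem gTot_mono_nil_cons (a : A) (as : List A) (h : H) : D.gTot (mono k [] (a :: as)) h =
    D.consG (D.symbTot (mono k [] (a :: as)) h) := D.gTot_of_succ _ _ _

/-- `h ⊗ u ↦ g(u 𝐚, h)`. -/
def gL (a : List A) : (n : ℕ) → TPow k H n →ₗ[k] TensorAlgebra k (Red k A) ⊗[k] H
  | 0 => 0
  | n + 1 => TPow.lift k n (D.gTot ∘ₗ (prodR hT n).flip (mono k [] a)).flip

theorem gL_cons (a : List A) (n : ℕ) (h : H) (u : TPow k H n) :
    D.gL a (n + 1) (TPow.cons k n h u) = D.gTot (prodR hT n u (mono k [] a)) h := rfl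

theorem consG_evS (a : List A) (n : ℕ) (t : A ⊗[k] TPow k H n) :
    D.consG (evS (mono k [] a) n t) = consC ((D.gL a n).lTensor A t) := by
  cases n with
  | zero => simp [evS, gL]
  | succ n =>
    induction t using tmul_cons_induction with
    | h0 b h u =>
      rw [evS_tmul, consG_tmul, LinearMap.lTensor_tmul, gL_cons]
      generalize D.gTot _ h = t
      induction t using TensorProduct.induction_on with
      | zero => simp
      | add x y hx hy => simp only [TensorProduct.tmul_add, map_add, hx, hy]
      | tmul x y => rfl
    | hadd x y hx hy => simp only [map_add, hx, hy]

theorem gL_succ_nil (n : ℕ) (h : H) (u : TPow k H (n + 1)) :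
    D.gL [] (n + 2) (TPow.cons k (n + 1) h u) = ∑ j ∈ Finset.range (n + 1),
      (-1 : k) ^ j • consC ((D.gL [] (n + 1)).lTensor A
        (D.merge (n + 1) j (TPow.cons k (n + 1) h u))) := by
  have h0 : ∀ h, D.symbTot (mono k [] ([] : List A)) h = 0 := fun h => D.symbTot_of_zero _ h
  rw [gL_cons, gTot_prodR_succ, D.symbTot_prodR (X := fun n => 0) (fun h => h0 h)
    (fun n h u => map_zero _), LinearMap.zero_apply, smul_zero, add_zero, map_sum]
  refine Finset.sum_congr rfl fun j _ => ?_
  rw [map_smul, consG_evS]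

/-- The same two-term recursion as for F: merge two neighbours, or carry a past all of them to the
front. The summand X of `symbTot_prodR` is the second one. -/
theorem gL_succ_cons (n : ℕ) (a : A) (as : List A) (h : H) (u : TPow k H n) :
    D.gL (a :: as) (n + 1) (TPow.cons k n h u) = ∑ j ∈ Finset.range n,
      (-1 : k) ^ j • consC ((D.gL (a :: as) n).lTensor A (D.merge n j (TPow.cons k n h u))) +
      (-1 : k) ^ n • consC ((D.gL as (n + 1)).lTensor A
        (D.twistT (n + 1) (TPow.cons k n h u ⊗ₜ a))) := by
  have h1 : D.gTot (prodR hT n u (mono k [] (a :: as))) h =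
      D.consG (D.symbTot (prodR hT n u (mono k [] (a :: as))) h) := by
    cases n with
    | zero => rw [TPow.zero_eq_smul u, map_smul, LinearMap.smul_apply, prodR_nil, map_smul,
        LinearMap.smul_apply, map_smul, LinearMap.smul_apply, map_smul, gTot_mono_nil_cons]
    | succ n => exact D.gTot_prodR_succ n u _ h
  rw [gL_cons, h1, D.symbTot_prodR (X := fun n => evS (mono k [] as) (n + 1) ∘ₗ D.twistT (n + 1) ∘ₗ
    (TensorProduct.mk k _ A).flip a), map_add, map_sum, map_smul]
  · refine congrArg₂ _ (Finset.sum_congr rfl fun j _ => ?_) ?_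
    · rw [map_smul, consG_evS]
    · rw [LinearMap.comp_apply, consG_evS]
      rfl
  · intro h
    change _ = evS (mono k [] as) 1 (D.twistT 1 (TPow.cons k 0 h (TPow.nil k) ⊗ₜ a))
    rw [symbTot_mono_nil_cons, twistT_cons, twistT_nil, twCons_tmul, evS_lTensor, prodR_nil,
      symbHA_red, toTensor_inH_mul_inA]
  · intro n h u
    change D.symbPush hT h (evS (mono k [] as) (n + 1) (D.twistT (n + 1) (u ⊗ₜ a))) =
      evS (mono k [] as) (n + 2) (D.twistT (n + 2) (TPow.cons k (n + 1) h u ⊗ₜ a))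
    rw [symbPush_evS, twistT_cons]

theorem lTensor_smul_apply {V W : Type u} [AddCommGroup V] [Module k V] [AddCommGroup W] [Module k W]
    (c : k) (g : V →ₗ[k] W) (t : A ⊗[k] V) : (c • g).lTensor A t = c • g.lTensor A t := by
  rw [LinearMap.lTensor_smul, LinearMap.smul_apply]

/-- The closed formula for the last term of the differential. -/
theorem gL_eq (a : List A) (n : ℕ) : D.gL a (n + 1) = (-1 : k) ^ n • D.FT (n + 1) a := by
  -- Both sides obey the same recursion, in which merging lowers n for the same list and moving
  -- shortens the list for the same n. Hence the outer induction on the list and the inner one on n;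
  -- the factor (-1)^n absorbs the difference between (-1)^j and (-1)^{j+1} in the merge terms.
  induction a generalizing n with
  | nil =>
    induction n with
    | zero =>
      refine TPow.ext_succ fun h u => ?_
      rw [TPow.zero_eq_smul u, map_smul, map_smul, map_smul, gL_cons, prodR_nil, gTot_mono_nil_nil,
        pow_zero, one_smul, FT_one_nil]
    | succ n ih =>
      refine TPow.ext_succ fun h u => ?_
      rw [gL_succ_nil, LinearMap.smul_apply, FT_succ_nil, Finset.smul_sum]
      refine Finset.sum_congr rfl fun j _ => ?_
      rw [ih, lTensor_smul_apply, map_smul, smul_smul, smul_smul]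
      congr 1
      ring
  | cons a as ih =>
    induction n with
    | zero =>
      refine TPow.ext_succ fun h u => ?_
      rw [gL_succ_cons, LinearMap.smul_apply, FT_succ_cons, ih]
      simp
    | succ n ih2 =>
      refine TPow.ext_succ fun h u => ?_
      rw [gL_succ_cons, LinearMap.smul_apply, FT_succ_cons, smul_add, Finset.smul_sum]
      refine congrArg₂ _ (Finset.sum_congr rfl fun j _ => ?_) ?_
      · rw [ih2, lTensor_smul_apply, map_smul, smul_smul, smul_smul]
        congr 1
        ring
      · rw [ih, lTensor_smul_apply, map_smul]

end CrossedProduct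

namespace CrossedProduct

variable {k A H : Type u} [CommRing k] [Ring A] [Algebra k A] [Ring H] [HopfAlgebra k H]
variable (D : CrossedProduct k A H)

/-! ### The differential of a word -/

theorem prodR_hT_ofList (hs : List H) (a : List A) :
    prodR hT hs.length (TPow.ofList k hs) (mono k [] a) = mono k hs a := by
  induction hs with
  | nil => exact prodR_nil _ _
  | cons h hs ih => exact (prodR_cons _ _ _ _ _).trans (congrArg (hT h) ih)

theorem prodR_zT_ofList (hs : List H) (a : List A) (e : D.E) :
    prodR D.zT hs.length (TPow.ofList k hs) (mono k [] a ⊗ₜ e) = mono k hs a ⊗ₜ e := by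
  induction hs with
  | nil => exact prodR_nil _ _
  | cons h hs ih => exact (prodR_cons _ _ _ _ _).trans (congrArg (D.zT h) ih)

/-- The terms of the differential that involve the last term of some `h w`. -/
def tailsL (a : List A) : List H → D.BiT
  | [] => 0
  | h :: hs => 1 ⊗ₜ D.tailT h (mono k hs a) + D.opQ D.zT h (tailsL a hs)

/-- The three summands of ∂(hw) unrolled separately: lead terms, tails, and the bar differential of
𝐚 moved through all the letters from H. -/
theorem bdT_mono (hs : List H) (a : List A) : D.bdT (mono k hs a) =
    D.leadR D.zT hs (mono k [] a ⊗ₜ 1) + D.tailsL a hs +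
      D.opsQ D.zT hs (D.bdT (mono k [] a)) := by
  induction hs with
  | nil => simp [leadR, tailsL, opsQ]
  | cons h hs ih =>
    have h1 : ∀ y, D.pushW (lMul k _ (D.inH h) y) = -D.opQ D.zT h y := fun y => (neg_neg _).symm
    change D.bdT (hT h (mono k hs a)) = _
    rw [bdT_hT, h1, ih, leadR, tailsL, opsQ, prodR_zT_ofList, map_add, map_add,
      LinearMap.comp_apply]
    abel

/-- `1 ⊗ 𝐡 ⊗ F(𝐡'⁽¹⁾ ⊗ 𝐚) ⊗ 𝔥'⁽²⁾`. -/
def tailTerm (a : List A) (hs hs' : List H) : D.ResTot :=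
  1 ⊗ₜ (clsL k hs ⊗ₜ D.inH.lTensor _ (D.FT hs'.length a (TPow.ofList k hs')))

theorem gTot_mono (h : H) (hs : List H) (a : List A) : D.gTot (mono k hs a) h =
    (-1 : k) ^ hs.length • D.FT (hs.length + 1) a (TPow.ofList k (h :: hs)) := by
  have h1 := LinearMap.congr_fun (D.gL_eq a hs.length) (TPow.ofList k (h :: hs))
  rw [← prodR_hT_ofList]
  exact h1

/-- A tail has r + s' letters from A, where s' counts the letters from H after h. Moving it past the
front letters gives the product in the exponent; s' more signs come from the closed formula for g,
and one from Θ = -g. -/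
theorem totEquiv_opsQ_tailT (h : H) (hs hs' : List H) (a : List A) :
    D.totEquiv (D.opsQ D.zT hs (1 ⊗ₜ D.tailT h (mono k hs' a))) =
      (-1 : k) ^ ((a.length + hs'.length + 1) * hs.length + (hs'.length + 1)) •
        D.tailTerm a hs (h :: hs') := by
  have h1 : ∀ n (w : Word k A H n), D.totEquiv (D.opsQ D.zT hs (1 ⊗ₜ D.tailT h (of k A H n w))) =
      (-1 : k) ^ ((n + 1) * hs.length + 1) •
        (1 ⊗ₜ (clsL k hs ⊗ₜ D.inH.lTensor _ (D.gTot (of k A H n w) h))) := by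
    intro n w
    have h2 : 1 ⊗ₜ D.tailT h (of k A H n w) = D.incKT n (1 ⊗ₜ D.theta n h (w ⊗ₜ 1)) := by
      rw [tailT_of]
      rfl
    have h3 : ∀ y : TPow k (Red k A) n ⊗[k] H, (TPow.toTensorAlgebra k n).rTensor D.E
        (D.inH.lTensor _ y) = D.inH.lTensor _ ((TPow.toTensorAlgebra k n).rTensor H y) := by
      intro y
      induction y using TensorProduct.induction_on with
      | zero => simp
      | add x y hx hy => simp only [map_add, hx, hy]
      | tmul x y => rfl
    rw [h2, totEquiv_opsQ, toTA, LinearMap.lTensor_tmul, theta_tmul, rMul_one, map_neg, h3, moveL_one,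
      gTot_of, pow_succ, mul_neg, mul_one, TensorProduct.tmul_neg, TensorProduct.tmul_neg, smul_neg,
      neg_smul]
  rw [← of_monoG, h1, of_monoG, gTot_mono, map_smul, TensorProduct.tmul_smul,
    TensorProduct.tmul_smul, smul_smul, ← pow_add, tailTerm]
  congr 2
  ring

theorem opsQ_append (hs : List H) (h : H) (y : D.BiT) :
    D.opsQ D.zT hs (D.opQ D.zT h y) = D.opsQ D.zT (hs ++ [h]) y := by
  induction hs with
  | nil => rfl
  | cons l hs ih => exact congrArg (D.opQ D.zT l) ih

theorem totEquiv_opsQ_tailsL (a : List A) (hs hs' : List H) :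
    D.totEquiv (D.opsQ D.zT hs (D.tailsL a hs')) = ∑ j ∈ Finset.range hs'.length,
      (-1 : k) ^ ((a.length + (hs'.length - j)) * (hs.length + j) + (hs'.length - j)) •
        D.tailTerm a (hs ++ hs'.take j) (hs'.drop j) := by
  induction hs' generalizing hs with
  | nil => simp [tailsL]
  | cons h hs' ih =>
    rw [tailsL, map_add, map_add, totEquiv_opsQ_tailT, opsQ_append, ih, List.length_cons,
      Finset.sum_range_succ', add_comm]
    refine congrArg₂ _ (Finset.sum_congr rfl fun j _ => ?_) ?_
    · rw [List.take_succ_cons, List.drop_succ_cons, List.append_assoc, List.singleton_append,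
        List.length_append, List.length_singleton, Nat.add_sub_add_right, add_assoc hs.length,
        add_comm 1 j]
    · rw [List.take_zero, List.drop_zero, List.append_nil, Nat.sub_zero, add_zero, add_assoc]

theorem totEquiv_leadR (h : H) (hs : List H) (a : List A) :
    D.totEquiv (D.leadR D.zT (h :: hs) (mono k [] a ⊗ₜ 1)) =
      (-1 : k) ^ (a.length * hs.length) • (D.inH h ⊗ₜ (clsL k hs ⊗ₜ (clsL k a ⊗ₜ 1)) +
        ∑ i ∈ Finset.range hs.length, (-1 : k) ^ (i + 1) • TensorProduct.map D.inA
          ((TensorProduct.mk k _ _).flip (clsL k a ⊗ₜ 1) ∘ₗ clsT k H hs.length)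
          (D.merge hs.length i (TPow.ofList k (h :: hs)))) := by
  have h1 : ∀ t : A ⊗[k] TPow k H hs.length,
      D.totEquiv (D.evA D.zT hs.length (mono k [] a ⊗ₜ 1) t) = (-1 : k) ^ (a.length * hs.length) •
        TensorProduct.map D.inA
          ((TensorProduct.mk k _ _).flip (clsL k a ⊗ₜ 1) ∘ₗ clsT k H hs.length) t := by
    intro t
    induction t using TensorProduct.induction_on with
    | zero => simp
    | add x y hx hy => simp only [map_add, hx, hy, smul_add]
    | tmul b u =>
      have h2 := D.zEquiv_prodR hs.length a.length u (redL k a ⊗ₜ 1)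
      rw [LinearMap.rTensor_tmul, LinearMap.rTensor_tmul, toTensorAlgebra_redL] at h2
      rw [evA_tmul, totEquiv_tmul]
      refine (congrArg (fun z => D.inA b ⊗ₜ[k] z) h2).trans ?_
      rw [TensorProduct.tmul_smul]
      rfl
  rw [leadR_cons, prodR_zT_ofList, map_add, map_sum, totEquiv_mono, smul_add, Finset.smul_sum]
  refine congrArg _ (Finset.sum_congr rfl fun i _ => ?_)
  rw [map_smul, h1, smul_comm]

/-! ### The closed formula for d̂ -/

section Hat

variable {M : Type u} [AddCommGroup M] [Module k M] [Module D.E M] [Module D.Eᵐᵒᵖ M]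
  [IsScalarTower k D.E M] [IsScalarTower k D.Eᵐᵒᵖ M]

theorem hatTail_eq (m : M) (h : List H) (a : List A) (l : ℕ) : D.hatTail m h a l =
    (-1 : k) ^ (l * (a.length + h.length)) • D.contrTot M (m ⊗ₜ
      D.tailTerm a (h.take (h.length - l)) (h.drop (h.length - l))) := by
  rw [hatTail, tailTerm, FT, LinearMap.comp_apply, coact, LinearMap.comp_apply]
  congr 1
  generalize comulT k H _ (TPow.ofList k (h.drop (h.length - l))) = t
  induction t using TensorProduct.induction_on with
  | zero => simp
  | add x y hx hy => simp only [TensorProduct.tmul_add, map_add, hx, hy]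
  | tmul x y =>
    rw [TensorProduct.comm_tmul, TensorProduct.map_tmul, LinearMap.lTensor_tmul,
      LinearMap.rTensor_tmul, LinearMap.lTensor_tmul, contrTot_clsL, MulOpposite.op_one, one_smul]
    rfl

/-- The tail that leaves j letters from H in front swallows the last l = s - j, hence is the l-th
summand of the statement. Only the signs remain to be compared. -/
theorem contrTot_tailsL (m : M) (h : List H) (a : List A) :
    D.contrTot M (m ⊗ₜ ((-1 : k) ^ (a.length * h.length) • D.totEquiv (D.tailsL a h))) =
      ∑ l ∈ Finset.Icc 1 h.length, D.hatTail m h a l := by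
  have h1 := D.totEquiv_opsQ_tailsL a [] h
  rw [opsQ, LinearMap.id_apply] at h1
  rw [h1, Finset.smul_sum, TensorProduct.tmul_sum, map_sum]
  refine Finset.sum_nbij' (fun j => h.length - j) (fun l => h.length - l) ?_ ?_ ?_ ?_ ?_
  · intro j hj
    rw [Finset.mem_range] at hj
    rw [Finset.mem_Icc]
    omega
  · intro l hl
    rw [Finset.mem_Icc] at hl
    rw [Finset.mem_range]
    omega
  · intro j hj
    rw [Finset.mem_range] at hj
    omega
  · intro l hl
    rw [Finset.mem_Icc] at hl
    omega
  · intro j hj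
    rw [Finset.mem_range] at hj
    obtain ⟨l, hl⟩ := Nat.exists_eq_add_of_le hj.le
    have h2 : h.length - (h.length - j) = j := by omega
    rw [hatTail_eq, smul_smul, TensorProduct.tmul_smul, map_smul, h2, List.nil_append, ← pow_add,
      List.length_nil, zero_add]
    congr 1
    have h3 : h.length - j = l := by omega
    rw [h3, hl]
    have h4 : ∀ p q : ℕ, p % 2 = q % 2 → (-1 : k) ^ p = (-1) ^ q := by
      intro p q hpq
      rw [neg_one_pow_eq_pow_mod_two, hpq, ← neg_one_pow_eq_pow_mod_two]
    refine h4 _ _ ?_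
    have h6 : (l * l - l) % 2 = 0 := by
      have := Nat.even_mul_pred_self l
      rw [Nat.mul_sub, mul_one] at this
      exact Nat.even_iff.1 this
    -- The two exponents differ by an even number, because l² - l and 2rj are even.
    have h5 : a.length * (j + l) + ((a.length + l) * j + l) + (l * l - l) =
        l * (a.length + (j + l)) + 2 * (a.length * j) := by
      rw [add_assoc, add_assoc, Nat.add_sub_cancel' (Nat.le_mul_self l)]
      ring
    omega

/-- The lead terms are d̂¹ without its last summand, which is the tail with l = 1. -/
theorem contrTot_leadR (m : M) (h : H) (hs : List H) (a : List A) :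
    D.contrTot M (m ⊗ₜ ((-1 : k) ^ (a.length * (h :: hs).length) •
      D.totEquiv (D.leadR D.zT (h :: hs) (mono k [] a ⊗ₜ 1)))) + D.hatTail m (h :: hs) a 1 =
      D.hatD1 m a (h :: hs) := by
  have h1 : ∀ t, D.contrTot M (m ⊗ₜ TensorProduct.map D.inA
      ((TensorProduct.mk k _ _).flip (clsL k a ⊗ₜ 1) ∘ₗ clsT k H hs.length) t) =
      TensorProduct.map (D.mulInA m)
        ((TensorProduct.mk k _ _).flip (clsL k a) ∘ₗ clsT k H hs.length) t := by
    intro t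
    induction t using TensorProduct.induction_on with
    | zero => simp
    | add x y hx hy => simp only [TensorProduct.tmul_add, map_add, hx, hy]
    | tmul b u =>
      rw [TensorProduct.map_tmul, TensorProduct.map_tmul]
      change D.contrTot M (m ⊗ₜ (D.inA b ⊗ₜ (clsT k H hs.length u ⊗ₜ (clsL k a ⊗ₜ 1)))) = _
      rw [contrTot_clsL, one_smul]
      rfl
  rw [totEquiv_leadR, List.length_cons, Nat.mul_succ, add_comm _ a.length, pow_add, ← smul_smul,
    neg_one_pow_smul_smul, hatD1, TensorProduct.tmul_smul, map_smul, TensorProduct.tmul_add, map_add,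
    contrTot_clsL, one_smul, smul_add, TensorProduct.tmul_sum, map_sum, Finset.smul_sum]
  rw [add_right_comm]
  refine congrArg _ (Finset.sum_congr rfl fun i _ => ?_)
  rw [TensorProduct.tmul_smul, map_smul, h1, smul_smul, ← pow_add]

theorem hatIncl_hatD_eq_hatFormula (n : ℕ) (m : M) (h : List H) (a : List A)
    (hn : a.length + h.length = n + 1) :
    hatIncl k A H M n (D.hatD M n (hatGen k m h a hn)) = D.hatFormula m h a := by
  rw [hatIncl_hatD, bdT_mono, map_add, map_add, smul_add, smul_add, TensorProduct.tmul_add,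
    TensorProduct.tmul_add, map_add, map_add, totEquiv_opsQ_bdT, neg_one_pow_smul_smul,
    contrTot_resD0, contrTot_tailsL, hatFormula]
  cases h with
  | nil => simp [leadR, hatD1]
  | cons h hs =>
    rw [← contrTot_leadR]
    -- The tail with l = 1 belongs to d̂¹, those with l ≥ 2 are the d̂^l.
    have h1 : Finset.Icc 1 (h :: hs).length = insert 1 (Finset.Icc 2 (h :: hs).length) := by
      ext i
      simp only [Finset.mem_insert, Finset.mem_Icc, List.length_cons]
      omega
    rw [h1, Finset.sum_insert (by simp)]
    abel

end Hat

theorem isHatDifferential_hatD (M : Type u) [AddCommGroup M] [Module k M] [Module D.E M]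
    [Module D.Eᵐᵒᵖ M] [IsScalarTower k D.E M] [IsScalarTower k D.Eᵐᵒᵖ M] :
    D.IsHatDifferential M (D.hatD M) := D.hatIncl_hatD_eq_hatFormula

theorem isResolutionData : D.IsResolutionData D.yDel D.resDl where
  del_apply := D.yDel_apply
  zero_apply := D.resDl_zero_apply
  map_left := D.resDl_totLeft
  map_right := D.resDl_totRight
  eq_zero := D.resDl_eq_zero
  one_nil := D.resDl_one_nil
  rec_nil := D.resDl_nil_eq_sum
  rec_apply := fun l h a h1 hl ha => D.resDl_eq_sum l h a h1 hl (Or.inl ha)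

theorem isResDifferential_resD : D.IsResDifferential D.resD :=
  ⟨D.yDel, D.resDl, D.isResolutionData, D.resIncl_resD⟩

end CrossedProduct

end HopfCrossed

end

/-! ### The theorem -/

open HopfCrossed in
theorem theorem2p1p1 {k A H : Type u} [CommRing k] [Ring A] [Algebra k A] [Ring H]
    [HopfAlgebra k H] (D : CrossedProduct k A H)
    (M : Type u) [AddCommGroup M] [Module k M] [Module D.E M] [Module D.Eᵐᵒᵖ M]
    [IsScalarTower k D.E M] [IsScalarTower k D.Eᵐᵒᵖ M] [SMulCommClass D.E D.Eᵐᵒᵖ M] :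
    ∃ d : ∀ n, CrossedProduct.Hat k A H M (n + 1) →ₗ[k] CrossedProduct.Hat k A H M n,
      D.IsHatDifferential M d ∧
      ∃ hd : ∀ n, d n ∘ₗ d (n + 1) = 0,
        (∀ n, Nonempty ((chainComplexOf k (CrossedProduct.Hat k A H M) d hd).homology n ≅
          HochschildHomology k D.E M n)) ∧
        ∃ dX : ∀ n, D.Res (n + 1) →ₗ[k] D.Res n,
          D.IsResDifferential dX ∧ (∀ n, dX n ∘ₗ dX (n + 1) = 0) ∧
          ∃ θ : ∀ n, CrossedProduct.Hat k A H M n ≃ₗ[k] D.ResTensor M n,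
            (∀ (n : ℕ) (m : M) (h : List H) (a : List A) (hn : a.length + h.length = n),
              θ n (CrossedProduct.hatGen k m h a hn) =
                (D.balancedRel M n).mkQ (m ⊗ₜ D.resGen h a hn)) ∧
            ∀ (n : ℕ) (z : M ⊗[k] D.Res (n + 1)),
              θ n (d n ((θ (n + 1)).symm ((D.balancedRel M (n + 1)).mkQ z))) =
                (D.balancedRel M n).mkQ ((dX n).lTensor M z) := by
  exact ⟨D.hatD M, D.isHatDifferential_hatD M, D.hatD_hatD M, D.nonempty_homology_iso_hochschild M, D.resD,
    D.isResDifferential_resD, D.resD_resD, D.tensorEquiv M, D.tensorEquiv_hatGen M, D.tensorEquiv_hatD M⟩
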